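/- Let $G\subseteq GL_N(\mathbb C)$ be a connected, Zariski-closed subgroup with semi-simple Lie algebra $\mathfrak g$ (i.e. a connected complex semi-simple group in a linear realization). Let $\tau$ be the conjugation of $\mathfrak g$ with respect to a compact real form, and let $\xi_1,\dots,\xi_d$ be a basis of $\mathfrak g$ that is orthonormal for the Killing form and self-adjoint, i.e. $\tau(\xi_a)=-\xi_a$. *The Koszul complex.* Let $\Lambda\otimes S$ be the free graded-commutative $\mathbb C$-algebra on odd generators $\psi^a(n)$ ($1\le a\le d$, $n<0$) and even generators $\sigma^a(n)$ ($n\le 0$); put $\psi^a(n)=0$ for $n\ge 0$ and $\sigma^a(n)=0$ for $n>0$. Here $\psi^a(-m)$ and $\sigma^a(-m)$ are dual to $z^m\xi_a$ in $\mathfrak g[z]/\mathfrak g$ and in $\mathfrak g[z]$. If $[\xi_a,\xi_b]=\sum_e c_{ab}^e\xi_e$, write $\psi^{[a,b]}(n)=\sum_e c_{ab}^e\psi^e(n)$, and similarly for $\sigma$. Let $\mathrm{ad}_a(m)$ be the derivation of $\Lambda$ with $\psi^b(n)\mapsto\psi^{[a,b]}(m+n)$ and let $R_a(m)$ be the derivation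 of $S$ with $\sigma^b(n)\mapsto\sigma^{[a,b]}(m+n)$ (each is extended by zero to the other factor). The restricted Koszul complex $C^*$ of $(\mathfrak g[z],\mathfrak g)$ with coefficients in $S\mathfrak g[z]^*_{res}$ is the space of $\mathfrak g$-invariants in $\Lambda\otimes S$, i.e. the joint kernel of the $R_a(0)+\mathrm{ad}_a(0)$, with differential $$\bar\partial=\sum_{a;\,m>0}\bigl(\psi^a(-m)\otimes R_a(m)+\tfrac12\,\psi^a(-m)\,\mathrm{ad}_a(m)\otimes 1\bigr).$$ Equip $\Lambda\otimes S$ with the hermitian metric in which the monomials in the $\psi^a(-m)$ and $\sigma^a(-m)$ are orthogonal, the square norm of a monomial being the product of $1/m$ over its factors $\psi^a(-m)$ and of $k!$ over its factors $\sigma^a(-m)^k$. Put $$\bar\partial^*=\sum_{a;\,m>0}\bigl(\psi^a(-m)^*\otimes R_a(-m)+\tfrac12\,\mathrm{ad}_a(m)^*\,\psi^a(-m)^*\otimes 1\bigr),$$ where $\psi^a(-m)^*$ is $\frac1m$ times the contraction with the coordinate of $\psi^a(-m)$ and $\mathrm{ad}_a(m)^*$ is the derivation of $\Lambda$ with $\psi^b(n)\mapsto\frac{n-m}{n}\psi^{[a,b]}(n-m)$.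 Let $\bar\square=\bar\partial\bar\partial^*+\bar\partial^*\bar\partial$. The *harmonic forms* are the $f\in C^*$ with $\bar\partial f=0$ and $\bar\square f=0$. *Polynomial functions on $\mathfrak g[[z,s]]$.* Let $s$ be an odd variable. For a supercommutative $\mathbb C$-algebra $B$, the $B$-points of the super-schemes $\mathfrak g[[z,s]]$ and $G[[z,s]]$ are $\mathfrak g\otimes B[[z,s]]_{even}$ and $G(B[[z,s]]_{even})$, and the latter acts on the former by the adjoint action. The ring of polynomial functions on $\mathfrak g[[z,s]]$ is the free graded-commutative algebra on even coordinates $\sigma^a(-m)$ and odd coordinates $\psi^a(-m)$, $m\ge 0$, which give the coefficients of $z^m\xi_a$ and of $s z^m\xi_a$. A polynomial function is $G[[z,s]]$-*invariant* if, for every $B$, it takes the same value in $B$ at any two $B$-points of $\mathfrak g[[z,s]]$ that are conjugate under a $B$-point of $G[[z,s]]$. **Proposition.** The operators $\bar\partial$ and $\bar\partial^*$ preserve $C^*$, and $\bar\partial^*$ is the adjoint of $\bar\partial$ there. Under the algebra isomorphism from $\Lambda\otimes S$ to the ring of polynomial functions on $\mathfrak g[[z,s]]$ that fixes the $\sigma^a(-m)$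 and identifies $(m+1)\cdot\psi^a(-m-1)\in\Lambda$ with the coordinate $\psi^a(-m)$, for $m\ge0$, the space of harmonic forms in $C^*$ corresponds exactly to the subring of polynomial functions that are invariant under the adjoint action of $G[[z,s]]$. -/

import Mathlib

open scoped TensorProduct MatrixGroups

attribute [local instance 100] LieRing.ofAssociativeRing

noncomputable section

namespace HarmonicForms

/-! ### Locally finite sums of operators -/

section LocallyFinite

variable {ι M : Type} [AddCommGroup M] [Module ℂ M]

/-- A family of operators is locally finite if every vector is killed by all but finitely many
of them. -/
def LocallyFinite (T : ι → Module.End ℂ M) : Prop := ∀ f, {m | T m f ≠ 0}.Finite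

/-- The sum of a locally finite family of operators. -/
def locSum (T : ι → Module.End ℂ M) (hT : LocallyFinite T) : Module.End ℂ M where
  toFun f := ∑ᶠ m, T m f
  map_add' f g := by
    simp only [map_add]
    exact finsum_add_distrib (hT f) (hT g)
  map_smul' c f := by
    simp only [map_smul, RingHom.id_apply]
    exact (smul_finsum' c (hT f)).symm

end LocallyFinite

/-! ### The algebra `Λ ⊗ S` -/

/-- The generators `ψ^a(-m)`, `m > 0`. -/
abbrev OddIndex (d : ℕ) : Type := Fin d ×ₗ ℕ+

/-- The restricted dual of `𝔤[z]/𝔤`, with basis `ψ^a(-m)`, `m > 0`. -/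
abbrev OddSpace (d : ℕ) : Type := OddIndex d →₀ ℂ

/-- `Λ(𝔤[z]/𝔤)^*_res`. -/
abbrev Ext (d : ℕ) : Type := ExteriorAlgebra ℂ (OddSpace d)

/-- `S𝔤[z]^*_res`: polynomials in the `σ^a(-m)`, `m ≥ 0`. -/
abbrev Sym (d : ℕ) : Type := MvPolynomial (Fin d × ℕ) ℂ

/-- `Λ ⊗ S`. -/
abbrev ExtSym (d : ℕ) : Type := Ext d ⊗[ℂ] Sym d

/-- `ψ^b(n)`; zero if `n ≥ 0`. -/
def psi {d : ℕ} (b : Fin d) (n : ℤ) : OddSpace d :=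
  if h : n < 0 then Finsupp.single (toLex (b, ⟨(-n).toNat, by omega⟩)) 1 else 0

/-- `σ^b(n)`; zero if `n > 0`. -/
def sigma {d : ℕ} (b : Fin d) (n : ℤ) : Sym d :=
  if n ≤ 0 then MvPolynomial.X (b, (-n).toNat) else 0

/-- For an endomorphism `D` of the space of generators, the algebra map `v ↦ v + ε D v` from the
exterior algebra to the dual numbers over it. -/
def extLift {d : ℕ} (D : Module.End ℂ (OddSpace d)) : Ext d →ₐ[ℂ] DualNumber (Ext d) :=
  ExteriorAlgebra.lift ℂ
    ⟨(TrivSqZeroExt.inlAlgHom ℂ (Ext d) (Ext d)).toLinearMap ∘ₗ ExteriorAlgebra.ι ℂ +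
      (TrivSqZeroExt.inrHom (Ext d) (Ext d)).restrictScalars ℂ ∘ₗ ExteriorAlgebra.ι ℂ ∘ₗ D, by
    intro v
    ext
    · simp
    · have h := ExteriorAlgebra.ι_add_mul_swap (R := ℂ) v (D v)
      simp [h]⟩

/-- The derivation of the exterior algebra that extends an endomorphism `D` of the space of
generators: the `ε`-part of `v ↦ v + ε D v`. -/
def extDeriv {d : ℕ} (D : Module.End ℂ (OddSpace d)) : Module.End ℂ (Ext d) :=
  (TrivSqZeroExt.sndHom (Ext d) (Ext d)).restrictScalars ℂ ∘ₗ (extLift D).toLinearMap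

theorem fst_extLift {d : ℕ} (D : Module.End ℂ (OddSpace d)) (x : Ext d) :
    (extLift D x).fst = x := by
  have h : (TrivSqZeroExt.fstHom ℂ (Ext d) (Ext d)).comp (extLift D) = AlgHom.id ℂ (Ext d) := by
    apply ExteriorAlgebra.hom_ext
    ext v
    simp [extLift]
  exact DFunLike.congr_fun h x

theorem extDeriv_ι {d : ℕ} (D : Module.End ℂ (OddSpace d)) (v : OddSpace d) :
    extDeriv D (ExteriorAlgebra.ι ℂ v) = ExteriorAlgebra.ι ℂ (D v) := by
  simp [extDeriv, extLift]

theorem extDeriv_algebraMap {d : ℕ} (D : Module.End ℂ (OddSpace d)) (r : ℂ) :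
    extDeriv D (algebraMap ℂ (Ext d) r) = 0 := by
  simp [extDeriv, TrivSqZeroExt.algebraMap_eq_inl']

theorem extDeriv_mul {d : ℕ} (D : Module.End ℂ (OddSpace d)) (x y : Ext d) :
    extDeriv D (x * y) = x * extDeriv D y + extDeriv D x * y := by
  simp [extDeriv, fst_extLift]

/-! ### The operators -/

section Operators

variable {d : ℕ} {L : Type} [LieRing L] [LieAlgebra ℂ L] (ξ : Module.Basis (Fin d) ℂ L)

/-- `ψ^{[a,b]}(n)`. -/
def psiBracket (a b : Fin d) (n : ℤ) : OddSpace d := ∑ e, ξ.repr ⁅ξ a, ξ b⁆ e • psi e n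

/-- `σ^{[a,b]}(n)`. -/
def sigmaBracket (a b : Fin d) (n : ℤ) : Sym d := ∑ e, ξ.repr ⁅ξ a, ξ b⁆ e • sigma e n

/-- `ad_a(m)`: the derivation of `Λ` with `ψ^b(n) ↦ ψ^{[a,b]}(m+n)`, truncated. -/
def adOp (a : Fin d) (m : ℤ) : Module.End ℂ (Ext d) :=
  extDeriv (Finsupp.linearCombination ℂ fun i =>
    psiBracket ξ a (ofLex i).1 (m + -((ofLex i).2 : ℤ)))

/-- `ad_a(m)^*`: the derivation of `Λ` with `ψ^b(n) ↦ ((n-m)/n) ψ^{[a,b]}(n-m)`, truncated. -/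
def adStarOp (a : Fin d) (m : ℤ) : Module.End ℂ (Ext d) :=
  extDeriv (Finsupp.linearCombination ℂ fun i =>
    ((-((ofLex i).2 : ℂ) - (m : ℂ)) / (-((ofLex i).2 : ℂ))) •
      psiBracket ξ a (ofLex i).1 (-((ofLex i).2 : ℤ) - m))

/-- `R_a(m)`: the derivation of `S` with `σ^b(n) ↦ σ^{[a,b]}(m+n)`, truncated. -/
def ROp (a : Fin d) (m : ℤ) : Module.End ℂ (Sym d) :=
  (MvPolynomial.mkDerivation ℂ fun i : Fin d × ℕ =>
    sigmaBracket ξ a i.1 (m + -(i.2 : ℤ))).toLinearMap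

/-- Multiplication by `ψ^a(-m)`, `m > 0`. -/
def psiMul (a : Fin d) (m : ℕ+) : Module.End ℂ (Ext d) :=
  LinearMap.mulLeft ℂ (ExteriorAlgebra.ι ℂ (psi a (-(m : ℤ))))

/-- `ψ^a(-m)^*`, the adjoint of multiplication by `ψ^a(-m)`: as `ψ^a(-m)` has square norm `1/m`,
this is `1/m` times the contraction with the coordinate of `ψ^a(-m)`. -/
def psiStar (a : Fin d) (m : ℕ+) : Module.End ℂ (Ext d) :=
  (1 / (m : ℂ)) • CliffordAlgebra.contractLeft (Q := (0 : QuadraticForm ℂ (OddSpace d)))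
    (Finsupp.lapply (toLex (a, m)))

/-- The summand of the Koszul differential with index `m`. -/
def dbarTerm (m : ℕ+) : Module.End ℂ (ExtSym d) :=
  ∑ a, (TensorProduct.map (psiMul a m) (ROp ξ a m) +
    TensorProduct.map ((1 / 2 : ℂ) • (psiMul a m * adOp ξ a m)) LinearMap.id)

/-- The summand of the adjoint of the Koszul differential with index `m`. -/
def dbarStarTerm (m : ℕ+) : Module.End ℂ (ExtSym d) :=
  ∑ a, (TensorProduct.map (psiStar a m) (ROp ξ a (-m)) +
    TensorProduct.map ((1 / 2 : ℂ) • (adStarOp ξ a m * psiStar a m)) LinearMap.id)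

end Operators

/-! ### Local finiteness -/

section Finiteness

variable {ι M M' : Type} [AddCommGroup M] [Module ℂ M] [AddCommGroup M'] [Module ℂ M']

theorem LocallyFinite.add {T U : ι → Module.End ℂ M} (hT : LocallyFinite T)
    (hU : LocallyFinite U) : LocallyFinite fun m => T m + U m := by
  intro f
  refine ((hT f).union (hU f)).subset fun m hm => ?_
  by_contra h
  simp only [Set.mem_union, Set.mem_ofPred_eq, not_or, not_not] at h
  exact hm (by simp [h.1, h.2])

theorem LocallyFinite.sum {κ : Type} (s : Finset κ) {T : κ → ι → Module.End ℂ M}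
    (hT : ∀ k, LocallyFinite (T k)) : LocallyFinite fun m => ∑ k ∈ s, T k m := by
  intro f
  refine (s.finite_toSet.biUnion fun k _ => hT k f).subset fun m hm => ?_
  by_contra h
  simp only [Set.mem_iUnion, Set.mem_ofPred_eq, not_exists, not_not] at h
  exact hm (by
    rw [LinearMap.sum_apply]
    exact Finset.sum_eq_zero fun k hk => h k hk)

theorem LocallyFinite.comp_left {T : ι → Module.End ℂ M} (hT : LocallyFinite T)
    (U : ι → Module.End ℂ M) : LocallyFinite fun m => U m * T m := by
  intro f
  refine (hT f).subset fun m hm h => hm ?_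
  simp [h]

theorem LocallyFinite.map_right (T : ι → Module.End ℂ M) {U : ι → Module.End ℂ M'}
    (hU : LocallyFinite U) : LocallyFinite fun m => TensorProduct.map (T m) (U m) := by
  intro f
  induction f using TensorProduct.induction_on with
  | zero => simp
  | tmul x y =>
    refine (hU y).subset fun m hm h => hm ?_
    simp [h]
  | add x y hx hy =>
    refine (hx.union hy).subset fun m hm => ?_
    by_contra h
    simp only [Set.mem_union, Set.mem_ofPred_eq, not_or, not_not] at h
    exact hm (by simp [h.1, h.2])

theorem LocallyFinite.map_left {T : ι → Module.End ℂ M} (hT : LocallyFinite T)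
    (U : ι → Module.End ℂ M') : LocallyFinite fun m => TensorProduct.map (T m) (U m) := by
  intro f
  induction f using TensorProduct.induction_on with
  | zero => simp
  | tmul x y =>
    refine (hT x).subset fun m hm h => hm ?_
    simp [h]
  | add x y hx hy =>
    refine (hx.union hy).subset fun m hm => ?_
    by_contra h
    simp only [Set.mem_union, Set.mem_ofPred_eq, not_or, not_not] at h
    exact hm (by simp [h.1, h.2])

theorem locallyFinite_extDeriv {d : ℕ} {D : ι → Module.End ℂ (OddSpace d)}
    (hD : LocallyFinite D) : LocallyFinite fun m => extDeriv (D m) := by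
  intro f
  induction f using ExteriorAlgebra.induction with
  | algebraMap r => simp [extDeriv_algebraMap]
  | ι v =>
    refine (hD v).subset fun m hm h => hm ?_
    simp [extDeriv_ι, h]
  | mul x y hx hy =>
    refine (hx.union hy).subset fun m hm => ?_
    by_contra h
    simp only [Set.mem_union, Set.mem_ofPred_eq, not_or, not_not] at h
    exact hm (by simp [extDeriv_mul, h.1, h.2])
  | add x y hx hy =>
    refine (hx.union hy).subset fun m hm => ?_
    by_contra h
    simp only [Set.mem_union, Set.mem_ofPred_eq, not_or, not_not] at h
    exact hm (by simp [h.1, h.2])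

theorem locallyFinite_linearCombination {κ : Type} {v : ι → κ → κ →₀ ℂ}
    (hv : ∀ i, {m | v m i ≠ 0}.Finite) :
    LocallyFinite fun m => Finsupp.linearCombination ℂ (v m) := by
  intro f
  refine (f.support.finite_toSet.biUnion fun i _ => hv i).subset fun m hm => ?_
  by_contra h
  simp only [Set.mem_iUnion, Set.mem_ofPred_eq, not_exists, not_not] at h
  refine hm ?_
  rw [Finsupp.linearCombination_apply]
  exact Finset.sum_eq_zero fun i hi => by simp [h i hi]

theorem locallyFinite_mkDerivation {κ : Type} {v : ι → κ → MvPolynomial κ ℂ}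
    (hv : ∀ i, {m | v m i ≠ 0}.Finite) :
    LocallyFinite fun m => (MvPolynomial.mkDerivation ℂ (v m)).toLinearMap := by
  intro f
  induction f using MvPolynomial.induction_on with
  | C r => simp
  | add x y hx hy =>
    refine (hx.union hy).subset fun m hm => ?_
    by_contra h
    simp only [Set.mem_union, Set.mem_ofPred_eq, not_or, not_not] at h
    exact hm (by rw [map_add, h.1, h.2, add_zero])
  | mul_X x i hx =>
    refine (hx.union (hv i)).subset fun m hm => ?_
    by_contra h
    simp only [Set.mem_union, Set.mem_ofPred_eq, not_or, not_not] at h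
    refine hm ?_
    have h1 := h.1
    rw [Derivation.coeFn_coe] at h1
    simp [h1, h.2]

variable {d : ℕ} {L : Type} [LieRing L] [LieAlgebra ℂ L] (ξ : Module.Basis (Fin d) ℂ L)

theorem locallyFinite_adOp (a : Fin d) : LocallyFinite fun m : ℕ+ => adOp ξ a m := by
  refine locallyFinite_extDeriv (locallyFinite_linearCombination fun i => ?_)
  refine (Set.finite_Iic (ofLex i).2).subset fun m hm => ?_
  by_contra h
  refine hm (Finset.sum_eq_zero fun e _ => ?_)
  have h1 : ((ofLex i).2 : ℕ) < m := by simpa using h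
  have h2 : ¬ ((m : ℤ) + -((ofLex i).2 : ℤ) < 0) := by omega
  rw [psi, dif_neg h2, smul_zero]

theorem locallyFinite_ROp (a : Fin d) : LocallyFinite fun m : ℕ+ => ROp ξ a m := by
  refine locallyFinite_mkDerivation fun i => ?_
  refine (Set.finite_Iic (Nat.succPNat i.2)).subset fun m hm => ?_
  by_contra h
  refine hm (Finset.sum_eq_zero fun e _ => ?_)
  have h1 : ((Nat.succPNat i.2 : ℕ+) : ℕ) < m := PNat.coe_lt_coe _ _ |>.2 (not_le.1 h)
  have h2 : ¬ ((m : ℤ) + -(i.2 : ℤ) ≤ 0) := by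
    rw [Nat.succPNat_coe] at h1
    omega
  rw [sigma, if_neg h2, smul_zero]

theorem locallyFinite_psiStar (a : Fin d) : LocallyFinite fun m : ℕ+ => psiStar a m := by
  intro f
  induction f using CliffordAlgebra.left_induction with
  | algebraMap r => simp [psiStar]
  | add x y hx hy =>
    refine (hx.union hy).subset fun m hm => ?_
    by_contra h
    simp only [Set.mem_union, Set.mem_ofPred_eq, not_or, not_not] at h
    exact hm (by rw [map_add, h.1, h.2, add_zero])
  | ι_mul x v hx =>
    have hv : {m : ℕ+ | v (toLex (a, m)) ≠ 0}.Finite :=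
      Set.Finite.preimage (f := fun m : ℕ+ => toLex (a, m))
        (fun m _ m' _ h => by simpa using h) v.hasFiniteSupport
    refine (hx.union hv).subset fun m hm => ?_
    by_contra h
    simp only [Set.mem_union, Set.mem_ofPred_eq, not_or, not_not] at h
    refine hm ?_
    have h1 := h.1
    simp only [psiStar, LinearMap.smul_apply, smul_eq_zero] at h1 ⊢
    right
    have h2 : (1 / (m : ℂ)) ≠ 0 := by simp
    rw [CliffordAlgebra.contractLeft_ι_mul, h1.resolve_left h2]
    simp [h.2]

theorem locallyFinite_dbarTerm : LocallyFinite fun m => dbarTerm ξ m := by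
  refine LocallyFinite.sum _ fun a => LocallyFinite.add ?_ ?_
  · exact LocallyFinite.map_right _ (locallyFinite_ROp ξ a)
  · refine LocallyFinite.map_left (T := fun m => (1 / 2 : ℂ) • (psiMul a m * adOp ξ a m)) ?_ _
    simp only [← smul_mul_assoc]
    exact LocallyFinite.comp_left (locallyFinite_adOp ξ a) _

theorem locallyFinite_dbarStarTerm : LocallyFinite fun m => dbarStarTerm ξ m := by
  refine LocallyFinite.sum _ fun a => LocallyFinite.add ?_ ?_
  · exact LocallyFinite.map_left (T := fun m : ℕ+ => psiStar a m) (locallyFinite_psiStar a)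
      fun m : ℕ+ => ROp ξ a (-m)
  · refine LocallyFinite.map_left (T := fun m : ℕ+ => (1 / 2 : ℂ) • (adStarOp ξ a m * psiStar a m)) ?_ _
    simp only [← smul_mul_assoc]
    exact LocallyFinite.comp_left (locallyFinite_psiStar a) _

end Finiteness

/-! ### The restricted Koszul complex, its metric, and harmonic forms -/

section Koszul

variable {d : ℕ} {L : Type} [LieRing L] [LieAlgebra ℂ L] (ξ : Module.Basis (Fin d) ℂ L)

/-- The Koszul differential
`∑_{a, m > 0} (ψ^a(-m) ⊗ R_a(m) + ψ^a(-m) ad_a(m) ⊗ 1/2)`. -/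
def dbar : Module.End ℂ (ExtSym d) := locSum (dbarTerm ξ) (locallyFinite_dbarTerm ξ)

/-- The operator
`∑_{a, m > 0} (ψ^a(-m)^* ⊗ R_a(-m) + ad_a(m)^* ψ^a(-m)^* ⊗ 1/2)`. -/
def dbarStar : Module.End ℂ (ExtSym d) := locSum (dbarStarTerm ξ) (locallyFinite_dbarStarTerm ξ)

/-- The Laplacian. -/
def laplacian : Module.End ℂ (ExtSym d) := dbar ξ * dbarStar ξ + dbarStar ξ * dbar ξ

/-- The restricted Koszul complex `C^*` of `(𝔤[z], 𝔤)`: the `𝔤`-invariants in `Λ ⊗ S`. -/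
def koszul : Submodule ℂ (ExtSym d) :=
  ⨅ a, LinearMap.ker (TensorProduct.map LinearMap.id (ROp ξ a 0) +
    TensorProduct.map (adOp ξ a 0) LinearMap.id)

/-- The harmonic forms: the cocycles in `C^*` that the Laplacian kills. -/
def harmonicForms : Submodule ℂ (ExtSym d) :=
  koszul ξ ⊓ LinearMap.ker (dbar ξ) ⊓ LinearMap.ker (laplacian ξ)

/-- The basis of `Λ ⊗ S` by monomials in the `ψ^a(-m)`, `m > 0`, and the `σ^a(-m)`, `m ≥ 0`. -/
def monomialBasis (d : ℕ) :
    Module.Basis (Finset (OddIndex d) × ((Fin d × ℕ) →₀ ℕ)) ℂ (ExtSym d) :=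
  (Finsupp.basisSingleOne (R := ℂ) (ι := OddIndex d)).ExteriorAlgebra.tensorProduct
    (MvPolynomial.basisMonomials (Fin d × ℕ) ℂ)

/-- The square norm of a monomial: `1/m` for each factor `ψ^a(-m)`, and `k!` for each factor
`σ^a(-m)^k`. -/
def monomialNormSq {d : ℕ} (i : Finset (OddIndex d) × ((Fin d × ℕ) →₀ ℕ)) : ℂ :=
  (∏ j ∈ i.1, 1 / ((ofLex j).2 : ℂ)) * i.2.prod fun _ k => (k.factorial : ℂ)

/-- The hermitian metric on `Λ ⊗ S`: the `ψ^a(-m)` and `σ^a(-m)` are orthogonal, with square norms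
`1/m` and `1`, and the metric is extended multilinearly, so that the monomials are orthogonal. -/
def metric {d : ℕ} (f g : ExtSym d) : ℂ :=
  ((monomialBasis d).repr f).sum fun i w =>
    starRingEnd ℂ w * monomialNormSq i * (monomialBasis d).repr g i

end Koszul

/-! ### Super-polynomials on `𝔤[[z,s]]` -/

/-- The super-polynomials on `𝔤[[z,s]] = 𝔤[[z]] ⊕ s 𝔤[[z]]`: the free supercommutative algebra on
the even coordinates `σ^a(-m)` on `𝔤[[z]]`, with `m ≥ 0`, (right factor) and the odd coordinates
`ψ^a(-m)` on `s 𝔤[[z]]`, with `m ≥ 0` (left factor). -/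
abbrev SuperPoly (d : ℕ) : Type :=
  ExteriorAlgebra ℂ ((Fin d × ℕ) →₀ ℂ) ⊗[ℂ] MvPolynomial (Fin d × ℕ) ℂ

/-- The coordinate `σ^a(-m)` on `𝔤[[z]]`. -/
def evenCoord {d : ℕ} (a : Fin d) (m : ℕ) : SuperPoly d := 1 ⊗ₜ MvPolynomial.X (a, m)

/-- The coordinate `ψ^a(-m)` on `s 𝔤[[z]]`. -/
def oddCoord {d : ℕ} (a : Fin d) (m : ℕ) : SuperPoly d :=
  ExteriorAlgebra.ι ℂ (Finsupp.single (a, m) 1) ⊗ₜ 1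

/-- The new `ψ^a(-m)` is `m + 1` times the old `ψ^a(-m-1)`. -/
def relabelGenInv (d : ℕ) : ((Fin d × ℕ) →₀ ℂ) →ₗ[ℂ] OddSpace d :=
  Finsupp.linearCombination ℂ fun i => ((i.2 : ℂ) + 1) • psi i.1 (-(i.2.succPNat : ℤ))

/-- The old `ψ^a(-m)` is `1/m` times the new `ψ^a(-(m-1))`. -/
def relabelGen (d : ℕ) : OddSpace d →ₗ[ℂ] ((Fin d × ℕ) →₀ ℂ) :=
  Finsupp.linearCombination ℂ fun i =>
    (1 / ((ofLex i).2 : ℂ)) • Finsupp.single ((ofLex i).1, (ofLex i).2.natPred) 1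

theorem psi_neg {d : ℕ} (a : Fin d) (m : ℕ+) :
    psi a (-(m : ℤ)) = Finsupp.single (toLex (a, m)) 1 := by
  have h : (-(m : ℤ) < 0) := by simp
  rw [psi, dif_pos h]
  congr
  rw [neg_neg, Int.toNat_natCast]
  rfl

theorem relabelGen_comp (d : ℕ) : relabelGen d ∘ₗ relabelGenInv d = LinearMap.id := by
  ext i : 2
  obtain ⟨a, m⟩ := i
  have h2 : (m : ℂ) + 1 ≠ 0 := by exact_mod_cast m.succ_ne_zero
  simp only [relabelGenInv, relabelGen, LinearMap.comp_apply, Finsupp.lsingle_apply,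
    Finsupp.linearCombination_single, psi_neg, map_smul]
  simp [h2]

theorem relabelGenInv_comp (d : ℕ) : relabelGenInv d ∘ₗ relabelGen d = LinearMap.id := by
  refine Finsupp.lhom_ext' fun i => LinearMap.ext_ring ?_
  obtain ⟨⟨a, m⟩, rfl⟩ := toLex.surjective i
  have h2 : (m.natPred : ℂ) + 1 = m := by
    exact_mod_cast congrArg (fun k : ℕ => (k : ℂ)) m.natPred_add_one
  have h3 : (m : ℂ) ≠ 0 := by simp
  simp only [relabelGenInv, relabelGen, LinearMap.comp_apply, Finsupp.lsingle_apply,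
    Finsupp.linearCombination_single, psi_neg, map_smul, ofLex_toLex, h2, PNat.succPNat_natPred,
    smul_smul, LinearMap.id_apply]
  simp [h3]

/-- The relabelling isomorphism from `Λ(𝔤[z]/𝔤)^*_res ⊗ S𝔤[z]^*_res` to
`Λ𝔤[z]^*_res ⊗ S𝔤[z]^*_res` that comes from `d/dz : 𝔤[z]/𝔤 ≅ 𝔤[z]`. -/
def relabel (d : ℕ) : ExtSym d ≃ₐ[ℂ] SuperPoly d :=
  Algebra.TensorProduct.congr
    (AlgEquiv.ofAlgHom (ExteriorAlgebra.map (relabelGen d)) (ExteriorAlgebra.map (relabelGenInv d))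
      (by rw [ExteriorAlgebra.map_comp_map, relabelGen_comp, ExteriorAlgebra.map_id])
      (by rw [ExteriorAlgebra.map_comp_map, relabelGenInv_comp, ExteriorAlgebra.map_id]))
    AlgEquiv.refl

/-! ### Supercommutative algebras and functions on the formal super-disk -/

/-- A `ℤ/2`-graded algebra is supercommutative if even elements are central and odd elements
anticommute. -/
class SuperCommutative {B : Type} [Ring B] [Algebra ℂ B] (ℬ : ZMod 2 → Submodule ℂ B) : Prop where
  even_comm : ∀ a ∈ ℬ 0, ∀ b, a * b = b * a
  odd_anticomm : ∀ a ∈ ℬ 1, ∀ b ∈ ℬ 1, a * b = -(b * a)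

section SuperDisk

variable {B : Type} [Ring B] [Algebra ℂ B] (ℬ : ZMod 2 → Submodule ℂ B) [GradedAlgebra ℬ]

/-- The even part of `B[[z,s]]`: the elements `u + s v` with `u ∈ B[[z]]` even and `v ∈ B[[z]]` odd.
On such elements, the rules `s² = 0` and `s b = (-1)^{|b|} b s` give the product
`(u + s v)(u' + s v') = u u' + s (v u' + u v')`, so they form a subalgebra of the dual numbers over
`B[[z]]`. -/
def superDisk : Subalgebra ℂ (DualNumber (PowerSeries B)) where
  carrier := {x | ∀ n, PowerSeries.coeff n x.fst ∈ ℬ 0 ∧ PowerSeries.coeff n x.snd ∈ ℬ 1}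
  mul_mem' {x y} hx hy n := by
    constructor
    · rw [TrivSqZeroExt.fst_mul, PowerSeries.coeff_mul]
      refine Submodule.sum_mem _ fun p _ => ?_
      simpa using SetLike.mul_mem_graded (hx p.1).1 (hy p.2).1
    · rw [TrivSqZeroExt.snd_mul, map_add]
      refine Submodule.add_mem _ ?_ ?_
      · rw [smul_eq_mul, PowerSeries.coeff_mul]
        refine Submodule.sum_mem _ fun p _ => ?_
        simpa using SetLike.mul_mem_graded (hx p.1).1 (hy p.2).2
      · rw [op_smul_eq_mul, PowerSeries.coeff_mul]
        refine Submodule.sum_mem _ fun p _ => ?_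
        simpa using SetLike.mul_mem_graded (hx p.1).2 (hy p.2).1
  add_mem' {x y} hx hy n := by
    simp only [TrivSqZeroExt.fst_add, TrivSqZeroExt.snd_add, map_add]
    exact ⟨Submodule.add_mem _ (hx n).1 (hy n).1, Submodule.add_mem _ (hx n).2 (hy n).2⟩
  algebraMap_mem' r n := by
    rw [TrivSqZeroExt.algebraMap_eq_inl']
    refine ⟨?_, by simp⟩
    rw [TrivSqZeroExt.fst_inl, Algebra.algebraMap_eq_smul_one, PowerSeries.coeff_smul,
      PowerSeries.coeff_one]
    split_ifs
    · exact Submodule.smul_mem _ _ SetLike.GradedOne.one_mem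
    · simp

instance superDisk.instCommRing [SuperCommutative ℬ] : CommRing (superDisk ℬ) where
  __ := (superDisk ℬ).toRing
  mul_comm x y := by
    have key : ∀ u v : PowerSeries B, (∀ n, PowerSeries.coeff n u ∈ ℬ 0) → u * v = v * u := by
      intro u v hu
      ext n
      rw [PowerSeries.coeff_mul, PowerSeries.coeff_mul, ← Finset.Nat.sum_antidiagonal_swap]
      exact Finset.sum_congr rfl fun p _ => SuperCommutative.even_comm _ (hu _) _
    obtain ⟨x, hx⟩ := x
    obtain ⟨y, hy⟩ := y
    apply Subtype.ext
    ext1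
    · exact key _ _ fun n => (hx n).1
    · change x.fst • y.snd + MulOpposite.op y.fst • x.snd =
        y.fst • x.snd + MulOpposite.op x.fst • y.snd
      simp only [smul_eq_mul, op_smul_eq_mul]
      rw [key x.fst y.snd fun n => (hx n).1, key y.fst x.snd fun n => (hy n).1, add_comm]

/-- A `B`-point of the super-scheme `𝔤[[z,s]]`, as a parity-preserving algebra map from its
coordinate ring to `B`. -/
structure SuperPoint (d : ℕ) where
  eval : SuperPoly d →ₐ[ℂ] B
  even_mem : ∀ a m, eval (evenCoord a m) ∈ ℬ 0
  odd_mem : ∀ a m, eval (oddCoord a m) ∈ ℬ 1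

/-- The coefficient of `ξ_a` in the element of `𝔤 ⊗ B[[z,s]]` given by a `B`-point of `𝔤[[z,s]]`:
`∑_m σ^a(-m) z^m + s ∑_m ψ^a(-m) z^m`. -/
def SuperPoint.component {ℬ : ZMod 2 → Submodule ℂ B} [GradedAlgebra ℬ] {d : ℕ}
    (x : SuperPoint ℬ d) (a : Fin d) : superDisk ℬ :=
  ⟨TrivSqZeroExt.inl (PowerSeries.mk fun m => x.eval (evenCoord a m)) +
    TrivSqZeroExt.inr (PowerSeries.mk fun m => x.eval (oddCoord a m)), fun n => by
      simpa using ⟨x.even_mem a n, x.odd_mem a n⟩⟩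

end SuperDisk

/-! ### The group and its Lie algebra -/

section Group

variable {N : ℕ}

/-- The ideal of polynomials in the matrix entries that vanish on `G`. -/
def groupIdeal (G : Subgroup (GL (Fin N) ℂ)) : Ideal (MvPolynomial (Fin N × Fin N) ℂ) where
  carrier := {p | ∀ g ∈ G, MvPolynomial.eval
    (fun ij => (g : Matrix (Fin N) (Fin N) ℂ) ij.1 ij.2) p = 0}
  add_mem' {p q} hp hq g hg := by rw [map_add, hp g hg, hq g hg, add_zero]
  zero_mem' g _ := map_zero _
  smul_mem' p q hq g hg := by rw [smul_eq_mul, map_mul, hq g hg, mul_zero]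

/-- `G` is Zariski closed in `GL_N(ℂ)`. -/
def IsZariskiClosed (G : Subgroup (GL (Fin N) ℂ)) : Prop :=
  ∀ g : GL (Fin N) ℂ, (∀ p ∈ groupIdeal G, MvPolynomial.eval
    (fun ij => (g : Matrix (Fin N) (Fin N) ℂ) ij.1 ij.2) p = 0) → g ∈ G

/-- The points of the linear algebraic group `G` over a commutative `ℂ`-algebra `R`. -/
def groupPoints (G : Subgroup (GL (Fin N) ℂ)) (R : Type) [CommRing R] [Algebra ℂ R] :
    Set (GL (Fin N) R) :=
  {g | ∀ p ∈ groupIdeal G, MvPolynomial.aeval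
    (fun ij : Fin N × Fin N => (g : Matrix (Fin N) (Fin N) R) ij.1 ij.2) p = 0}

/-- The left-invariant vector field on matrices with value `X` at `1`: the derivation
`p ↦ d/dε p(g(1 + εX))` of the polynomials in the matrix entries. -/
def leftInvariant (X : Matrix (Fin N) (Fin N) ℂ) :
    Derivation ℂ (MvPolynomial (Fin N × Fin N) ℂ) (MvPolynomial (Fin N × Fin N) ℂ) :=
  MvPolynomial.mkDerivation ℂ fun ij => ∑ k, X k ij.2 • MvPolynomial.X (ij.1, k)

theorem leftInvariant_add (X Y : Matrix (Fin N) (Fin N) ℂ) :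
    leftInvariant (X + Y) = leftInvariant X + leftInvariant Y := by
  apply MvPolynomial.derivation_ext
  intro ij
  simp [leftInvariant, MvPolynomial.mkDerivation_X, add_smul, Finset.sum_add_distrib]

theorem leftInvariant_smul (c : ℂ) (X : Matrix (Fin N) (Fin N) ℂ) :
    leftInvariant (c • X) = c • leftInvariant X := by
  apply MvPolynomial.derivation_ext
  intro ij
  simp [leftInvariant, MvPolynomial.mkDerivation_X, mul_smul, Finset.smul_sum]

theorem leftInvariant_lie (X Y : Matrix (Fin N) (Fin N) ℂ) :
    leftInvariant ⁅X, Y⁆ = ⁅leftInvariant X, leftInvariant Y⁆ := by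
  apply MvPolynomial.derivation_ext
  intro ij
  have h : ∀ X Y : Matrix (Fin N) (Fin N) ℂ,
      leftInvariant X (leftInvariant Y (MvPolynomial.X ij)) =
        ∑ k, (X * Y) k ij.2 • (MvPolynomial.X (ij.1, k) : MvPolynomial (Fin N × Fin N) ℂ) := by
    intro X Y
    simp only [leftInvariant, MvPolynomial.mkDerivation_X, map_sum, Derivation.map_smul,
      Matrix.mul_apply, Finset.sum_smul, Finset.smul_sum, smul_smul]
    rw [Finset.sum_comm]
    refine Finset.sum_congr rfl fun k _ => Finset.sum_congr rfl fun l _ => ?_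
    rw [mul_comm]
  rw [Derivation.commutator_apply, h, h, ← Finset.sum_sub_distrib]
  simp only [leftInvariant, MvPolynomial.mkDerivation_X, Ring.lie_def, Matrix.sub_apply, sub_smul]

/-- The Lie algebra of `G`: the matrices `X` whose left-invariant vector field is tangent to `G`. -/
def lieAlgebraOf (G : Subgroup (GL (Fin N) ℂ)) : LieSubalgebra ℂ (Matrix (Fin N) (Fin N) ℂ) where
  carrier := {X | ∀ p ∈ groupIdeal G, leftInvariant X p ∈ groupIdeal G}
  add_mem' {X Y} hX hY p hp := by
    rw [leftInvariant_add]
    exact Ideal.add_mem _ (hX p hp) (hY p hp)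
  zero_mem' p hp := by
    have h : leftInvariant (0 : Matrix (Fin N) (Fin N) ℂ) = 0 := by
      simpa using leftInvariant_smul (0 : ℂ) (0 : Matrix (Fin N) (Fin N) ℂ)
    rw [h]
    exact Ideal.zero_mem _
  smul_mem' c X hX p hp := by
    rw [leftInvariant_smul, Derivation.smul_apply, MvPolynomial.smul_eq_C_mul]
    exact Ideal.mul_mem_left _ _ (hX p hp)
  lie_mem' {X Y} hX hY p hp := by
    rw [leftInvariant_lie, Derivation.commutator_apply]
    exact Ideal.sub_mem _ (hX _ (hY p hp)) (hY _ (hX p hp))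

/-- `τ` is the conjugation of a complex Lie algebra with respect to a compact real form: an
antilinear involutive automorphism, with the Killing form negative definite on its fixed points. -/
structure IsCompactConjugation {L : Type} [LieRing L] [LieAlgebra ℂ L]
    (τ : L →ₛₗ[starRingEnd ℂ] L) : Prop where
  involutive : ∀ x, τ (τ x) = x
  lie : ∀ x y, τ ⁅x, y⁆ = ⁅τ x, τ y⁆
  neg_def : ∀ x, τ x = x → x ≠ 0 → (killingForm ℂ L x x).re < 0

variable {d : ℕ} (G : Subgroup (GL (Fin N) ℂ)) (ξ : Module.Basis (Fin d) ℂ (lieAlgebraOf G))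

/-- The element `∑_a x_a ξ_a` of `𝔤 ⊗ B[[z,s]]` given by a `B`-point of `𝔤[[z,s]]`, as a matrix. -/
def SuperPoint.matrix {B : Type} [Ring B] [Algebra ℂ B] {ℬ : ZMod 2 → Submodule ℂ B}
    [GradedAlgebra ℬ] [SuperCommutative ℬ] (x : SuperPoint ℬ d) :
    Matrix (Fin N) (Fin N) (superDisk ℬ) :=
  ∑ a, x.component a • (ξ a : Matrix (Fin N) (Fin N) ℂ).map (algebraMap ℂ (superDisk ℬ))

/-- The ring of polynomial functions on the super-scheme `𝔤[[z,s]]` that are invariant under the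
adjoint action of the super-group scheme `G[[z,s]]`: for every supercommutative algebra `B`, they
take the same value at any two `B`-points of `𝔤[[z,s]]` that are conjugate under a `B`-point of
`G[[z,s]]`, that is, under a point of `G` over the even part of `B[[z,s]]`. -/
def invariantFunctions : Subalgebra ℂ (SuperPoly d) where
  carrier := {f | ∀ (B : Type) [Ring B] [Algebra ℂ B] (ℬ : ZMod 2 → Submodule ℂ B)
    [GradedAlgebra ℬ] [SuperCommutative ℬ] (g : GL (Fin N) (superDisk ℬ)) (x y : SuperPoint ℬ d),
    g ∈ groupPoints G (superDisk ℬ) →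
    y.matrix G ξ = (g : Matrix (Fin N) (Fin N) (superDisk ℬ)) * x.matrix G ξ *
      ((g⁻¹ : GL (Fin N) (superDisk ℬ)) : Matrix (Fin N) (Fin N) (superDisk ℬ)) →
    y.eval f = x.eval f}
  mul_mem' {f h} hf hh B _ _ ℬ _ _ g x y hg hxy := by
    rw [map_mul, map_mul, hf B ℬ g x y hg hxy, hh B ℬ g x y hg hxy]
  add_mem' {f h} hf hh B _ _ ℬ _ _ g x y hg hxy := by
    rw [map_add, map_add, hf B ℬ g x y hg hxy, hh B ℬ g x y hg hxy]
  algebraMap_mem' r B _ _ ℬ _ _ g x y hg hxy := by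
    rw [AlgHom.commutes, AlgHom.commutes]

end Group

end HarmonicForms

end

/-!
The algebra `Λ ⊗ S` is a free supercommutative algebra, and so is the algebra of polynomial functions
on `𝔤[[z,s]]`. The relabelling of the generators turns the dual of `z^m ξ_a` in `𝔤[z]/𝔤` into the
coordinate of `s z^(m-1) ξ_a`. Both sides of the claim are compared with the functions that the Lie
superalgebra `𝔤[z,s]` kills (`LieInvariant`).

*Harmonic forms.* Let `T_a(m)` and `E_a(m)` be the even and the odd derivation by which `z^m ξ_a` and
`s z^(m-1) ξ_a` act on `Λ ⊗ S`, and let `T'` and `E'` be their adjoints. The key identity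
(`KoszulOperators.laplacian_eq`) is
`□ = ∑_{a, m > 0} (1/m) T'_a(m) T_a(m) + ∑_{a, m > 0} E'_a(m) E_a(m) - ∑_a Y_a T_a(0)`,
where the `Y_a` are even derivations. Each term is a differential operator of order two, so the two
sides agree once they agree on products of at most two generators. There the identity follows from
the invariance of the Killing form and from the fact that the Casimir operator of `𝔤` in the adjoint
representation is `1`. The `T_a(0)` vanish on the Koszul complex, so `⟨f, □ f⟩` is a sum of square
norms, and an element of the complex is harmonic if and only if all `T_a(m)` and `E_a(m)` kill it
(`DualOperators.harmonic_iff`, `mem_harmonicForms_iff`). That the basis is self-adjoint for a compact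
conjugation makes the structure constants imaginary (`isImaginary_of_conjugation`), which is what the
adjointness relations need.

*Invariant functions are killed by `𝔤[z,s]`.* The matrix `1 - T ξ_a` with `T = t z^m` or
`T = η s z^m`, where `t` is even of square zero and `η` is odd, is a point of `G[[z,s]]`, and
conjugation by it changes the value of `f` by `t` or `η` times the value of the derivative of `f`. At
the universal point of `𝔤[[z,s]]`, with two free odd parameters `η₀`, `η₁` adjoined, `t = η₀ η₁` and
`η = η₀` can be cancelled (`lieInvariant_of_mem_invariantFunctions`).

*Functions killed by `𝔤[z,s]` are invariant.* Consider a family `h` of points of `G[[z,s]]` over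
`B ⊗ A`, where `A` is a commutative algebra with derivations that kill only the scalars. The conjugates
`Y = h x h⁻¹` of a fixed point `x` satisfy the Lax equation `∂Y = [∂h h⁻¹, Y]` for each of these
derivations (`lax_equation`), and `∂h h⁻¹` has values in `𝔤`. So `∂ f(Y)` is a combination of
derivatives of `f` along `𝔤[z,s]` and vanishes (`derivation_eval_conj`), and the value of `f` is the
same for all the members of the family (`exists_eval_conj_eq`). For `A = ℂ[l]` and the scaling
`z ↦ l z`, `s ↦ l s`, this replaces a point of `G[[z,s]]` by its value at `z = s = 0`. For the
coordinate ring `A` of `G` and its universal point, it replaces that value by `1`.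

Connectedness enters through the fact that the left-invariant vector fields kill only the constants of
the coordinate ring (`evalAt_eq_of_leftInvariant`). A function killed by them that vanishes at the
identity vanishes there to infinite order, since an Euler field at the identity is a combination of
left-invariant fields. By Krull's theorem it vanishes near the identity, so a function killed by the
left-invariant fields is locally constant on `G`. The same fact gives `det = 1` on `G`
(`detPoly_sub_one_mem`), so inverses are polynomial on `G`.
-/

noncomputable section

namespace HarmonicForms

/-! ### Derivations of free supercommutative algebras -/

section Super

/-- An algebra that is generated by odd elements indexed by `κ` and central even elements indexed
by `I`, together with its parity automorphism, which is `1` on even elements and `-1` on odd ones.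
The induction principle says that products of generators span the algebra. -/
structure SuperGen (κ I A : Type) [Ring A] [Algebra ℂ A] where
  odd : κ → A
  even : I → A
  parity : A →ₐ[ℂ] A
  parity_odd : ∀ k, parity (odd k) = -odd k
  parity_even : ∀ i, parity (even i) = even i
  even_mul : ∀ i x, even i * x = x * even i
  odd_mul : ∀ k x, odd k * x = parity x * odd k
  induction : ∀ {p : A → Prop}, p 1 → (∀ x y, p x → p y → p (x + y)) →
    (∀ (c : ℂ) x, p x → p (c • x)) → (∀ k x, p x → p (odd k * x)) →
    (∀ i x, p x → p (even i * x)) → ∀ x, p x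

variable {κ I A : Type} [Ring A] [Algebra ℂ A] (S : SuperGen κ I A)

theorem super_induction {p : A → Prop} (one : p 1) (add : ∀ x y, p x → p y → p (x + y))
    (smul : ∀ (c : ℂ) x, p x → p (c • x)) (odd : ∀ k x, p x → p (S.odd k * x))
    (even : ∀ i x, p x → p (S.even i * x)) (x : A) : p x :=
  S.induction one add smul odd even x

theorem SuperGen.parity_parity (x : A) : S.parity (S.parity x) = x := by
  induction x using super_induction S with
  | one => simp
  | add x y hx hy => simp [hx, hy]
  | smul c x hx => simp [hx]
  | odd k x hx => simp [S.parity_odd, hx]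
  | even i x hx => simp [S.parity_even, hx]

/-- An even derivation of a free supercommutative algebra. -/
structure EvenDer (P : Module.End ℂ A) : Prop where
  leibniz : ∀ x y, P (x * y) = P x * y + x * P y
  parity : ∀ x, P (S.parity x) = S.parity (P x)

/-- An odd derivation of a free supercommutative algebra. -/
structure OddDer (P : Module.End ℂ A) : Prop where
  leibniz : ∀ x y, P (x * y) = P x * y + S.parity x * P y
  parity : ∀ x, P (S.parity x) = -S.parity (P x)

variable {S}

theorem EvenDer.map_one {P : Module.End ℂ A} (hP : EvenDer S P) : P 1 = 0 := by
  simpa using hP.leibniz 1 1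

theorem OddDer.map_one {P : Module.End ℂ A} (hP : OddDer S P) : P 1 = 0 := by
  simpa using hP.leibniz 1 1

theorem OddDer.of_gen {P : Module.End ℂ A} (one : P 1 = 0)
    (odd : ∀ k x, P (S.odd k * x) = P (S.odd k) * x - S.odd k * P x)
    (even : ∀ i x, P (S.even i * x) = P (S.even i) * x + S.even i * P x)
    (odd' : ∀ k, S.parity (P (S.odd k)) = P (S.odd k))
    (even' : ∀ i, S.parity (P (S.even i)) = -P (S.even i)) : OddDer S P where
  leibniz x y := by
    induction x using super_induction S with
    | one => simp [one]
    | add x x' hx hx' => simp only [add_mul, map_add, hx, hx', add_add_add_comm]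
    | smul c x hx => simp only [smul_mul_assoc, map_smul, hx, smul_add]
    | odd k x hx => rw [mul_assoc, odd, hx, odd, map_mul, S.parity_odd]; noncomm_ring
    | even i x hx => rw [mul_assoc, even, hx, even, map_mul, S.parity_even]; noncomm_ring
  parity x := by
    induction x using super_induction S with
    | one => simp [one]
    | add x x' hx hx' => simp only [map_add, hx, hx']; abel
    | smul c x hx => simp only [map_smul, hx, smul_neg]
    | odd k x hx =>
      rw [odd, map_mul, S.parity_odd, neg_mul, map_neg, odd, hx, map_sub, map_mul, map_mul, odd',
        S.parity_odd]
      noncomm_ring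
    | even i x hx =>
      rw [even, map_mul, S.parity_even, even, hx, map_add, map_mul, map_mul, even',
        S.parity_even]
      noncomm_ring

theorem EvenDer.ext_gen {P Q : Module.End ℂ A} (hP : EvenDer S P) (hQ : EvenDer S Q)
    (odd : ∀ k, P (S.odd k) = Q (S.odd k)) (even : ∀ i, P (S.even i) = Q (S.even i)) :
    P = Q := by
  ext x
  induction x using super_induction S with
  | one => rw [hP.map_one, hQ.map_one]
  | add x y hx hy => rw [map_add, map_add, hx, hy]
  | smul c x hx => rw [map_smul, map_smul, hx]
  | odd k x hx => rw [hP.leibniz, hQ.leibniz, odd, hx]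
  | even i x hx => rw [hP.leibniz, hQ.leibniz, even, hx]

theorem OddDer.ext_gen {P Q : Module.End ℂ A} (hP : OddDer S P) (hQ : OddDer S Q)
    (odd : ∀ k, P (S.odd k) = Q (S.odd k)) (even : ∀ i, P (S.even i) = Q (S.even i)) :
    P = Q := by
  ext x
  induction x using super_induction S with
  | one => rw [hP.map_one, hQ.map_one]
  | add x y hx hy => rw [map_add, map_add, hx, hy]
  | smul c x hx => rw [map_smul, map_smul, hx]
  | odd k x hx => rw [hP.leibniz, hQ.leibniz, odd, hx]
  | even i x hx => rw [hP.leibniz, hQ.leibniz, even, hx]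

theorem EvenDer.zero : EvenDer S (0 : Module.End ℂ A) := ⟨by simp, by simp⟩

theorem OddDer.zero : OddDer S (0 : Module.End ℂ A) := ⟨by simp, by simp⟩

theorem EvenDer.add {P Q : Module.End ℂ A} (hP : EvenDer S P) (hQ : EvenDer S Q) :
    EvenDer S (P + Q) where
  leibniz x y := by
    simp only [LinearMap.add_apply, hP.leibniz, hQ.leibniz]; noncomm_ring
  parity x := by simp only [LinearMap.add_apply, hP.parity, hQ.parity, map_add]

theorem OddDer.add {P Q : Module.End ℂ A} (hP : OddDer S P) (hQ : OddDer S Q) :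
    OddDer S (P + Q) where
  leibniz x y := by
    simp only [LinearMap.add_apply, hP.leibniz, hQ.leibniz]; noncomm_ring
  parity x := by simp only [LinearMap.add_apply, hP.parity, hQ.parity, map_add]; abel

theorem EvenDer.smul {P : Module.End ℂ A} (hP : EvenDer S P) (c : ℂ) :
    EvenDer S (c • P) where
  leibniz x y := by simp only [LinearMap.smul_apply, hP.leibniz, smul_add, smul_mul_assoc,
    mul_smul_comm]
  parity x := by simp only [LinearMap.smul_apply, hP.parity, map_smul]

theorem OddDer.smul {P : Module.End ℂ A} (hP : OddDer S P) (c : ℂ) :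
    OddDer S (c • P) where
  leibniz x y := by simp only [LinearMap.smul_apply, hP.leibniz, smul_add, smul_mul_assoc,
    mul_smul_comm]
  parity x := by simp only [LinearMap.smul_apply, hP.parity, map_smul, smul_neg]

theorem EvenDer.sum {ι : Type} {P : ι → Module.End ℂ A} (s : Finset ι)
    (hP : ∀ i ∈ s, EvenDer S (P i)) : EvenDer S (∑ i ∈ s, P i) := by
  classical
  induction s using Finset.induction_on with
  | empty => simpa using EvenDer.zero
  | insert a s ha ih =>
    rw [Finset.sum_insert ha]
    exact (hP a (by simp)).add (ih fun i hi => hP i (by simp [hi]))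

theorem OddDer.sum {ι : Type} {P : ι → Module.End ℂ A} (s : Finset ι)
    (hP : ∀ i ∈ s, OddDer S (P i)) : OddDer S (∑ i ∈ s, P i) := by
  classical
  induction s using Finset.induction_on with
  | empty => simpa using OddDer.zero
  | insert a s ha ih =>
    rw [Finset.sum_insert ha]
    exact (hP a (by simp)).add (ih fun i hi => hP i (by simp [hi]))

theorem locSum_apply {ι M : Type} [AddCommGroup M] [Module ℂ M] {T : ι → Module.End ℂ M}
    (hT : LocallyFinite T) (f : M) : locSum T hT f = ∑ᶠ m, T m f := rfl

/-- On finitely many vectors, a locally finite sum is a finite sum. -/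
theorem exists_finset_locSum {ι M : Type} [AddCommGroup M] [Module ℂ M]
    {T : ι → Module.End ℂ M} (hT : LocallyFinite T) {F : Set M} (hF : F.Finite) :
    ∃ s : Finset ι, ∀ f ∈ F, locSum T hT f = (∑ m ∈ s, T m) f := by
  classical
  refine ⟨(hF.biUnion fun f _ => hT f).toFinset, fun f hf => ?_⟩
  rw [locSum_apply, LinearMap.sum_apply]
  refine finsum_eq_sum_of_support_subset _ fun m hm => ?_
  simp only [Set.Finite.coe_toFinset, Set.mem_iUnion]
  exact ⟨f, hf, hm⟩

theorem EvenDer.locSum {ι : Type} {P : ι → Module.End ℂ A}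
    (hP : ∀ i, EvenDer S (P i)) (hf : LocallyFinite P) : EvenDer S (locSum P hf) where
  leibniz x y := by
    obtain ⟨s, hs⟩ := exists_finset_locSum hf (F := {x * y, x, y}) (by simp)
    rw [hs _ (by simp), hs x (by simp), hs y (by simp)]
    exact (EvenDer.sum s fun i _ => hP i).leibniz x y
  parity x := by
    obtain ⟨s, hs⟩ := exists_finset_locSum hf (F := {S.parity x, x}) (by simp)
    rw [hs _ (by simp), hs x (by simp)]
    exact (EvenDer.sum s fun i _ => hP i).parity x

theorem OddDer.locSum {ι : Type} {P : ι → Module.End ℂ A}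
    (hP : ∀ i, OddDer S (P i)) (hf : LocallyFinite P) : OddDer S (locSum P hf) where
  leibniz x y := by
    obtain ⟨s, hs⟩ := exists_finset_locSum hf (F := {x * y, x, y}) (by simp)
    rw [hs _ (by simp), hs x (by simp), hs y (by simp)]
    exact (OddDer.sum s fun i _ => hP i).leibniz x y
  parity x := by
    obtain ⟨s, hs⟩ := exists_finset_locSum hf (F := {S.parity x, x}) (by simp)
    rw [hs _ (by simp), hs x (by simp)]
    exact (OddDer.sum s fun i _ => hP i).parity x

/-- Left multiplication. -/
abbrev mulL (w : A) : Module.End ℂ A := LinearMap.mulLeft ℂ w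

/-- The elements that behave like linear combinations of odd generators. -/
structure IsOdd (S : SuperGen κ I A) (w : A) : Prop where
  mul : ∀ x, w * x = S.parity x * w
  parity : S.parity w = -w

theorem EvenDer.mulL_odd {P : Module.End ℂ A} (hP : EvenDer S P) {w : A} (hw : IsOdd S w) :
    OddDer S (mulL w * P) where
  leibniz x y := by
    simp only [Module.End.mul_apply, LinearMap.mulLeft_apply, hP.leibniz, mul_add]
    rw [← mul_assoc, ← mul_assoc, ← mul_assoc, hw.mul x]
  parity x := by
    simp only [Module.End.mul_apply, LinearMap.mulLeft_apply, hP.parity, map_mul, hw.parity,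
      neg_mul, neg_neg]

theorem OddDer.mulL_odd {P : Module.End ℂ A} (hP : OddDer S P) {w : A} (hw : IsOdd S w) :
    EvenDer S (mulL w * P) where
  leibniz x y := by
    simp only [Module.End.mul_apply, LinearMap.mulLeft_apply, hP.leibniz, mul_add]
    rw [← mul_assoc, ← mul_assoc, ← mul_assoc, hw.mul (S.parity x),
      S.parity_parity]
  parity x := by
    simp only [Module.End.mul_apply, LinearMap.mulLeft_apply, hP.parity, map_mul, hw.parity,
      neg_mul, mul_neg]

theorem EvenDer.comm_odd {P Q : Module.End ℂ A} (hP : EvenDer S P) (hQ : OddDer S Q) :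
    OddDer S (P * Q - Q * P) where
  leibniz x y := by
    simp only [LinearMap.sub_apply, Module.End.mul_apply, hP.leibniz, hQ.leibniz, map_add,
      hP.parity]
    noncomm_ring
  parity x := by
    simp only [LinearMap.sub_apply, Module.End.mul_apply, hP.parity, hQ.parity, map_neg, map_sub]
    abel

theorem OddDer.anticomm {P Q : Module.End ℂ A} (hP : OddDer S P) (hQ : OddDer S Q) :
    EvenDer S (P * Q + Q * P) where
  leibniz x y := by
    simp only [LinearMap.add_apply, Module.End.mul_apply, hP.leibniz, hQ.leibniz, map_add,
      hP.parity, hQ.parity, S.parity_parity]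
    noncomm_ring
  parity x := by
    simp only [LinearMap.add_apply, Module.End.mul_apply, hP.parity, hQ.parity, map_neg, map_add]
    abel

end Super

/-! ### Second-order operators -/

section SecondOrder

variable {κ I A : Type} [Ring A] [Algebra ℂ A] {S : SuperGen κ I A}

/-- The double supercommutator `[[Z, g], h]` of an even operator `Z` with left multiplications by
`g` and `h`, applied to `x`; the scalar `ε` is the sign with which `g` and `h` commute. -/
def doubleComm (Z : Module.End ℂ A) (ε : ℂ) (g h x : A) : A :=
  Z (g * h * x) - g * Z (h * x) - ε • (h * Z (g * x)) + g * h * Z x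

/-- An even operator is a differential operator of order at most `2` if its double commutators with
generators are multiplication operators. -/
structure IsOrderTwo (S : SuperGen κ I A) (Z : Module.End ℂ A) : Prop where
  even_even : ∀ i j x, doubleComm Z 1 (S.even i) (S.even j) x =
    doubleComm Z 1 (S.even i) (S.even j) 1 * x
  even_odd : ∀ i k x, doubleComm Z 1 (S.even i) (S.odd k) x =
    doubleComm Z 1 (S.even i) (S.odd k) 1 * x
  odd_odd : ∀ k l x, doubleComm Z (-1) (S.odd k) (S.odd l) x =
    doubleComm Z (-1) (S.odd k) (S.odd l) 1 * x

theorem doubleComm_zero (ε : ℂ) (g h x : A) : doubleComm (0 : Module.End ℂ A) ε g h x = 0 := by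
  simp [doubleComm]

theorem doubleComm_add (Z W : Module.End ℂ A) (ε : ℂ) (g h x : A) :
    doubleComm (Z + W) ε g h x = doubleComm Z ε g h x + doubleComm W ε g h x := by
  simp only [doubleComm, LinearMap.add_apply, mul_add, smul_add]
  abel

theorem doubleComm_smul (c : ℂ) (Z : Module.End ℂ A) (ε : ℂ) (g h x : A) :
    doubleComm (c • Z) ε g h x = c • doubleComm Z ε g h x := by
  simp only [doubleComm, LinearMap.smul_apply, mul_smul_comm, smul_add, smul_sub]
  rw [smul_comm]

theorem IsOrderTwo.zero : IsOrderTwo S 0 where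
  even_even := by simp [doubleComm_zero]
  even_odd := by simp [doubleComm_zero]
  odd_odd := by simp [doubleComm_zero]

theorem IsOrderTwo.add {Z W : Module.End ℂ A} (hZ : IsOrderTwo S Z) (hW : IsOrderTwo S W) :
    IsOrderTwo S (Z + W) where
  even_even i j x := by
    rw [doubleComm_add, hZ.even_even, hW.even_even, doubleComm_add, add_mul]
  even_odd i j x := by
    rw [doubleComm_add, hZ.even_odd, hW.even_odd, doubleComm_add, add_mul]
  odd_odd i j x := by
    rw [doubleComm_add, hZ.odd_odd, hW.odd_odd, doubleComm_add, add_mul]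

theorem IsOrderTwo.smul {Z : Module.End ℂ A} (hZ : IsOrderTwo S Z) (c : ℂ) :
    IsOrderTwo S (c • Z) where
  even_even i j x := by
    rw [doubleComm_smul, hZ.even_even, doubleComm_smul, smul_mul_assoc]
  even_odd i j x := by
    rw [doubleComm_smul, hZ.even_odd, doubleComm_smul, smul_mul_assoc]
  odd_odd i j x := by
    rw [doubleComm_smul, hZ.odd_odd, doubleComm_smul, smul_mul_assoc]

theorem IsOrderTwo.sum {ι : Type} {Z : ι → Module.End ℂ A} (s : Finset ι)
    (hZ : ∀ i, IsOrderTwo S (Z i)) : IsOrderTwo S (∑ i ∈ s, Z i) := by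
  classical
  induction s using Finset.induction_on with
  | empty => simpa using IsOrderTwo.zero
  | insert a s ha ih =>
    rw [Finset.sum_insert ha]
    exact (hZ a).add ih

theorem IsOrderTwo.locSum {ι : Type} {Z : ι → Module.End ℂ A}
    (hZ : ∀ i, IsOrderTwo S (Z i)) (hf : LocallyFinite Z) : IsOrderTwo S (locSum Z hf) := by
  have key : ∀ (ε : ℂ) (g h x : A), ∃ s : Finset ι,
      doubleComm (HarmonicForms.locSum Z hf) ε g h x = doubleComm (∑ m ∈ s, Z m) ε g h x ∧
      doubleComm (HarmonicForms.locSum Z hf) ε g h 1 = doubleComm (∑ m ∈ s, Z m) ε g h 1 := by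
    intro ε g h x
    obtain ⟨s, hs⟩ := exists_finset_locSum hf
      (F := {g * h * x, h * x, g * x, x, g * h * 1, h * 1, g * 1, 1}) (by simp)
    refine ⟨s, ?_, ?_⟩
    · rw [doubleComm, hs (g * h * x) (by simp), hs (h * x) (by simp), hs (g * x) (by simp),
        hs x (by simp), doubleComm]
    · rw [doubleComm, hs (g * h * 1) (by simp), hs (h * 1) (by simp), hs (g * 1) (by simp),
        hs 1 (by simp), doubleComm]
  refine ⟨fun i j x => ?_, fun i j x => ?_, fun i j x => ?_⟩
  all_goals
    obtain ⟨s, h1, h2⟩ := key _ _ _ x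
    rw [h1, h2]
  exacts [(IsOrderTwo.sum s hZ).even_even i j x, (IsOrderTwo.sum s hZ).even_odd i j x,
    (IsOrderTwo.sum s hZ).odd_odd i j x]

/-- An operator of order at most `2` is determined by its values on products of at most two
generators. -/
theorem IsOrderTwo.eq_zero {Z : Module.End ℂ A} (hZ : IsOrderTwo S Z) (one : Z 1 = 0)
    (even : ∀ i, Z (S.even i) = 0) (odd : ∀ k, Z (S.odd k) = 0)
    (even_even : ∀ i j, Z (S.even i * S.even j) = 0)
    (even_odd : ∀ i k, Z (S.even i * S.odd k) = 0)
    (odd_odd : ∀ k l, Z (S.odd k * S.odd l) = 0) : Z = 0 := by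
  suffices h : ∀ x, Z x = 0 ∧ (∀ i, Z (S.even i * x) = 0) ∧ ∀ k, Z (S.odd k * x) = 0 from
    LinearMap.ext fun x => (h x).1
  have h1 : ∀ i j x, Z (S.even i * S.even j * x) = S.even i * Z (S.even j * x) +
      S.even j * Z (S.even i * x) - S.even i * S.even j * Z x := by
    intro i j x
    have h := hZ.even_even i j x
    simp only [doubleComm, mul_one, one, even, even_even, mul_zero, smul_zero, sub_zero, add_zero,
      zero_mul, one_smul] at h
    rw [← sub_eq_zero, ← h]
    abel
  have h2 : ∀ i k x, Z (S.even i * S.odd k * x) = S.even i * Z (S.odd k * x) +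
      S.odd k * Z (S.even i * x) - S.even i * S.odd k * Z x := by
    intro i k x
    have h := hZ.even_odd i k x
    simp only [doubleComm, mul_one, one, even, odd, even_odd, mul_zero, smul_zero, sub_zero,
      add_zero, zero_mul, one_smul] at h
    rw [← sub_eq_zero, ← h]
    abel
  have h3 : ∀ k l x, Z (S.odd k * S.odd l * x) = S.odd k * Z (S.odd l * x) -
      S.odd l * Z (S.odd k * x) - S.odd k * S.odd l * Z x := by
    intro k l x
    have h := hZ.odd_odd k l x
    simp only [doubleComm, mul_one, one, odd, odd_odd, mul_zero, smul_zero, sub_zero,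
      add_zero, zero_mul, neg_smul, one_smul] at h
    rw [← sub_eq_zero, ← h]
    abel
  intro x
  induction x using super_induction S with
  | one => simp [one, even, odd]
  | add x y hx hy => simp [mul_add, hx, hy]
  | smul c x hx => simp [hx]
  | odd k x hx =>
    obtain ⟨hx, hxe, hxo⟩ := hx
    refine ⟨hxo k, fun i => ?_, fun l => ?_⟩
    · rw [← mul_assoc, h2, hx, hxe, hxo]; simp
    · rw [← mul_assoc, h3, hx, hxo, hxo]; simp
  | even i x hx =>
    obtain ⟨hx, hxe, hxo⟩ := hx
    refine ⟨hxe i, fun j => ?_, fun k => ?_⟩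
    · rw [← mul_assoc, h1, hx, hxe, hxe]; simp
    · rw [← mul_assoc, ← S.even_mul, h2, hx, hxe, hxo]; simp

theorem odd_mul_odd_mul (k : κ) {y : A} (hy : S.parity y = -y) (z : A) :
    S.odd k * (y * z) = -(y * (S.odd k * z)) := by
  rw [← mul_assoc, S.odd_mul, hy, neg_mul, neg_mul, mul_assoc]

theorem odd_mul_even_mul (k : κ) {y : A} (hy : S.parity y = y) (z : A) :
    S.odd k * (y * z) = y * (S.odd k * z) := by
  rw [← mul_assoc, S.odd_mul, hy, mul_assoc]

theorem even_mul_left_comm (i : I) (y z : A) : S.even i * (y * z) = y * (S.even i * z) := by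
  rw [← mul_assoc, S.even_mul, mul_assoc]

theorem EvenDer.parity_even {P : Module.End ℂ A} (hP : EvenDer S P) (i : I) :
    S.parity (P (S.even i)) = P (S.even i) := by rw [← hP.parity, S.parity_even]

theorem EvenDer.parity_odd {P : Module.End ℂ A} (hP : EvenDer S P) (k : κ) :
    S.parity (P (S.odd k)) = -P (S.odd k) := by rw [← hP.parity, S.parity_odd, map_neg]

theorem OddDer.parity_even {P : Module.End ℂ A} (hP : OddDer S P) (i : I) :
    S.parity (P (S.even i)) = -P (S.even i) := by
  rw [← neg_eq_iff_eq_neg, ← hP.parity, S.parity_even]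

theorem OddDer.parity_odd {P : Module.End ℂ A} (hP : OddDer S P) (k : κ) :
    S.parity (P (S.odd k)) = P (S.odd k) := by
  rw [← neg_inj, ← hP.parity, S.parity_odd, map_neg]

theorem EvenDer.isOrderTwo_mul {P Q : Module.End ℂ A} (hP : EvenDer S P) (hQ : EvenDer S Q) :
    IsOrderTwo S (P * Q) := by
  have hPQ : ∀ k, S.parity (P (Q (S.odd k))) = -P (Q (S.odd k)) := fun k => by
    rw [← hP.parity, hQ.parity_odd, map_neg]
  have hPQ' : ∀ i, S.parity (P (Q (S.even i))) = P (Q (S.even i)) := fun k => by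
    rw [← hP.parity, hQ.parity_even]
  refine ⟨fun i j x => ?_, fun i k x => ?_, fun k l x => ?_⟩
  · simp only [doubleComm, Module.End.mul_apply, hP.leibniz, hQ.leibniz, map_add, mul_add, add_mul,
      hQ.map_one, mul_one, mul_zero, map_zero, mul_assoc, one_smul, sub_mul, add_zero,
      even_mul_left_comm j]
    rw [S.even_mul j (P _)]
    abel
  · simp only [doubleComm, Module.End.mul_apply, hP.leibniz, hQ.leibniz, map_add, mul_add, add_mul,
      hQ.map_one, mul_one, mul_zero, map_zero, mul_assoc, one_smul, sub_mul, add_zero,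
      odd_mul_even_mul k (hP.parity_even i), odd_mul_even_mul k (hQ.parity_even i),
      odd_mul_even_mul k (hPQ' i), odd_mul_even_mul k (S.parity_even i)]
    abel
  · simp only [doubleComm, Module.End.mul_apply, hP.leibniz, hQ.leibniz, map_add, mul_add, add_mul,
      hQ.map_one, mul_one, mul_zero, map_zero, mul_assoc, one_smul, sub_mul, add_zero,
      odd_mul_odd_mul l (hP.parity_odd k), odd_mul_odd_mul l (hQ.parity_odd k),
      odd_mul_odd_mul l (hPQ k), odd_mul_odd_mul l (S.parity_odd k), neg_smul, sub_neg_eq_add]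
    abel

theorem OddDer.isOrderTwo_mul {P Q : Module.End ℂ A} (hP : OddDer S P) (hQ : OddDer S Q) :
    IsOrderTwo S (P * Q) := by
  have hPQ : ∀ k, S.parity (P (Q (S.odd k))) = -P (Q (S.odd k)) := fun k => by
    rw [← neg_inj, ← hP.parity, hQ.parity_odd, neg_neg]
  have hPQ' : ∀ i, S.parity (P (Q (S.even i))) = P (Q (S.even i)) := fun k => by
    rw [← neg_inj, ← hP.parity, hQ.parity_even, map_neg]
  refine ⟨fun i j x => ?_, fun i k x => ?_, fun k l x => ?_⟩
  · simp only [doubleComm, Module.End.mul_apply, hP.leibniz, hQ.leibniz, map_add, mul_add, add_mul,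
      hQ.map_one, mul_one, mul_zero, map_zero, mul_assoc, one_smul, sub_mul, add_zero,
      S.parity_even, hQ.parity_even, neg_mul,
      even_mul_left_comm j, mul_neg]
    rw [S.even_mul j (P _)]
    abel
  · simp only [doubleComm, Module.End.mul_apply, hP.leibniz, hQ.leibniz, map_add, mul_add, add_mul,
      hQ.map_one, mul_one, mul_zero, map_zero, mul_assoc, one_smul, sub_mul, add_zero,
      S.parity_even, S.parity_odd, hQ.parity_even, hQ.parity_odd, neg_mul, map_neg,
      odd_mul_odd_mul k (hP.parity_even i), odd_mul_odd_mul k (hQ.parity_even i), mul_neg,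
      odd_mul_even_mul k (hPQ' i), odd_mul_even_mul k (S.parity_even i), neg_neg]
    abel
  · simp only [doubleComm, Module.End.mul_apply, hP.leibniz, hQ.leibniz, map_add, mul_add, add_mul,
      hQ.map_one, mul_one, mul_zero, map_zero, mul_assoc, one_smul, sub_mul, add_zero,
      S.parity_odd, hQ.parity_odd, neg_mul, map_neg,
      odd_mul_even_mul l (hP.parity_odd k), odd_mul_even_mul l (hQ.parity_odd k), mul_neg,
      odd_mul_odd_mul l (hPQ k), odd_mul_odd_mul l (S.parity_odd k), neg_smul, sub_neg_eq_add,
      neg_neg]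
    abel

end SecondOrder

/-! ### Lie algebras with an orthonormal basis for the Killing form -/

section Casimir

variable {d : ℕ} {L : Type} [LieRing L] [LieAlgebra ℂ L] {ξ : Module.Basis (Fin d) ℂ L}

/-- The basis is orthonormal for the Killing form. -/
def IsOrthonormal (ξ : Module.Basis (Fin d) ℂ L) : Prop :=
  ∀ a b, killingForm ℂ L (ξ a) (ξ b) = if a = b then 1 else 0

theorem IsOrthonormal.repr_eq (hK : IsOrthonormal ξ) (v : L) (e : Fin d) :
    ξ.repr v e = killingForm ℂ L v (ξ e) := by
  conv_rhs => rw [← ξ.sum_repr v]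
  simp only [map_sum, map_smul, LinearMap.sum_apply, LinearMap.smul_apply, smul_eq_mul]
  rw [Finset.sum_eq_single e (fun a _ ha => by rw [hK a e, if_neg ha, mul_zero]) (by simp),
    hK e e, if_pos rfl, mul_one]

theorem IsOrthonormal.repr_lie_swap (hK : IsOrthonormal ξ) (u : L) (a e : Fin d) :
    ξ.repr ⁅u, ξ a⁆ e = -ξ.repr ⁅u, ξ e⁆ a := by
  rw [hK.repr_eq, hK.repr_eq, killingForm, LieModule.traceForm_apply_lie_apply,
    LieModule.traceForm_apply_lie_apply, ← lie_skew, map_neg]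

theorem IsOrthonormal.ext (hK : IsOrthonormal ξ) {v w : L}
    (h : ∀ e, killingForm ℂ L v (ξ e) = killingForm ℂ L w (ξ e)) : v = w := by
  apply ξ.repr.injective
  ext e
  rw [hK.repr_eq, hK.repr_eq, h]

/-- The Casimir operator of the Killing form is the identity in the adjoint representation. -/
theorem IsOrthonormal.casimir (hK : IsOrthonormal ξ) (v : L) : ∑ a, ⁅ξ a, ⁅ξ a, v⁆⁆ = v := by
  refine hK.ext fun e => ?_
  have h1 : killingForm ℂ L v (ξ e) = ∑ a, killingForm ℂ L ⁅v, ⁅ξ e, ξ a⁆⁆ (ξ a) := by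
    rw [killingForm_apply_apply, LinearMap.trace_eq_matrix_trace ℂ ξ, Matrix.trace]
    refine Finset.sum_congr rfl fun a _ => ?_
    rw [Matrix.diag_apply, LinearMap.toMatrix_apply, hK.repr_eq]
    rfl
  rw [h1, map_sum, LinearMap.sum_apply]
  refine Finset.sum_congr rfl fun a _ => ?_
  have h2 : ∀ x y z : L, killingForm ℂ L ⁅x, y⁆ z = killingForm ℂ L x ⁅y, z⁆ :=
    LieModule.traceForm_apply_lie_apply ℂ L L
  have h3 : killingForm ℂ L ⁅ξ a, ⁅ξ a, v⁆⁆ (ξ e) = killingForm ℂ L (ξ e) ⁅ξ a, ⁅ξ a, v⁆⁆ :=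
    LieModule.traceForm_comm ℂ L L _ _
  rw [h3, ← h2, ← lie_skew v ⁅ξ e, ξ a⁆, map_neg, LinearMap.neg_apply, h2 _ v,
    ← lie_skew v (ξ a), map_neg, neg_neg]

variable {A : Type} [Ring A] [Algebra ℂ A]

theorem IsOrthonormal.casimir_apply (hK : IsOrthonormal ξ) (φ : L →ₗ[ℂ] A) (v : L) :
    ∑ a, φ ⁅ξ a, ⁅ξ a, v⁆⁆ = φ v := by rw [← map_sum, hK.casimir]

/-- The canonical element `∑ ξ_a ⊗ ξ_a` is invariant. -/
theorem IsOrthonormal.sum_lie_mul (hK : IsOrthonormal ξ) (φ χ : L →ₗ[ℂ] A) (u : L) :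
    ∑ a, φ ⁅u, ξ a⁆ * χ (ξ a) = -∑ a, φ (ξ a) * χ ⁅u, ξ a⁆ := by
  have h1 : ∀ (φ : L →ₗ[ℂ] A) a, φ ⁅u, ξ a⁆ = ∑ e, ξ.repr ⁅u, ξ a⁆ e • φ (ξ e) := fun φ a => by
    conv_lhs => rw [← ξ.sum_repr ⁅u, ξ a⁆, map_sum]
    simp only [map_smul]
  simp only [h1, Finset.sum_mul, Finset.mul_sum]
  rw [Finset.sum_comm, ← Finset.sum_neg_distrib]
  refine Finset.sum_congr rfl fun e _ => ?_
  rw [← Finset.sum_neg_distrib]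
  refine Finset.sum_congr rfl fun a _ => ?_
  rw [hK.repr_lie_swap, smul_mul_assoc, mul_smul_comm, neg_smul]

theorem IsOrthonormal.sum_mul_lie (hK : IsOrthonormal ξ) (φ χ : L →ₗ[ℂ] A) (u : L) :
    ∑ a, φ (ξ a) * χ ⁅ξ a, u⁆ = -∑ a, φ ⁅ξ a, u⁆ * χ (ξ a) := by
  have h := hK.sum_lie_mul φ χ u
  simp only [← lie_skew u, map_neg, neg_mul, mul_neg, Finset.sum_neg_distrib] at h
  rw [h, neg_neg]

theorem IsOrthonormal.sum_mul_lie_lie (hK : IsOrthonormal ξ) (φ χ : L →ₗ[ℂ] A) (w v : L) :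
    ∑ a, φ (ξ a) * χ ⁅⁅ξ a, w⁆, v⁆ = -∑ a, φ ⁅ξ a, w⁆ * χ ⁅ξ a, v⁆ := by
  have h := hK.sum_mul_lie φ (χ ∘ₗ (LieAlgebra.ad ℂ L v : L →ₗ[ℂ] L)) w
  simp only [LinearMap.comp_apply, LieAlgebra.ad_apply, ← lie_skew v, map_neg, mul_neg,
    Finset.sum_neg_distrib, neg_inj] at h
  rw [h]

theorem IsOrthonormal.sum_mul_lie_lie' (hK : IsOrthonormal ξ) (φ χ : L →ₗ[ℂ] A) (w v : L) :
    ∑ a, φ (ξ a) * χ ⁅w, ⁅ξ a, v⁆⁆ = ∑ a, φ ⁅ξ a, v⁆ * χ ⁅ξ a, w⁆ := by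
  simp only [← lie_skew w, map_neg, mul_neg, Finset.sum_neg_distrib]
  rw [hK.sum_mul_lie_lie, neg_neg]

theorem IsOrthonormal.sum_mul_lie_lie'' (hK : IsOrthonormal ξ) (φ χ : L →ₗ[ℂ] A) (w v : L) :
    ∑ a, φ (ξ a) * χ ⁅ξ a, ⁅w, v⁆⁆ =
      ∑ a, φ ⁅ξ a, v⁆ * χ ⁅ξ a, w⁆ - ∑ a, φ ⁅ξ a, w⁆ * χ ⁅ξ a, v⁆ := by
  simp only [leibniz_lie _ w v, map_add, mul_add, Finset.sum_add_distrib]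
  rw [hK.sum_mul_lie_lie, hK.sum_mul_lie_lie']
  abel

end Casimir

/-! ### Vector-valued generators -/

section Generators

variable {d : ℕ} {L : Type} [LieRing L] [LieAlgebra ℂ L] {A : Type} [Ring A] [Algebra ℂ A]

/-- `σ^v(-n)`, depending linearly on `v`. -/
def SuperGen.sig {κ : Type} (S : SuperGen κ (Fin d × ℕ) A) (ξ : Module.Basis (Fin d) ℂ L)
    (n : ℕ) : L →ₗ[ℂ] A :=
  ξ.constr ℂ fun b => S.even (b, n)

/-- `ψ^v(-n)`, depending linearly on `v`; it is zero if `n = 0`. -/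
def SuperGen.psi {I : Type} (S : SuperGen (OddIndex d) I A) (ξ : Module.Basis (Fin d) ℂ L)
    (n : ℕ) : L →ₗ[ℂ] A :=
  if h : 0 < n then ξ.constr ℂ fun b => S.odd (toLex (b, ⟨n, h⟩)) else 0

theorem SuperGen.sig_basis {κ : Type} (S : SuperGen κ (Fin d × ℕ) A)
    (ξ : Module.Basis (Fin d) ℂ L) (n : ℕ) (b : Fin d) : S.sig ξ n (ξ b) = S.even (b, n) := by
  simp [SuperGen.sig]

theorem SuperGen.psi_basis {I : Type} (S : SuperGen (OddIndex d) I A)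
    (ξ : Module.Basis (Fin d) ℂ L) (n : ℕ+) (b : Fin d) :
    S.psi ξ n (ξ b) = S.odd (toLex (b, n)) := by
  rw [SuperGen.psi, dif_pos n.pos]
  simp only [Module.Basis.constr_basis]
  rfl

theorem SuperGen.psi_zero {I : Type} (S : SuperGen (OddIndex d) I A)
    (ξ : Module.Basis (Fin d) ℂ L) : S.psi ξ 0 = 0 := by
  simp [SuperGen.psi]

theorem SuperGen.sig_mul {κ : Type} (S : SuperGen κ (Fin d × ℕ) A) (ξ : Module.Basis (Fin d) ℂ L)
    (n : ℕ) (v : L) (x : A) : S.sig ξ n v * x = x * S.sig ξ n v := by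
  rw [SuperGen.sig, ξ.constr_apply_fintype ℂ]
  simp only [Finset.sum_mul, Finset.mul_sum, smul_mul_assoc, mul_smul_comm, S.even_mul _ x]

theorem SuperGen.isOdd_psi {I : Type} (S : SuperGen (OddIndex d) I A)
    (ξ : Module.Basis (Fin d) ℂ L) (n : ℕ) (v : L) : IsOdd S (S.psi ξ n v) := by
  rw [SuperGen.psi]
  split_ifs with h
  · rw [ξ.constr_apply_fintype ℂ]
    constructor
    · intro x
      simp only [Finset.sum_mul, Finset.mul_sum, smul_mul_assoc, mul_smul_comm, S.odd_mul _ x]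
    · simp [S.parity_odd]
  · exact ⟨by simp, by simp⟩

theorem SuperGen.parity_sig {κ : Type} (S : SuperGen κ (Fin d × ℕ) A)
    (ξ : Module.Basis (Fin d) ℂ L) (n : ℕ) (v : L) : S.parity (S.sig ξ n v) = S.sig ξ n v := by
  rw [SuperGen.sig, ξ.constr_apply_fintype ℂ]
  simp [S.parity_even]

theorem SuperGen.psi_mul_psi {I : Type} (S : SuperGen (OddIndex d) I A)
    (ξ : Module.Basis (Fin d) ℂ L) (m n : ℕ) (v w : L) :
    S.psi ξ m v * S.psi ξ n w = -(S.psi ξ n w * S.psi ξ m v) := by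
  rw [(S.isOdd_psi ξ m v).mul, (S.isOdd_psi ξ n w).parity, neg_mul]

variable {S : SuperGen (OddIndex d) (Fin d × ℕ) A} {ξ : Module.Basis (Fin d) ℂ L}

theorem EvenDer.ext_vec {P Q : Module.End ℂ A} (hP : EvenDer S P) (hQ : EvenDer S Q)
    (psi : ∀ n v, n ≠ 0 → P (S.psi ξ n v) = Q (S.psi ξ n v))
    (sig : ∀ n v, P (S.sig ξ n v) = Q (S.sig ξ n v)) : P = Q :=
  hP.ext_gen hQ (fun k => by
      obtain ⟨⟨b, n⟩, rfl⟩ := toLex.surjective k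
      rw [← S.psi_basis ξ]
      exact psi _ _ n.ne_zero) fun i => by
    rw [← S.sig_basis ξ]
    exact sig _ _

theorem OddDer.ext_vec {P Q : Module.End ℂ A} (hP : OddDer S P) (hQ : OddDer S Q)
    (psi : ∀ n v, n ≠ 0 → P (S.psi ξ n v) = Q (S.psi ξ n v))
    (sig : ∀ n v, P (S.sig ξ n v) = Q (S.sig ξ n v)) : P = Q :=
  hP.ext_gen hQ (fun k => by
      obtain ⟨⟨b, n⟩, rfl⟩ := toLex.surjective k
      rw [← S.psi_basis ξ]
      exact psi _ _ n.ne_zero) fun i => by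
    rw [← S.sig_basis ξ]
    exact sig _ _

theorem IsOrderTwo.eq_zero_vec {Z : Module.End ℂ A} (hZ : IsOrderTwo S Z) (one : Z 1 = 0)
    (sig : ∀ n v, Z (S.sig ξ n v) = 0) (psi : ∀ n v, n ≠ 0 → Z (S.psi ξ n v) = 0)
    (sig_sig : ∀ n k v w, Z (S.sig ξ n v * S.sig ξ k w) = 0)
    (sig_psi : ∀ n p v w, p ≠ 0 → Z (S.sig ξ n v * S.psi ξ p w) = 0)
    (psi_psi : ∀ n p v w, n ≠ 0 → p ≠ 0 → Z (S.psi ξ n v * S.psi ξ p w) = 0) : Z = 0 := by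
  have ho : ∀ k : OddIndex d, ∃ n v, n ≠ 0 ∧ S.odd k = S.psi ξ n v := fun k => by
    obtain ⟨⟨b, n⟩, rfl⟩ := toLex.surjective k
    exact ⟨n, ξ b, n.ne_zero, (S.psi_basis ξ n b).symm⟩
  have he : ∀ i : Fin d × ℕ, ∃ n v, S.even i = S.sig ξ n v := fun i =>
    ⟨i.2, ξ i.1, (S.sig_basis ξ i.2 i.1).symm⟩
  refine hZ.eq_zero one (fun i => ?_) (fun k => ?_) (fun i j => ?_) (fun i k => ?_) fun k l => ?_
  · obtain ⟨n, v, h⟩ := he i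
    rw [h, sig]
  · obtain ⟨n, v, h0, h⟩ := ho k
    rw [h, psi _ _ h0]
  · obtain ⟨n, v, h⟩ := he i
    obtain ⟨k, w, h'⟩ := he j
    rw [h, h', sig_sig]
  · obtain ⟨n, v, h⟩ := he i
    obtain ⟨p, w, h0, h'⟩ := ho k
    rw [h, h', sig_psi _ _ _ _ h0]
  · obtain ⟨n, v, h0, h⟩ := ho k
    obtain ⟨p, w, h0', h'⟩ := ho l
    rw [h, h', psi_psi _ _ _ _ h0 h0']

end Generators

/-! ### The formula for the Laplacian -/

section Laplacian

open Finset.HasAntidiagonal (antidiagonal mem_antidiagonal)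

variable {d : ℕ} {L : Type} [LieRing L] [LieAlgebra ℂ L] {A : Type} [Ring A] [Algebra ℂ A]

/-- The operators that enter the formula for the Laplacian, described by their values on
generators: the Koszul differential `D`, its adjoint `D'`, the even derivations `T a m` and the odd
derivations `E a m` by which `z^m ξ_a` and `s z^(m-1) ξ_a` act, their adjoints `T'` and `E'`, and an
even derivation `Y a`. Since `1 / 0 = 0` and `ψ(0) = 0`, the formulas hold for all indices unless
stated otherwise. -/
structure KoszulOperators (S : SuperGen (OddIndex d) (Fin d × ℕ) A) (ξ : Module.Basis (Fin d) ℂ L)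
    (D D' : Module.End ℂ A) (T T' E E' : Fin d → ℕ → Module.End ℂ A)
    (Y : Fin d → Module.End ℂ A) : Prop where
  D_der : OddDer S D
  D_sig : ∀ n v, D (S.sig ξ n v) =
    ∑ p ∈ antidiagonal n, ∑ a, S.psi ξ p.1 (ξ a) * S.sig ξ p.2 ⁅ξ a, v⁆
  D_psi : ∀ n v, D (S.psi ξ n v) =
    (1 / 2 : ℂ) • ∑ p ∈ antidiagonal n, ∑ a, S.psi ξ p.1 (ξ a) * S.psi ξ p.2 ⁅ξ a, v⁆
  D'_one : D' 1 = 0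
  D'_sig : ∀ n v, D' (S.sig ξ n v) = 0
  D'_sig_sig : ∀ n k v w, D' (S.sig ξ n v * S.sig ξ k w) = 0
  D'_psi_mul : ∀ n v, ∃ V : Module.End ℂ A, EvenDer S V ∧
    (∀ k w, V (S.sig ξ k w) = S.sig ξ (k + n) ⁅v, w⁆) ∧
    (∀ k w, V (S.psi ξ k w) = (((k + n : ℕ) : ℂ) / k) • S.psi ξ (k + n) ⁅v, w⁆) ∧
    ∀ x, D' (S.psi ξ n v * x) = -(S.psi ξ n v * D' x) + (1 / (n : ℂ)) • V x
  laplacian_order : IsOrderTwo S (D * D' + D' * D)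
  T_der : ∀ a m, EvenDer S (T a m)
  T_sig : ∀ a m n v, T a m (S.sig ξ n v) = if m ≤ n then S.sig ξ (n - m) ⁅ξ a, v⁆ else 0
  T_psi : ∀ a m n v, T a m (S.psi ξ n v) =
    if m ≤ n then (((n - m : ℕ) : ℂ) / n) • S.psi ξ (n - m) ⁅ξ a, v⁆ else 0
  T'_der : ∀ a m, EvenDer S (T' a m)
  T'_sig : ∀ a m n v, T' a m (S.sig ξ n v) = S.sig ξ (n + m) ⁅ξ a, v⁆
  T'_psi : ∀ a m n v, n ≠ 0 → T' a m (S.psi ξ n v) = S.psi ξ (n + m) ⁅ξ a, v⁆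
  E_der : ∀ a m, OddDer S (E a m)
  E_sig : ∀ a m n v, E a m (S.sig ξ n v) = 0
  E_psi : ∀ a m n v, E a m (S.psi ξ n v) =
    if m ≤ n then (1 / (n : ℂ)) • S.sig ξ (n - m) ⁅ξ a, v⁆ else 0
  E'_der : ∀ a m, OddDer S (E' a m)
  E'_sig : ∀ a m n v, E' a m (S.sig ξ n v) = S.psi ξ (n + m) ⁅ξ a, v⁆
  E'_psi : ∀ a m n v, E' a m (S.psi ξ n v) = 0
  Y_der : ∀ a, EvenDer S (Y a)
  Y_sig : ∀ a n v, Y a (S.sig ξ n v) = 0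
  Y_psi : ∀ a n v, Y a (S.psi ξ n v) = (1 / (n : ℂ)) • S.psi ξ n ⁅ξ a, v⁆
  T_fin : LocallyFinite fun m => ∑ a, (1 / ((m : ℕ) : ℂ)) • (T' a m * T a m)
  E_fin : LocallyFinite fun m => ∑ a, E' a (m + 1) * E a (m + 1)

variable {S : SuperGen (OddIndex d) (Fin d × ℕ) A} {ξ : Module.Basis (Fin d) ℂ L}
  {D D' : Module.End ℂ A} {T T' E E' : Fin d → ℕ → Module.End ℂ A} {Y : Fin d → Module.End ℂ A}

/-! ### Sums over the decompositions of an energy -/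

theorem sum_range_ite {M : Type} [AddCommMonoid M] (g : ℕ → ℕ → M) {n N : ℕ} (h : n ≤ N) :
    ∑ m ∈ Finset.range (N + 1), (if m ≤ n then g m (n - m) else 0) =
      ∑ p ∈ antidiagonal n, g p.1 p.2 := by
  rw [Finset.Nat.sum_antidiagonal_eq_sum_range_succ (f := g), ← Finset.sum_filter]
  refine Finset.sum_congr ?_ fun _ _ => rfl
  ext m
  simp only [Finset.mem_filter, Finset.mem_range]
  omega

theorem sum_antidiagonal_shift {M : Type} [AddCommMonoid M] (g : ℕ → ℕ → M) (n p : ℕ) :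
    ∑ q ∈ antidiagonal n, g (q.1 + p) q.2 =
      ∑ q ∈ antidiagonal (n + p), if p ≤ q.1 then g q.1 q.2 else 0 := by
  rw [← Finset.sum_filter]
  refine Finset.sum_nbij' (fun q => (q.1 + p, q.2)) (fun q => (q.1 - p, q.2)) ?_ ?_ ?_ ?_ ?_
  · intro q hq; simp only [Finset.mem_filter, mem_antidiagonal] at hq ⊢; omega
  · intro q hq; simp only [Finset.mem_filter, mem_antidiagonal] at hq ⊢; omega
  · intro q _; simp
  · rintro ⟨i, j⟩ hq
    simp only [Finset.mem_filter, mem_antidiagonal] at hq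
    exact Prod.ext (by omega) rfl
  · intro q _; rfl

theorem sum_antidiagonal_shift' {M : Type} [AddCommMonoid M] (g : ℕ → ℕ → M) (n p : ℕ) :
    ∑ q ∈ antidiagonal p, g q.1 (q.2 + n) =
      ∑ q ∈ antidiagonal (n + p), if q.1 ≤ p then g q.1 q.2 else 0 := by
  rw [← Finset.sum_filter]
  refine Finset.sum_nbij' (fun q => (q.1, q.2 + n)) (fun q => (q.1, q.2 - n)) ?_ ?_ ?_ ?_ ?_
  · intro q hq; simp only [Finset.mem_filter, mem_antidiagonal] at hq ⊢; omega
  · intro q hq; simp only [Finset.mem_filter, mem_antidiagonal] at hq ⊢; omega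
  · intro q _; simp
  · rintro ⟨i, j⟩ hq
    simp only [Finset.mem_filter, mem_antidiagonal] at hq
    exact Prod.ext rfl (by omega)
  · intro q _; rfl

theorem sum_antidiagonal_comm {M : Type} [AddCommMonoid M] (g : ℕ → ℕ → M) (n : ℕ) :
    ∑ q ∈ antidiagonal n, g q.2 q.1 = ∑ q ∈ antidiagonal n, g q.1 q.2 :=
  Finset.Nat.sum_antidiagonal_swap (f := fun q : ℕ × ℕ => g q.1 q.2)

namespace KoszulOperators

/-- The positive part `∑ (1/m) T'T` of the formula. -/
def sumT (h : KoszulOperators S ξ D D' T T' E E' Y) : Module.End ℂ A := locSum _ h.T_fin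

/-- The positive part `∑ E'E` of the formula. -/
def sumE (h : KoszulOperators S ξ D D' T T' E E' Y) : Module.End ℂ A := locSum _ h.E_fin

theorem D'_psi (h : KoszulOperators S ξ D D' T T' E E' Y)
    (n : ℕ) (v : L) : D' (S.psi ξ n v) = 0 := by
  obtain ⟨V, hV, -, -, h1⟩ := h.D'_psi_mul n v
  have := h1 1
  rwa [mul_one, h.D'_one, mul_zero, neg_zero, hV.map_one, smul_zero, add_zero] at this

theorem D'_psi_sig (h : KoszulOperators S ξ D D' T T' E E' Y)
    (n k : ℕ) (v w : L) : D' (S.psi ξ n v * S.sig ξ k w) =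
    (1 / (n : ℂ)) • S.sig ξ (k + n) ⁅v, w⁆ := by
  obtain ⟨V, hV, h2, h3, h1⟩ := h.D'_psi_mul n v
  rw [h1, h.D'_sig, mul_zero, neg_zero, zero_add, h2]

theorem D'_psi_psi (h : KoszulOperators S ξ D D' T T' E E' Y)
    (n k : ℕ) (v w : L) : D' (S.psi ξ n v * S.psi ξ k w) =
    (1 / (n : ℂ)) • (((k + n : ℕ) : ℂ) / k) • S.psi ξ (k + n) ⁅v, w⁆ := by
  obtain ⟨V, hV, h2, h3, h1⟩ := h.D'_psi_mul n v
  rw [h1, h.D'_psi, mul_zero, neg_zero, zero_add, h3]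

theorem D'_psi_sig_sig (h : KoszulOperators S ξ D D' T T' E E' Y)
    (n k l : ℕ) (u v w : L) :
    D' (S.psi ξ n u * (S.sig ξ k v * S.sig ξ l w)) = (1 / (n : ℂ)) •
      (S.sig ξ (k + n) ⁅u, v⁆ * S.sig ξ l w + S.sig ξ k v * S.sig ξ (l + n) ⁅u, w⁆) := by
  obtain ⟨V, hV, h2, h3, h1⟩ := h.D'_psi_mul n u
  rw [h1, h.D'_sig_sig, mul_zero, neg_zero, zero_add, hV.leibniz, h2, h2]

theorem D'_psi_sig_psi (h : KoszulOperators S ξ D D' T T' E E' Y)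
    (n k l : ℕ) (u v w : L) :
    D' (S.psi ξ n u * (S.sig ξ k v * S.psi ξ l w)) =
      -(S.psi ξ n u * (1 / (l : ℂ)) • S.sig ξ (k + l) ⁅w, v⁆) + (1 / (n : ℂ)) •
      (S.sig ξ (k + n) ⁅u, v⁆ * S.psi ξ l w +
        S.sig ξ k v * (((l + n : ℕ) : ℂ) / l) • S.psi ξ (l + n) ⁅u, w⁆) := by
  obtain ⟨V, hV, h2, h3, h1⟩ := h.D'_psi_mul n u
  rw [h1, hV.leibniz, h2, h3, S.sig_mul, h.D'_psi_sig]

theorem D'_psi_psi_psi (h : KoszulOperators S ξ D D' T T' E E' Y)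
    (n k l : ℕ) (u v w : L) :
    D' (S.psi ξ n u * (S.psi ξ k v * S.psi ξ l w)) =
      -(S.psi ξ n u * (1 / (k : ℂ)) • (((l + k : ℕ) : ℂ) / l) • S.psi ξ (l + k) ⁅v, w⁆) +
      (1 / (n : ℂ)) • ((((k + n : ℕ) : ℂ) / k) • S.psi ξ (k + n) ⁅u, v⁆ * S.psi ξ l w +
        S.psi ξ k v * (((l + n : ℕ) : ℂ) / l) • S.psi ξ (l + n) ⁅u, w⁆) := by
  obtain ⟨V, hV, h2, h3, h1⟩ := h.D'_psi_mul n u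
  rw [h1, hV.leibniz, h3, h3, h.D'_psi_psi]

/-! ### The Laplacian on products of at most two generators -/

/-- On one generator the Laplacian is scalar, because the Casimir operator of the adjoint
representation is `1`. -/
theorem D'_D_sig (h : KoszulOperators S ξ D D' T T' E E' Y)
    (hK : IsOrthonormal ξ) (n : ℕ) (v : L) : D' (D (S.sig ξ n v)) =
    (∑ p ∈ antidiagonal n, 1 / (p.1 : ℂ)) • S.sig ξ n v := by
  rw [h.D_sig, map_sum, Finset.sum_smul]
  refine Finset.sum_congr rfl fun p hp => ?_
  rw [map_sum]
  simp only [h.D'_psi_sig]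
  rw [← Finset.smul_sum, hK.casimir_apply, add_comm, mem_antidiagonal.1 hp]

theorem D'_D_psi (h : KoszulOperators S ξ D D' T T' E E' Y)
    (hK : IsOrthonormal ξ) (n : ℕ) (v : L) : D' (D (S.psi ξ n v)) =
    (1 / 2 * ∑ p ∈ antidiagonal n, 1 / (p.1 : ℂ) * (n / p.2)) • S.psi ξ n v := by
  rw [h.D_psi, map_smul, map_sum, mul_smul, Finset.sum_smul]
  congr 1
  refine Finset.sum_congr rfl fun p hp => ?_
  rw [map_sum]
  simp only [h.D'_psi_psi]
  rw [← Finset.smul_sum, ← Finset.smul_sum, hK.casimir_apply, add_comm,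
    mem_antidiagonal.1 hp, smul_smul]

theorem laplacian_sig (h : KoszulOperators S ξ D D' T T' E E' Y)
    (n : ℕ) (v : L) :
    (D * D' + D' * D) (S.sig ξ n v) = D' (D (S.sig ξ n v)) := by
  simp [h.D'_sig]

theorem laplacian_psi (h : KoszulOperators S ξ D D' T T' E E' Y)
    (n : ℕ) (v : L) :
    (D * D' + D' * D) (S.psi ξ n v) = D' (D (S.psi ξ n v)) := by
  simp [h.D'_psi]

/-- The terms beyond the Leibniz rule are those of the symbol of the Laplacian. -/
theorem laplacian_sig_sig (h : KoszulOperators S ξ D D' T T' E E' Y)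
    (hK : IsOrthonormal ξ) (n k : ℕ) (v w : L) :
    (D * D' + D' * D) (S.sig ξ n v * S.sig ξ k w) =
      D' (D (S.sig ξ n v)) * S.sig ξ k w + S.sig ξ n v * D' (D (S.sig ξ k w)) +
      (∑ p ∈ antidiagonal n, (1 / (p.1 : ℂ)) •
        ∑ a, S.sig ξ p.2 ⁅ξ a, v⁆ * S.sig ξ (k + p.1) ⁅ξ a, w⁆ +
      ∑ p ∈ antidiagonal k, (1 / (p.1 : ℂ)) •
        ∑ a, S.sig ξ (n + p.1) ⁅ξ a, v⁆ * S.sig ξ p.2 ⁅ξ a, w⁆) := by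
  rw [LinearMap.add_apply, Module.End.mul_apply, Module.End.mul_apply, h.D'_sig_sig, map_zero,
    zero_add, h.D_der.leibniz, S.parity_sig, map_add, h.D'_D_sig hK, h.D'_D_sig hK, h.D_sig,
    h.D_sig]
  simp only [Finset.sum_mul, Finset.mul_sum, map_sum, Finset.sum_smul]
  have h1 : ∀ p ∈ antidiagonal n, ∑ a, D' (S.psi ξ p.1 (ξ a) * S.sig ξ p.2 ⁅ξ a, v⁆ *
      S.sig ξ k w) = (1 / (p.1 : ℂ)) • S.sig ξ n v * S.sig ξ k w + (1 / (p.1 : ℂ)) •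
        ∑ a, S.sig ξ p.2 ⁅ξ a, v⁆ * S.sig ξ (k + p.1) ⁅ξ a, w⁆ := by
    intro p hp
    simp only [mul_assoc, h.D'_psi_sig_sig, smul_add, Finset.sum_add_distrib]
    rw [← Finset.smul_sum, ← Finset.sum_mul, hK.casimir_apply, add_comm p.2,
      mem_antidiagonal.1 hp, ← Finset.smul_sum, smul_mul_assoc]
  have h2 : ∀ p ∈ antidiagonal k, ∑ a, D' (S.sig ξ n v * (S.psi ξ p.1 (ξ a) *
      S.sig ξ p.2 ⁅ξ a, w⁆)) = S.sig ξ n v * (1 / (p.1 : ℂ)) • S.sig ξ k w + (1 / (p.1 : ℂ)) •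
        ∑ a, S.sig ξ (n + p.1) ⁅ξ a, v⁆ * S.sig ξ p.2 ⁅ξ a, w⁆ := by
    intro p hp
    have h3 : ∀ a, S.sig ξ n v * (S.psi ξ p.1 (ξ a) * S.sig ξ p.2 ⁅ξ a, w⁆) =
        S.psi ξ p.1 (ξ a) * (S.sig ξ n v * S.sig ξ p.2 ⁅ξ a, w⁆) := fun a => by
      rw [← mul_assoc, S.sig_mul, mul_assoc]
    simp only [h3, h.D'_psi_sig_sig, smul_add, Finset.sum_add_distrib]
    rw [add_comm, ← Finset.smul_sum, ← Finset.mul_sum, hK.casimir_apply, add_comm p.2,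
      mem_antidiagonal.1 hp, ← Finset.smul_sum, mul_smul_comm]
  rw [Finset.sum_congr rfl h1, Finset.sum_congr rfl h2]
  simp only [Finset.sum_add_distrib, Finset.smul_sum]
  abel

/-- The terms beyond the Leibniz rule: besides those of the symbol there is the one from `D D'`. -/
theorem laplacian_sig_psi (h : KoszulOperators S ξ D D' T T' E E' Y)
    (hK : IsOrthonormal ξ) (n p : ℕ) (v w : L) :
    (D * D' + D' * D) (S.sig ξ n v * S.psi ξ p w) =
      D' (D (S.sig ξ n v)) * S.psi ξ p w + S.sig ξ n v * D' (D (S.psi ξ p w)) +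
      ((1 / (p : ℂ)) • ∑ q ∈ antidiagonal (n + p),
        ∑ a, S.psi ξ q.1 (ξ a) * S.sig ξ q.2 ⁅ξ a, ⁅w, v⁆⁆ +
      (∑ q ∈ antidiagonal n, (-(1 / (p : ℂ)) •
          (∑ a, S.psi ξ q.1 (ξ a) * S.sig ξ (q.2 + p) ⁅w, ⁅ξ a, v⁆⁆) +
        ((1 / (q.1 : ℂ)) * ((p + q.1 : ℕ) / (p : ℂ))) •
          ∑ a, S.psi ξ (p + q.1) ⁅ξ a, w⁆ * S.sig ξ q.2 ⁅ξ a, v⁆) +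
      (1 / 2 : ℂ) • ∑ q ∈ antidiagonal p, (-(1 / (q.2 : ℂ)) •
          (∑ a, S.psi ξ q.1 (ξ a) * S.sig ξ (n + q.2) ⁅⁅ξ a, w⁆, v⁆) +
        (1 / (q.1 : ℂ)) •
          ∑ a, S.psi ξ q.2 ⁅ξ a, w⁆ * S.sig ξ (n + q.1) ⁅ξ a, v⁆))) := by
  have h0 : D (D' (S.sig ξ n v * S.psi ξ p w)) = (1 / (p : ℂ)) • ∑ q ∈ antidiagonal (n + p),
        ∑ a, S.psi ξ q.1 (ξ a) * S.sig ξ q.2 ⁅ξ a, ⁅w, v⁆⁆ := by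
    rw [S.sig_mul, h.D'_psi_sig, map_smul, h.D_sig]
  rw [LinearMap.add_apply, Module.End.mul_apply, Module.End.mul_apply, h0, h.D_der.leibniz,
    S.parity_sig, map_add, h.D'_D_sig hK, h.D'_D_psi hK, h.D_sig, h.D_psi]
  simp only [Finset.sum_mul, Finset.mul_sum, map_sum, Finset.sum_smul, mul_smul_comm, map_smul]
  have h1 : ∀ q ∈ antidiagonal n, ∑ a, D' (S.psi ξ q.1 (ξ a) * S.sig ξ q.2 ⁅ξ a, v⁆ *
      S.psi ξ p w) = (1 / (q.1 : ℂ)) • S.sig ξ n v * S.psi ξ p w + (-(1 / (p : ℂ)) •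
          (∑ a, S.psi ξ q.1 (ξ a) * S.sig ξ (q.2 + p) ⁅w, ⁅ξ a, v⁆⁆) +
        ((1 / (q.1 : ℂ)) * ((p + q.1 : ℕ) / (p : ℂ))) •
          ∑ a, S.psi ξ (p + q.1) ⁅ξ a, w⁆ * S.sig ξ q.2 ⁅ξ a, v⁆) := by
    intro q hq
    have hq' : q.2 + q.1 = n := by rw [add_comm, mem_antidiagonal.1 hq]
    simp only [mul_assoc, h.D'_psi_sig_psi, smul_add, Finset.sum_add_distrib]
    rw [← Finset.smul_sum (r := (1 / (q.1 : ℂ))), ← Finset.sum_mul, hK.casimir_apply, hq']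
    simp only [mul_smul_comm, Finset.sum_neg_distrib, S.sig_mul, ← Finset.smul_sum, neg_smul,
      smul_smul, smul_mul_assoc]
    abel
  have h2 : ∀ q ∈ antidiagonal p, ∑ a, D' (S.sig ξ n v * (S.psi ξ q.1 (ξ a) *
      S.psi ξ q.2 ⁅ξ a, w⁆)) = S.sig ξ n v * (1 / (q.1 : ℂ) * (p / q.2)) • S.psi ξ p w +
        (-(1 / (q.2 : ℂ)) • (∑ a, S.psi ξ q.1 (ξ a) * S.sig ξ (n + q.2) ⁅⁅ξ a, w⁆, v⁆) +
        (1 / (q.1 : ℂ)) • ∑ a, S.psi ξ q.2 ⁅ξ a, w⁆ * S.sig ξ (n + q.1) ⁅ξ a, v⁆) := by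
    intro q hq
    have h3 : ∀ a, S.sig ξ n v * (S.psi ξ q.1 (ξ a) * S.psi ξ q.2 ⁅ξ a, w⁆) =
        S.psi ξ q.1 (ξ a) * (S.sig ξ n v * S.psi ξ q.2 ⁅ξ a, w⁆) := fun a => by
      rw [← mul_assoc, S.sig_mul, mul_assoc]
    simp only [h3, h.D'_psi_sig_psi, smul_add, Finset.sum_add_distrib, mul_smul_comm]
    rw [← Finset.smul_sum (r := (1 / (q.1 : ℂ))) (f := fun a => (_ : ℂ) • _),
      ← Finset.smul_sum (f := fun a => S.sig ξ n v * _), ← Finset.mul_sum, hK.casimir_apply,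
      add_comm q.2, mem_antidiagonal.1 hq]
    simp only [Finset.sum_neg_distrib, S.sig_mul, ← Finset.smul_sum, neg_smul, smul_smul]
    abel
  rw [Finset.sum_congr rfl h1, Finset.sum_congr rfl h2]
  simp only [Finset.sum_add_distrib, Finset.smul_sum, smul_add, mul_smul_comm, mul_smul,
    smul_mul_assoc]
  abel

end KoszulOperators

end Laplacian

section Laplacian

open Finset.HasAntidiagonal (antidiagonal mem_antidiagonal)

variable {d : ℕ} {L : Type} [LieRing L] [LieAlgebra ℂ L] {A : Type} [Ring A] [Algebra ℂ A]
  {S : SuperGen (OddIndex d) (Fin d × ℕ) A} {ξ : Module.Basis (Fin d) ℂ L}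
  {D D' : Module.End ℂ A} {T T' E E' : Fin d → ℕ → Module.End ℂ A} {Y : Fin d → Module.End ℂ A}

theorem sum_antidiagonal_add {M : Type} [AddCommGroup M] (g : ℕ → ℕ → M) (n p : ℕ) :
    ∑ q ∈ antidiagonal (n + p), g q.1 q.2 = ∑ q ∈ antidiagonal n, g q.1 (q.2 + p) +
      ∑ q ∈ antidiagonal p, g (n + q.1) q.2 - g n p := by
  have h1 := sum_antidiagonal_shift' g p n
  have h2 := sum_antidiagonal_shift g p n
  simp only [add_comm n]
  rw [h1, h2, ← Finset.sum_add_distrib]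
  have h3 : ∑ q ∈ antidiagonal (p + n), (if q = (n, p) then g n p else 0) = g n p := by
    rw [Finset.sum_ite_eq', if_pos (by rw [mem_antidiagonal, add_comm])]
  conv_rhs => rw [← h3]
  rw [← Finset.sum_sub_distrib]
  refine Finset.sum_congr rfl ?_
  rintro ⟨i, j⟩ hq
  rw [mem_antidiagonal] at hq
  simp only [Prod.mk.injEq] at hq ⊢
  by_cases h : i = n
  · have : j = p := by omega
    subst h this
    simp
  · have h' : ¬ (i = n ∧ j = p) := fun h' => h h'.1
    rw [if_neg h']
    by_cases hi : i ≤ n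
    · rw [if_pos hi, if_neg (by omega)]; simp
    · rw [if_neg hi, if_pos (by omega)]; simp

theorem sum_antidiagonal_ne_zero {M : Type} [AddCommGroup M] (g : ℕ → ℕ → M) (n : ℕ) :
    ∑ q ∈ antidiagonal n, (if q.1 = 0 then 0 else g q.1 q.2) =
      ∑ q ∈ antidiagonal n, g q.1 q.2 - g 0 n := by
  have h3 : ∑ q ∈ antidiagonal n, (if q = (0, n) then g 0 n else 0) = g 0 n := by
    rw [Finset.sum_ite_eq', if_pos (by simp)]
  conv_rhs => rw [← h3]
  rw [← Finset.sum_sub_distrib]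
  refine Finset.sum_congr rfl ?_
  rintro ⟨i, j⟩ hq
  rw [mem_antidiagonal] at hq
  simp only [Prod.mk.injEq] at hq ⊢
  by_cases h : i = 0
  · have : j = n := by omega
    subst h this
    simp
  · have h' : ¬ (i = 0 ∧ j = n) := fun h' => h h'.1
    rw [if_neg h', if_neg h, sub_zero]

namespace KoszulOperators

/-- The sum over `antidiagonal (n + p)` comes from `D D'`, the other two from `D' D`. -/
theorem laplacian_psi_psi (h : KoszulOperators S ξ D D' T T' E E' Y)
    (hK : IsOrthonormal ξ) (n p : ℕ) (v w : L) :
    (D * D' + D' * D) (S.psi ξ n v * S.psi ξ p w) =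
      D' (D (S.psi ξ n v)) * S.psi ξ p w + S.psi ξ n v * D' (D (S.psi ξ p w)) +
      (-((1 / (n : ℂ)) * ((p + n : ℕ) / (p : ℂ))) • (∑ q ∈ antidiagonal (n + p),
        ∑ a, S.psi ξ q.1 ⁅ξ a, v⁆ * S.psi ξ q.2 ⁅ξ a, w⁆) +
      ∑ q ∈ antidiagonal n, ((1 / (q.1 : ℂ)) * ((p + q.1 : ℕ) / (p : ℂ))) •
          (∑ a, S.psi ξ q.2 ⁅ξ a, v⁆ * S.psi ξ (p + q.1) ⁅ξ a, w⁆) +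
      ∑ q ∈ antidiagonal p, ((1 / (q.1 : ℂ)) * ((n + q.1 : ℕ) / (n : ℂ))) •
          ∑ a, S.psi ξ (n + q.1) ⁅ξ a, v⁆ * S.psi ξ q.2 ⁅ξ a, w⁆) := by
  have h0 : D (D' (S.psi ξ n v * S.psi ξ p w)) =
      -((1 / (n : ℂ)) * ((p + n : ℕ) / (p : ℂ))) • (∑ q ∈ antidiagonal (n + p),
        ∑ a, S.psi ξ q.1 ⁅ξ a, v⁆ * S.psi ξ q.2 ⁅ξ a, w⁆) := by
    rw [h.D'_psi_psi, map_smul, map_smul, h.D_psi, smul_smul, neg_smul, ← smul_neg, add_comm p n]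
    congr 1
    have h1 : ∀ q : ℕ × ℕ, ∑ a, S.psi ξ q.1 (ξ a) * S.psi ξ q.2 ⁅ξ a, ⁅v, w⁆⁆ =
        -∑ a, S.psi ξ q.2 ⁅ξ a, v⁆ * S.psi ξ q.1 ⁅ξ a, w⁆ -
          ∑ a, S.psi ξ q.1 ⁅ξ a, v⁆ * S.psi ξ q.2 ⁅ξ a, w⁆ := by
      intro q
      rw [hK.sum_mul_lie_lie'']
      congr 1
      rw [← Finset.sum_neg_distrib]
      exact Finset.sum_congr rfl fun a _ => S.psi_mul_psi ξ _ _ _ _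
    simp only [h1, Finset.sum_sub_distrib, Finset.sum_neg_distrib]
    rw [sum_antidiagonal_comm (fun i j => ∑ a, S.psi ξ i ⁅ξ a, v⁆ * S.psi ξ j ⁅ξ a, w⁆)]
    rw [← neg_add', smul_neg, ← two_smul ℂ, smul_smul]
    norm_num
  have h1 : ∀ q ∈ antidiagonal n, ∑ a, D' (S.psi ξ q.1 (ξ a) * S.psi ξ q.2 ⁅ξ a, v⁆ *
      S.psi ξ p w) = (1 / (q.1 : ℂ) * (n / q.2)) • (S.psi ξ n v * S.psi ξ p w) +
        (((1 / (q.2 : ℂ)) * ((p + q.2 : ℕ) / (p : ℂ))) •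
          (∑ a, S.psi ξ q.1 ⁅ξ a, v⁆ * S.psi ξ (p + q.2) ⁅ξ a, w⁆) +
        ((1 / (q.1 : ℂ)) * ((p + q.1 : ℕ) / (p : ℂ))) •
          ∑ a, S.psi ξ q.2 ⁅ξ a, v⁆ * S.psi ξ (p + q.1) ⁅ξ a, w⁆) := by
    intro q hq
    have hq' : q.2 + q.1 = n := by rw [add_comm, mem_antidiagonal.1 hq]
    simp only [mul_assoc, h.D'_psi_psi_psi, smul_add, Finset.sum_add_distrib, mul_smul_comm,
      smul_mul_assoc, smul_smul, ← smul_neg]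
    simp only [← Finset.smul_sum, Finset.sum_neg_distrib, hK.sum_mul_lie_lie, neg_neg]
    rw [← Finset.sum_mul, hK.casimir_apply, hq']
    abel
  have h2 : ∀ q ∈ antidiagonal p, ∑ a, D' (S.psi ξ n v * (S.psi ξ q.1 (ξ a) *
      S.psi ξ q.2 ⁅ξ a, w⁆)) = -((1 / (q.1 : ℂ) * (p / q.2)) • (S.psi ξ n v * S.psi ξ p w) +
        (((1 / (q.2 : ℂ)) * ((n + q.2 : ℕ) / (n : ℂ))) •
          (∑ a, S.psi ξ (n + q.2) ⁅ξ a, v⁆ * S.psi ξ q.1 ⁅ξ a, w⁆) +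
        ((1 / (q.1 : ℂ)) * ((n + q.1 : ℕ) / (n : ℂ))) •
          ∑ a, S.psi ξ (n + q.1) ⁅ξ a, v⁆ * S.psi ξ q.2 ⁅ξ a, w⁆)) := by
    intro q hq
    have hq' : q.2 + q.1 = p := by rw [add_comm, mem_antidiagonal.1 hq]
    have h3 : ∀ a, S.psi ξ n v * (S.psi ξ q.1 (ξ a) * S.psi ξ q.2 ⁅ξ a, w⁆) =
        -(S.psi ξ q.1 (ξ a) * (S.psi ξ n v * S.psi ξ q.2 ⁅ξ a, w⁆)) := fun a => by
      rw [← mul_assoc, S.psi_mul_psi ξ n, neg_mul, mul_assoc]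
    have h4 : ∑ a, S.psi ξ q.1 ⁅ξ a, w⁆ * S.psi ξ (q.2 + n) ⁅ξ a, v⁆ =
        -∑ a, S.psi ξ (n + q.2) ⁅ξ a, v⁆ * S.psi ξ q.1 ⁅ξ a, w⁆ := by
      rw [← Finset.sum_neg_distrib, add_comm n]
      exact Finset.sum_congr rfl fun a _ => S.psi_mul_psi ξ _ _ _ _
    simp only [h3, map_neg, h.D'_psi_psi_psi, smul_add, Finset.sum_add_distrib, mul_smul_comm,
      smul_mul_assoc, smul_smul, ← smul_neg, Finset.sum_neg_distrib]
    simp only [← Finset.smul_sum, Finset.sum_neg_distrib, hK.sum_mul_lie_lie', h4, neg_neg]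
    rw [← Finset.mul_sum, hK.casimir_apply, hq']
    have h5 : 1 / (n : ℂ) * ((q.2 + n : ℕ) / q.2) = 1 / (q.2 : ℂ) * ((n + q.2 : ℕ) / n) := by
      rw [add_comm n]; ring
    rw [h5, add_comm n q.1]
    abel
  rw [LinearMap.add_apply, Module.End.mul_apply, Module.End.mul_apply, h0, h.D_der.leibniz,
    (S.isOdd_psi ξ n v).parity, map_add, h.D'_D_psi hK, h.D'_D_psi hK, h.D_psi, h.D_psi, neg_mul,
    map_neg]
  simp only [Finset.sum_mul, Finset.mul_sum, map_sum, mul_smul_comm, map_smul, smul_mul_assoc]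
  rw [Finset.sum_congr rfl h1, Finset.sum_congr rfl h2]
  simp only [Finset.sum_add_distrib, Finset.sum_neg_distrib]
  rw [sum_antidiagonal_comm (fun i j => ((1 / (i : ℂ)) * ((p + i : ℕ) / (p : ℂ))) •
          (∑ a, S.psi ξ j ⁅ξ a, v⁆ * S.psi ξ (p + i) ⁅ξ a, w⁆)),
    sum_antidiagonal_comm (fun i j => ((1 / (i : ℂ)) * ((n + i : ℕ) / (n : ℂ))) •
          (∑ a, S.psi ξ (n + i) ⁅ξ a, v⁆ * S.psi ξ j ⁅ξ a, w⁆)),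
    ← Finset.sum_smul, ← Finset.sum_smul, ← two_smul ℂ, ← two_smul ℂ, smul_add, smul_neg, neg_neg,
    smul_add, smul_smul, smul_smul, smul_smul, smul_smul]
  simp only [one_div, Finset.mul_sum]
  norm_num
  abel

end KoszulOperators

end Laplacian

section Laplacian

open Finset.HasAntidiagonal (antidiagonal mem_antidiagonal)

variable {d : ℕ} {L : Type} [LieRing L] [LieAlgebra ℂ L] {A : Type} [Ring A] [Algebra ℂ A]
  {S : SuperGen (OddIndex d) (Fin d × ℕ) A} {ξ : Module.Basis (Fin d) ℂ L}
  {D D' : Module.End ℂ A} {T T' E E' : Fin d → ℕ → Module.End ℂ A} {Y : Fin d → Module.End ℂ A}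

theorem locSum_eq_sum_range {M : Type} [AddCommGroup M] [Module ℂ M] {U : ℕ → Module.End ℂ M}
    (hU : LocallyFinite U) {x : M} {N : ℕ} (hN : ∀ m, N < m → U m x = 0) :
    locSum U hU x = ∑ m ∈ Finset.range (N + 1), U m x := by
  rw [locSum_apply]
  refine finsum_eq_sum_of_support_subset _ fun m hm => ?_
  rw [Function.mem_support] at hm
  simp only [Finset.coe_range, Set.mem_Iio]
  by_contra hlt
  exact hm (hN m (by omega))

namespace KoszulOperators

/-- The symbol of `sumT`: its failure to satisfy the Leibniz rule on `x y`, written as a finite sum over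
the energies that `T` can remove from `x` and `y`. -/
theorem sumT_mul (h : KoszulOperators S ξ D D' T T' E E' Y) {x y : A} {N : ℕ}
    (hx : ∀ a m, N < m → T a m x = 0) (hy : ∀ a m, N < m → T a m y = 0) :
    h.sumT (x * y) = h.sumT x * y + x * h.sumT y +
      (∑ m ∈ Finset.range (N + 1), (1 / (m : ℂ)) • (∑ a, T a m x * T' a m y) +
      ∑ m ∈ Finset.range (N + 1), (1 / (m : ℂ)) • ∑ a, T' a m x * T a m y) := by
  rw [sumT, locSum_eq_sum_range h.T_fin (N := N) (fun m hm => by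
      simp [hx _ m hm, hy _ m hm, (h.T_der _ m).leibniz]),
    locSum_eq_sum_range h.T_fin (N := N) (fun m hm => by simp [hx _ m hm]),
    locSum_eq_sum_range h.T_fin (N := N) (fun m hm => by simp [hy _ m hm]),
    Finset.sum_mul, Finset.mul_sum, ← Finset.sum_add_distrib, ← Finset.sum_add_distrib,
    ← Finset.sum_add_distrib]
  refine Finset.sum_congr rfl fun m _ => ?_
  simp only [LinearMap.sum_apply, LinearMap.smul_apply, Module.End.mul_apply,
    (h.T_der _ m).leibniz, (h.T'_der _ m).leibniz, map_add, Finset.sum_mul, Finset.mul_sum,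
    Finset.smul_sum, ← Finset.sum_add_distrib, smul_add, smul_mul_assoc, mul_smul_comm]
  refine Finset.sum_congr rfl fun a _ => ?_
  abel

theorem T_sig_of_lt (h : KoszulOperators S ξ D D' T T' E E' Y) {n N : ℕ} (hn : n ≤ N) (v : L)
    (a : Fin d) (m : ℕ) (hm : N < m) : T a m (S.sig ξ n v) = 0 := by
  rw [h.T_sig, if_neg (by omega)]

theorem T_psi_of_lt (h : KoszulOperators S ξ D D' T T' E E' Y) {n N : ℕ} (hn : n ≤ N) (v : L)
    (a : Fin d) (m : ℕ) (hm : N < m) : T a m (S.psi ξ n v) = 0 := by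
  rw [h.T_psi, if_neg (by omega)]

theorem sum_T_sig_mul (h : KoszulOperators S ξ D D' T T' E E' Y) {n N : ℕ} (hn : n ≤ N) (v : L)
    (y : ℕ → Fin d → A) :
    ∑ m ∈ Finset.range (N + 1), (1 / (m : ℂ)) • (∑ a, T a m (S.sig ξ n v) * y m a) =
      ∑ q ∈ antidiagonal n, (1 / (q.1 : ℂ)) • ∑ a, S.sig ξ q.2 ⁅ξ a, v⁆ * y q.1 a := by
  rw [← sum_range_ite (fun i j => (1 / (i : ℂ)) • ∑ a, S.sig ξ j ⁅ξ a, v⁆ * y i a) hn]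
  refine Finset.sum_congr rfl fun m _ => ?_
  simp only [h.T_sig]
  split_ifs <;> simp

theorem sum_mul_T_sig (h : KoszulOperators S ξ D D' T T' E E' Y) {n N : ℕ} (hn : n ≤ N) (v : L)
    (y : ℕ → Fin d → A) :
    ∑ m ∈ Finset.range (N + 1), (1 / (m : ℂ)) • (∑ a, y m a * T a m (S.sig ξ n v)) =
      ∑ q ∈ antidiagonal n, (1 / (q.1 : ℂ)) • ∑ a, y q.1 a * S.sig ξ q.2 ⁅ξ a, v⁆ := by
  rw [← sum_range_ite (fun i j => (1 / (i : ℂ)) • ∑ a, y i a * S.sig ξ j ⁅ξ a, v⁆) hn]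
  refine Finset.sum_congr rfl fun m _ => ?_
  simp only [h.T_sig]
  split_ifs <;> simp

theorem sum_T_psi_mul (h : KoszulOperators S ξ D D' T T' E E' Y) {n N : ℕ} (hn : n ≤ N) (v : L)
    (y : ℕ → Fin d → A) :
    ∑ m ∈ Finset.range (N + 1), (1 / (m : ℂ)) • (∑ a, T a m (S.psi ξ n v) * y m a) =
      ∑ q ∈ antidiagonal n, (1 / (q.1 : ℂ) * (q.2 / n)) •
        ∑ a, S.psi ξ q.2 ⁅ξ a, v⁆ * y q.1 a := by
  rw [← sum_range_ite (fun i j => (1 / (i : ℂ) * (j / n)) •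
    ∑ a, S.psi ξ j ⁅ξ a, v⁆ * y i a) hn]
  refine Finset.sum_congr rfl fun m _ => ?_
  simp only [h.T_psi]
  split_ifs
  · simp only [smul_mul_assoc, ← Finset.smul_sum, smul_smul]
  · simp

theorem sum_mul_T_psi (h : KoszulOperators S ξ D D' T T' E E' Y) {n N : ℕ} (hn : n ≤ N) (v : L)
    (y : ℕ → Fin d → A) :
    ∑ m ∈ Finset.range (N + 1), (1 / (m : ℂ)) • (∑ a, y m a * T a m (S.psi ξ n v)) =
      ∑ q ∈ antidiagonal n, (1 / (q.1 : ℂ) * (q.2 / n)) •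
        ∑ a, y q.1 a * S.psi ξ q.2 ⁅ξ a, v⁆ := by
  rw [← sum_range_ite (fun i j => (1 / (i : ℂ) * (j / n)) •
    ∑ a, y i a * S.psi ξ j ⁅ξ a, v⁆) hn]
  refine Finset.sum_congr rfl fun m _ => ?_
  simp only [h.T_psi]
  split_ifs
  · simp only [mul_smul_comm, ← Finset.smul_sum, smul_smul]
  · simp

theorem sumT_sig (h : KoszulOperators S ξ D D' T T' E E' Y) (hK : IsOrthonormal ξ)
    (n : ℕ) (v : L) :
    h.sumT (S.sig ξ n v) = (∑ q ∈ antidiagonal n, 1 / (q.1 : ℂ)) • S.sig ξ n v := by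
  rw [sumT, locSum_eq_sum_range h.T_fin (N := n) (fun m hm => by
    simp [h.T_sig_of_lt le_rfl v _ m hm]), Finset.sum_smul,
    ← sum_range_ite (fun i j => (1 / (i : ℂ)) • S.sig ξ n v) le_rfl]
  refine Finset.sum_congr rfl fun m _ => ?_
  simp only [LinearMap.sum_apply, LinearMap.smul_apply, Module.End.mul_apply, h.T_sig]
  split_ifs with hm
  · simp only [h.T'_sig]
    rw [← Finset.smul_sum, hK.casimir_apply, Nat.sub_add_cancel hm]
  · simp

theorem sumT_psi (h : KoszulOperators S ξ D D' T T' E E' Y) (hK : IsOrthonormal ξ)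
    (n : ℕ) (v : L) :
    h.sumT (S.psi ξ n v) = (∑ q ∈ antidiagonal n, 1 / (q.1 : ℂ) * (q.2 / n)) • S.psi ξ n v := by
  rw [sumT, locSum_eq_sum_range h.T_fin (N := n) (fun m hm => by
    simp [h.T_psi_of_lt le_rfl v _ m hm]), Finset.sum_smul,
    ← sum_range_ite (fun i j => (1 / (i : ℂ) * (j / n)) • S.psi ξ n v) le_rfl]
  refine Finset.sum_congr rfl fun m _ => ?_
  simp only [LinearMap.sum_apply, LinearMap.smul_apply, Module.End.mul_apply, h.T_psi]
  split_ifs with hm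
  · rcases Nat.eq_zero_or_pos (n - m) with h0 | h0
    · simp [h0]
    · simp only [map_smul, h.T'_psi _ _ _ _ h0.ne']
      rw [← Finset.smul_sum, ← Finset.smul_sum, hK.casimir_apply, Nat.sub_add_cancel hm, smul_smul]
  · simp

theorem sumE_sig (h : KoszulOperators S ξ D D' T T' E E' Y) (n : ℕ) (v : L) :
    h.sumE (S.sig ξ n v) = 0 := by
  rw [sumE, locSum_eq_sum_range h.E_fin (N := 0) (fun m hm => by simp [h.E_sig])]
  simp [h.E_sig]

theorem sumE_sig_sig (h : KoszulOperators S ξ D D' T T' E E' Y) (n k : ℕ) (v w : L) :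
    h.sumE (S.sig ξ n v * S.sig ξ k w) = 0 := by
  have h0 : ∀ a m, E a m (S.sig ξ n v * S.sig ξ k w) = 0 := fun a m => by
    simp [(h.E_der a m).leibniz, h.E_sig]
  rw [sumE, locSum_eq_sum_range h.E_fin (N := 0) (fun m hm => by simp [h0])]
  simp [h0]

/-- The operators `E` lower the energy of `ψ`, so a sum over `E` of one generator is a sum over the
decompositions of its energy with nonzero first part. -/
theorem sum_range_succ_ite {M : Type} [AddCommMonoid M] (g : ℕ → ℕ → M) (n : ℕ) :
    ∑ m ∈ Finset.range (n + 1), (if m + 1 ≤ n then g (m + 1) (n - (m + 1)) else 0) =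
      ∑ q ∈ antidiagonal n, if q.1 = 0 then 0 else g q.1 q.2 := by
  have h1 := sum_range_ite (fun i j => if i = 0 then 0 else g i j) (le_refl n)
  rw [← h1, Finset.sum_range_succ, Finset.sum_range_succ' (n := n)]
  simp

theorem sumE_sig_psi (h : KoszulOperators S ξ D D' T T' E E' Y) (hK : IsOrthonormal ξ)
    (n p : ℕ) (v w : L) :
    h.sumE (S.sig ξ n v * S.psi ξ p w) =
      (∑ q ∈ antidiagonal p, if q.1 = 0 then 0 else 1 / (p : ℂ)) • (S.sig ξ n v * S.psi ξ p w) +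
      (1 / (p : ℂ)) • ∑ q ∈ antidiagonal p, if q.1 = 0 then 0 else
        ∑ a, S.psi ξ (n + q.1) ⁅ξ a, v⁆ * S.sig ξ q.2 ⁅ξ a, w⁆ := by
  have h0 : ∀ a m, E a m (S.sig ξ n v * S.psi ξ p w) = if m ≤ p then
      (1 / (p : ℂ)) • (S.sig ξ n v * S.sig ξ (p - m) ⁅ξ a, w⁆) else 0 := fun a m => by
    rw [(h.E_der a m).leibniz, h.E_sig, h.E_psi, S.parity_sig]
    split_ifs <;> simp
  rw [sumE, locSum_eq_sum_range h.E_fin (N := p) (fun m hm => by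
    simp [h0, show ¬ m + 1 ≤ p by omega]), Finset.sum_smul, Finset.smul_sum,
    ← Finset.sum_add_distrib]
  have h1 := sum_range_succ_ite (fun i j => (1 / (p : ℂ)) • (S.sig ξ n v * S.psi ξ p w) +
    (1 / (p : ℂ)) • ∑ a, S.psi ξ (n + i) ⁅ξ a, v⁆ * S.sig ξ j ⁅ξ a, w⁆) p
  refine Eq.trans ?_ (h1.trans (Finset.sum_congr rfl fun q _ => by split_ifs <;> simp))
  refine Finset.sum_congr rfl fun m _ => ?_
  simp only [LinearMap.sum_apply, Module.End.mul_apply, h0]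
  split_ifs with hm
  · simp only [map_smul, (h.E'_der _ _).leibniz, h.E'_sig, S.parity_sig]
    rw [← Finset.smul_sum, Finset.sum_add_distrib, ← Finset.mul_sum, hK.casimir_apply, smul_add,
      add_comm, Nat.sub_add_cancel hm]
  · simp

theorem sumE_psi (h : KoszulOperators S ξ D D' T T' E E' Y) (hK : IsOrthonormal ξ)
    (p : ℕ) (w : L) :
    h.sumE (S.psi ξ p w) =
      (∑ q ∈ antidiagonal p, if q.1 = 0 then 0 else 1 / (p : ℂ)) • S.psi ξ p w := by
  rw [sumE, locSum_eq_sum_range h.E_fin (N := p) (fun m hm => by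
    simp [h.E_psi, show ¬ m + 1 ≤ p by omega]), Finset.sum_smul]
  have h1 := sum_range_succ_ite (fun i j => (1 / (p : ℂ)) • S.psi ξ p w) p
  refine Eq.trans ?_ (h1.trans (Finset.sum_congr rfl fun q _ => by split_ifs <;> simp))
  refine Finset.sum_congr rfl fun m _ => ?_
  simp only [LinearMap.sum_apply, Module.End.mul_apply, h.E_psi]
  split_ifs with hm
  · simp only [map_smul, h.E'_sig]
    rw [← Finset.smul_sum, hK.casimir_apply, Nat.sub_add_cancel hm]
  · simp

/-- On two odd generators `sumE` satisfies the Leibniz rule: `E'` kills every `ψ`. -/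
theorem sumE_psi_psi (h : KoszulOperators S ξ D D' T T' E E' Y) (n p : ℕ) (v w : L) :
    h.sumE (S.psi ξ n v * S.psi ξ p w) =
      h.sumE (S.psi ξ n v) * S.psi ξ p w + S.psi ξ n v * h.sumE (S.psi ξ p w) := by
  have h0 : ∀ a m, n + p < m + 1 → E a (m + 1) (S.psi ξ n v) = 0 ∧ E a (m + 1) (S.psi ξ p w) = 0 :=
    fun a m hm => by
      rw [h.E_psi, h.E_psi, if_neg (by omega), if_neg (by omega)]
      simp
  rw [sumE, locSum_eq_sum_range h.E_fin (N := n + p) (fun m hm => by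
      simp [(h.E_der _ _).leibniz, h0 _ m (by omega)]),
    locSum_eq_sum_range h.E_fin (N := n + p) (fun m hm => by simp [h0 _ m (by omega)]),
    locSum_eq_sum_range h.E_fin (N := n + p) (fun m hm => by simp [h0 _ m (by omega)]),
    Finset.sum_mul, Finset.mul_sum, ← Finset.sum_add_distrib]
  refine Finset.sum_congr rfl fun m _ => ?_
  simp only [LinearMap.sum_apply, Module.End.mul_apply, Finset.sum_mul, Finset.mul_sum,
    ← Finset.sum_add_distrib]
  refine Finset.sum_congr rfl fun a _ => ?_
  have h1 : ∀ k u, S.parity (E a (m + 1) (S.psi ξ k u)) = E a (m + 1) (S.psi ξ k u) := by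
    intro k u
    rw [h.E_psi]
    split_ifs <;> simp [S.parity_sig]
  simp only [(h.E_der _ _).leibniz, map_add, (S.isOdd_psi ξ _ _).parity, neg_mul, map_neg,
    (h.E'_der _ _).leibniz, h.E'_psi, h1]
  simp

end KoszulOperators

end Laplacian

section Laplacian

open Finset.HasAntidiagonal (antidiagonal mem_antidiagonal)

variable {d : ℕ} {L : Type} [LieRing L] [LieAlgebra ℂ L] {A : Type} [Ring A] [Algebra ℂ A]
  {S : SuperGen (OddIndex d) (Fin d × ℕ) A} {ξ : Module.Basis (Fin d) ℂ L}
  {D D' : Module.End ℂ A} {T T' E E' : Fin d → ℕ → Module.End ℂ A} {Y : Fin d → Module.End ℂ A}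

/-- The eigenvalues of the three terms of the formula on `ψ(-p)` add up to that of the Laplacian. Both
sides come down to harmonic sums by `p / (i j) = 1 / i + 1 / j` for `i + j = p`; the terms with
`i j = 0` vanish on the left because `1 / 0 = 0`. -/
theorem half_sum_antidiagonal (p : ℕ) (hp : p ≠ 0) :
    (1 / 2 : ℂ) * ∑ q ∈ antidiagonal p, 1 / (q.1 : ℂ) * (p / q.2) =
      ∑ q ∈ antidiagonal p, 1 / (q.1 : ℂ) * (q.2 / p) +
        (∑ q ∈ antidiagonal p, if q.1 = 0 then 0 else 1 / (p : ℂ)) - 1 / (p : ℂ) := by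
  have hp' : (p : ℂ) ≠ 0 := by exact_mod_cast hp
  have h1 : ∀ q ∈ antidiagonal p, 1 / (q.1 : ℂ) * (p / q.2) =
      1 / (q.1 : ℂ) + 1 / (q.2 : ℂ) - (if q = (0, p) then 1 / (p : ℂ) else 0) -
        (if q = (p, 0) then 1 / (p : ℂ) else 0) := by
    rintro ⟨m, k⟩ hq
    rw [mem_antidiagonal] at hq
    simp only [Prod.mk.injEq] at hq ⊢
    by_cases hm : m = 0
    · obtain rfl : k = p := by omega
      subst hm
      simp [Ne.symm hp]
    by_cases hk : k = 0
    · obtain rfl : m = p := by omega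
      subst hk
      simp [Ne.symm hp]
    · rw [if_neg (by tauto), if_neg (by tauto)]
      have : (m : ℂ) ≠ 0 := by exact_mod_cast hm
      have : (k : ℂ) ≠ 0 := by exact_mod_cast hk
      have : (p : ℂ) = m + k := by rw [← hq]; push_cast; ring
      rw [this]
      field_simp
      ring
  have h2 : ∀ q ∈ antidiagonal p, 1 / (q.1 : ℂ) * (q.2 / p) =
      1 / (q.1 : ℂ) - (if q.1 = 0 then 0 else 1 / (p : ℂ)) := by
    rintro ⟨m, k⟩ hq
    rw [mem_antidiagonal] at hq
    dsimp only at hq ⊢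
    by_cases hm : m = 0
    · simp [hm]
    · rw [if_neg hm]
      have : (m : ℂ) ≠ 0 := by exact_mod_cast hm
      have : (p : ℂ) = m + k := by rw [← hq]; push_cast; ring
      field_simp
      rw [this]
      ring
  rw [Finset.sum_congr rfl h1, Finset.sum_congr rfl h2]
  simp only [Finset.sum_sub_distrib, Finset.sum_add_distrib, Finset.sum_ite_eq']
  rw [sum_antidiagonal_comm (fun i j => 1 / (i : ℂ)), if_pos (by simp), if_pos (by simp)]
  ring

namespace KoszulOperators

/-- The symbol of `∑ Y T(0)`. -/
theorem sum_Y_T_mul (h : KoszulOperators S ξ D D' T T' E E' Y) (x y : A) :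
    (∑ c, Y c * T c 0) (x * y) = (∑ c, Y c * T c 0) x * y + x * (∑ c, Y c * T c 0) y +
      (∑ c, T c 0 x * Y c y + ∑ c, Y c x * T c 0 y) := by
  simp only [LinearMap.sum_apply, Module.End.mul_apply, (h.T_der _ _).leibniz,
    (h.Y_der _).leibniz, map_add, Finset.sum_add_distrib, Finset.sum_mul, Finset.mul_sum]
  abel

theorem sum_Y_T_sig (h : KoszulOperators S ξ D D' T T' E E' Y) (n : ℕ) (v : L) :
    (∑ c, Y c * T c 0) (S.sig ξ n v) = 0 := by
  simp [h.T_sig, h.Y_sig]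

theorem T_zero_psi (h : KoszulOperators S ξ D D' T T' E E' Y) (a : Fin d) (n : ℕ) (v : L) :
    T a 0 (S.psi ξ n v) = S.psi ξ n ⁅ξ a, v⁆ := by
  rcases eq_or_ne n 0 with rfl | hn
  · simp [S.psi_zero]
  · have : (n : ℂ) ≠ 0 := by exact_mod_cast hn
    simp [h.T_psi, this]

theorem sum_Y_T_psi (h : KoszulOperators S ξ D D' T T' E E' Y) (hK : IsOrthonormal ξ)
    (n : ℕ) (v : L) : (∑ c, Y c * T c 0) (S.psi ξ n v) = (1 / (n : ℂ)) • S.psi ξ n v := by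
  simp only [LinearMap.sum_apply, Module.End.mul_apply, h.T_zero_psi, h.Y_psi]
  rw [← Finset.smul_sum, hK.casimir_apply]

theorem laplacian_defect_sig (h : KoszulOperators S ξ D D' T T' E E' Y) (hK : IsOrthonormal ξ)
    (n : ℕ) (v : L) :
    (D * D' + D' * D) (S.sig ξ n v) = (h.sumT + h.sumE - ∑ c, Y c * T c 0) (S.sig ξ n v) := by
  rw [h.laplacian_sig, h.D'_D_sig hK, LinearMap.sub_apply, LinearMap.add_apply, h.sumT_sig hK,
    h.sumE_sig, h.sum_Y_T_sig, add_zero, sub_zero]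

theorem laplacian_defect_psi (h : KoszulOperators S ξ D D' T T' E E' Y) (hK : IsOrthonormal ξ)
    (n : ℕ) (v : L) (hn : n ≠ 0) :
    (D * D' + D' * D) (S.psi ξ n v) = (h.sumT + h.sumE - ∑ c, Y c * T c 0) (S.psi ξ n v) := by
  rw [h.laplacian_psi, h.D'_D_psi hK, LinearMap.sub_apply, LinearMap.add_apply, h.sumT_psi hK,
    h.sumE_psi hK, h.sum_Y_T_psi hK, ← add_smul, ← sub_smul, half_sum_antidiagonal n hn]

theorem laplacian_defect_sig_sig (h : KoszulOperators S ξ D D' T T' E E' Y)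
    (hK : IsOrthonormal ξ) (n k : ℕ) (v w : L) :
    (D * D' + D' * D) (S.sig ξ n v * S.sig ξ k w) =
      (h.sumT + h.sumE - ∑ c, Y c * T c 0) (S.sig ξ n v * S.sig ξ k w) := by
  rw [h.laplacian_sig_sig hK, LinearMap.sub_apply, LinearMap.add_apply,
    h.sumT_mul (N := n + k) (h.T_sig_of_lt (by omega) v) (h.T_sig_of_lt (by omega) w),
    h.sumE_sig_sig, h.sum_Y_T_mul, h.sum_T_sig_mul (by omega), h.sum_mul_T_sig (by omega)]
  simp only [h.T'_sig, h.D'_D_sig hK, h.sumT_sig hK, h.sum_Y_T_sig, h.Y_sig]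
  simp

theorem laplacian_defect_sig_psi (h : KoszulOperators S ξ D D' T T' E E' Y)
    (hK : IsOrthonormal ξ) (n p : ℕ) (v w : L) (hp : p ≠ 0) :
    (D * D' + D' * D) (S.sig ξ n v * S.psi ξ p w) =
      (h.sumT + h.sumE - ∑ c, Y c * T c 0) (S.sig ξ n v * S.psi ξ p w) := by
  have hp' : (p : ℂ) ≠ 0 := by exact_mod_cast hp
  have hpsi := h.laplacian_defect_psi hK p w hp
  rw [h.laplacian_psi, LinearMap.sub_apply, LinearMap.add_apply, h.sumE_psi hK,
    h.sum_Y_T_psi hK] at hpsi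
  rw [h.laplacian_sig_psi hK, LinearMap.sub_apply, LinearMap.add_apply,
    h.sumT_mul (N := n + p) (h.T_sig_of_lt (by omega) v) (h.T_psi_of_lt (by omega) w),
    h.sumE_sig_psi hK, h.sum_Y_T_mul, h.sum_T_sig_mul (by omega), h.sum_mul_T_psi (by omega),
    hpsi, h.sum_Y_T_sig, h.sum_Y_T_psi hK, h.D'_D_sig hK, h.sumT_sig hK]
  simp only [h.T'_sig, h.T'_psi _ _ _ _ hp, h.Y_sig, h.Y_psi, h.T_sig, zero_mul,
    Finset.sum_const_zero, add_zero, zero_le, if_true, Nat.sub_zero, S.sig_mul,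
    hK.sum_mul_lie_lie, hK.sum_mul_lie_lie', hK.sum_mul_lie_lie'']
  -- `K j k` and `K' j k` are the two contractions of `ψ_j ⊗ σ_k` with `v` and `w`
  let K : ℕ → ℕ → A := fun j k => ∑ a, S.psi ξ j ⁅ξ a, w⁆ * S.sig ξ k ⁅ξ a, v⁆
  let K' : ℕ → ℕ → A := fun j k => ∑ a, S.psi ξ j ⁅ξ a, v⁆ * S.sig ξ k ⁅ξ a, w⁆
  have e1 := sum_antidiagonal_add K p n
  have e2 := sum_antidiagonal_add K' n p
  have e3 := sum_antidiagonal_ne_zero (fun i j => K' (n + i) j) p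
  have e4 := sum_antidiagonal_ne_zero (fun i j => K (p + i) j) n
  have e5 := sum_antidiagonal_ne_zero (fun i j => K j (n + i)) p
  have k1 : ∀ j k, ∑ a, S.psi ξ j ⁅ξ a, w⁆ * S.sig ξ k ⁅ξ a, v⁆ = K j k := fun _ _ => rfl
  have k2 : ∀ j k, ∑ a, S.psi ξ j ⁅ξ a, v⁆ * S.sig ξ k ⁅ξ a, w⁆ = K' j k := fun _ _ => rfl
  have h1 : ∀ q ∈ antidiagonal n, ((1 / (q.1 : ℂ)) * ((p + q.1 : ℕ) / (p : ℂ))) • K (p + q.1) q.2 =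
      (1 / (q.1 : ℂ)) • K (p + q.1) q.2 +
        (1 / (p : ℂ)) • if q.1 = 0 then 0 else K (p + q.1) q.2 := by
    rintro ⟨m, k⟩ -
    dsimp only
    by_cases hm : m = 0
    · simp [hm]
    · have : (m : ℂ) ≠ 0 := by exact_mod_cast hm
      rw [if_neg hm, ← add_smul]
      congr 1
      push_cast
      field_simp
  have h2 : ∀ q ∈ antidiagonal p, (1 / (q.1 : ℂ)) • K q.2 (n + q.1) =
      ((1 / (q.1 : ℂ)) * (q.2 / (p : ℂ))) • K q.2 (n + q.1) +
        (1 / (p : ℂ)) • if q.1 = 0 then 0 else K q.2 (n + q.1) := by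
    rintro ⟨m, k⟩ hq
    rw [mem_antidiagonal] at hq
    dsimp only at hq ⊢
    by_cases hm : m = 0
    · simp [hm]
    · have : (m : ℂ) ≠ 0 := by exact_mod_cast hm
      have h5 : (p : ℂ) = m + k := by rw [← hq]; push_cast; ring
      rw [if_neg hm, ← add_smul]
      congr 1
      field_simp
      rw [h5]
      ring
  have e6 := sum_antidiagonal_comm (fun i j => K i (n + j)) p
  have e7 := sum_antidiagonal_comm (fun i j => (1 / (j : ℂ)) • K i (n + j)) p
  simp only [k1, k2, smul_neg, neg_smul, neg_neg, ← Finset.smul_sum, Finset.sum_add_distrib,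
    Finset.sum_neg_distrib, Finset.sum_sub_distrib, ← e7, add_comm _ n] at *
  rw [Finset.sum_congr rfl h1, Finset.sum_congr rfl h2]
  simp only [Finset.sum_add_distrib, ← Finset.smul_sum, e1, e2, e3, e4, e5, e6, add_zero, sub_mul,
    add_mul, smul_mul_assoc]
  module

theorem laplacian_defect_psi_psi (h : KoszulOperators S ξ D D' T T' E E' Y)
    (hK : IsOrthonormal ξ) (n p : ℕ) (v w : L) (hn : n ≠ 0) (hp : p ≠ 0) :
    (D * D' + D' * D) (S.psi ξ n v * S.psi ξ p w) =
      (h.sumT + h.sumE - ∑ c, Y c * T c 0) (S.psi ξ n v * S.psi ξ p w) := by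
  have hp' : (p : ℂ) ≠ 0 := by exact_mod_cast hp
  have hn' : (n : ℂ) ≠ 0 := by exact_mod_cast hn
  have h1 := h.laplacian_defect_psi hK p w hp
  have h2 := h.laplacian_defect_psi hK n v hn
  rw [h.laplacian_psi, LinearMap.sub_apply, LinearMap.add_apply] at h1 h2
  rw [h.laplacian_psi_psi hK, LinearMap.sub_apply, LinearMap.add_apply,
    h.sumT_mul (N := n + p) (h.T_psi_of_lt (by omega) v) (h.T_psi_of_lt (by omega) w),
    h.sumE_psi_psi, h.sum_Y_T_mul, h.sum_T_psi_mul (by omega), h.sum_mul_T_psi (by omega),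
    h1, h2]
  simp only [h.T'_psi _ _ _ _ hp, h.T'_psi _ _ _ _ hn, h.Y_psi, h.T_zero_psi, mul_smul_comm,
    smul_mul_assoc, ← Finset.smul_sum]
  let Q : ℕ → ℕ → A := fun j k => ∑ a, S.psi ξ j ⁅ξ a, v⁆ * S.psi ξ k ⁅ξ a, w⁆
  have k1 : ∀ j k, ∑ a, S.psi ξ j ⁅ξ a, v⁆ * S.psi ξ k ⁅ξ a, w⁆ = Q j k := fun _ _ => rfl
  have e1 := sum_antidiagonal_add Q n p
  have e2 := sum_antidiagonal_ne_zero (fun i j => Q (n + i) j) p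
  have e3 := sum_antidiagonal_ne_zero (fun i j => Q j (p + i)) n
  have e4 := sum_antidiagonal_comm (fun i j => Q i (p + j)) n
  have h3 : ∀ q ∈ antidiagonal n, ((1 / (q.1 : ℂ)) * ((p + q.1 : ℕ) / (p : ℂ))) • Q q.2 (p + q.1) =
      ((1 / (q.1 : ℂ)) * (q.2 / (n : ℂ))) • Q q.2 (p + q.1) +
        (1 / (n : ℂ) + 1 / (p : ℂ)) • if q.1 = 0 then 0 else Q q.2 (p + q.1) := by
    rintro ⟨m, k⟩ hq
    rw [mem_antidiagonal] at hq
    dsimp only at hq ⊢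
    by_cases hm : m = 0
    · simp [hm]
    · have : (m : ℂ) ≠ 0 := by exact_mod_cast hm
      have h5 : (k : ℂ) = n - m := by rw [← hq]; push_cast; ring
      rw [if_neg hm, ← add_smul]
      congr 1
      push_cast
      rw [h5]
      field_simp
      ring
  have h4 : ∀ q ∈ antidiagonal p, ((1 / (q.1 : ℂ)) * ((n + q.1 : ℕ) / (n : ℂ))) • Q (n + q.1) q.2 =
      ((1 / (q.1 : ℂ)) * (q.2 / (p : ℂ))) • Q (n + q.1) q.2 +
        (1 / (n : ℂ) + 1 / (p : ℂ)) • if q.1 = 0 then 0 else Q (n + q.1) q.2 := by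
    rintro ⟨m, k⟩ hq
    rw [mem_antidiagonal] at hq
    dsimp only at hq ⊢
    by_cases hm : m = 0
    · simp [hm]
    · have : (m : ℂ) ≠ 0 := by exact_mod_cast hm
      have h5 : (k : ℂ) = p - m := by rw [← hq]; push_cast; ring
      rw [if_neg hm, ← add_smul]
      congr 1
      push_cast
      rw [h5]
      field_simp
      ring
  have h5 : (1 / (n : ℂ)) * ((p + n : ℕ) / (p : ℂ)) = 1 / (n : ℂ) + 1 / (p : ℂ) := by
    push_cast
    field_simp
  simp only [k1, add_comm _ p] at *
  rw [Finset.sum_congr rfl h3, Finset.sum_congr rfl h4, h5]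
  simp only [Finset.sum_add_distrib, ← Finset.smul_sum, e1, e2, e3, e4, add_zero, sub_mul,
    mul_sub, mul_add, add_mul]
  module

/-- The key identity: `□ = ∑ (1/m) T'T + ∑ E'E - ∑ Y T(0)`. All terms are differential operators
of order two, so it is enough to compare them on products of at most two generators. -/
theorem laplacian_eq (h : KoszulOperators S ξ D D' T T' E E' Y) (hK : IsOrthonormal ξ) :
    D * D' + D' * D = h.sumT + h.sumE - ∑ c, Y c * T c 0 := by
  have key : IsOrderTwo S (D * D' + D' * D +
      (-1 : ℂ) • (h.sumT + h.sumE + (-1 : ℂ) • ∑ c, Y c * T c 0)) := by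
    refine h.laplacian_order.add (IsOrderTwo.smul (.add (.add ?_ ?_) (.smul ?_ _)) _)
    · exact IsOrderTwo.locSum (fun m => IsOrderTwo.sum _ fun a =>
        IsOrderTwo.smul ((h.T'_der a m).isOrderTwo_mul (h.T_der a m)) _) _
    · exact IsOrderTwo.locSum (fun m => IsOrderTwo.sum _ fun a =>
        (h.E'_der a _).isOrderTwo_mul (h.E_der a _)) _
    · exact IsOrderTwo.sum _ fun a => (h.Y_der a).isOrderTwo_mul (h.T_der a 0)
  rw [neg_one_smul, neg_one_smul, ← sub_eq_add_neg, ← sub_eq_add_neg] at key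
  rw [← sub_eq_zero]
  refine key.eq_zero_vec (ξ := ξ) ?_ (fun n v => ?_) (fun n v hn => ?_) (fun n k v w => ?_)
    (fun n p v w hp => ?_) fun n p v w hn hp => ?_
  · have h1 : D 1 = 0 := h.D_der.map_one
    have hT : ∀ a m, T a m 1 = 0 := fun a m => (h.T_der a m).map_one
    have hE : ∀ a m, E a m 1 = 0 := fun a m => (h.E_der a m).map_one
    have h2 : h.sumT 1 = 0 := by
      rw [sumT, locSum_eq_sum_range h.T_fin (N := 0) (by simp [hT])]
      simp [hT]
    have h3 : h.sumE 1 = 0 := by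
      rw [sumE, locSum_eq_sum_range h.E_fin (N := 0) (by simp [hE])]
      simp [hE]
    simp [h1, h2, h3, h.D'_one, hT]
  · rw [LinearMap.sub_apply, sub_eq_zero, h.laplacian_defect_sig hK]
  · rw [LinearMap.sub_apply, sub_eq_zero, h.laplacian_defect_psi hK _ _ hn]
  · rw [LinearMap.sub_apply, sub_eq_zero, h.laplacian_defect_sig_sig hK]
  · rw [LinearMap.sub_apply, sub_eq_zero, h.laplacian_defect_sig_psi hK _ _ _ _ hp]
  · rw [LinearMap.sub_apply, sub_eq_zero, h.laplacian_defect_psi_psi hK _ _ _ _ hn hp]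

end KoszulOperators

end Laplacian

/-! ### The operators of the Koszul complex in terms of multiplications and contractions -/

section Even

variable {κ I A : Type} [Ring A] [Algebra ℂ A] {S : SuperGen κ I A}

/-- The elements that behave like linear combinations of even generators. -/
structure IsEven (S : SuperGen κ I A) (w : A) : Prop where
  mul : ∀ x, w * x = x * w
  parity : S.parity w = w

theorem OddDer.mulL_isEven {P : Module.End ℂ A} (hP : OddDer S P) {w : A} (hw : IsEven S w) :
    OddDer S (mulL w * P) where
  leibniz x y := by
    simp only [Module.End.mul_apply, LinearMap.mulLeft_apply, hP.leibniz, mul_add]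
    rw [← mul_assoc, ← mul_assoc, ← mul_assoc, hw.mul (S.parity x)]
  parity x := by
    simp only [Module.End.mul_apply, LinearMap.mulLeft_apply, hP.parity, map_mul, hw.parity,
      mul_neg]

theorem EvenDer.mulL_isEven {P : Module.End ℂ A} (hP : EvenDer S P) {w : A} (hw : IsEven S w) :
    EvenDer S (mulL w * P) where
  leibniz x y := by
    simp only [Module.End.mul_apply, LinearMap.mulLeft_apply, hP.leibniz, mul_add]
    rw [← mul_assoc, ← mul_assoc, ← mul_assoc, hw.mul x]
  parity x := by
    simp only [Module.End.mul_apply, LinearMap.mulLeft_apply, hP.parity, map_mul, hw.parity]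

/-- A family of operators whose vanishing on a product follows from that on the factors is locally
finite if it is so on generators. -/
theorem locallyFinite_of_gen {ι : Type} {P : ι → Module.End ℂ A}
    (one : ∀ i, P i 1 = 0) (mul : ∀ i x y, P i x = 0 → P i y = 0 → P i (x * y) = 0)
    (odd : ∀ k, {i | P i (S.odd k) ≠ 0}.Finite) (even : ∀ k, {i | P i (S.even k) ≠ 0}.Finite) :
    LocallyFinite P := by
  have key : ∀ x y, {i | P i x ≠ 0}.Finite → {i | P i y ≠ 0}.Finite →
      {i | P i (x * y) ≠ 0}.Finite := fun x y hx hy => by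
    refine (hx.union hy).subset fun i hi => ?_
    by_contra h
    simp only [Set.mem_union, Set.mem_ofPred_eq, not_or, not_not] at h
    exact hi (mul i x y h.1 h.2)
  intro x
  induction x using super_induction S with
  | one => simp [one]
  | add x y hx hy =>
    refine (hx.union hy).subset fun i hi => ?_
    by_contra h
    simp only [Set.mem_union, Set.mem_ofPred_eq, not_or, not_not] at h
    exact hi (by rw [map_add, h.1, h.2, add_zero])
  | smul c x hx =>
    refine hx.subset fun i hi h => hi ?_
    rw [map_smul, h, smul_zero]
  | odd k x hx => exact key _ _ (odd k) hx
  | even k x hx => exact key _ _ (even k) hx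

theorem EvenDer.locallyFinite {ι : Type} {P : ι → Module.End ℂ A} (hP : ∀ i, EvenDer S (P i))
    (odd : ∀ k, {i | P i (S.odd k) ≠ 0}.Finite) (even : ∀ k, {i | P i (S.even k) ≠ 0}.Finite) :
    LocallyFinite P :=
  locallyFinite_of_gen (fun i => (hP i).map_one)
    (fun i x y hx hy => by rw [(hP i).leibniz, hx, hy]; simp) odd even

theorem OddDer.locallyFinite {ι : Type} {P : ι → Module.End ℂ A} (hP : ∀ i, OddDer S (P i))
    (odd : ∀ k, {i | P i (S.odd k) ≠ 0}.Finite) (even : ∀ k, {i | P i (S.even k) ≠ 0}.Finite) :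
    LocallyFinite P :=
  locallyFinite_of_gen (fun i => (hP i).map_one)
    (fun i x y hx hy => by rw [(hP i).leibniz, hx, hy]; simp) odd even

end Even

section Bracket

variable {d : ℕ} {L : Type} [LieRing L] [LieAlgebra ℂ L] {A : Type} [Ring A] [Algebra ℂ A]

theorem SuperGen.isEven_sig {κ : Type} (S : SuperGen κ (Fin d × ℕ) A)
    (ξ : Module.Basis (Fin d) ℂ L) (n : ℕ) (v : L) : IsEven S (S.sig ξ n v) :=
  ⟨S.sig_mul ξ n v, S.parity_sig ξ n v⟩

theorem EvenDer.locallyFinite_vec {S : SuperGen (OddIndex d) (Fin d × ℕ) A}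
    (ξ : Module.Basis (Fin d) ℂ L) {ι : Type} {P : ι → Module.End ℂ A} (hP : ∀ i, EvenDer S (P i))
    (psi : ∀ n v, {i | P i (S.psi ξ n v) ≠ 0}.Finite)
    (sig : ∀ n v, {i | P i (S.sig ξ n v) ≠ 0}.Finite) : LocallyFinite P :=
  EvenDer.locallyFinite hP (fun k => by
      obtain ⟨⟨b, n⟩, rfl⟩ := toLex.surjective k
      rw [← S.psi_basis ξ]
      exact psi _ _) fun i => by
    rw [← S.sig_basis ξ]
    exact sig _ _

theorem OddDer.locallyFinite_vec {S : SuperGen (OddIndex d) (Fin d × ℕ) A}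
    (ξ : Module.Basis (Fin d) ℂ L) {ι : Type} {P : ι → Module.End ℂ A} (hP : ∀ i, OddDer S (P i))
    (psi : ∀ n v, {i | P i (S.psi ξ n v) ≠ 0}.Finite)
    (sig : ∀ n v, {i | P i (S.sig ξ n v) ≠ 0}.Finite) : LocallyFinite P :=
  OddDer.locallyFinite hP (fun k => by
      obtain ⟨⟨b, n⟩, rfl⟩ := toLex.surjective k
      rw [← S.psi_basis ξ]
      exact psi _ _) fun i => by
    rw [← S.sig_basis ξ]
    exact sig _ _

theorem LocallyFinite.shift {N : ℕ → Module.End ℂ A} (hN : LocallyFinite N) (m : ℕ) :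
    LocallyFinite fun k => N (k + m) := fun f =>
  Set.Finite.preimage (f := fun k : ℕ => k + m) (fun a _ b _ h => by simpa using h) (hN f)

theorem locallyFinite_bracket (ξ : Module.Basis (Fin d) ℂ L) (a : Fin d) (M : ℕ → L →ₗ[ℂ] A)
    {N : Fin d → ℕ → Module.End ℂ A} (hN : ∀ b, LocallyFinite (N b)) :
    LocallyFinite fun k => ∑ b, mulL (M k ⁅ξ a, ξ b⁆) * N b k :=
  LocallyFinite.sum _ fun b => (hN b).comp_left _

/-- The operator `∑_{k, b} M_k([ξ_a, ξ_b]) N_{b, k}`. -/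
def bracketOp (ξ : Module.Basis (Fin d) ℂ L) (a : Fin d) (M : ℕ → L →ₗ[ℂ] A)
    {N : Fin d → ℕ → Module.End ℂ A} (hN : ∀ b, LocallyFinite (N b)) : Module.End ℂ A :=
  locSum _ (locallyFinite_bracket ξ a M hN)

theorem bracketOp_apply (ξ : Module.Basis (Fin d) ℂ L) (a : Fin d) (M : ℕ → L →ₗ[ℂ] A)
    {N : Fin d → ℕ → Module.End ℂ A} (hN : ∀ b, LocallyFinite (N b)) {x : A} {n : ℕ} {c : ℂ}
    {v : L} (hx : ∀ b k, N b k x = if k = n then (c * ξ.repr v b) • (1 : A) else 0) :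
    bracketOp ξ a M hN x = c • M n ⁅ξ a, v⁆ := by
  rw [bracketOp, locSum_apply, finsum_eq_single _ n (fun k hk => by simp [hx, hk])]
  have h1 : M n ⁅ξ a, v⁆ = ∑ b, ξ.repr v b • M n ⁅ξ a, ξ b⁆ := by
    conv_lhs => rw [← ξ.sum_repr v]
    simp only [lie_sum, lie_smul, map_sum, map_smul]
  simp [hx, Finset.smul_sum, mul_smul, h1]

theorem bracketOp_apply_zero (ξ : Module.Basis (Fin d) ℂ L) (a : Fin d) (M : ℕ → L →ₗ[ℂ] A)
    {N : Fin d → ℕ → Module.End ℂ A} (hN : ∀ b, LocallyFinite (N b)) {x : A}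
    (hx : ∀ b k, N b k x = 0) : bracketOp ξ a M hN x = 0 := by
  simp [bracketOp, locSum_apply, hx]

theorem bracketOp_apply_shift (ξ : Module.Basis (Fin d) ℂ L) (a : Fin d) (M : ℕ → L →ₗ[ℂ] A)
    {N : Fin d → ℕ → Module.End ℂ A} (hN : ∀ b, LocallyFinite (N b)) (m : ℕ) {x : A} {n : ℕ}
    {c : ℂ} {v : L} (hx : ∀ b k, N b k x = if k = n then (c * ξ.repr v b) • (1 : A) else 0) :
    bracketOp ξ a M (fun b => (hN b).shift m) x =
      if m ≤ n then c • M (n - m) ⁅ξ a, v⁆ else 0 := by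
  split_ifs with h
  · refine bracketOp_apply ξ a M _ fun b k => ?_
    simp only [hx, show (k + m = n) = (k = n - m) by rw [eq_iff_iff]; omega]
  · refine bracketOp_apply_zero ξ a M _ fun b k => ?_
    rw [hx, if_neg (by omega)]

theorem bracketOp_evenDer {κ I : Type} {S : SuperGen κ I A} (ξ : Module.Basis (Fin d) ℂ L)
    (a : Fin d) (M : ℕ → L →ₗ[ℂ] A) {N : Fin d → ℕ → Module.End ℂ A}
    (hN : ∀ b, LocallyFinite (N b)) (h : ∀ k b, EvenDer S (mulL (M k ⁅ξ a, ξ b⁆) * N b k)) :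
    EvenDer S (bracketOp ξ a M hN) :=
  EvenDer.locSum (fun k => EvenDer.sum _ fun b _ => h k b) _

theorem bracketOp_oddDer {κ I : Type} {S : SuperGen κ I A} (ξ : Module.Basis (Fin d) ℂ L)
    (a : Fin d) (M : ℕ → L →ₗ[ℂ] A) {N : Fin d → ℕ → Module.End ℂ A}
    (hN : ∀ b, LocallyFinite (N b)) (h : ∀ k b, OddDer S (mulL (M k ⁅ξ a, ξ b⁆) * N b k)) :
    OddDer S (bracketOp ξ a M hN) :=
  OddDer.locSum (fun k => OddDer.sum _ fun b _ => h k b) _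

/-- The partial derivatives in the `σ^b(-n)`, and the contractions with the `ψ^b(-n)`, divided
by `n`. -/
structure DualOperators (S : SuperGen (OddIndex d) (Fin d × ℕ) A) (ξ : Module.Basis (Fin d) ℂ L)
    (ds dp : Fin d → ℕ → Module.End ℂ A) : Prop where
  ds_der : ∀ b n, EvenDer S (ds b n)
  dp_der : ∀ b n, OddDer S (dp b n)
  ds_sig : ∀ b k n v, ds b k (S.sig ξ n v) = if k = n then (1 * ξ.repr v b) • (1 : A) else 0
  ds_psi : ∀ b k n v, ds b k (S.psi ξ n v) = 0
  dp_sig : ∀ b k n v, dp b k (S.sig ξ n v) = 0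
  dp_psi : ∀ b k n v, dp b k (S.psi ξ n v) =
    if k = n then ((1 / (n : ℂ)) * ξ.repr v b) • (1 : A) else 0

variable {S : SuperGen (OddIndex d) (Fin d × ℕ) A} {ξ : Module.Basis (Fin d) ℂ L}
  {ds dp : Fin d → ℕ → Module.End ℂ A}

namespace DualOperators

theorem ds_fin (h : DualOperators S ξ ds dp) (b : Fin d) : LocallyFinite (ds b) :=
  EvenDer.locallyFinite_vec ξ (h.ds_der b) (fun n v => by simp [h.ds_psi]) fun n v =>
    (Set.finite_singleton n).subset fun k hk => by
      by_contra hne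
      exact hk (by rw [h.ds_sig, if_neg (show ¬k = n from hne)])

theorem dp_fin (h : DualOperators S ξ ds dp) (b : Fin d) : LocallyFinite (dp b) :=
  OddDer.locallyFinite_vec ξ (h.dp_der b) (fun n v =>
    (Set.finite_singleton n).subset fun k hk => by
      by_contra hne
      exact hk (by rw [h.dp_psi, if_neg (show ¬k = n from hne)])) fun n v => by simp [h.dp_sig]

/-- The even derivation `σ^v(-n) ↦ σ^{[a,v]}(m-n)`. -/
def sigLow (h : DualOperators S ξ ds dp) (a : Fin d) (m : ℕ) : Module.End ℂ A :=
  bracketOp ξ a (S.sig ξ) fun b => (h.ds_fin b).shift m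

/-- The even derivation `σ^v(-n) ↦ σ^{[a,v]}(-m-n)`. -/
def sigUp (h : DualOperators S ξ ds dp) (a : Fin d) (m : ℕ) : Module.End ℂ A :=
  bracketOp ξ a (fun k => S.sig ξ (k + m)) h.ds_fin

/-- The even derivation `ψ^v(-n) ↦ (w(n-m)/n) ψ^{[a,v]}(m-n)`. -/
def psiLow (h : DualOperators S ξ ds dp) (w : ℕ → ℂ) (a : Fin d) (m : ℕ) : Module.End ℂ A :=
  bracketOp ξ a (fun k => w k • S.psi ξ k) fun b => (h.dp_fin b).shift m

/-- The even derivation `ψ^v(-n) ↦ (w(n)/n) ψ^{[a,v]}(-m-n)`. -/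
def psiUp (h : DualOperators S ξ ds dp) (w : ℕ → ℂ) (a : Fin d) (m : ℕ) : Module.End ℂ A :=
  bracketOp ξ a (fun k => w k • S.psi ξ (k + m)) h.dp_fin

/-- The odd derivation `ψ^v(-n) ↦ (1/n) σ^{[a,v]}(m-n)`. -/
def opE (h : DualOperators S ξ ds dp) (a : Fin d) (m : ℕ) : Module.End ℂ A :=
  bracketOp ξ a (S.sig ξ) fun b => (h.dp_fin b).shift m

/-- The odd derivation `σ^v(-n) ↦ ψ^{[a,v]}(-m-n)`. -/
def opE' (h : DualOperators S ξ ds dp) (a : Fin d) (m : ℕ) : Module.End ℂ A :=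
  bracketOp ξ a (fun k => S.psi ξ (k + m)) h.ds_fin

theorem isOdd_smul {w : A} (hw : IsOdd S w) (c : ℂ) : IsOdd S (c • w) :=
  ⟨fun x => by rw [smul_mul_assoc, hw.mul, mul_smul_comm], by rw [map_smul, hw.parity, smul_neg]⟩

theorem sigLow_der (h : DualOperators S ξ ds dp) (a m) : EvenDer S (h.sigLow a m) :=
  bracketOp_evenDer ξ a _ _ fun _ b =>
    (h.ds_der b _).mulL_isEven (S.isEven_sig ξ _ _)

theorem sigUp_der (h : DualOperators S ξ ds dp) (a m) : EvenDer S (h.sigUp a m) :=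
  bracketOp_evenDer ξ a _ _ fun _ b =>
    (h.ds_der b _).mulL_isEven (S.isEven_sig ξ _ _)

theorem psiLow_der (h : DualOperators S ξ ds dp) (w a m) : EvenDer S (h.psiLow w a m) :=
  bracketOp_evenDer ξ a _ _ fun _ b =>
    (h.dp_der b _).mulL_odd (isOdd_smul (S.isOdd_psi ξ _ _) _)

theorem psiUp_der (h : DualOperators S ξ ds dp) (w a m) : EvenDer S (h.psiUp w a m) :=
  bracketOp_evenDer ξ a _ _ fun _ b =>
    (h.dp_der b _).mulL_odd (isOdd_smul (S.isOdd_psi ξ _ _) _)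

theorem opE_der (h : DualOperators S ξ ds dp) (a m) : OddDer S (h.opE a m) :=
  bracketOp_oddDer ξ a _ _ fun _ b =>
    (h.dp_der b _).mulL_isEven (S.isEven_sig ξ _ _)

theorem opE'_der (h : DualOperators S ξ ds dp) (a m) : OddDer S (h.opE' a m) :=
  bracketOp_oddDer ξ a _ _ fun _ b =>
    (h.ds_der b _).mulL_odd (S.isOdd_psi ξ _ _)

theorem sigLow_sig (h : DualOperators S ξ ds dp) (a m n v) :
    h.sigLow a m (S.sig ξ n v) = if m ≤ n then S.sig ξ (n - m) ⁅ξ a, v⁆ else 0 := by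
  rw [sigLow, bracketOp_apply_shift ξ a _ h.ds_fin m fun b k => h.ds_sig b k n v]
  simp

theorem sigLow_psi (h : DualOperators S ξ ds dp) (a m n v) : h.sigLow a m (S.psi ξ n v) = 0 :=
  bracketOp_apply_zero ξ a _ _ fun b _ => h.ds_psi b _ n v

theorem sigUp_sig (h : DualOperators S ξ ds dp) (a m n v) :
    h.sigUp a m (S.sig ξ n v) = S.sig ξ (n + m) ⁅ξ a, v⁆ := by
  rw [sigUp, bracketOp_apply ξ a _ h.ds_fin fun b k => h.ds_sig b k n v]
  simp

theorem sigUp_psi (h : DualOperators S ξ ds dp) (a m n v) : h.sigUp a m (S.psi ξ n v) = 0 :=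
  bracketOp_apply_zero ξ a _ _ fun b _ => h.ds_psi b _ n v

theorem psiLow_psi (h : DualOperators S ξ ds dp) (w a m n v) :
    h.psiLow w a m (S.psi ξ n v) =
      if m ≤ n then (w (n - m) / n) • S.psi ξ (n - m) ⁅ξ a, v⁆ else 0 := by
  rw [psiLow, bracketOp_apply_shift ξ a _ h.dp_fin m fun b k => h.dp_psi b k n v]
  simp only [LinearMap.smul_apply, smul_smul]
  rw [one_div_mul_eq_div]

theorem psiLow_sig (h : DualOperators S ξ ds dp) (w a m n v) : h.psiLow w a m (S.sig ξ n v) = 0 :=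
  bracketOp_apply_zero ξ a _ _ fun b k => h.dp_sig b _ n v

theorem psiUp_psi (h : DualOperators S ξ ds dp) (w a m n v) :
    h.psiUp w a m (S.psi ξ n v) = (w n / n) • S.psi ξ (n + m) ⁅ξ a, v⁆ := by
  rw [psiUp, bracketOp_apply ξ a _ h.dp_fin fun b k => h.dp_psi b k n v]
  simp only [LinearMap.smul_apply, smul_smul]
  rw [one_div_mul_eq_div]

theorem psiUp_sig (h : DualOperators S ξ ds dp) (w a m n v) : h.psiUp w a m (S.sig ξ n v) = 0 :=
  bracketOp_apply_zero ξ a _ _ fun b k => h.dp_sig b _ n v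

theorem opE_psi (h : DualOperators S ξ ds dp) (a m n v) :
    h.opE a m (S.psi ξ n v) = if m ≤ n then (1 / (n : ℂ)) • S.sig ξ (n - m) ⁅ξ a, v⁆ else 0 := by
  rw [opE, bracketOp_apply_shift ξ a _ h.dp_fin m fun b k => h.dp_psi b k n v]

theorem opE_sig (h : DualOperators S ξ ds dp) (a m n v) : h.opE a m (S.sig ξ n v) = 0 :=
  bracketOp_apply_zero ξ a _ _ fun b k => h.dp_sig b _ n v

theorem opE'_sig (h : DualOperators S ξ ds dp) (a m n v) :
    h.opE' a m (S.sig ξ n v) = S.psi ξ (n + m) ⁅ξ a, v⁆ := by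
  rw [opE', bracketOp_apply ξ a _ h.ds_fin fun b k => h.ds_sig b k n v]
  simp

theorem opE'_psi (h : DualOperators S ξ ds dp) (a m n v) : h.opE' a m (S.psi ξ n v) = 0 :=
  bracketOp_apply_zero ξ a _ _ fun b _ => h.ds_psi b _ n v

/-- The derivation by which `z^m ξ_a` acts. -/
def opT (h : DualOperators S ξ ds dp) (a : Fin d) (m : ℕ) : Module.End ℂ A :=
  h.sigLow a m + h.psiLow (fun k => k) a m

/-- The adjoint of `opT`. -/
def opT' (h : DualOperators S ξ ds dp) (a : Fin d) (m : ℕ) : Module.End ℂ A :=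
  h.sigUp a m + h.psiUp (fun k => k) a m

/-- The even derivation `R_a(m) + ½ ad_a(m)`. -/
def opA (h : DualOperators S ξ ds dp) (a : Fin d) (m : ℕ) : Module.End ℂ A :=
  h.sigLow a m + (1 / 2 : ℂ) • h.psiLow (fun k => (k + m : ℕ)) a m

/-- The even derivation `R_a(-m) + ½ ad_a(m)^*`. -/
def opA' (h : DualOperators S ξ ds dp) (a : Fin d) (m : ℕ) : Module.End ℂ A :=
  h.sigUp a m + (1 / 2 : ℂ) • h.psiUp (fun k => (k + m : ℕ)) a m

theorem opT_der (h : DualOperators S ξ ds dp) (a m) : EvenDer S (h.opT a m) :=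
  (h.sigLow_der a m).add (h.psiLow_der _ a m)

theorem opT'_der (h : DualOperators S ξ ds dp) (a m) : EvenDer S (h.opT' a m) :=
  (h.sigUp_der a m).add (h.psiUp_der _ a m)

theorem opA_der (h : DualOperators S ξ ds dp) (a m) : EvenDer S (h.opA a m) :=
  (h.sigLow_der a m).add ((h.psiLow_der _ a m).smul _)

theorem opA'_der (h : DualOperators S ξ ds dp) (a m) : EvenDer S (h.opA' a m) :=
  (h.sigUp_der a m).add ((h.psiUp_der _ a m).smul _)

theorem finite_of_le {P : ℕ → A} (n : ℕ) (h : ∀ m, n < m → P m = 0) : {m | P m ≠ 0}.Finite :=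
  (Set.finite_Iic n).subset fun m hm => by
    by_contra hlt
    exact hm (h m (not_le.1 hlt))

theorem opT_fin (h : DualOperators S ξ ds dp) (a) : LocallyFinite (h.opT a) :=
  EvenDer.locallyFinite_vec ξ (h.opT_der a)
    (fun n v => finite_of_le n fun m hm => by
      simp [opT, h.sigLow_psi, h.psiLow_psi, not_le.2 hm])
    fun n v => finite_of_le n fun m hm => by
      simp [opT, h.sigLow_sig, h.psiLow_sig, not_le.2 hm]

theorem opA_fin (h : DualOperators S ξ ds dp) (a) : LocallyFinite (h.opA a) :=
  EvenDer.locallyFinite_vec ξ (h.opA_der a)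
    (fun n v => finite_of_le n fun m hm => by
      simp [opA, h.sigLow_psi, h.psiLow_psi, not_le.2 hm])
    fun n v => finite_of_le n fun m hm => by
      simp [opA, h.sigLow_sig, h.psiLow_sig, not_le.2 hm]

theorem opE_fin (h : DualOperators S ξ ds dp) (a) : LocallyFinite (h.opE a) :=
  OddDer.locallyFinite_vec ξ (h.opE_der a)
    (fun n v => finite_of_le n fun m hm => by simp [h.opE_psi, not_le.2 hm])
    fun n v => by simp [h.opE_sig]

theorem opD_fin (h : DualOperators S ξ ds dp) :
    LocallyFinite fun m => ∑ a, mulL (S.psi ξ m (ξ a)) * h.opA a m :=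
  LocallyFinite.sum _ fun a => (h.opA_fin a).comp_left _

theorem opD'_fin (h : DualOperators S ξ ds dp) : LocallyFinite fun m => ∑ a, h.opA' a m * dp a m :=
  LocallyFinite.sum _ fun a => (h.dp_fin a).comp_left _

/-- The Koszul differential. -/
def opD (h : DualOperators S ξ ds dp) : Module.End ℂ A := locSum _ h.opD_fin

/-- The adjoint of the Koszul differential. -/
def opD' (h : DualOperators S ξ ds dp) : Module.End ℂ A := locSum _ h.opD'_fin

theorem opD_der (h : DualOperators S ξ ds dp) : OddDer S h.opD :=
  OddDer.locSum (fun _ => OddDer.sum _ fun a _ => (h.opA_der a _).mulL_odd (S.isOdd_psi ξ _ _)) _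

end DualOperators

end Bracket

section Bracket

open Finset.HasAntidiagonal (antidiagonal mem_antidiagonal)

variable {d : ℕ} {L : Type} [LieRing L] [LieAlgebra ℂ L] {A : Type} [Ring A] [Algebra ℂ A]
  {S : SuperGen (OddIndex d) (Fin d × ℕ) A} {ξ : Module.Basis (Fin d) ℂ L}
  {ds dp : Fin d → ℕ → Module.End ℂ A}

namespace DualOperators

theorem opD_sig (h : DualOperators S ξ ds dp) (n : ℕ) (v : L) : h.opD (S.sig ξ n v) =
    ∑ p ∈ antidiagonal n, ∑ a, S.psi ξ p.1 (ξ a) * S.sig ξ p.2 ⁅ξ a, v⁆ := by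
  rw [opD, locSum_eq_sum_range h.opD_fin (N := n) (fun m hm => by
    simp [opA, h.sigLow_sig, h.psiLow_sig, not_le.2 hm]),
    ← sum_range_ite (fun i j => ∑ a, S.psi ξ i (ξ a) * S.sig ξ j ⁅ξ a, v⁆) le_rfl]
  refine Finset.sum_congr rfl fun m _ => ?_
  simp only [LinearMap.sum_apply, Module.End.mul_apply, opA, LinearMap.add_apply,
    LinearMap.smul_apply, h.sigLow_sig, h.psiLow_sig, smul_zero, add_zero,
    LinearMap.mulLeft_apply]
  split_ifs <;> simp

theorem opD_psi (h : DualOperators S ξ ds dp) (n : ℕ) (v : L) : h.opD (S.psi ξ n v) =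
    (1 / 2 : ℂ) • ∑ p ∈ antidiagonal n, ∑ a, S.psi ξ p.1 (ξ a) * S.psi ξ p.2 ⁅ξ a, v⁆ := by
  rcases eq_or_ne n 0 with rfl | hn
  · simp [S.psi_zero]
  have hn' : (n : ℂ) ≠ 0 := by exact_mod_cast hn
  rw [opD, locSum_eq_sum_range h.opD_fin (N := n) (fun m hm => by
    simp [opA, h.sigLow_psi, h.psiLow_psi, not_le.2 hm]),
    ← sum_range_ite (fun i j => ∑ a, S.psi ξ i (ξ a) * S.psi ξ j ⁅ξ a, v⁆) le_rfl,
    Finset.smul_sum]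
  refine Finset.sum_congr rfl fun m _ => ?_
  simp only [LinearMap.sum_apply, Module.End.mul_apply, opA, LinearMap.add_apply,
    LinearMap.smul_apply, h.sigLow_psi, h.psiLow_psi, zero_add, LinearMap.mulLeft_apply]
  split_ifs with hm
  · rw [Nat.sub_add_cancel hm, div_self hn']
    simp [Finset.smul_sum]
  · simp

theorem opA'_psi (h : DualOperators S ξ ds dp) (a m n v) : h.opA' a m (S.psi ξ n v) =
    (1 / 2 * ((n + m : ℕ) / n : ℂ)) • S.psi ξ (n + m) ⁅ξ a, v⁆ := by
  simp [opA', h.sigUp_psi, h.psiUp_psi, smul_smul]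

/-- The even derivation `R_v(-n) + ad_v(n)^*`. -/
def opV (h : DualOperators S ξ ds dp) (n : ℕ) (v : L) : Module.End ℂ A :=
  ∑ a, ξ.repr v a • (h.sigUp a n + h.psiUp (fun k => (k + n : ℕ)) a n)

theorem opV_der (h : DualOperators S ξ ds dp) (n v) : EvenDer S (h.opV n v) :=
  EvenDer.sum _ fun a _ => ((h.sigUp_der a n).add (h.psiUp_der _ a n)).smul _

theorem sum_repr_lie (ξ : Module.Basis (Fin d) ℂ L) (φ : L →ₗ[ℂ] A) (v w : L) :
    ∑ a, ξ.repr v a • φ ⁅ξ a, w⁆ = φ ⁅v, w⁆ := by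
  conv_rhs => rw [← ξ.sum_repr v]
  simp only [sum_lie, smul_lie, map_sum, map_smul]

theorem opV_sig (h : DualOperators S ξ ds dp) (n v k w) :
    h.opV n v (S.sig ξ k w) = S.sig ξ (k + n) ⁅v, w⁆ := by
  simp [opV, h.sigUp_sig, h.psiUp_sig, sum_repr_lie ξ (S.sig ξ (k + n))]

theorem opV_psi (h : DualOperators S ξ ds dp) (n v k w) :
    h.opV n v (S.psi ξ k w) = (((k + n : ℕ) : ℂ) / k) • S.psi ξ (k + n) ⁅v, w⁆ := by
  simp only [opV, LinearMap.sum_apply, LinearMap.smul_apply, LinearMap.add_apply, h.sigUp_psi,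
    h.psiUp_psi, zero_add]
  rw [← sum_repr_lie ξ (S.psi ξ (k + n)), Finset.smul_sum]
  exact Finset.sum_congr rfl fun a _ => smul_comm _ _ _

/-- Since each `ψ*` is an odd derivation, `D'` anticommutes with multiplication by `ψ^v(-n)` up to a
derivation. -/
theorem opD'_psi_mul (h : DualOperators S ξ ds dp) (n : ℕ) (v : L) (x : A) :
    h.opD' (S.psi ξ n v * x) = -(S.psi ξ n v * h.opD' x) + (1 / (n : ℂ)) • h.opV n v x := by
  have hW : LocallyFinite fun m => ∑ a, mulL (h.opA' a m (S.psi ξ n v)) * dp a m :=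
    LocallyFinite.sum _ fun a => (h.dp_fin a).comp_left _
  -- the terms of `D'` in which the derivation falls on `ψ`
  have h1 : (1 / (n : ℂ)) • ∑ a, ξ.repr v a • h.opA' a n - locSum _ hW =
      (1 / (n : ℂ)) • h.opV n v := by
    refine EvenDer.ext_vec (S := S) (ξ := ξ) ?_ ((h.opV_der n v).smul _) (fun k w hk => ?_)
      fun k w => ?_
    · rw [sub_eq_add_neg, ← neg_one_smul ℂ]
      refine EvenDer.add (.smul (.sum _ fun a _ => (h.opA'_der a n).smul _) _) (.smul ?_ _)
      refine EvenDer.locSum (fun m => EvenDer.sum _ fun a _ => (h.dp_der a m).mulL_odd ?_) _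
      rw [h.opA'_psi]
      exact isOdd_smul (S.isOdd_psi ξ _ _) _
    · rw [LinearMap.sub_apply, locSum_apply, finsum_eq_single _ k (fun m hm => by
        simp [h.dp_psi, hm])]
      simp only [LinearMap.smul_apply, LinearMap.sum_apply, h.opV_psi, h.opA'_psi,
        Module.End.mul_apply, LinearMap.mulLeft_apply, h.dp_psi, if_true]
      have e1 := sum_repr_lie ξ (S.psi ξ (k + n)) v w
      have e2 := sum_repr_lie ξ (S.psi ξ (n + k)) w v
      have e3 : ∑ a, ξ.repr v a • (1 / 2 * ((k + n : ℕ) / k : ℂ)) • S.psi ξ (k + n) ⁅ξ a, w⁆ =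
          (1 / 2 * ((k + n : ℕ) / k : ℂ)) • S.psi ξ (k + n) ⁅v, w⁆ := by
        rw [← e1, Finset.smul_sum]
        exact Finset.sum_congr rfl fun a _ => smul_comm _ _ _
      have e4 : ∑ a, (1 / 2 * ((n + k : ℕ) / n : ℂ)) • S.psi ξ (n + k) ⁅ξ a, v⁆ *
          (1 / (k : ℂ) * ξ.repr w a) • (1 : A) =
          -(1 / 2 * ((n + k : ℕ) / n : ℂ) * (1 / k)) • S.psi ξ (k + n) ⁅v, w⁆ := by
        rw [← lie_skew v w, map_neg, neg_smul, smul_neg, neg_neg, add_comm k n, ← e2,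
          Finset.smul_sum]
        refine Finset.sum_congr rfl fun a _ => ?_
        rw [mul_smul_comm, mul_one, smul_smul, smul_smul]
        congr 1
        ring
      rw [e3, e4, add_comm n k, smul_smul, smul_smul, ← sub_smul]
      congr 1
      ring
    · rw [LinearMap.sub_apply, locSum_apply]
      simp [h.dp_sig, h.opV_sig, opA', h.sigUp_sig, h.psiUp_sig,
        sum_repr_lie ξ (S.sig ξ (k + n))]
  have h4 : S.psi ξ n v * h.opD' x =
      ∑ᶠ m, S.psi ξ n v * (∑ a, h.opA' a m * dp a m : Module.End ℂ A) x :=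
    map_finsum (LinearMap.mulLeft ℂ (S.psi ξ n v)) (h.opD'_fin x)
  rw [← LinearMap.smul_apply, ← h1, LinearMap.sub_apply, h4, opD', locSum_apply, locSum_apply]
  have h2 : ((1 / (n : ℂ)) • ∑ a, ξ.repr v a • h.opA' a n) x =
      ∑ᶠ m, if m = n then ((1 / (n : ℂ)) • ∑ a, ξ.repr v a • h.opA' a n) x else 0 := by
    rw [finsum_eq_single _ n (fun m hm => by simp [hm]), if_pos rfl]
  rw [h2, ← finsum_sub_distrib, ← finsum_neg_distrib, ← finsum_add_distrib]
  · refine finsum_congr fun m => ?_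
    have h3 : ∀ a, h.opA' a m (dp a m (S.psi ξ n v * x)) =
        -(S.psi ξ n v * h.opA' a m (dp a m x)) +
        ((if m = n then (1 / (n : ℂ)) • ξ.repr v a • h.opA' a n x else 0) -
          h.opA' a m (S.psi ξ n v) * dp a m x) := by
      intro a
      rw [(h.dp_der a m).leibniz, h.dp_psi, (S.isOdd_psi ξ n v).parity, neg_mul, map_add, map_neg,
        (h.opA'_der a m).leibniz (S.psi ξ n v)]
      split_ifs with hm
      · subst hm
        rw [smul_mul_assoc, one_mul, map_smul, mul_smul]
        abel
      · rw [zero_mul, map_zero]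
        abel
    simp only [LinearMap.sum_apply, Module.End.mul_apply, h3, Finset.sum_add_distrib,
      Finset.sum_sub_distrib, Finset.sum_neg_distrib, LinearMap.mulLeft_apply, Finset.mul_sum]
    congr 2
    split_ifs
    · simp [Finset.smul_sum]
    · simp
  · refine Set.Finite.subset (h.opD'_fin x) fun m hm h0 => hm ?_
    simp only [h0, mul_zero, neg_zero]
  · refine ((Set.finite_singleton n).union (hW x)).subset fun m hm => ?_
    by_contra hne
    simp only [Set.mem_union, Set.mem_singleton_iff, Set.mem_ofPred_eq, not_or, not_not] at hne
    exact hm (by simp only [if_neg hne.1, hne.2, sub_zero])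
  · refine (Set.finite_singleton n).subset fun m hm => ?_
    by_contra hne
    exact hm (if_neg hne)
  · exact hW x

theorem laplacian_order (h : DualOperators S ξ ds dp) :
    IsOrderTwo S (h.opD * h.opD' + h.opD' * h.opD) := by
  have hZ : LocallyFinite fun m => ∑ a, ((h.opD * h.opA' a m - h.opA' a m * h.opD) * dp a m +
      h.opA' a m * (h.opD * dp a m + dp a m * h.opD)) := by
    refine LocallyFinite.sum _ fun a => LocallyFinite.add ((h.dp_fin a).comp_left _)
      (LocallyFinite.comp_left (LocallyFinite.add ((h.dp_fin a).comp_left _) ?_) _)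
    exact fun x => h.dp_fin a (h.opD x)
  have h1 : h.opD * h.opD' + h.opD' * h.opD = locSum _ hZ := by
    ext x
    rw [LinearMap.add_apply, Module.End.mul_apply, Module.End.mul_apply, opD', locSum_apply,
      locSum_apply, locSum_apply, map_finsum _ (h.opD'_fin x), ← finsum_add_distrib]
    · refine finsum_congr fun m => ?_
      simp only [LinearMap.sum_apply, map_sum, ← Finset.sum_add_distrib, LinearMap.add_apply,
        LinearMap.sub_apply, Module.End.mul_apply, map_add]
      exact Finset.sum_congr rfl fun a _ => by abel
    · refine Set.Finite.subset (h.opD'_fin x) fun m hm h0 => hm ?_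
      simp only [h0, map_zero]
    · exact h.opD'_fin _
  rw [h1]
  refine IsOrderTwo.locSum (fun m => IsOrderTwo.sum _ fun a => IsOrderTwo.add ?_ ?_) _
  · have h2 := (h.opA'_der a m).comm_odd h.opD_der
    have h3 : h.opD * h.opA' a m - h.opA' a m * h.opD =
      (-1 : ℂ) • (h.opA' a m * h.opD - h.opD * h.opA' a m) := by
      rw [neg_one_smul, neg_sub]
    rw [h3]
    exact (h2.smul _).isOrderTwo_mul (h.dp_der a m)
  · exact (h.opA'_der a m).isOrderTwo_mul (h.opD_der.anticomm (h.dp_der a m))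

/-- The operators of the Koszul complex satisfy the assumptions of the formula for the Laplacian. -/
theorem koszulOperators (h : DualOperators S ξ ds dp) :
    KoszulOperators S ξ h.opD h.opD' h.opT h.opT' h.opE h.opE'
      (fun a => h.psiUp (fun _ => 1) a 0) where
  D_der := h.opD_der
  D_sig := h.opD_sig
  D_psi := h.opD_psi
  D'_one := by simp [opD', locSum_apply, (h.dp_der _ _).map_one]
  D'_sig n v := by simp [opD', locSum_apply, h.dp_sig]
  D'_sig_sig n k v w := by simp [opD', locSum_apply, h.dp_sig, (h.dp_der _ _).leibniz]
  D'_psi_mul n v := ⟨h.opV n v, h.opV_der n v, h.opV_sig n v, h.opV_psi n v, h.opD'_psi_mul n v⟩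
  laplacian_order := h.laplacian_order
  T_der := h.opT_der
  T_sig a m n v := by simp [opT, h.sigLow_sig, h.psiLow_sig]
  T_psi a m n v := by simp [opT, h.sigLow_psi, h.psiLow_psi]
  T'_der := h.opT'_der
  T'_sig a m n v := by simp [opT', h.sigUp_sig, h.psiUp_sig]
  T'_psi a m n v hn := by
    have hn' : (n : ℂ) ≠ 0 := by exact_mod_cast hn
    simp [opT', h.sigUp_psi, h.psiUp_psi, hn']
  E_der := h.opE_der
  E_sig := h.opE_sig
  E_psi := h.opE_psi
  E'_der := h.opE'_der
  E'_sig := h.opE'_sig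
  E'_psi := h.opE'_psi
  Y_der a := h.psiUp_der _ a 0
  Y_sig a n v := h.psiUp_sig _ a 0 n v
  Y_psi a n v := by simp [h.psiUp_psi]
  T_fin := by
    refine LocallyFinite.sum _ fun a => ?_
    simp only [← smul_mul_assoc]
    exact (h.opT_fin a).comp_left _
  E_fin := LocallyFinite.sum _ fun a => LocallyFinite.comp_left ((h.opE_fin a).shift 1) _

end DualOperators

end Bracket

/-! ### Adjoint operators and harmonic forms -/

section Adjoint

open Finset.HasAntidiagonal (antidiagonal mem_antidiagonal)

variable {d : ℕ} {L : Type} [LieRing L] [LieAlgebra ℂ L] {A : Type} [Ring A] [Algebra ℂ A]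

/-- A positive definite hermitian form. -/
structure IsHermitianForm (F : A → A → ℂ) : Prop where
  add_right : ∀ f g h, F f (g + h) = F f g + F f h
  smul_right : ∀ (c : ℂ) f g, F f (c • g) = c * F f g
  conj_symm : ∀ f g, starRingEnd ℂ (F f g) = F g f
  pos : ∀ f, f ≠ 0 → 0 < (F f f).re

/-- `Q` is the adjoint of `P`. -/
def IsAdjoint (F : A → A → ℂ) (P Q : Module.End ℂ A) : Prop := ∀ f g, F (P f) g = F f (Q g)

variable {F : A → A → ℂ}

namespace IsHermitianForm

theorem add_left (hF : IsHermitianForm F) (f g h : A) : F (f + g) h = F f h + F g h := by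
  rw [← hF.conj_symm, hF.add_right, map_add, hF.conj_symm, hF.conj_symm]

theorem smul_left (hF : IsHermitianForm F) (c : ℂ) (f g : A) :
    F (c • f) g = starRingEnd ℂ c * F f g := by
  rw [← hF.conj_symm, hF.smul_right, map_mul, hF.conj_symm]

/-- The form as a linear map in the second argument. -/
def right (hF : IsHermitianForm F) (f : A) : A →ₗ[ℂ] ℂ where
  toFun := F f
  map_add' := hF.add_right f
  map_smul' c g := hF.smul_right c f g

theorem zero_right (hF : IsHermitianForm F) (f : A) : F f 0 = 0 := map_zero (hF.right f)

theorem zero_left (hF : IsHermitianForm F) (f : A) : F 0 f = 0 := by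
  rw [← hF.conj_symm, hF.zero_right, map_zero]

theorem re_nonneg (hF : IsHermitianForm F) (f : A) : 0 ≤ (F f f).re := by
  rcases eq_or_ne f 0 with rfl | hf
  · rw [hF.zero_left]; simp
  · exact (hF.pos f hf).le

theorem eq_zero (hF : IsHermitianForm F) {f : A} (h : (F f f).re = 0) : f = 0 := by
  by_contra hf
  exact (hF.pos f hf).ne' h

theorem locSum_nonneg (hF : IsHermitianForm F) {ι : Type} {U : ι → Module.End ℂ A}
    (hU : LocallyFinite U) (f : A) (h : ∀ m, 0 ≤ (F f (U m f)).re) :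
    ∀ m, (F f (U m f)).re ≤ (F f (locSum U hU f)).re := by
  intro m
  have h1 : (F f (locSum U hU f)).re = ∑ᶠ m, (F f (U m f)).re :=
    map_finsum (Complex.reLm ∘ₗ (hF.right f).restrictScalars ℝ) (hU f)
  rw [h1]
  refine single_le_finsum m ((hU f).subset fun i hi h0 => hi ?_) h
  simp [h0, hF.zero_right]

end IsHermitianForm

namespace IsAdjoint

theorem zero (hF : IsHermitianForm F) : IsAdjoint F 0 0 := fun f g => by
  simp [hF.zero_left, hF.zero_right]

theorem add (hF : IsHermitianForm F) {P Q P' Q' : Module.End ℂ A} (h : IsAdjoint F P Q)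
    (h' : IsAdjoint F P' Q') : IsAdjoint F (P + P') (Q + Q') := fun f g => by
  simp only [LinearMap.add_apply, hF.add_left, hF.add_right, h f g, h' f g]

theorem smul (hF : IsHermitianForm F) {P Q : Module.End ℂ A} (h : IsAdjoint F P Q) (c : ℂ) :
    IsAdjoint F (c • P) (starRingEnd ℂ c • Q) := fun f g => by
  simp only [LinearMap.smul_apply, hF.smul_left, hF.smul_right, h f g]

theorem mul {P Q P' Q' : Module.End ℂ A} (h : IsAdjoint F P Q)
    (h' : IsAdjoint F P' Q') : IsAdjoint F (P * P') (Q' * Q) := fun f g => by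
  rw [Module.End.mul_apply, Module.End.mul_apply, h, h']

theorem symm (hF : IsHermitianForm F) {P Q : Module.End ℂ A} (h : IsAdjoint F P Q) :
    IsAdjoint F Q P := fun f g => by
  rw [← hF.conj_symm, ← h, hF.conj_symm]

theorem sum (hF : IsHermitianForm F) {ι : Type} (s : Finset ι) {P Q : ι → Module.End ℂ A}
    (h : ∀ i, IsAdjoint F (P i) (Q i)) : IsAdjoint F (∑ i ∈ s, P i) (∑ i ∈ s, Q i) := by
  classical
  induction s using Finset.induction_on with
  | empty => simpa using zero hF
  | insert a s ha ih =>
    rw [Finset.sum_insert ha, Finset.sum_insert ha]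
    exact add hF (h a) ih

theorem locSum (hF : IsHermitianForm F) {ι : Type} {P Q : ι → Module.End ℂ A}
    (h : ∀ i, IsAdjoint F (P i) (Q i)) (hP : LocallyFinite P) (hQ : LocallyFinite Q) :
    IsAdjoint F (HarmonicForms.locSum P hP) (HarmonicForms.locSum Q hQ) := fun f g => by
  have h1 : F f (HarmonicForms.locSum Q hQ g) = ∑ᶠ m, F f (Q m g) :=
    map_finsum (hF.right f) (hQ g)
  have h2 : F g (HarmonicForms.locSum P hP f) = ∑ᶠ m, F g (P m f) :=
    map_finsum (hF.right g) (hP f)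
  rw [h1, ← hF.conj_symm, h2]
  have hfin : (Function.support fun m => F g (P m f)).Finite :=
    (hP f).subset fun m hm h0 => hm (by simp [h0, hF.zero_right])
  rw [show starRingEnd ℂ (∑ᶠ m, F g (P m f)) = ∑ᶠ m, starRingEnd ℂ (F g (P m f)) from
    (starRingEnd ℂ).toAddMonoidHom.map_finsum hfin]
  refine finsum_congr fun m => ?_
  rw [hF.conj_symm, h m]

end IsAdjoint

/-- The structure constants are imaginary. -/
def IsImaginary (ξ : Module.Basis (Fin d) ℂ L) : Prop :=
  ∀ a b e, starRingEnd ℂ (ξ.repr ⁅ξ a, ξ b⁆ e) = -ξ.repr ⁅ξ a, ξ b⁆ e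

theorem bracketOp_isAdjoint (hF : IsHermitianForm F) {ξ : Module.Basis (Fin d) ℂ L}
    (hK : IsOrthonormal ξ) (hI : IsImaginary ξ) (a : Fin d) (M M' : ℕ → L →ₗ[ℂ] A)
    {N N' : Fin d → ℕ → Module.End ℂ A} (hN : ∀ b, LocallyFinite (N b))
    (hN' : ∀ b, LocallyFinite (N' b))
    (h : ∀ b e k, IsAdjoint F (mulL (M k (ξ e)) * N b k) (mulL (M' k (ξ b)) * N' e k)) :
    IsAdjoint F (bracketOp ξ a M hN) (bracketOp ξ a M' hN') := by
  refine IsAdjoint.locSum hF (fun k => ?_) _ _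
  have h1 : ∀ (φ : L →ₗ[ℂ] A) b, mulL (φ ⁅ξ a, ξ b⁆) =
      ∑ e, ξ.repr ⁅ξ a, ξ b⁆ e • mulL (φ (ξ e)) := fun φ b => by
    have h2 : φ ⁅ξ a, ξ b⁆ = ∑ e, ξ.repr ⁅ξ a, ξ b⁆ e • φ (ξ e) := by
      conv_lhs => rw [← ξ.sum_repr ⁅ξ a, ξ b⁆]
      simp only [map_sum, map_smul]
    ext x
    simp [Finset.sum_mul, h2]
  have h2 : ∑ b, mulL (M' k ⁅ξ a, ξ b⁆) * N' b k =
      ∑ b, ∑ e, starRingEnd ℂ (ξ.repr ⁅ξ a, ξ b⁆ e) • (mulL (M' k (ξ b)) * N' e k) := by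
    simp only [h1, Finset.sum_mul]
    rw [Finset.sum_comm]
    refine Finset.sum_congr rfl fun b _ => Finset.sum_congr rfl fun e _ => ?_
    rw [hI, hK.repr_lie_swap, smul_mul_assoc]
  rw [h2]
  simp only [h1, Finset.sum_mul, smul_mul_assoc]
  exact IsAdjoint.sum hF _ fun b => IsAdjoint.sum hF _ fun e => (h b e k).smul hF _

variable {S : SuperGen (OddIndex d) (Fin d × ℕ) A} {ξ : Module.Basis (Fin d) ℂ L}
  {ds dp : Fin d → ℕ → Module.End ℂ A}

/-- Contractions with generators are adjoint to the multiplications by them. -/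
structure IsSuperMetric (S : SuperGen (OddIndex d) (Fin d × ℕ) A) (ξ : Module.Basis (Fin d) ℂ L)
    (ds dp : Fin d → ℕ → Module.End ℂ A) (F : A → A → ℂ) : Prop extends IsHermitianForm F where
  adj_sig : ∀ b n, IsAdjoint F (mulL (S.sig ξ n (ξ b))) (ds b n)
  adj_psi : ∀ b n, IsAdjoint F (mulL (S.psi ξ n (ξ b))) (dp b n)

namespace DualOperators

theorem sigLow_adjoint (h : DualOperators S ξ ds dp) (hF : IsSuperMetric S ξ ds dp F)
    (hK : IsOrthonormal ξ) (hI : IsImaginary ξ) (a m) :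
    IsAdjoint F (h.sigLow a m) (h.sigUp a m) :=
  bracketOp_isAdjoint hF.toIsHermitianForm hK hI a _ _ _ _ fun b e k =>
    (hF.adj_sig e k).mul ((hF.adj_sig b (k + m)).symm hF.toIsHermitianForm)

theorem psiLow_adjoint (h : DualOperators S ξ ds dp) (hF : IsSuperMetric S ξ ds dp F)
    (hK : IsOrthonormal ξ) (hI : IsImaginary ξ) {w : ℕ → ℂ} (hw : ∀ k, starRingEnd ℂ (w k) = w k)
    (a m) : IsAdjoint F (h.psiLow w a m) (h.psiUp w a m) := by
  refine bracketOp_isAdjoint hF.toIsHermitianForm hK hI a _ _ _ _ fun b e k => ?_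
  have h1 : ∀ (u : A), mulL (w k • u) = w k • mulL u := fun u => by
    ext x
    simp
  simp only [LinearMap.smul_apply, h1, smul_mul_assoc]
  have h2 := ((hF.adj_psi e k).mul
    ((hF.adj_psi b (k + m)).symm hF.toIsHermitianForm)).smul hF.toIsHermitianForm (w k)
  rwa [hw] at h2

theorem opE_adjoint (h : DualOperators S ξ ds dp) (hF : IsSuperMetric S ξ ds dp F)
    (hK : IsOrthonormal ξ) (hI : IsImaginary ξ) (a m) :
    IsAdjoint F (h.opE a m) (h.opE' a m) :=
  bracketOp_isAdjoint hF.toIsHermitianForm hK hI a _ _ _ _ fun b e k =>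
    (hF.adj_sig e k).mul ((hF.adj_psi b (k + m)).symm hF.toIsHermitianForm)

theorem opT_adjoint (h : DualOperators S ξ ds dp) (hF : IsSuperMetric S ξ ds dp F)
    (hK : IsOrthonormal ξ) (hI : IsImaginary ξ) (a m) :
    IsAdjoint F (h.opT a m) (h.opT' a m) :=
  (h.sigLow_adjoint hF hK hI a m).add hF.toIsHermitianForm
    (h.psiLow_adjoint hF hK hI (fun k => by simp) a m)

theorem opA_adjoint (h : DualOperators S ξ ds dp) (hF : IsSuperMetric S ξ ds dp F)
    (hK : IsOrthonormal ξ) (hI : IsImaginary ξ) (a m) :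
    IsAdjoint F (h.opA a m) (h.opA' a m) := by
  have h2 := (h.psiLow_adjoint hF hK hI (w := fun k => (k + m : ℕ)) (fun k => by simp) a m).smul
    hF.toIsHermitianForm (1 / 2)
  rw [show starRingEnd ℂ (1 / 2) = 1 / 2 by simp [map_ofNat]] at h2
  exact (h.sigLow_adjoint hF hK hI a m).add hF.toIsHermitianForm h2

theorem opD_adjoint (h : DualOperators S ξ ds dp) (hF : IsSuperMetric S ξ ds dp F)
    (hK : IsOrthonormal ξ) (hI : IsImaginary ξ) : IsAdjoint F h.opD h.opD' :=
  IsAdjoint.locSum hF.toIsHermitianForm (fun m => IsAdjoint.sum hF.toIsHermitianForm _ fun a =>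
    (hF.adj_psi a m).mul (h.opA_adjoint hF hK hI a m)) _ _

theorem opT'_zero (h : DualOperators S ξ ds dp) (a : Fin d) : h.opT' a 0 = h.opT a 0 :=
  EvenDer.ext_vec (ξ := ξ) (h.opT'_der a 0) (h.opT_der a 0)
    (fun n v _ => by simp [opT, opT', h.sigUp_psi, h.sigLow_psi, h.psiUp_psi, h.psiLow_psi])
    fun n v => by simp [opT, opT', h.sigUp_sig, h.sigLow_sig, h.psiUp_sig, h.psiLow_sig]

/-- The differential is invariant. -/
theorem opT_opD (h : DualOperators S ξ ds dp) (hK : IsOrthonormal ξ) (a : Fin d) :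
    h.opT a 0 * h.opD = h.opD * h.opT a 0 := by
  have hsig : ∀ n v, h.opT a 0 (S.sig ξ n v) = S.sig ξ n ⁅ξ a, v⁆ := fun n v => by
    simp [h.koszulOperators.T_sig]
  have hpsi : ∀ n v, h.opT a 0 (S.psi ξ n v) = S.psi ξ n ⁅ξ a, v⁆ := fun n v =>
    h.koszulOperators.T_zero_psi a n v
  rw [← sub_eq_zero]
  refine OddDer.ext_vec (ξ := ξ) ((h.opT_der a 0).comm_odd h.opD_der) OddDer.zero
    (fun n v _ => ?_) fun n v => ?_
  · rw [LinearMap.sub_apply, Module.End.mul_apply, Module.End.mul_apply, hpsi, h.opD_psi,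
      h.opD_psi, LinearMap.zero_apply, sub_eq_zero, map_smul, map_sum]
    congr 1
    refine Finset.sum_congr rfl fun p _ => ?_
    simp only [map_sum, (h.opT_der a 0).leibniz, hpsi, Finset.sum_add_distrib]
    have h1 := hK.sum_lie_mul (S.psi ξ p.1)
      ((S.psi ξ p.2) ∘ₗ (-(LieAlgebra.ad ℂ L v) : L →ₗ[ℂ] L)) (ξ a)
    simp only [LinearMap.comp_apply, LinearMap.neg_apply, LieAlgebra.ad_apply, lie_skew] at h1
    rw [h1, ← sub_eq_zero, neg_add_eq_sub, ← Finset.sum_sub_distrib, ← Finset.sum_sub_distrib]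
    refine Finset.sum_eq_zero fun b _ => ?_
    rw [leibniz_lie (ξ a), map_add, mul_add]
    abel
  · rw [LinearMap.sub_apply, Module.End.mul_apply, Module.End.mul_apply, hsig, h.opD_sig,
      h.opD_sig, LinearMap.zero_apply, sub_eq_zero, map_sum]
    refine Finset.sum_congr rfl fun p _ => ?_
    simp only [map_sum, (h.opT_der a 0).leibniz, hpsi, hsig, Finset.sum_add_distrib]
    have h1 := hK.sum_lie_mul (S.psi ξ p.1)
      ((S.sig ξ p.2) ∘ₗ (-(LieAlgebra.ad ℂ L v) : L →ₗ[ℂ] L)) (ξ a)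
    simp only [LinearMap.comp_apply, LinearMap.neg_apply, LieAlgebra.ad_apply, lie_skew] at h1
    rw [h1, ← sub_eq_zero, neg_add_eq_sub, ← Finset.sum_sub_distrib, ← Finset.sum_sub_distrib]
    refine Finset.sum_eq_zero fun b _ => ?_
    rw [leibniz_lie (ξ a), map_add, mul_add]
    abel

/-- The adjoint of the differential is invariant. -/
theorem opT_opD' (h : DualOperators S ξ ds dp) (hF : IsSuperMetric S ξ ds dp F)
    (hK : IsOrthonormal ξ) (hI : IsImaginary ξ) (a : Fin d) :
    h.opT a 0 * h.opD' = h.opD' * h.opT a 0 := by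
  have hT := h.opT_adjoint hF hK hI a 0
  rw [h.opT'_zero] at hT
  have hD := h.opD_adjoint hF hK hI
  have h1 : IsAdjoint F (h.opD * h.opT a 0) (h.opT a 0 * h.opD') := hD.mul hT
  have h2 : IsAdjoint F (h.opT a 0 * h.opD) (h.opD' * h.opT a 0) := hT.mul hD
  rw [h.opT_opD hK] at h2
  rw [← sub_eq_zero]
  ext g
  refine hF.eq_zero ?_
  have h3 : ∀ f, F f ((h.opT a 0 * h.opD' - h.opD' * h.opT a 0) g) = 0 := fun f => by
    rw [LinearMap.sub_apply, sub_eq_add_neg, ← neg_one_smul ℂ, hF.add_right, hF.smul_right,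
      ← h1, ← h2]
    ring
  rw [LinearMap.sub_apply] at h3 ⊢
  rw [h3]
  rfl

/-- An invariant form is harmonic if and only if all the `z^m ξ_a` and `s z^m ξ_a` kill it: by the
formula for the Laplacian, `⟨f, □ f⟩` is the sum of the square norms of the images. -/
theorem harmonic_iff (h : DualOperators S ξ ds dp) (hF : IsSuperMetric S ξ ds dp F)
    (hK : IsOrthonormal ξ) (hI : IsImaginary ξ) {f : A} (hf : ∀ a, h.opT a 0 f = 0) :
    h.opD f = 0 ∧ (h.opD * h.opD' + h.opD' * h.opD) f = 0 ↔
      (∀ a m, h.opT a m f = 0) ∧ ∀ a m, h.opE a (m + 1) f = 0 := by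
  have hH := hF.toIsHermitianForm
  have hKO := h.koszulOperators
  have key : (h.opD * h.opD' + h.opD' * h.opD) f = hKO.sumT f + hKO.sumE f := by
    rw [hKO.laplacian_eq hK]
    simp [hf]
  constructor
  · rintro ⟨-, h0⟩
    have hT : ∀ a m, F f (h.opT' a m (h.opT a m f)) = F (h.opT a m f) (h.opT a m f) := fun a m =>
      (h.opT_adjoint hF hK hI a m f _).symm
    have hE : ∀ a m, F f (h.opE' a m (h.opE a m f)) = F (h.opE a m f) (h.opE a m f) := fun a m =>
      (h.opE_adjoint hF hK hI a m f _).symm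
    -- `⟨f, T'T f⟩ = ⟨T f, T f⟩`, and likewise for `E`.
    have hT1 : ∀ m, F f ((∑ a, (1 / ((m : ℕ) : ℂ)) • (h.opT' a m * h.opT a m)) f) =
        ∑ a, (1 / (m : ℂ)) * F (h.opT a m f) (h.opT a m f) := fun m => by
      rw [LinearMap.sum_apply]
      refine (map_sum (hH.right f) _ _).trans (Finset.sum_congr rfl fun a _ => ?_)
      rw [← hT]
      exact hH.smul_right _ _ _
    have hE1 : ∀ m, F f ((∑ a, h.opE' a (m + 1) * h.opE a (m + 1)) f) =
        ∑ a, F (h.opE a (m + 1) f) (h.opE a (m + 1) f) := fun m => by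
      rw [LinearMap.sum_apply]
      refine (map_sum (hH.right f) _ _).trans (Finset.sum_congr rfl fun a _ => ?_)
      rw [← hE]
      rfl
    have hre : ∀ (m : ℕ) (z : ℂ), ((1 / (m : ℂ)) * z).re = (1 / (m : ℝ)) * z.re := fun m z => by
      rw [← Complex.re_ofReal_mul]
      simp
    have hT2 : ∀ m a, 0 ≤ ((1 / ((m : ℕ) : ℂ)) * F (h.opT a m f) (h.opT a m f)).re := fun m a => by
      rw [hre]
      exact mul_nonneg (by positivity) (hH.re_nonneg _)
    have hT3 : ∀ m, 0 ≤ (F f ((∑ a, (1 / ((m : ℕ) : ℂ)) • (h.opT' a m * h.opT a m)) f)).re :=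
      fun m => by
        rw [hT1, Complex.re_sum]
        exact Finset.sum_nonneg fun a _ => hT2 m a
    have hE3 : ∀ m, 0 ≤ (F f ((∑ a, h.opE' a (m + 1) * h.opE a (m + 1)) f)).re := fun m => by
      rw [hE1, Complex.re_sum]
      exact Finset.sum_nonneg fun a _ => hH.re_nonneg _
    have hT4 := hH.locSum_nonneg hKO.T_fin f hT3
    have hE4 := hH.locSum_nonneg hKO.E_fin f hE3
    -- A sum of nonnegative terms vanishes, so each term does.
    have hsum : (F f (hKO.sumT f)).re + (F f (hKO.sumE f)).re = 0 := by
      rw [← Complex.add_re, ← hF.add_right, ← key, h0, hH.zero_right]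
      rfl
    have hT0 := (hT3 0).trans (hT4 0)
    have hE0 := (hE3 0).trans (hE4 0)
    have hTs : (F f (hKO.sumT f)).re = 0 := by
      unfold KoszulOperators.sumT KoszulOperators.sumE at *
      linarith
    have hEs : (F f (hKO.sumE f)).re = 0 := by linarith
    constructor
    · intro a m
      rcases Nat.eq_zero_or_pos m with rfl | hm
      · exact hf a
      have h1 := le_antisymm ((hT4 m).trans hTs.le) (hT3 m)
      rw [hT1, Complex.re_sum, Finset.sum_eq_zero_iff_of_nonneg fun a _ => hT2 m a] at h1
      have h2 := h1 a (Finset.mem_univ a)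
      rw [hre] at h2
      have hm' : (1 / (m : ℝ)) ≠ 0 := by positivity
      exact hH.eq_zero ((mul_eq_zero.1 h2).resolve_left hm')
    · intro a m
      have h1 := le_antisymm ((hE4 m).trans hEs.le) (hE3 m)
      rw [hE1, Complex.re_sum, Finset.sum_eq_zero_iff_of_nonneg fun a _ => hH.re_nonneg _] at h1
      exact hH.eq_zero (h1 a (Finset.mem_univ a))
  · rintro ⟨hT, hE⟩
    have h0 : (h.opD * h.opD' + h.opD' * h.opD) f = 0 := by
      rw [key]
      simp [KoszulOperators.sumT, KoszulOperators.sumE, locSum_apply, hT, hE]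
    -- From `⟨f, □ f⟩ = ‖D'f‖² + ‖D f‖²`, the form is closed.
    refine ⟨hH.eq_zero ?_, h0⟩
    have hD := h.opD_adjoint hF hK hI
    have h1 : F f ((h.opD * h.opD' + h.opD' * h.opD) f) =
        F (h.opD' f) (h.opD' f) + F (h.opD f) (h.opD f) := by
      rw [LinearMap.add_apply, hF.add_right, Module.End.mul_apply, Module.End.mul_apply, ← hD,
        hD.symm hH]
    rw [h0, hH.zero_right] at h1
    have h2 := congrArg Complex.re h1
    rw [Complex.add_re, Complex.zero_re] at h2
    have := hH.re_nonneg (h.opD' f)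
    have := hH.re_nonneg (h.opD f)
    linarith

end DualOperators

end Adjoint

/-! ### The free supercommutative algebra -/

section Free

variable {κ I : Type}

/-- The free supercommutative algebra with odd generators indexed by `κ` and even generators
indexed by `I`. Both `ExtSym d` and `SuperPoly d` have this form. -/
abbrev FreeSuper (κ I : Type) : Type := ExteriorAlgebra ℂ (κ →₀ ℂ) ⊗[ℂ] MvPolynomial I ℂ

/-- The linear odd element of `FreeSuper κ I` given by a vector. -/
def oddLin (v : κ →₀ ℂ) : FreeSuper κ I := ExteriorAlgebra.ι ℂ v ⊗ₜ 1

/-- The parity automorphism: `1` on even elements, `-1` on odd ones. -/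
def parity (κ I : Type) : FreeSuper κ I →ₐ[ℂ] FreeSuper κ I :=
  Algebra.TensorProduct.map (CliffordAlgebra.involute (Q := (0 : QuadraticForm ℂ (κ →₀ ℂ))))
    (AlgHom.id ℂ (MvPolynomial I ℂ))

theorem parity_tmul (x : ExteriorAlgebra ℂ (κ →₀ ℂ)) (p : MvPolynomial I ℂ) :
    parity κ I (x ⊗ₜ p) = CliffordAlgebra.involute x ⊗ₜ p := rfl

theorem involute_ι (v : κ →₀ ℂ) :
    CliffordAlgebra.involute (ExteriorAlgebra.ι ℂ v) = -ExteriorAlgebra.ι ℂ v :=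
  CliffordAlgebra.involute_ι v

theorem parity_oddLin (v : κ →₀ ℂ) : parity κ I (oddLin v) = -oddLin v := by
  rw [oddLin, parity_tmul, involute_ι, TensorProduct.neg_tmul]

theorem oddLin_add (v w : κ →₀ ℂ) : (oddLin (v + w) : FreeSuper κ I) = oddLin v + oddLin w := by
  simp [oddLin, TensorProduct.add_tmul]

theorem oddLin_smul (c : ℂ) (v : κ →₀ ℂ) :
    (oddLin (c • v) : FreeSuper κ I) = c • oddLin v := by
  simp [oddLin, TensorProduct.smul_tmul']

/-- The free supercommutative algebra is spanned by the products of generators. -/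
theorem freeSuper_induction {p : FreeSuper κ I → Prop} (one : p 1)
    (add : ∀ x y, p x → p y → p (x + y)) (smul : ∀ (c : ℂ) x, p x → p (c • x))
    (odd : ∀ k x, p x → p (oddLin (Finsupp.single k 1) * x))
    (even : ∀ i x, p x → p ((1 ⊗ₜ MvPolynomial.X i) * x)) (x : FreeSuper κ I) : p x := by
  have zero : p 0 := by simpa using smul 0 1 one
  have h1 : ∀ q : MvPolynomial I ℂ, p (1 ⊗ₜ q) := by
    intro q
    induction q using MvPolynomial.induction_on with
    | C r =>
      have := smul r 1 one
      rwa [Algebra.TensorProduct.one_def, ← TensorProduct.tmul_smul, MvPolynomial.smul_eq_C_mul,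
        mul_one] at this
    | add q r hq hr => rw [TensorProduct.tmul_add]; exact add _ _ hq hr
    | mul_X q i hq =>
      have := even i _ hq
      rwa [Algebra.TensorProduct.tmul_mul_tmul, one_mul, mul_comm] at this
  have h2 : ∀ (v : κ →₀ ℂ) (y : FreeSuper κ I), p y → p (oddLin v * y) := by
    intro v y hy
    induction v using Finsupp.induction_linear with
    | zero => simpa [oddLin] using zero
    | add v w hv hw => rw [oddLin_add, add_mul]; exact add _ _ hv hw
    | single k c =>
      have := smul c _ (odd k _ hy)
      rwa [← smul_mul_assoc, ← oddLin_smul, Finsupp.smul_single, smul_eq_mul, mul_one]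
        at this
  have h3 : ∀ (u : ExteriorAlgebra ℂ (κ →₀ ℂ)) (q : MvPolynomial I ℂ), p (u ⊗ₜ q) := by
    intro u q
    induction u using CliffordAlgebra.left_induction with
    | algebraMap r =>
      have := smul r _ (h1 q)
      rwa [TensorProduct.smul_tmul', ← Algebra.algebraMap_eq_smul_one] at this
    | add x y hx hy => rw [TensorProduct.add_tmul]; exact add _ _ hx hy
    | ι_mul x v hx =>
      have := h2 v _ hx
      rwa [oddLin, Algebra.TensorProduct.tmul_mul_tmul, one_mul] at this
  induction x using TensorProduct.induction_on with
  | zero => exact zero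
  | tmul u q => exact h3 u q
  | add x y hx hy => exact add _ _ hx hy

theorem one_tmul_mul (q : MvPolynomial I ℂ) (x : FreeSuper κ I) :
    (1 ⊗ₜ q) * x = x * (1 ⊗ₜ q) := by
  induction x using TensorProduct.induction_on with
  | zero => simp
  | tmul u q => simp [mul_comm]
  | add x y hx hy => rw [mul_add, add_mul, hx, hy]

theorem ι_mul_eq_involute_mul (v : κ →₀ ℂ) (u : ExteriorAlgebra ℂ (κ →₀ ℂ)) :
    ExteriorAlgebra.ι ℂ v * u = CliffordAlgebra.involute u * ExteriorAlgebra.ι ℂ v := by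
  induction u using CliffordAlgebra.left_induction with
  | algebraMap r => rw [AlgHom.commutes]; exact (Algebra.commutes r _).symm
  | add x y hx hy => rw [mul_add, hx, hy, map_add, add_mul]
  | ι_mul x w hx =>
    have h := ExteriorAlgebra.ι_add_mul_swap (R := ℂ) v w
    rw [map_mul, CliffordAlgebra.involute_ι, mul_assoc, ← hx, ← mul_assoc,
      eq_neg_of_add_eq_zero_left h, ← mul_assoc, neg_mul, neg_mul, neg_mul]

theorem oddLin_mul (v : κ →₀ ℂ) (x : FreeSuper κ I) : oddLin v * x = parity κ I x * oddLin v := by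
  induction x using TensorProduct.induction_on with
  | zero => simp
  | tmul u q => simp [oddLin, ι_mul_eq_involute_mul, parity_tmul]
  | add x y hx hy => rw [mul_add, map_add, add_mul, hx, hy]

/-- The generators of the free supercommutative algebra. -/
def freeSuper (κ I : Type) : SuperGen κ I (FreeSuper κ I) where
  odd k := oddLin (Finsupp.single k 1)
  even i := 1 ⊗ₜ MvPolynomial.X i
  parity := parity κ I
  parity_odd k := parity_oddLin _
  parity_even i := by rw [parity_tmul, map_one]
  even_mul i x := one_tmul_mul _ x
  odd_mul k x := oddLin_mul _ x
  induction := freeSuper_induction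

/-- A derivation of the symmetric factor extends to an even derivation. -/
theorem evenDer_map_derivation (D : Derivation ℂ (MvPolynomial I ℂ) (MvPolynomial I ℂ)) :
    EvenDer (freeSuper κ I) (TensorProduct.map LinearMap.id D.toLinearMap) where
  leibniz x y := by
    induction x using TensorProduct.induction_on with
    | zero => simp
    | add x x' hx hx' => simp only [add_mul, map_add, hx, hx']; abel
    | tmul u q =>
      induction y using TensorProduct.induction_on with
      | zero => simp
      | add y y' hy hy' => simp only [mul_add, map_add, hy, hy']; abel
      | tmul w r =>
        simp [TensorProduct.tmul_add, mul_comm, add_comm]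
  parity x := by
    induction x using TensorProduct.induction_on with
    | zero => simp
    | add x x' hx hx' => simp only [map_add, hx, hx']
    | tmul u q => simp [freeSuper, parity_tmul]

theorem extDeriv_involute {d : ℕ} (D : Module.End ℂ (OddSpace d)) (u : Ext d) :
    extDeriv D (CliffordAlgebra.involute u) = CliffordAlgebra.involute (extDeriv D u) := by
  induction u using ExteriorAlgebra.induction with
  | algebraMap r =>
    rw [AlgHom.commutes, extDeriv_algebraMap, map_zero]
  | ι v => rw [involute_ι, map_neg, extDeriv_ι, involute_ι]
  | mul x y hx hy =>
    rw [map_mul, extDeriv_mul, extDeriv_mul, hx, hy, map_add, map_mul, map_mul]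
  | add x y hx hy => rw [map_add, map_add, map_add, map_add, hx, hy]

/-- A derivation of the exterior factor extends to an even derivation. -/
theorem evenDer_map_extDeriv {d : ℕ} (D : Module.End ℂ (OddSpace d)) :
    EvenDer (freeSuper (OddIndex d) I) (TensorProduct.map (extDeriv D) LinearMap.id) where
  leibniz x y := by
    induction x using TensorProduct.induction_on with
    | zero => simp
    | add x x' hx hx' => simp only [add_mul, map_add, hx, hx']; abel
    | tmul u q =>
      induction y using TensorProduct.induction_on with
      | zero => simp
      | add y y' hy hy' => simp only [mul_add, map_add, hy, hy']; abel
      | tmul w r =>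
        simp [TensorProduct.add_tmul, extDeriv_mul, add_comm]
  parity x := by
    induction x using TensorProduct.induction_on with
    | zero => simp
    | add x x' hx hx' => simp only [map_add, hx, hx']
    | tmul u q => simp [freeSuper, parity_tmul, extDeriv_involute]

/-- Contraction of the exterior factor with a linear form. -/
def contract (φ : Module.Dual ℂ (κ →₀ ℂ)) : Module.End ℂ (ExteriorAlgebra ℂ (κ →₀ ℂ)) :=
  CliffordAlgebra.contractLeft (Q := (0 : QuadraticForm ℂ (κ →₀ ℂ))) φ

theorem contract_ι_mul (φ : Module.Dual ℂ (κ →₀ ℂ)) (v : κ →₀ ℂ)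
    (u : ExteriorAlgebra ℂ (κ →₀ ℂ)) :
    contract φ (ExteriorAlgebra.ι ℂ v * u) = φ v • u - ExteriorAlgebra.ι ℂ v * contract φ u :=
  CliffordAlgebra.contractLeft_ι_mul _ _ _

theorem contract_one (φ : Module.Dual ℂ (κ →₀ ℂ)) : contract φ 1 = 0 :=
  CliffordAlgebra.contractLeft_one (Q := (0 : QuadraticForm ℂ (κ →₀ ℂ))) φ

theorem contract_ι (φ : Module.Dual ℂ (κ →₀ ℂ)) (v : κ →₀ ℂ) :
    contract φ (ExteriorAlgebra.ι ℂ v) = φ v • 1 := by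
  have h := contract_ι_mul φ v 1
  rwa [mul_one, contract_one, mul_zero, sub_zero] at h

/-- Contraction of the exterior factor is an odd derivation. -/
theorem oddDer_map_contract (φ : Module.Dual ℂ (κ →₀ ℂ)) :
    OddDer (freeSuper κ I) (TensorProduct.map (contract φ) LinearMap.id) := by
  refine OddDer.of_gen ?_ (fun k x => ?_) (fun i x => ?_) (fun k => ?_) fun i => ?_
  · rw [Algebra.TensorProduct.one_def, TensorProduct.map_tmul, contract_one,
      TensorProduct.zero_tmul]
  · induction x using TensorProduct.induction_on with
    | zero => simp
    | add x y hx hy => rw [mul_add, map_add, hx, hy, mul_add, map_add, mul_add]; abel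
    | tmul u q =>
      simp only [freeSuper, oddLin, Algebra.TensorProduct.tmul_mul_tmul, TensorProduct.map_tmul,
        contract_ι_mul, contract_ι, TensorProduct.sub_tmul, LinearMap.id_apply, one_mul,
        smul_mul_assoc]
  · induction x using TensorProduct.induction_on with
    | zero => simp
    | add x y hx hy => rw [mul_add, map_add, hx, hy, mul_add, map_add, mul_add]; abel
    | tmul u q =>
      simp only [freeSuper, Algebra.TensorProduct.tmul_mul_tmul, TensorProduct.map_tmul,
        contract_one, LinearMap.id_apply, one_mul, TensorProduct.zero_tmul, zero_mul, zero_add]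
  · simp only [freeSuper, oddLin, TensorProduct.map_tmul, contract_ι, parity_tmul,
      LinearMap.id_apply, map_smul, map_one]
  · simp only [freeSuper, TensorProduct.map_tmul, contract_one, TensorProduct.zero_tmul, map_zero]
    exact neg_zero.symm

end Free

/-! ### The Koszul complex as an algebra with generators -/

section Concrete

variable {d : ℕ} {L : Type} [LieRing L] [LieAlgebra ℂ L]

/-- `Λ ⊗ S` with its generators. -/
abbrev extSym (d : ℕ) : SuperGen (OddIndex d) (Fin d × ℕ) (ExtSym d) :=
  freeSuper (OddIndex d) (Fin d × ℕ)

/-- The derivative in the direction of `σ^b(-n)`. -/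
def dSigma (b : Fin d) (n : ℕ) : Module.End ℂ (ExtSym d) :=
  TensorProduct.map LinearMap.id (MvPolynomial.pderiv (R := ℂ) (b, n)).toLinearMap

/-- The adjoint of multiplication by `ψ^b(-n)`; zero if `n = 0`. -/
def dPsi (b : Fin d) (n : ℕ) : Module.End ℂ (ExtSym d) :=
  if h : 0 < n then TensorProduct.map (psiStar b (n.toPNat h)) LinearMap.id else 0

theorem psiStar_eq (b : Fin d) (n : ℕ+) :
    psiStar b n = (1 / (n : ℂ)) • contract (Finsupp.lapply (toLex (b, n))) := rfl

theorem dPsi_coe (b : Fin d) (n : ℕ+) :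
    dPsi b n = TensorProduct.map (psiStar b n) LinearMap.id := dif_pos n.pos

variable (ξ : Module.Basis (Fin d) ℂ L)

theorem psi_neg_natCast (b : Fin d) (n : ℕ) (h : 0 < n) :
    psi b (-(n : ℤ)) = Finsupp.single (toLex (b, n.toPNat h)) 1 := psi_neg b (n.toPNat h)

theorem sigma_neg_natCast (b : Fin d) (n : ℕ) : sigma b (-(n : ℤ)) = MvPolynomial.X (b, n) := by
  simp [sigma]

theorem extSym_psi_basis (n : ℕ) (b : Fin d) :
    (extSym d).psi ξ n (ξ b) = oddLin (psi b (-(n : ℤ))) := by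
  rcases Nat.eq_zero_or_pos n with rfl | h
  · simp [SuperGen.psi_zero, psi, oddLin]
  · rw [psi_neg_natCast b n h]
    exact (extSym d).psi_basis ξ (n.toPNat h) b

theorem extSym_sig_basis (n : ℕ) (b : Fin d) :
    (extSym d).sig ξ n (ξ b) = 1 ⊗ₜ sigma b (-(n : ℤ)) := by
  rw [SuperGen.sig_basis, sigma_neg_natCast]
  rfl

/-- Two linear maps that agree on a basis agree. -/
theorem linearMap_eq_of_basis {M : Type} [AddCommGroup M] [Module ℂ M] {φ χ : L →ₗ[ℂ] M}
    (h : ∀ b, φ (ξ b) = χ (ξ b)) (v : L) : φ v = χ v := by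
  rw [ξ.ext h]

theorem dualOperators : DualOperators (extSym d) ξ dSigma dPsi where
  ds_der b n := evenDer_map_derivation _
  dp_der b n := by
    rw [dPsi]
    split_ifs with h
    · rw [psiStar_eq, TensorProduct.map_smul_left]
      exact (oddDer_map_contract _).smul _
    · exact OddDer.zero
  ds_sig b k n v := by
    refine linearMap_eq_of_basis ξ (φ := dSigma b k ∘ₗ (extSym d).sig ξ n)
      (χ := if k = n then (LinearMap.toSpanSingleton ℂ (ExtSym d) 1) ∘ₗ
        ((1 : ℂ) • ξ.coord b) else 0) (fun c => ?_) v |>.trans ?_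
    · rw [LinearMap.comp_apply, extSym_sig_basis, sigma_neg_natCast, dSigma,
        TensorProduct.map_tmul]
      rw [Derivation.coeFn_coe, MvPolynomial.pderiv_X]
      by_cases hk : k = n
      · subst hk
        by_cases hb : b = c
        · subst hb
          simp [Algebra.TensorProduct.one_def]
        · simp [hb, Finsupp.single_apply, Ne.symm hb, Pi.single_apply]
      · simp [hk, Pi.single_apply, Ne.symm hk]
    · split_ifs <;> simp
  ds_psi b k n v := by
    refine linearMap_eq_of_basis ξ (φ := dSigma b k ∘ₗ (extSym d).psi ξ n) (χ := 0)
      (fun c => ?_) v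
    rw [LinearMap.comp_apply, extSym_psi_basis, oddLin, dSigma, TensorProduct.map_tmul]
    simp
  dp_sig b k n v := by
    refine linearMap_eq_of_basis ξ (φ := dPsi b k ∘ₗ (extSym d).sig ξ n) (χ := 0)
      (fun c => ?_) v
    rw [LinearMap.comp_apply, extSym_sig_basis, dPsi]
    split_ifs
    · rw [psiStar_eq, TensorProduct.map_tmul, LinearMap.smul_apply, contract_one]
      simp
    · simp
  dp_psi b k n v := by
    refine linearMap_eq_of_basis ξ (φ := dPsi b k ∘ₗ (extSym d).psi ξ n)
      (χ := if k = n then (LinearMap.toSpanSingleton ℂ (ExtSym d) 1) ∘ₗ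
        ((1 / (n : ℂ)) • ξ.coord b) else 0) (fun c => ?_) v |>.trans ?_
    · rw [LinearMap.comp_apply]
      rcases Nat.eq_zero_or_pos n with rfl | hn
      · rw [SuperGen.psi_zero]
        split_ifs <;> simp
      rw [extSym_psi_basis, psi_neg_natCast _ _ hn, dPsi]
      by_cases hk : k = n
      · subst hk
        rw [dif_pos hn, if_pos rfl, oddLin, psiStar_eq, TensorProduct.map_tmul,
          LinearMap.smul_apply, contract_ι]
        by_cases hb : b = c
        · subst hb
          simp [Algebra.TensorProduct.one_def, TensorProduct.smul_tmul', Nat.toPNat]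
        · simp [Finsupp.single_apply, Ne.symm hb]
      · rw [if_neg hk]
        split_ifs with hk0
        · rw [oddLin, psiStar_eq, TensorProduct.map_tmul, LinearMap.smul_apply, contract_ι,
            Finsupp.lapply_apply, Finsupp.single_eq_of_ne fun h => hk
              (congrArg (fun i : OddIndex d => ((ofLex i).2 : ℕ)) (a₁ := toLex (b, k.toPNat hk0))
                (a₂ := toLex (c, n.toPNat hn)) h), zero_smul,
            smul_zero, TensorProduct.zero_tmul]
          rfl
        · simp
    · split_ifs <;> simp

end Concrete

section Concrete

variable {d : ℕ} {L : Type} [LieRing L] [LieAlgebra ℂ L]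

theorem EvenDer.ext_basis {A : Type} [Ring A] [Algebra ℂ A]
    {S : SuperGen (OddIndex d) (Fin d × ℕ) A} {P Q : Module.End ℂ A}
    (ξ : Module.Basis (Fin d) ℂ L) (hP : EvenDer S P) (hQ : EvenDer S Q)
    (psi : ∀ (n : ℕ+) b, P (S.psi ξ n (ξ b)) = Q (S.psi ξ n (ξ b)))
    (sig : ∀ n b, P (S.sig ξ n (ξ b)) = Q (S.sig ξ n (ξ b))) : P = Q :=
  hP.ext_gen hQ (fun k => by
      obtain ⟨⟨b, n⟩, rfl⟩ := toLex.surjective k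
      rw [← S.psi_basis ξ]
      exact psi _ _) fun i => by
    rw [← S.sig_basis ξ]
    exact sig _ _

variable (ξ : Module.Basis (Fin d) ℂ L)

theorem extSym_sig_lie (a b : Fin d) (n : ℕ) :
    (extSym d).sig ξ n ⁅ξ a, ξ b⁆ = 1 ⊗ₜ sigmaBracket ξ a b (-(n : ℤ)) := by
  conv_lhs => rw [← ξ.sum_repr ⁅ξ a, ξ b⁆]
  simp only [map_sum, map_smul, extSym_sig_basis, sigmaBracket, TensorProduct.tmul_sum,
    TensorProduct.tmul_smul]

theorem oddLin_sum_smul {κ I ι : Type} (s : Finset ι) (c : ι → ℂ) (v : ι → κ →₀ ℂ) :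
    (oddLin (∑ e ∈ s, c e • v e) : FreeSuper κ I) = ∑ e ∈ s, c e • oddLin (v e) := by
  simp only [oddLin, map_sum, map_smul, TensorProduct.sum_tmul, TensorProduct.smul_tmul']

theorem extSym_psi_lie (a b : Fin d) (n : ℕ) :
    (extSym d).psi ξ n ⁅ξ a, ξ b⁆ = oddLin (psiBracket ξ a b (-(n : ℤ))) := by
  conv_lhs => rw [← ξ.sum_repr ⁅ξ a, ξ b⁆]
  rw [psiBracket, oddLin_sum_smul]
  simp only [map_sum, map_smul, extSym_psi_basis]

theorem sigmaBracket_of_pos (a b : Fin d) {n : ℤ} (hn : 0 < n) : sigmaBracket ξ a b n = 0 :=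
  Finset.sum_eq_zero fun e _ => by rw [sigma, if_neg (not_le.2 hn), smul_zero]

theorem psiBracket_of_nonneg (a b : Fin d) {n : ℤ} (hn : 0 ≤ n) : psiBracket ξ a b n = 0 :=
  Finset.sum_eq_zero fun e _ => by rw [psi, dif_neg (not_lt.2 hn), smul_zero]

theorem map_ROp_sig (a b : Fin d) (m : ℤ) (n : ℕ) :
    TensorProduct.map LinearMap.id (ROp ξ a m) ((extSym d).sig ξ n (ξ b)) =
      1 ⊗ₜ sigmaBracket ξ a b (m + -(n : ℤ)) := by
  rw [extSym_sig_basis, TensorProduct.map_tmul, sigma_neg_natCast, ROp, Derivation.coeFn_coe,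
    MvPolynomial.mkDerivation_X]
  rfl

theorem map_ROp_psi (a b : Fin d) (m : ℤ) (n : ℕ) :
    TensorProduct.map LinearMap.id (ROp ξ a m) ((extSym d).psi ξ n (ξ b)) = 0 := by
  rw [extSym_psi_basis, oddLin, TensorProduct.map_tmul, ROp, Derivation.coeFn_coe]
  simp

theorem map_extDeriv_sig (D : Module.End ℂ (OddSpace d)) (n : ℕ) (b : Fin d) :
    TensorProduct.map (extDeriv D) LinearMap.id ((extSym d).sig ξ n (ξ b)) = 0 := by
  rw [extSym_sig_basis, TensorProduct.map_tmul, ← map_one (algebraMap ℂ (Ext d)),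
    extDeriv_algebraMap, TensorProduct.zero_tmul]

theorem map_extDeriv_psi (v : OddIndex d → OddSpace d) (n : ℕ+) (b : Fin d) :
    TensorProduct.map (extDeriv (Finsupp.linearCombination ℂ v)) LinearMap.id
      ((extSym d).psi ξ n (ξ b)) = oddLin (v (toLex (b, n))) := by
  rw [extSym_psi_basis, oddLin, TensorProduct.map_tmul, extDeriv_ι, psi_neg,
    Finsupp.linearCombination_single, one_smul]
  rfl

theorem map_ROp_eq_sigLow (a : Fin d) (m : ℕ) :
    TensorProduct.map LinearMap.id (ROp ξ a m) = (dualOperators ξ).sigLow a m := by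
  refine EvenDer.ext_basis ξ (evenDer_map_derivation _) ((dualOperators ξ).sigLow_der a m)
    (fun n b => ?_) fun n b => ?_
  · rw [map_ROp_psi, DualOperators.sigLow_psi]
  · rw [map_ROp_sig, DualOperators.sigLow_sig]
    split_ifs with h
    · rw [extSym_sig_lie]
      congr 2
      omega
    · rw [sigmaBracket_of_pos ξ a b (by omega), TensorProduct.tmul_zero]

theorem map_ROp_eq_sigUp (a : Fin d) (m : ℕ) :
    TensorProduct.map LinearMap.id (ROp ξ a (-(m : ℤ))) = (dualOperators ξ).sigUp a m := by
  refine EvenDer.ext_basis ξ (evenDer_map_derivation _) ((dualOperators ξ).sigUp_der a m)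
    (fun n b => ?_) fun n b => ?_
  · rw [map_ROp_psi, DualOperators.sigUp_psi]
  · rw [map_ROp_sig, DualOperators.sigUp_sig, extSym_sig_lie]
    congr 2
    omega

theorem map_adOp_eq_psiLow (a : Fin d) (m : ℕ) :
    TensorProduct.map (adOp ξ a m) LinearMap.id =
      (dualOperators ξ).psiLow (fun k => (k + m : ℕ)) a m := by
  refine EvenDer.ext_basis ξ (evenDer_map_extDeriv _) ((dualOperators ξ).psiLow_der _ a m)
    (fun n b => ?_) fun n b => ?_
  · rw [adOp, map_extDeriv_psi, DualOperators.psiLow_psi, ofLex_toLex]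
    dsimp only
    split_ifs with h
    · rw [extSym_psi_lie, Nat.sub_add_cancel h, div_self (by simp), one_smul]
      congr 2
      omega
    · rw [psiBracket_of_nonneg ξ a b (by omega)]
      simp [oddLin]
  · rw [adOp, map_extDeriv_sig, DualOperators.psiLow_sig]

theorem map_adStarOp_eq_psiUp (a : Fin d) (m : ℕ) :
    TensorProduct.map (adStarOp ξ a m) LinearMap.id =
      (dualOperators ξ).psiUp (fun k => (k + m : ℕ)) a m := by
  refine EvenDer.ext_basis ξ (evenDer_map_extDeriv _) ((dualOperators ξ).psiUp_der _ a m)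
    (fun n b => ?_) fun n b => ?_
  · rw [adStarOp, map_extDeriv_psi, DualOperators.psiUp_psi, ofLex_toLex, extSym_psi_lie,
      oddLin_smul]
    congr 1
    · rw [← neg_div_neg_eq]
      push_cast
      congr 1 <;> ring
    · congr 2
      push_cast
      ring
  · rw [adStarOp, map_extDeriv_sig, DualOperators.psiUp_sig]

theorem koszul_operator_eq (a : Fin d) :
    TensorProduct.map LinearMap.id (ROp ξ a 0) + TensorProduct.map (adOp ξ a 0) LinearMap.id =
      (dualOperators ξ).opT a 0 := by
  have h1 := map_ROp_eq_sigLow ξ a 0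
  have h2 := map_adOp_eq_psiLow ξ a 0
  rw [Nat.cast_zero] at h1 h2
  rw [h1, h2, DualOperators.opT]
  rfl

theorem mem_koszul {f : ExtSym d} : f ∈ koszul ξ ↔ ∀ a, (dualOperators ξ).opT a 0 f = 0 := by
  simp only [koszul, Submodule.mem_iInf, LinearMap.mem_ker, koszul_operator_eq]

/-- A locally finite sum over the positive integers as one over the natural numbers. -/
theorem locSum_pnat {M : Type} [AddCommGroup M] [Module ℂ M] {U : ℕ+ → Module.End ℂ M}
    {V : ℕ → Module.End ℂ M} (hU : LocallyFinite U) (hV : LocallyFinite V) (h0 : V 0 = 0)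
    (h : ∀ m : ℕ+, U m = V m) : locSum U hU = locSum V hV := by
  ext x
  rw [locSum_apply, locSum_apply]
  refine (finsum_congr fun m => by rw [h m]).trans ?_
  refine (finsum_mem_range (f := fun m => V m x) (g := ((↑) : ℕ+ → ℕ)) PNat.coe_injective).symm.trans ?_
  rw [← finsum_mem_univ (fun m => V m x)]
  refine finsum_mem_inter_support_eq' _ _ _ fun m hm => ?_
  refine iff_of_true ?_ trivial
  rcases Nat.eq_zero_or_pos m with rfl | hpos
  · simp [h0] at hm
  · exact ⟨⟨m, hpos⟩, rfl⟩

theorem dbarTerm_eq (m : ℕ+) : dbarTerm ξ m =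
    ∑ a, mulL ((extSym d).psi ξ m (ξ a)) * (dualOperators ξ).opA a m := by
  refine Finset.sum_congr rfl fun a _ => ?_
  have h1 := map_ROp_eq_sigLow ξ a m
  have h2 := map_adOp_eq_psiLow ξ a m
  rw [DualOperators.opA, ← h1, ← h2, extSym_psi_basis]
  refine TensorProduct.ext' fun x y => ?_
  simp only [oddLin, LinearMap.add_apply, TensorProduct.map_tmul, Module.End.mul_apply,
    LinearMap.smul_apply, LinearMap.mulLeft_apply, LinearMap.id_apply, mul_add, mul_smul_comm,
    Algebra.TensorProduct.tmul_mul_tmul, one_mul, psiMul, TensorProduct.smul_tmul']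

theorem dbarStarTerm_eq (m : ℕ+) : dbarStarTerm ξ m =
    ∑ a, (dualOperators ξ).opA' a m * dPsi a m := by
  refine Finset.sum_congr rfl fun a _ => ?_
  have h1 := map_ROp_eq_sigUp ξ a m
  have h2 := map_adStarOp_eq_psiUp ξ a m
  rw [DualOperators.opA', ← h1, ← h2, dPsi_coe]
  refine TensorProduct.ext' fun x y => ?_
  simp only [LinearMap.add_apply, TensorProduct.map_tmul, Module.End.mul_apply,
    LinearMap.smul_apply, LinearMap.id_apply, TensorProduct.smul_tmul']

theorem dbar_eq : dbar ξ = (dualOperators ξ).opD :=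
  locSum_pnat _ _ (by simp [SuperGen.psi_zero]) (dbarTerm_eq ξ)

theorem dbarStar_eq : dbarStar ξ = (dualOperators ξ).opD' :=
  locSum_pnat _ _ (by simp [dPsi]) (dbarStarTerm_eq ξ)

end Concrete

/-! ### The metric -/

section Metric

variable {d : ℕ}

/-- The monomials in the `ψ^a(-m)`. -/
def psiMonomial (T : Finset (OddIndex d)) : Ext d :=
  (Finsupp.basisSingleOne (R := ℂ) (ι := OddIndex d)).ExteriorAlgebra T

theorem psiMonomial_empty : psiMonomial (∅ : Finset (OddIndex d)) = 1 := by
  rw [psiMonomial, ExteriorAlgebra.basis_apply_ofCard _ (n := 0) Finset.card_empty]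
  exact ExteriorAlgebra.ιMulti_zero_apply _

theorem psiMonomial_singleton (k : OddIndex d) :
    psiMonomial {k} = ExteriorAlgebra.ι ℂ (Finsupp.single k 1) := by
  rw [psiMonomial, ExteriorAlgebra.basis_apply_ofCard _ (n := 1) (Finset.card_singleton k)]
  obtain ⟨j, hj⟩ := (Set.powersetCard.mem_range_ofFinEmbEquiv_symm_iff_mem
    (Set.powersetCard.ofCard (Finset.card_singleton k)) k).2 (Finset.mem_singleton_self k)
  obtain rfl : j = 0 := Subsingleton.elim _ _
  rw [ExteriorAlgebra.ιMulti_family, ExteriorAlgebra.ιMulti_apply, List.ofFn_succ, List.ofFn_zero, List.prod_singleton, Function.comp_apply, hj,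
    Finsupp.coe_basisSingleOne]

theorem ι_mul_psiMonomial {k : OddIndex d} {T : Finset (OddIndex d)} (hk : k ∉ T) :
    ∃ ε : ℤˣ, ExteriorAlgebra.ι ℂ (Finsupp.single k 1) * psiMonomial T =
      ε • psiMonomial (insert k T) := by
  have h : Disjoint (Set.powersetCard.ofCard (Finset.card_singleton k)).val
    (Set.powersetCard.ofCard (s := T) rfl).val := by simpa using hk
  have h1 := ExteriorAlgebra.basis_mul_of_disjoint (Finsupp.basisSingleOne (R := ℂ) (ι := OddIndex d))
    (Set.powersetCard.ofCard (Finset.card_singleton k)) (Set.powersetCard.ofCard (s := T) rfl) h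
  refine ⟨Equiv.Perm.sign (Set.powersetCard.permOfDisjoint h), ?_⟩
  rw [← psiMonomial_singleton]
  have h2 : (Set.powersetCard.disjUnion h : Finset (OddIndex d)) = insert k T := by
    rw [Set.powersetCard.coe_disjUnion, Finset.disjUnion_eq_union]
    rfl
  rw [h2] at h1
  exact h1

theorem contract_psiMonomial {k : OddIndex d} {T : Finset (OddIndex d)} (hk : k ∉ T) :
    contract (Finsupp.lapply k) (psiMonomial T) = 0 := by
  induction T using Finset.induction_on with
  | empty => rw [psiMonomial_empty, contract_one]
  | insert j T hj ih =>
    obtain ⟨ε, hε⟩ := ι_mul_psiMonomial hj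
    have h1 : psiMonomial (insert j T) =
        ε⁻¹ • (ExteriorAlgebra.ι ℂ (Finsupp.single j 1) * psiMonomial T) := by
      rw [hε, inv_smul_smul]
    have hkj : k ≠ j := fun h => hk (by simp [h])
    have hkT : k ∉ T := fun h => hk (by simp [h])
    have h2 : contract (Finsupp.lapply k)
        (ExteriorAlgebra.ι ℂ (Finsupp.single j 1) * psiMonomial T) = 0 := by
      rw [contract_ι_mul, ih hkT, Finsupp.lapply_apply, Finsupp.single_eq_of_ne hkj]
      simp
    rw [h1, Units.smul_def, map_zsmul, h2, smul_zero]

theorem ι_mul_psiMonomial_insert {k : OddIndex d} {T : Finset (OddIndex d)} (hk : k ∉ T) :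
    ExteriorAlgebra.ι ℂ (Finsupp.single k 1) * psiMonomial (insert k T) = 0 := by
  obtain ⟨ε, hε⟩ := ι_mul_psiMonomial hk
  rw [show psiMonomial (insert k T) = ε⁻¹ • (ExteriorAlgebra.ι ℂ (Finsupp.single k 1) *
    psiMonomial T) by rw [hε, inv_smul_smul], mul_smul_comm, ← mul_assoc,
    ExteriorAlgebra.ι_sq_zero, zero_mul, smul_zero]

theorem contract_psiMonomial_insert {k : OddIndex d} {T : Finset (OddIndex d)} (hk : k ∉ T)
    {ε : ℤˣ} (hε : ExteriorAlgebra.ι ℂ (Finsupp.single k 1) * psiMonomial T =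
      ε • psiMonomial (insert k T)) :
    contract (Finsupp.lapply k) (psiMonomial (insert k T)) = ε • psiMonomial T := by
  rw [show psiMonomial (insert k T) = ε⁻¹ • (ExteriorAlgebra.ι ℂ (Finsupp.single k 1) *
    psiMonomial T) by rw [hε, inv_smul_smul], Units.smul_def, map_zsmul, contract_ι_mul,
    contract_psiMonomial hk]
  simp [Units.smul_def]

end Metric

section Diagonal

variable {A J : Type} [AddCommGroup A] [Module ℂ A] (B : Module.Basis J ℂ A) (w : J → ℂ)

/-- The form for which the basis `B` is orthogonal with square norms `w`. -/
def diagForm (f g : A) : ℂ := (B.repr f).sum fun i c => starRingEnd ℂ c * w i * B.repr g i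

theorem diagForm_basis_left (i : J) (g : A) : diagForm B w (B i) g = w i * B.repr g i := by
  rw [diagForm, B.repr_self, Finsupp.sum_single_index] <;> simp

end Diagonal

theorem diagForm_isHermitianForm {A J : Type} [Ring A] [Algebra ℂ A] (B : Module.Basis J ℂ A)
    (w : J → ℂ) (hw : ∀ i, ∃ r : ℝ, 0 < r ∧ w i = r) : IsHermitianForm (diagForm B w) where
  add_right f g h := by
    simp only [diagForm, map_add, Finsupp.add_apply, mul_add, Finsupp.sum_add]
  smul_right c f g := by
    simp only [diagForm, map_smul, Finsupp.smul_apply, smul_eq_mul, Finsupp.mul_sum]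
    exact Finsupp.sum_congr fun i _ => by ring
  conj_symm f g := by
    classical
    have h1 : ∀ f g, diagForm B w f g = ∑ i ∈ (B.repr f).support ∪ (B.repr g).support,
        starRingEnd ℂ (B.repr f i) * w i * B.repr g i := fun f g => by
      rw [diagForm, Finsupp.sum]
      refine Finset.sum_subset Finset.subset_union_left fun i _ hi => ?_
      rw [Finsupp.notMem_support_iff.1 hi]
      simp
    rw [h1, h1, map_sum, Finset.union_comm]
    refine Finset.sum_congr rfl fun i _ => ?_
    obtain ⟨r, -, hr⟩ := hw i
    rw [map_mul, map_mul, hr, Complex.conj_conj, Complex.conj_ofReal]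
    ring
  pos f hf := by
    rw [diagForm, Finsupp.sum, Complex.re_sum]
    have h1 : ∀ i, (starRingEnd ℂ (B.repr f i) * w i * B.repr f i).re =
        (w i).re * Complex.normSq (B.repr f i) := fun i => by
      obtain ⟨r, -, hr⟩ := hw i
      rw [mul_right_comm, ← Complex.normSq_eq_conj_mul_self, hr, ← Complex.ofReal_mul,
        Complex.ofReal_re, Complex.ofReal_re, mul_comm]
    refine Finset.sum_pos (fun i hi => ?_) ?_
    · rw [h1]
      obtain ⟨r, hr0, hr⟩ := hw i
      rw [hr, Complex.ofReal_re]
      exact mul_pos hr0 (Complex.normSq_pos.2 (Finsupp.mem_support_iff.1 hi))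
    · rw [Finsupp.support_nonempty_iff]
      exact fun h => hf (B.repr.map_eq_zero_iff.1 h)

theorem isAdjoint_of_basis {A J : Type} [Ring A] [Algebra ℂ A] {F : A → A → ℂ}
    (hF : IsHermitianForm F) (B : Module.Basis J ℂ A) {P Q : Module.End ℂ A}
    (h : ∀ i j, F (P (B i)) (B j) = F (B i) (Q (B j))) : IsAdjoint F P Q := by
  have h1 : ∀ i g, F (P (B i)) g = F (B i) (Q g) := fun i g =>
    DFunLike.congr_fun (B.ext (f₁ := hF.right (P (B i))) (f₂ := hF.right (B i) ∘ₗ Q) (h i)) g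
  intro f g
  rw [← hF.conj_symm g, ← hF.conj_symm (Q g)]
  congr 1
  refine DFunLike.congr_fun (B.ext (f₁ := hF.right g ∘ₗ P) (f₂ := hF.right (Q g)) fun i => ?_) f
  change F g (P (B i)) = F (Q g) (B i)
  rw [← hF.conj_symm, h1, hF.conj_symm]

theorem isImaginary_of_conjugation {d : ℕ} {L : Type} [LieRing L] [LieAlgebra ℂ L]
    {ξ : Module.Basis (Fin d) ℂ L} {τ : L →ₛₗ[starRingEnd ℂ] L} (hτ : IsCompactConjugation τ)
    (h : ∀ a, τ (ξ a) = -ξ a) : IsImaginary ξ := by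
  intro a b e
  have h1 : τ ⁅ξ a, ξ b⁆ = ⁅ξ a, ξ b⁆ := by rw [hτ.lie, h, h, neg_lie, lie_neg, neg_neg]
  have h2 : τ ⁅ξ a, ξ b⁆ = ∑ e, (-starRingEnd ℂ (ξ.repr ⁅ξ a, ξ b⁆ e)) • ξ e := by
    conv_lhs => rw [← ξ.sum_repr ⁅ξ a, ξ b⁆]
    rw [map_sum]
    refine Finset.sum_congr rfl fun e _ => ?_
    rw [map_smulₛₗ, h, smul_neg, neg_smul]
  rw [h1] at h2
  have h3 := congrArg (fun v => ξ.repr v e) h2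
  simp only [ξ.repr_sum_self] at h3
  conv_rhs => rw [h3]
  rw [neg_neg]

section Metric

variable {d : ℕ} {L : Type} [LieRing L] [LieAlgebra ℂ L]

theorem monomialBasis_apply (i : Finset (OddIndex d) × ((Fin d × ℕ) →₀ ℕ)) :
    monomialBasis d i = psiMonomial i.1 ⊗ₜ MvPolynomial.monomial i.2 1 := by
  obtain ⟨T, s⟩ := i
  rw [monomialBasis, Module.Basis.tensorProduct_apply, MvPolynomial.coe_basisMonomials]
  rfl

theorem monomialNormSq_pos (i : Finset (OddIndex d) × ((Fin d × ℕ) →₀ ℕ)) :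
    ∃ r : ℝ, 0 < r ∧ monomialNormSq i = r := by
  refine ⟨(∏ j ∈ i.1, 1 / ((ofLex j).2 : ℝ)) * i.2.prod fun _ k => (k.factorial : ℝ), ?_, ?_⟩
  · refine mul_pos (Finset.prod_pos fun j _ => by positivity) (Finset.prod_pos fun j _ => ?_)
    exact Nat.cast_pos.2 (Nat.factorial_pos _)
  · simp [monomialNormSq, Finsupp.prod]

theorem metric_isHermitianForm : IsHermitianForm (metric (d := d)) :=
  diagForm_isHermitianForm (monomialBasis d) monomialNormSq monomialNormSq_pos

theorem monomialNormSq_insert {k : OddIndex d} {T : Finset (OddIndex d)} (hk : k ∉ T)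
    (s : (Fin d × ℕ) →₀ ℕ) :
    monomialNormSq (insert k T, s) = 1 / ((ofLex k).2 : ℂ) * monomialNormSq (T, s) := by
  rw [monomialNormSq, monomialNormSq, Finset.prod_insert hk, mul_assoc]

theorem monomialNormSq_add_single (T : Finset (OddIndex d)) (s : (Fin d × ℕ) →₀ ℕ)
    (i : Fin d × ℕ) :
    monomialNormSq (T, s + Finsupp.single i 1) = ((s i : ℂ) + 1) * monomialNormSq (T, s) := by
  classical
  have h1 : ∀ s : (Fin d × ℕ) →₀ ℕ, (s.prod fun _ k => (k.factorial : ℂ)) =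
      (s i).factorial * ∏ j ∈ s.support.erase i, ((s j).factorial : ℂ) := fun s => by
    rw [Finsupp.prod]
    by_cases hi : i ∈ s.support
    · rw [← Finset.mul_prod_erase _ _ hi]
    · rw [Finset.erase_eq_of_notMem hi, Finsupp.notMem_support_iff.1 hi]
      simp
  have h2 : (s + Finsupp.single i 1).support.erase i = s.support.erase i := by
    ext j
    by_cases hj : j = i
    · simp [hj]
    · simp [hj, Finsupp.single_apply, Ne.symm hj]
  have h3 : ∏ j ∈ s.support.erase i, (((s + Finsupp.single i 1 : (Fin d × ℕ) →₀ ℕ) j).factorial : ℂ) =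
      ∏ j ∈ s.support.erase i, ((s j).factorial : ℂ) :=
    Finset.prod_congr rfl fun j hj => by
      rw [Finsupp.add_apply, Finsupp.single_eq_of_ne (Finset.ne_of_mem_erase hj), add_zero]
  rw [monomialNormSq, monomialNormSq, h1, h1 s]
  rw [h2, h3, Finsupp.add_apply, Finsupp.single_eq_same, Nat.factorial_succ]
  push_cast
  ring

theorem metric_basis (i j : Finset (OddIndex d) × ((Fin d × ℕ) →₀ ℕ)) :
    metric (monomialBasis d i) (monomialBasis d j) = if i = j then monomialNormSq i else 0 := by
  classical
  rw [show metric (monomialBasis d i) (monomialBasis d j) = _ from diagForm_basis_left _ _ _ _,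
    Module.Basis.repr_self, Finsupp.single_apply]
  split_ifs <;> simp_all

theorem adjoint_sigma (b : Fin d) (n : ℕ) :
    IsAdjoint metric (mulL ((1 : Ext d) ⊗ₜ[ℂ] (MvPolynomial.X (b, n) : Sym d))) (dSigma b n) := by
  classical
  refine isAdjoint_of_basis metric_isHermitianForm (monomialBasis d) ?_
  rintro ⟨T, s⟩ ⟨U, r⟩
  have h1 : mulL ((1 : Ext d) ⊗ₜ[ℂ] (MvPolynomial.X (b, n) : Sym d)) (monomialBasis d (T, s)) =
      monomialBasis d (T, s + Finsupp.single (b, n) 1) := by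
    rw [monomialBasis_apply, monomialBasis_apply, LinearMap.mulLeft_apply,
      Algebra.TensorProduct.tmul_mul_tmul, one_mul, MvPolynomial.X, MvPolynomial.monomial_mul,
      one_mul, add_comm]
  have h2 : dSigma b n (monomialBasis d (U, r)) =
      (r (b, n) : ℂ) • monomialBasis d (U, r - Finsupp.single (b, n) 1) := by
    rw [monomialBasis_apply, monomialBasis_apply, dSigma, TensorProduct.map_tmul,
      Derivation.coeFn_coe, MvPolynomial.pderiv_monomial, one_mul, ← TensorProduct.tmul_smul,
      MvPolynomial.smul_monomial, smul_eq_mul, mul_one]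
    rfl
  rw [h1, h2, metric_isHermitianForm.smul_right, metric_basis, metric_basis]
  simp only [Prod.mk.injEq]
  by_cases hTU : T = U
  · subst hTU
    by_cases hs : s + Finsupp.single (b, n) 1 = r
    · subst hs
      rw [if_pos ⟨rfl, rfl⟩, if_pos ⟨rfl, by simp⟩, monomialNormSq_add_single]
      simp
    · rw [if_neg (by tauto)]
      by_cases hr : r (b, n) = 0
      · simp [hr]
      · rw [if_neg, mul_zero]
        rintro ⟨-, rfl⟩
        refine hs (tsub_add_cancel_of_le ?_)
        rw [Finsupp.single_le_iff]
        omega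
  · simp [hTU]

theorem adjoint_psi (b : Fin d) (n : ℕ+) :
    IsAdjoint metric (mulL (oddLin (Finsupp.single (toLex (b, n)) 1)))
      (TensorProduct.map (psiStar b n) LinearMap.id) := by
  classical
  refine isAdjoint_of_basis metric_isHermitianForm (monomialBasis d) ?_
  rintro ⟨T, s⟩ ⟨U, r⟩
  set k : OddIndex d := toLex (b, n) with hk
  have hP : ∀ x : Ext d, mulL (oddLin (Finsupp.single k 1)) (x ⊗ₜ[ℂ] MvPolynomial.monomial s 1) =
      (ExteriorAlgebra.ι ℂ (Finsupp.single k 1) * x) ⊗ₜ[ℂ]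
        (MvPolynomial.monomial s 1 : Sym d) := fun x => by
    rw [LinearMap.mulLeft_apply, oddLin, Algebra.TensorProduct.tmul_mul_tmul, one_mul]
  have hQ : ∀ x : Ext d, TensorProduct.map (psiStar b n) LinearMap.id
      (x ⊗ₜ[ℂ] (MvPolynomial.monomial r 1 : Sym d)) =
      (1 / (n : ℂ)) • (contract (Finsupp.lapply k) x ⊗ₜ[ℂ] (MvPolynomial.monomial r 1 : Sym d)) :=
    fun x => by
      rw [TensorProduct.map_tmul, psiStar_eq, LinearMap.smul_apply, TensorProduct.smul_tmul']
      rfl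
  rw [monomialBasis_apply (T, s), monomialBasis_apply (U, r), hP, hQ,
    metric_isHermitianForm.smul_right]
  dsimp only
  have hb : ∀ (T : Finset (OddIndex d)) (s : (Fin d × ℕ) →₀ ℕ),
      psiMonomial T ⊗ₜ[ℂ] (MvPolynomial.monomial s 1 : Sym d) = monomialBasis d (T, s) :=
    fun T s => (monomialBasis_apply (T, s)).symm
  have hsm : ∀ (ε : ℤˣ) (T : Finset (OddIndex d)) (s : (Fin d × ℕ) →₀ ℕ),
      (ε • psiMonomial T) ⊗ₜ[ℂ] (MvPolynomial.monomial s 1 : Sym d) =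
        ((ε : ℤ) : ℂ) • monomialBasis d (T, s) := fun ε T s => by
    rw [monomialBasis_apply, Units.smul_def, ← Int.cast_smul_eq_zsmul ℂ, TensorProduct.smul_tmul']
  by_cases hT : k ∈ T
  · have hT' : insert k (T.erase k) = T := Finset.insert_erase hT
    rw [← hT', ι_mul_psiMonomial_insert (Finset.notMem_erase k T), TensorProduct.zero_tmul,
      metric_isHermitianForm.zero_left, hT', ← monomialBasis_apply (T, s)]
    by_cases hU : k ∈ U
    · have hU' : insert k (U.erase k) = U := Finset.insert_erase hU
      obtain ⟨ε, hε⟩ := ι_mul_psiMonomial (Finset.notMem_erase k U)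
      have hc := contract_psiMonomial_insert (Finset.notMem_erase k U) hε
      rw [hU'] at hc
      rw [hc, hsm,
        metric_isHermitianForm.smul_right, metric_basis, if_neg, mul_zero, mul_zero]
      simp only [Prod.mk.injEq, not_and]
      rintro rfl
      exact absurd hT (Finset.notMem_erase k U)
    · rw [contract_psiMonomial hU, TensorProduct.zero_tmul, metric_isHermitianForm.zero_right,
        mul_zero]
  · obtain ⟨ε, hε⟩ := ι_mul_psiMonomial hT
    rw [hε, hsm, metric_isHermitianForm.smul_left, ← monomialBasis_apply (U, r), metric_basis]
    by_cases hU : k ∈ U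
    · have hU' : insert k (U.erase k) = U := Finset.insert_erase hU
      by_cases hTU : (T, s) = (U.erase k, r)
      · rw [Prod.mk.injEq] at hTU
        obtain ⟨rfl, rfl⟩ := hTU
        have hc := contract_psiMonomial_insert hT hε
        rw [hU'] at hc
        have hn : monomialNormSq (U, s) = 1 / (n : ℂ) * monomialNormSq (U.erase k, s) := by
          have h := monomialNormSq_insert hT s
          rwa [hU'] at h
        rw [hc, hsm, hb, metric_isHermitianForm.smul_right, metric_basis, if_pos rfl,
          if_pos (by rw [hU']), hU', hn, map_intCast]
        exact mul_left_comm _ _ _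
      · have hTU' : (insert k T, s) ≠ (U, r) := by
          rintro h
          rw [Prod.mk.injEq] at h
          obtain ⟨rfl, rfl⟩ := h
          exact hTU (by rw [Finset.erase_insert hT])
        obtain ⟨ε', hε'⟩ := ι_mul_psiMonomial (Finset.notMem_erase k U)
        have hc := contract_psiMonomial_insert (Finset.notMem_erase k U) hε'
        rw [hU'] at hc
        rw [hc, hsm, hb,
          metric_isHermitianForm.smul_right, metric_basis, if_neg hTU, if_neg hTU', mul_zero,
          mul_zero, mul_zero]
    · rw [contract_psiMonomial hU, TensorProduct.zero_tmul, metric_isHermitianForm.zero_right,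
        mul_zero, if_neg, mul_zero]
      simp only [Prod.mk.injEq, not_and]
      rintro rfl
      simp at hU

theorem metric_isSuperMetric (ξ : Module.Basis (Fin d) ℂ L) :
    IsSuperMetric (extSym d) ξ dSigma dPsi metric where
  toIsHermitianForm := metric_isHermitianForm
  adj_sig b n := by
    rw [SuperGen.sig_basis]
    exact adjoint_sigma b n
  adj_psi b n := by
    rcases Nat.eq_zero_or_pos n with rfl | hn
    · intro f g
      simp [SuperGen.psi_zero, dPsi, metric_isHermitianForm.zero_left,
        metric_isHermitianForm.zero_right]
    · rw [extSym_psi_basis, psi_neg_natCast b n hn, dPsi, dif_pos hn]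
      exact adjoint_psi b _

end Metric

/-! ### Harmonic forms as the functions that a Lie superalgebra kills -/

section LieInvariant

variable {d : ℕ} {L : Type} [LieRing L] [LieAlgebra ℂ L] (ξ : Module.Basis (Fin d) ℂ L)

theorem relabel_evenGen (i : Fin d × ℕ) :
    relabel d ((extSym d).even i) = evenCoord i.1 i.2 := by
  rw [relabel]
  exact (Algebra.TensorProduct.congr_apply _ _ _).trans (by
    simp [extSym, freeSuper, evenCoord])

theorem relabel_oddLin (v : OddSpace d) :
    relabel d (oddLin v) = oddLin (relabelGen d v) := by
  rw [relabel, oddLin, oddLin]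
  exact (Algebra.TensorProduct.congr_apply _ _ _).trans (by simp)

theorem relabel_parity (f : ExtSym d) :
    relabel d ((extSym d).parity f) =
      (freeSuper (Fin d × ℕ) (Fin d × ℕ)).parity (relabel d f) := by
  induction f using super_induction (extSym d) with
  | one => simp
  | add x y hx hy => simp only [map_add, hx, hy]
  | smul c x hx => simp only [map_smul, hx]
  | odd k x hx =>
    have h : (freeSuper (Fin d × ℕ) (Fin d × ℕ)).parity (oddLin (relabelGen d
        (Finsupp.single k 1))) = -oddLin (relabelGen d (Finsupp.single k 1)) := parity_oddLin _
    have h2 : relabel d ((extSym d).odd k) = oddLin (relabelGen d (Finsupp.single k 1)) :=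
      relabel_oddLin _
    rw [map_mul, map_mul, map_mul, map_mul, (extSym d).parity_odd, map_neg, hx, h2, h]
  | even i x hx =>
    have h : (freeSuper (Fin d × ℕ) (Fin d × ℕ)).parity (evenCoord i.1 i.2) =
        evenCoord i.1 i.2 := (freeSuper (Fin d × ℕ) (Fin d × ℕ)).parity_even i
    rw [map_mul, map_mul, map_mul, map_mul, (extSym d).parity_even, hx, relabel_evenGen, h]

/-- The even derivation by which `z^m ξ_a` acts on the functions on `𝔤[[z,s]]`. -/
def lieDer (a : Fin d) (m : ℕ) : Module.End ℂ (SuperPoly d) :=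
  (relabel d).toLinearEquiv.conj ((dualOperators ξ).opT a m)

/-- The odd derivation by which `s z^m ξ_a` acts on the functions on `𝔤[[z,s]]`. -/
def oddLieDer (a : Fin d) (m : ℕ) : Module.End ℂ (SuperPoly d) :=
  (relabel d).toLinearEquiv.conj ((dualOperators ξ).opE a (m + 1))

theorem lieDer_relabel (a : Fin d) (m : ℕ) (f : ExtSym d) :
    lieDer ξ a m (relabel d f) = relabel d ((dualOperators ξ).opT a m f) := by
  simp [lieDer, LinearEquiv.conj_apply]

theorem oddLieDer_relabel (a : Fin d) (m : ℕ) (f : ExtSym d) :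
    oddLieDer ξ a m (relabel d f) = relabel d ((dualOperators ξ).opE a (m + 1) f) := by
  simp [oddLieDer, LinearEquiv.conj_apply]

theorem lieDer_evenDer (a : Fin d) (m : ℕ) :
    EvenDer (freeSuper (Fin d × ℕ) (Fin d × ℕ)) (lieDer ξ a m) where
  leibniz x y := by
    obtain ⟨x, rfl⟩ := (relabel d).surjective x
    obtain ⟨y, rfl⟩ := (relabel d).surjective y
    rw [← map_mul, lieDer_relabel, ((dualOperators ξ).opT_der a m).leibniz, map_add, map_mul,
      map_mul, lieDer_relabel, lieDer_relabel]
  parity x := by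
    obtain ⟨x, rfl⟩ := (relabel d).surjective x
    rw [← relabel_parity, lieDer_relabel, lieDer_relabel, ((dualOperators ξ).opT_der a m).parity,
      relabel_parity]

theorem oddLieDer_oddDer (a : Fin d) (m : ℕ) :
    OddDer (freeSuper (Fin d × ℕ) (Fin d × ℕ)) (oddLieDer ξ a m) where
  leibniz x y := by
    obtain ⟨x, rfl⟩ := (relabel d).surjective x
    obtain ⟨y, rfl⟩ := (relabel d).surjective y
    rw [← map_mul, oddLieDer_relabel, ((dualOperators ξ).opE_der a _).leibniz, map_add, map_mul,
      map_mul, oddLieDer_relabel, oddLieDer_relabel, relabel_parity]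
  parity x := by
    obtain ⟨x, rfl⟩ := (relabel d).surjective x
    rw [← relabel_parity, oddLieDer_relabel, oddLieDer_relabel,
      ((dualOperators ξ).opE_der a _).parity, map_neg, relabel_parity]

theorem relabel_sig (n : ℕ) (v : L) :
    relabel d ((extSym d).sig ξ n v) = ∑ e, ξ.repr v e • evenCoord e n := by
  conv_lhs => rw [← ξ.sum_repr v]
  simp only [map_sum, map_smul, SuperGen.sig_basis, relabel_evenGen]

theorem relabel_psi (n : ℕ) (v : L) : relabel d ((extSym d).psi ξ (n + 1) v) =
    (1 / ((n : ℂ) + 1)) • ∑ e, ξ.repr v e • oddCoord e n := by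
  conv_lhs => rw [← ξ.sum_repr v]
  simp only [map_sum, map_smul, Finset.smul_sum]
  refine Finset.sum_congr rfl fun e _ => ?_
  rw [extSym_psi_basis, relabel_oddLin, psi_neg_natCast e _ n.succ_pos, relabelGen,
    Finsupp.linearCombination_single, one_smul, oddLin_smul, smul_comm]
  congr 2
  exact Nat.cast_succ n

theorem lieDer_evenCoord (a b : Fin d) (m n : ℕ) : lieDer ξ a m (evenCoord b n) =
    if m ≤ n then ∑ e, ξ.repr ⁅ξ a, ξ b⁆ e • evenCoord e (n - m) else 0 := by
  have h1 : evenCoord b n = relabel d ((extSym d).sig ξ n (ξ b)) := by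
    rw [SuperGen.sig_basis, relabel_evenGen]
  rw [h1, lieDer_relabel, DualOperators.opT, LinearMap.add_apply, DualOperators.sigLow_sig,
    DualOperators.psiLow_sig, add_zero]
  split_ifs
  · rw [relabel_sig]
  · rw [map_zero]

theorem oddCoord_eq (b : Fin d) (n : ℕ) :
    oddCoord b n = relabel d (((n : ℂ) + 1) • (extSym d).psi ξ (n + 1) (ξ b)) := by
  have h2 : (n : ℂ) + 1 ≠ 0 := by exact_mod_cast n.succ_ne_zero
  rw [map_smul, relabel_psi, smul_smul, mul_one_div_cancel h2, one_smul,
    Finset.sum_eq_single b (fun e _ he => by simp [Finsupp.single_apply, Ne.symm he]) (by simp)]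
  simp

theorem lieDer_oddCoord (a b : Fin d) (m n : ℕ) : lieDer ξ a m (oddCoord b n) =
    if m ≤ n then ∑ e, ξ.repr ⁅ξ a, ξ b⁆ e • oddCoord e (n - m) else 0 := by
  have h2 : (n : ℂ) + 1 ≠ 0 := by exact_mod_cast n.succ_ne_zero
  rw [oddCoord_eq ξ, lieDer_relabel, DualOperators.opT, LinearMap.add_apply, map_smul, map_smul,
    DualOperators.sigLow_psi, DualOperators.psiLow_psi, smul_zero, zero_add]
  by_cases h : m ≤ n
  · have h3 : ((n - m : ℕ) : ℂ) + 1 ≠ 0 := by exact_mod_cast (n - m).succ_ne_zero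
    rw [if_pos h, if_pos (by omega), smul_smul, map_smul, show n + 1 - m = n - m + 1 by omega,
      relabel_psi, smul_smul]
    push_cast
    rw [show ((n : ℂ) + 1) * ((((n - m : ℕ) : ℂ) + 1) / ((n : ℂ) + 1)) *
      (1 / (((n - m : ℕ) : ℂ) + 1)) = 1 by field_simp, one_smul]
  · rw [if_neg h]
    split_ifs with h4
    · rw [show n + 1 - m = 0 by omega, SuperGen.psi_zero]
      simp
    · simp

theorem oddLieDer_evenCoord (a b : Fin d) (m n : ℕ) : oddLieDer ξ a m (evenCoord b n) = 0 := by
  have h1 : evenCoord b n = relabel d ((extSym d).sig ξ n (ξ b)) := by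
    rw [SuperGen.sig_basis, relabel_evenGen]
  rw [h1, oddLieDer_relabel, DualOperators.opE_sig, map_zero]

theorem oddLieDer_oddCoord (a b : Fin d) (m n : ℕ) : oddLieDer ξ a m (oddCoord b n) =
    if m ≤ n then ∑ e, ξ.repr ⁅ξ a, ξ b⁆ e • evenCoord e (n - m) else 0 := by
  have h2 : (n : ℂ) + 1 ≠ 0 := by exact_mod_cast n.succ_ne_zero
  rw [oddCoord_eq ξ, oddLieDer_relabel, map_smul, DualOperators.opE_psi]
  by_cases h : m ≤ n
  · rw [if_pos h, if_pos (by omega), smul_smul, map_smul, relabel_sig,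
      show n + 1 - (m + 1) = n - m by omega]
    push_cast
    rw [mul_one_div_cancel h2, one_smul]
  · rw [if_neg h, if_neg (by omega), smul_zero, map_zero]

/-- The functions on `𝔤[[z,s]]` that the Lie superalgebra `𝔤[z,s]` kills. -/
def LieInvariant (f : SuperPoly d) : Prop :=
  (∀ a m, lieDer ξ a m f = 0) ∧ ∀ a m, oddLieDer ξ a m f = 0

variable {ξ}

theorem koszul_preserved (hK : IsOrthonormal ξ) (hI : IsImaginary ξ) {f : ExtSym d}
    (hf : f ∈ koszul ξ) : dbar ξ f ∈ koszul ξ ∧ dbarStar ξ f ∈ koszul ξ := by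
  rw [mem_koszul] at hf
  constructor <;> rw [mem_koszul] <;> intro a
  · rw [dbar_eq, ← Module.End.mul_apply, (dualOperators ξ).opT_opD hK, Module.End.mul_apply, hf,
      map_zero]
  · rw [dbarStar_eq, ← Module.End.mul_apply,
      (dualOperators ξ).opT_opD' (metric_isSuperMetric ξ) hK hI, Module.End.mul_apply, hf,
      map_zero]

theorem metric_dbar (hK : IsOrthonormal ξ) (hI : IsImaginary ξ) (f g : ExtSym d) :
    metric (dbar ξ f) g = metric f (dbarStar ξ g) := by
  rw [dbar_eq, dbarStar_eq]
  exact (dualOperators ξ).opD_adjoint (metric_isSuperMetric ξ) hK hI f g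

/-- Harmonic forms correspond to the functions killed by `𝔤[z,s]`: the case `m = 0` of the even
derivations is membership in the Koszul complex. -/
theorem mem_harmonicForms_iff (hK : IsOrthonormal ξ) (hI : IsImaginary ξ) {f : ExtSym d} :
    f ∈ harmonicForms ξ ↔ LieInvariant ξ (relabel d f) := by
  have h0 : ∀ x : ExtSym d, relabel d x = 0 ↔ x = 0 := fun x =>
    map_eq_zero_iff (relabel d) (relabel d).injective
  simp only [LieInvariant, lieDer_relabel, oddLieDer_relabel, h0]
  rw [harmonicForms, Submodule.mem_inf, Submodule.mem_inf, LinearMap.mem_ker, LinearMap.mem_ker,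
    laplacian, dbar_eq, dbarStar_eq, mem_koszul, and_assoc]
  constructor
  · rintro ⟨h1, h2⟩
    exact ((dualOperators ξ).harmonic_iff (metric_isSuperMetric ξ) hK hI h1).1 h2
  · intro h
    have h1 := fun a => h.1 a 0
    exact ⟨h1, ((dualOperators ξ).harmonic_iff (metric_isSuperMetric ξ) hK hI h1).2 h⟩

end LieInvariant

/-! ### The tangent space of a linear group at the identity -/

section Tangent

variable {N : ℕ}

/-- The value of a polynomial in the matrix entries at a matrix over a commutative algebra. -/
abbrev evalAt {R : Type} [CommRing R] [Algebra ℂ R] (M : Matrix (Fin N) (Fin N) R) :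
    MvPolynomial (Fin N × Fin N) ℂ →ₐ[ℂ] R :=
  MvPolynomial.aeval fun ij => M ij.1 ij.2

section Eval

variable {R S : Type} [CommRing R] [Algebra ℂ R] [CommRing S] [Algebra ℂ S]

theorem map_evalAt (φ : R →ₐ[ℂ] S) (M : Matrix (Fin N) (Fin N) R)
    (p : MvPolynomial (Fin N × Fin N) ℂ) : φ (evalAt M p) = evalAt (M.map φ) p := by
  have h : φ.comp (evalAt M) = evalAt (M.map φ) := by
    ext ij
    simp
  exact DFunLike.congr_fun h p

theorem evalAt_algebraMap (M : Matrix (Fin N) (Fin N) ℂ) (p : MvPolynomial (Fin N × Fin N) ℂ) :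
    evalAt (M.map (algebraMap ℂ R)) p = algebraMap ℂ R (evalAt M p) :=
  (map_evalAt (Algebra.ofId ℂ R) M p).symm

theorem mem_groupIdeal {G : Subgroup (GL (Fin N) ℂ)} {p : MvPolynomial (Fin N × Fin N) ℂ} :
    p ∈ groupIdeal G ↔ ∀ g ∈ G, evalAt (g : Matrix (Fin N) (Fin N) ℂ) p = 0 := Iff.rfl

/-- The first-order Taylor expansion of a polynomial, as its value at a matrix over the dual
numbers. -/
theorem snd_evalAt (M : Matrix (Fin N) (Fin N) (DualNumber R))
    (p : MvPolynomial (Fin N × Fin N) ℂ) :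
    (evalAt M p).snd = ∑ ij : Fin N × Fin N,
      evalAt (M.map TrivSqZeroExt.fst) (MvPolynomial.pderiv ij p) * (M ij.1 ij.2).snd := by
  have hfst : ∀ p, (evalAt M p).fst = evalAt (M.map TrivSqZeroExt.fst) p :=
    map_evalAt (TrivSqZeroExt.fstHom ℂ R R) M
  induction p using MvPolynomial.induction_on with
  | C r => simp [TrivSqZeroExt.algebraMap_eq_inl']
  | add p q hp hq =>
    simp only [map_add, TrivSqZeroExt.snd_add, hp, hq, add_mul, Finset.sum_add_distrib]
  | mul_X p kl hp =>
    rw [map_mul, TrivSqZeroExt.snd_mul, hp, hfst, hfst]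
    simp only [Derivation.leibniz, map_add, smul_eq_mul, map_mul, MvPolynomial.pderiv_X,
      add_mul, Finset.sum_add_distrib, op_smul_eq_mul, Finset.sum_mul, MvPolynomial.aeval_X]
    congr 1
    · rw [Finset.sum_eq_single kl (fun ij _ h => by simp [Pi.single_apply, h]) (by simp)]
      simp
    · refine Finset.sum_congr rfl fun ij _ => ?_
      ring

end Eval

theorem leftInvariant_eq (X : Matrix (Fin N) (Fin N) ℂ) (p : MvPolynomial (Fin N × Fin N) ℂ) :
    leftInvariant X p = ∑ ij : Fin N × Fin N, MvPolynomial.pderiv ij p *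
      ∑ k, X k ij.2 • MvPolynomial.X (ij.1, k) := by
  induction p using MvPolynomial.induction_on with
  | C r => simp
  | add p q hp hq => simp only [map_add, hp, hq, add_mul, Finset.sum_add_distrib]
  | mul_X p kl hp =>
    rw [Derivation.leibniz, hp, leftInvariant, MvPolynomial.mkDerivation_X]
    simp only [Derivation.leibniz, smul_eq_mul, MvPolynomial.pderiv_X,
      add_mul, Finset.sum_add_distrib, Finset.mul_sum (Finset.univ : Finset (Fin N × Fin N))]
    congr 1
    · rw [Finset.sum_eq_single kl (fun ij _ h => by simp [Pi.single_apply, h]) (by simp)]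
      simp
    · refine Finset.sum_congr rfl fun ij _ => ?_
      ring

/-- The value of the left-invariant field of `X` at `g` is the derivative at `g` in the direction
`g X`. -/
theorem evalAt_leftInvariant {R : Type} [CommRing R] [Algebra ℂ R]
    (M : Matrix (Fin N) (Fin N) R) (X : Matrix (Fin N) (Fin N) ℂ)
    (p : MvPolynomial (Fin N × Fin N) ℂ) : evalAt M (leftInvariant X p) =
      ∑ ij : Fin N × Fin N, evalAt M (MvPolynomial.pderiv ij p) *
        (M * X.map (algebraMap ℂ R)) ij.1 ij.2 := by
  rw [leftInvariant_eq, map_sum]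
  refine Finset.sum_congr rfl fun ij _ => ?_
  simp only [map_mul, map_sum, map_smul, MvPolynomial.aeval_X, Matrix.mul_apply, Matrix.map_apply]
  simp only [Algebra.smul_def, mul_comm]

/-- The differential at the identity of a polynomial in the matrix entries. -/
def tangent : MvPolynomial (Fin N × Fin N) ℂ →ₗ[ℂ] Module.Dual ℂ (Matrix (Fin N) (Fin N) ℂ) where
  toFun p := ∑ ij : Fin N × Fin N, evalAt (1 : Matrix (Fin N) (Fin N) ℂ)
    (MvPolynomial.pderiv ij p) • Matrix.entryLinearMap ℂ ℂ ij.1 ij.2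
  map_add' p q := by simp only [map_add, add_smul, Finset.sum_add_distrib]
  map_smul' c p := by simp only [Derivation.map_smul, map_smul, smul_assoc, Finset.smul_sum,
    RingHom.id_apply]

theorem tangent_apply (p : MvPolynomial (Fin N × Fin N) ℂ) (X : Matrix (Fin N) (Fin N) ℂ) :
    tangent p X = evalAt 1 (leftInvariant X p) := by
  rw [evalAt_leftInvariant]
  simp [tangent, LinearMap.sum_apply]

/-- The pullback of polynomials in the matrix entries by a left translation. -/
def leftTranslate (g : Matrix (Fin N) (Fin N) ℂ) :
    MvPolynomial (Fin N × Fin N) ℂ →ₐ[ℂ] MvPolynomial (Fin N × Fin N) ℂ :=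
  MvPolynomial.aeval fun ij => ∑ k, g ij.1 k • MvPolynomial.X (k, ij.2)

theorem evalAt_leftTranslate {R : Type} [CommRing R] [Algebra ℂ R]
    (g : Matrix (Fin N) (Fin N) ℂ) (M : Matrix (Fin N) (Fin N) R)
    (p : MvPolynomial (Fin N × Fin N) ℂ) :
    evalAt M (leftTranslate g p) = evalAt (g.map (algebraMap ℂ R) * M) p := by
  have h : (evalAt M).comp (leftTranslate g) = evalAt (g.map (algebraMap ℂ R) * M) := by
    ext ij
    simp [leftTranslate, Matrix.mul_apply, Algebra.smul_def]
  exact DFunLike.congr_fun h p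

theorem leftInvariant_leftTranslate (g X : Matrix (Fin N) (Fin N) ℂ)
    (p : MvPolynomial (Fin N × Fin N) ℂ) :
    leftInvariant X (leftTranslate g p) = leftTranslate g (leftInvariant X p) := by
  induction p using MvPolynomial.induction_on with
  | C r =>
    rw [← MvPolynomial.algebraMap_eq, AlgHom.commutes, Derivation.map_algebraMap, map_zero]
  | add p q hp hq => simp only [map_add, hp, hq]
  | mul_X p ij hp =>
    have h : leftInvariant X (leftTranslate g (MvPolynomial.X ij)) =
        leftTranslate g (leftInvariant X (MvPolynomial.X ij)) := by
      simp only [leftInvariant, leftTranslate, MvPolynomial.mkDerivation_X, MvPolynomial.aeval_X,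
        map_sum, map_smul, Derivation.map_smul, Finset.smul_sum, smul_smul]
      rw [Finset.sum_comm]
      refine Finset.sum_congr rfl fun k _ => Finset.sum_congr rfl fun l _ => ?_
      rw [mul_comm]
    simp only [map_mul, Derivation.leibniz, hp, h, smul_eq_mul, map_add]

variable {G : Subgroup (GL (Fin N) ℂ)}

theorem leftTranslate_mem {g : GL (Fin N) ℂ} (hg : g ∈ G) {p : MvPolynomial (Fin N × Fin N) ℂ}
    (hp : p ∈ groupIdeal G) : leftTranslate (g : Matrix (Fin N) (Fin N) ℂ) p ∈ groupIdeal G := by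
  rw [mem_groupIdeal] at hp ⊢
  intro h hh
  rw [evalAt_leftTranslate]
  exact hp (g * h) (mul_mem hg hh)

theorem mem_lieAlgebraOf {X : Matrix (Fin N) (Fin N) ℂ} :
    X ∈ lieAlgebraOf G ↔ ∀ p ∈ groupIdeal G, tangent p X = 0 := by
  constructor
  · intro hX p hp
    rw [tangent_apply]
    exact hX p hp 1 (one_mem G)
  · intro hX p hp g hg
    have h := hX _ (leftTranslate_mem hg hp)
    rw [tangent_apply, leftInvariant_leftTranslate, evalAt_leftTranslate, Matrix.mul_one] at h
    exact h

/-- In finite dimension, the linear functions that vanish on the Lie algebra are the differentials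
of the equations of the group. -/
theorem exists_tangent_eq {φ : Module.Dual ℂ (Matrix (Fin N) (Fin N) ℂ)}
    (hφ : ∀ X ∈ lieAlgebraOf G, φ X = 0) : ∃ p ∈ groupIdeal G, tangent p = φ := by
  have h := Subspace.dualCoannihilator_dualAnnihilator_eq
    (W := ((groupIdeal G).restrictScalars ℂ).map tangent)
  have h2 : φ ∈ (((groupIdeal G).restrictScalars ℂ).map tangent).dualCoannihilator.dualAnnihilator :=
    (Submodule.mem_dualAnnihilator _).2 fun X hX => hφ X (mem_lieAlgebraOf.2 fun p hp =>
      Submodule.mem_dualCoannihilator _ |>.1 hX _ ⟨p, hp, rfl⟩)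
  rw [h] at h2
  exact h2

end Tangent

/-! ### Matrices with values in the Lie algebra of the group -/

section LieValued

variable {N d : ℕ} {G : Subgroup (GL (Fin N) ℂ)} (ξ : Module.Basis (Fin d) ℂ (lieAlgebraOf G))
  {R : Type} [CommRing R] [Algebra ℂ R]

/-- The extension of scalars of a linear function on matrices. -/
def extendScalars (φ : Module.Dual ℂ (Matrix (Fin N) (Fin N) ℂ)) :
    Matrix (Fin N) (Fin N) R →ₗ[R] R where
  toFun M := ∑ ij : Fin N × Fin N, algebraMap ℂ R (φ (Matrix.single ij.1 ij.2 1)) * M ij.1 ij.2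
  map_add' M M' := by simp only [Matrix.add_apply, mul_add, Finset.sum_add_distrib]
  map_smul' c M := by
    simp only [Matrix.smul_apply, smul_eq_mul, Finset.mul_sum, RingHom.id_apply, mul_left_comm]

theorem extendScalars_map (φ : Module.Dual ℂ (Matrix (Fin N) (Fin N) ℂ))
    (X : Matrix (Fin N) (Fin N) ℂ) :
    extendScalars φ (X.map (algebraMap ℂ R)) = algebraMap ℂ R (φ X) := by
  conv_rhs => rw [Matrix.matrix_eq_sum_single X]
  simp only [extendScalars, LinearMap.coe_mk, AddHom.coe_mk, Fintype.sum_prod_type, map_sum,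
    Matrix.map_apply, ← map_mul]
  refine Finset.sum_congr rfl fun i _ => Finset.sum_congr rfl fun j _ => ?_
  rw [show Matrix.single i j (X i j) = X i j • Matrix.single i j (1 : ℂ) by simp, map_smul,
    smul_eq_mul, mul_comm]

/-- The matrix `∑_a c_a ξ_a`. -/
def lieMatrix (c : Fin d → R) : Matrix (Fin N) (Fin N) R :=
  ∑ a, c a • (ξ a : Matrix (Fin N) (Fin N) ℂ).map (algebraMap ℂ R)

/-- Linear functions on matrices that extend the coordinates of `𝔤`. -/
theorem exists_coordinates : ∃ l : Fin d → Module.Dual ℂ (Matrix (Fin N) (Fin N) ℂ),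
    ∀ a (X : lieAlgebraOf G), l a X = ξ.repr X a := by
  have h : ∀ a, ∃ l : Module.Dual ℂ (Matrix (Fin N) (Fin N) ℂ),
      l.comp (lieAlgebraOf G).toSubmodule.subtype = ξ.coord a := fun a =>
    LinearMap.exists_extend (ξ.coord a)
  choose l hl using h
  exact ⟨l, fun a X => DFunLike.congr_fun (hl a) X⟩

theorem extendScalars_lieMatrix {l : Fin d → Module.Dual ℂ (Matrix (Fin N) (Fin N) ℂ)}
    (hl : ∀ a (X : lieAlgebraOf G), l a X = ξ.repr X a) (c : Fin d → R) (a : Fin d) :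
    extendScalars (l a) (lieMatrix ξ c) = c a := by
  simp only [lieMatrix, map_sum, map_smul, extendScalars_map, hl, Module.Basis.repr_self,
    smul_eq_mul]
  rw [Finset.sum_eq_single a (fun b _ hb => by simp [Finsupp.single_apply, hb]) (by simp)]
  simp

theorem lieMatrix_injective : Function.Injective (lieMatrix ξ (R := R)) := by
  obtain ⟨l, hl⟩ := exists_coordinates ξ
  intro c c' h
  ext a
  rw [← extendScalars_lieMatrix ξ hl c, h, extendScalars_lieMatrix ξ hl]

theorem eq_lieMatrix_of_tangent {l : Fin d → Module.Dual ℂ (Matrix (Fin N) (Fin N) ℂ)}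
    (hl : ∀ a (X : lieAlgebraOf G), l a X = ξ.repr X a) {M : Matrix (Fin N) (Fin N) R}
    (hM : ∀ p ∈ groupIdeal G, extendScalars (tangent p) M = 0) :
    M = lieMatrix ξ fun a => extendScalars (l a) M := by
  ext i j
  set φ : Module.Dual ℂ (Matrix (Fin N) (Fin N) ℂ) := Matrix.entryLinearMap ℂ ℂ i j -
    ∑ a, (ξ a : Matrix (Fin N) (Fin N) ℂ) i j • l a with hφ
  obtain ⟨p, hp, hpφ⟩ := exists_tangent_eq (G := G) (φ := φ) fun X hX => by
    have h1 := congrArg (fun Y : lieAlgebraOf G => (Y : Matrix (Fin N) (Fin N) ℂ) i j)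
      (ξ.sum_repr ⟨X, hX⟩)
    simp only [AddSubmonoidClass.coe_finset_sum, SetLike.val_smul, Matrix.sum_apply,
      Matrix.smul_apply, smul_eq_mul] at h1
    simp only [hφ, LinearMap.sub_apply, LinearMap.sum_apply, LinearMap.smul_apply, smul_eq_mul,
      hl _ ⟨X, hX⟩, Matrix.entryLinearMap_apply]
    rw [← h1, sub_eq_zero]
    exact Finset.sum_congr rfl fun a _ => mul_comm _ _
  have h2 := hM p hp
  have h3 : extendScalars φ M = M i j -
      ∑ a, algebraMap ℂ R ((ξ a : Matrix (Fin N) (Fin N) ℂ) i j) * extendScalars (l a) M := by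
    have h4 : ∑ kl : Fin N × Fin N, algebraMap ℂ R
        (Matrix.single kl.1 kl.2 (1 : ℂ) i j) * M kl.1 kl.2 = M i j := by
      rw [Finset.sum_eq_single (i, j) (fun kl _ hkl => ?_) (by simp)]
      · simp
      · rw [Matrix.single_apply, if_neg (fun h => hkl (Prod.ext h.1 h.2)), map_zero, zero_mul]
    simp only [extendScalars, LinearMap.coe_mk, AddHom.coe_mk, hφ, LinearMap.sub_apply,
      LinearMap.sum_apply, LinearMap.smul_apply, smul_eq_mul, map_sub, map_sum, map_mul, sub_mul,
      Finset.sum_sub_distrib, Matrix.entryLinearMap_apply, h4, Finset.sum_mul, Finset.mul_sum]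
    rw [Finset.sum_comm]
    simp only [mul_assoc]
  rw [hpφ, h3, sub_eq_zero] at h2
  rw [h2, lieMatrix, Matrix.sum_apply]
  refine Finset.sum_congr rfl fun a _ => ?_
  rw [Matrix.smul_apply, Matrix.map_apply, smul_eq_mul, mul_comm]

end LieValued

/-! ### Functions on the group that its Lie algebra kills -/

section Constant

variable {N d : ℕ} {G : Subgroup (GL (Fin N) ℂ)}

/-- The ideal of the identity matrix. -/
abbrev identityIdeal (N : ℕ) : Ideal (MvPolynomial (Fin N × Fin N) ℂ) :=
  RingHom.ker (evalAt (1 : Matrix (Fin N) (Fin N) ℂ))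

/-- The coordinates centred at the identity matrix. -/
def centred (ij : Fin N × Fin N) : MvPolynomial (Fin N × Fin N) ℂ :=
  MvPolynomial.X ij - MvPolynomial.C ((1 : Matrix (Fin N) (Fin N) ℂ) ij.1 ij.2)

theorem centred_mem (ij : Fin N × Fin N) : centred ij ∈ identityIdeal N := by
  rw [RingHom.mem_ker, centred, map_sub, MvPolynomial.aeval_X, ← MvPolynomial.algebraMap_eq,
    AlgHom.commutes]
  exact sub_self _

/-- The first-order Taylor formula at the identity. -/
theorem taylor_mem (p : MvPolynomial (Fin N × Fin N) ℂ) :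
    p - MvPolynomial.C (evalAt 1 p) - ∑ ij : Fin N × Fin N,
      MvPolynomial.C (evalAt 1 (MvPolynomial.pderiv ij p)) * centred ij ∈ identityIdeal N ^ 2 := by
  induction p using MvPolynomial.induction_on with
  | C r => simp
  | add p q hp hq =>
    convert add_mem hp hq using 1
    simp only [map_add, add_mul, Finset.sum_add_distrib]
    ring
  | mul_X p kl hp =>
    set T := ∑ ij : Fin N × Fin N,
      MvPolynomial.C (evalAt 1 (MvPolynomial.pderiv ij p)) * centred ij with hT
    have hTm : T ∈ identityIdeal N :=
      Ideal.sum_mem _ fun ij _ => Ideal.mul_mem_left _ _ (centred_mem ij)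
    have h1 : ∑ ij : Fin N × Fin N,
        MvPolynomial.C (evalAt 1 (MvPolynomial.pderiv ij (p * MvPolynomial.X kl))) * centred ij =
        MvPolynomial.C (evalAt 1 p) * centred kl +
          T * MvPolynomial.C ((1 : Matrix (Fin N) (Fin N) ℂ) kl.1 kl.2) := by
      have hd : ∀ ij : Fin N × Fin N, MvPolynomial.C (evalAt (1 : Matrix (Fin N) (Fin N) ℂ)
          (MvPolynomial.pderiv ij (p * MvPolynomial.X kl))) * centred ij =
          (if ij = kl then MvPolynomial.C (evalAt 1 p) * centred kl else 0) +
            MvPolynomial.C (evalAt 1 (MvPolynomial.pderiv ij p)) * centred ij *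
              MvPolynomial.C ((1 : Matrix (Fin N) (Fin N) ℂ) kl.1 kl.2) := fun ij => by
        rw [Derivation.leibniz, MvPolynomial.pderiv_X, smul_eq_mul, smul_eq_mul, map_add,
          map_mul, map_mul, MvPolynomial.aeval_X, map_add, map_mul, map_mul]
        by_cases h : ij = kl
        · subst h
          rw [if_pos rfl, Pi.single_eq_same, map_one, map_one]
          ring
        · rw [if_neg h, Pi.single_eq_of_ne (Ne.symm h), map_zero, map_zero]
          ring
      rw [Finset.sum_congr rfl fun ij _ => hd ij, Finset.sum_add_distrib, Finset.sum_ite_eq',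
        if_pos (Finset.mem_univ _), hT, Finset.sum_mul]
    have h2 : MvPolynomial.X kl = centred kl +
        MvPolynomial.C ((1 : Matrix (Fin N) (Fin N) ℂ) kl.1 kl.2) := by simp [centred]
    have h3 : T * centred kl ∈ identityIdeal N ^ 2 := by
      rw [pow_two]
      exact Ideal.mul_mem_mul hTm (centred_mem kl)
    convert add_mem (Ideal.mul_mem_right (MvPolynomial.X kl) _ hp) h3 using 1
    rw [h1, map_mul, MvPolynomial.aeval_X, map_mul, h2]
    ring

theorem mem_sq_of_tangent_eq_zero {p : MvPolynomial (Fin N × Fin N) ℂ} (hp : p ∈ identityIdeal N)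
    (h : tangent p = 0) : p ∈ identityIdeal N ^ 2 := by
  have h1 := taylor_mem p
  have h2 : ∀ ij : Fin N × Fin N,
      evalAt (1 : Matrix (Fin N) (Fin N) ℂ) (MvPolynomial.pderiv ij p) = 0 := fun ij => by
    have h3 := DFunLike.congr_fun h (Matrix.single ij.1 ij.2 1)
    simp only [tangent, LinearMap.coe_mk, AddHom.coe_mk, LinearMap.sum_apply,
      LinearMap.smul_apply, Matrix.entryLinearMap_apply, smul_eq_mul, LinearMap.zero_apply] at h3
    rw [Finset.sum_eq_single ij (fun kl _ hkl => ?_) (by simp)] at h3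
    · rwa [Matrix.single_apply_same, mul_one] at h3
    · rw [Matrix.single_apply, if_neg (fun h => hkl (Prod.ext h.1.symm h.2.symm)), mul_zero]
  rw [RingHom.mem_ker] at hp
  have hp' : evalAt (1 : Matrix (Fin N) (Fin N) ℂ) p = 0 := hp
  rw [hp', map_zero, sub_zero] at h1
  simpa only [h2, map_zero, zero_mul, Finset.sum_const_zero, sub_zero] using h1

/-- Every linear function on matrices is the differential of a function that vanishes at `1`. -/
theorem exists_mem_tangent_eq (φ : Module.Dual ℂ (Matrix (Fin N) (Fin N) ℂ)) :
    ∃ x ∈ identityIdeal N, tangent x = φ := by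
  refine ⟨∑ ij : Fin N × Fin N, φ (Matrix.single ij.1 ij.2 1) • centred ij,
    Submodule.sum_mem _ fun ij _ => by
      rw [MvPolynomial.smul_eq_C_mul]
      exact Ideal.mul_mem_left _ _ (centred_mem ij), ?_⟩
  ext X
  have h1 : ∀ ij : Fin N × Fin N, tangent (centred ij) X = X ij.1 ij.2 := fun ij => by
    rw [tangent_apply, centred, map_sub, ← MvPolynomial.algebraMap_eq, Derivation.map_algebraMap,
      sub_zero, leftInvariant, MvPolynomial.mkDerivation_X]
    simp [Matrix.one_apply]
  conv_rhs => rw [Matrix.matrix_eq_sum_single X]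
  simp only [map_sum, map_smul, LinearMap.sum_apply, LinearMap.smul_apply, h1, smul_eq_mul,
    Fintype.sum_prod_type]
  refine Finset.sum_congr rfl fun i _ => Finset.sum_congr rfl fun j _ => ?_
  rw [show Matrix.single i j (X i j) = X i j • Matrix.single i j (1 : ℂ) by simp, map_smul,
    smul_eq_mul, mul_comm]

theorem groupIdeal_le (G : Subgroup (GL (Fin N) ℂ)) : groupIdeal G ≤ identityIdeal N :=
  fun _ hp => hp 1 (one_mem G)

/-- There is an Euler field at the identity: a derivation that preserves the ideal of the group,
is a combination of left-invariant fields of the Lie algebra, and acts as the identity on the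
cotangent space of the group. -/
theorem exists_euler (ξ : Module.Basis (Fin d) ℂ (lieAlgebraOf G)) :
    ∃ E : Derivation ℂ (MvPolynomial (Fin N × Fin N) ℂ) (MvPolynomial (Fin N × Fin N) ℂ),
      (∀ p, (∀ X ∈ lieAlgebraOf G, leftInvariant X p ∈ groupIdeal G) → E p ∈ groupIdeal G) ∧
      (∀ p ∈ groupIdeal G, E p ∈ groupIdeal G) ∧
      ∀ p ∈ identityIdeal N, E p - p ∈ identityIdeal N ^ 2 ⊔ groupIdeal G := by
  obtain ⟨l, hl⟩ := exists_coordinates ξ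
  -- The `x a` are functions that vanish at `1`, with the coordinates of `𝔤` as differentials; the
  -- Euler field is `∑ x_a ξ_a`.
  choose x hx hxl using fun a => exists_mem_tangent_eq (l a)
  set E := ∑ a, x a • leftInvariant (ξ a : Matrix (Fin N) (Fin N) ℂ) with hE
  have hEp : ∀ p, E p = ∑ a, x a * leftInvariant (ξ a : Matrix (Fin N) (Fin N) ℂ) p := fun p => by
    have h := congrFun (map_sum Derivation.coeFnAddMonoidHom
      (fun a => x a • leftInvariant (ξ a : Matrix (Fin N) (Fin N) ℂ)) Finset.univ) p
    rw [Finset.sum_apply] at h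
    exact h
  have h1 : ∀ p, (∀ X ∈ lieAlgebraOf G, leftInvariant X p ∈ groupIdeal G) →
      E p ∈ groupIdeal G := fun p hp => by
    rw [hEp]
    exact Ideal.sum_mem _ fun a _ => Ideal.mul_mem_left _ _ (hp _ (ξ a).2)
  have h2 : ∀ p ∈ groupIdeal G, E p ∈ groupIdeal G := fun p hp => h1 p fun X hX => hX p hp
  have h3 : ∀ p, E p ∈ identityIdeal N := fun p => by
    rw [hEp]
    exact Ideal.sum_mem _ fun a _ => Ideal.mul_mem_right _ _ (hx a)
  have h4 : ∀ p ∈ identityIdeal N ^ 2, E p ∈ identityIdeal N ^ 2 := fun p hp => by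
    rw [pow_two] at hp ⊢
    refine Submodule.mul_induction_on hp (fun a ha b hb => ?_) fun a b ha hb => ?_
    · rw [Derivation.leibniz, smul_eq_mul, smul_eq_mul]
      exact add_mem (Ideal.mul_mem_mul ha (h3 b)) (Ideal.mul_mem_mul hb (h3 a))
    · rw [map_add]
      exact add_mem ha hb
  have h5 : ∀ b, E (x b) - x b ∈ identityIdeal N ^ 2 := fun b => by
    have h6 : E (x b) - x b = ∑ a, x a *
        (leftInvariant (ξ a : Matrix (Fin N) (Fin N) ℂ) (x b) -
          MvPolynomial.C (if a = b then 1 else 0)) := by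
      rw [hEp]
      simp only [mul_sub, Finset.sum_sub_distrib]
      congr 1
      rw [Finset.sum_eq_single b (fun a _ h => by simp [h]) (by simp)]
      simp
    rw [h6, pow_two]
    refine Ideal.sum_mem _ fun a _ => Ideal.mul_mem_mul (hx a) ?_
    have h7 := tangent_apply (x b) (ξ a)
    rw [hxl, hl, Module.Basis.repr_self, Finsupp.single_apply] at h7
    rw [RingHom.mem_ker, map_sub, ← h7, ← MvPolynomial.algebraMap_eq, AlgHom.commutes]
    exact sub_self _
  refine ⟨E, h1, h2, fun p hp => ?_⟩
  -- The differential of `p'` vanishes on `𝔤`, so up to second order `p'` is an equation of `G`.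
  obtain ⟨p', hp'⟩ : ∃ p', p' = p - ∑ a, tangent p (ξ a) • x a := ⟨_, rfl⟩
  obtain ⟨q, hq, hqp⟩ := exists_tangent_eq (G := G) (φ := tangent p') fun X hX => by
    simp only [hp', map_sub, map_sum, map_smul, LinearMap.sub_apply, LinearMap.sum_apply,
      LinearMap.smul_apply, hxl, hl _ ⟨X, hX⟩]
    have h8 := congrArg (fun Y : lieAlgebraOf G => tangent p (Y : Matrix (Fin N) (Fin N) ℂ))
      (ξ.sum_repr ⟨X, hX⟩)
    simp only [AddSubmonoidClass.coe_finset_sum, SetLike.val_smul, map_sum, map_smul,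
      smul_eq_mul] at h8
    rw [← h8, sub_eq_zero]
    exact Finset.sum_congr rfl fun a _ => mul_comm _ _
  have hr : p' - q ∈ identityIdeal N ^ 2 := by
    refine mem_sq_of_tangent_eq_zero (sub_mem ?_ (groupIdeal_le G hq)) ?_
    · rw [hp']
      refine sub_mem hp ?_
      refine Submodule.sum_mem _ fun a _ => ?_
      rw [MvPolynomial.smul_eq_C_mul]
      exact Ideal.mul_mem_left _ _ (hx a)
    · rw [map_sub, hqp, sub_self]
  have h8 : E p - p = ∑ a, tangent p (ξ a) • (E (x a) - x a) + (E (p' - q) - (p' - q)) +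
      (E q - q) := by
    have h9 : ∑ a, tangent p (ξ a) • (E (x a) - x a) = E (p - p') - (p - p') := by
      rw [hp', sub_sub_cancel, map_sum, ← Finset.sum_sub_distrib]
      simp only [Derivation.map_smul, smul_sub]
    have e1 : E (p - p') = E p - E p' := map_sub E p p'
    have e2 : E (p' - q) = E p' - E q := map_sub E p' q
    rw [h9, e1, e2]
    abel
  rw [h8]
  refine add_mem (Ideal.mem_sup_left (add_mem (Submodule.sum_mem _ fun a _ => ?_)
    (sub_mem (h4 _ hr) hr))) (Ideal.mem_sup_right (sub_mem (h2 q hq) hq))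
  rw [MvPolynomial.smul_eq_C_mul]
  exact Ideal.mul_mem_left _ _ (h5 a)

/-- A function killed by the Lie algebra that vanishes at the identity vanishes there to infinite
order, since the Euler field acts by `k` on the forms of degree `k`. -/
theorem mem_pow_sup_groupIdeal (ξ : Module.Basis (Fin d) ℂ (lieAlgebraOf G))
    {p : MvPolynomial (Fin N × Fin N) ℂ}
    (hp : ∀ X ∈ lieAlgebraOf G, leftInvariant X p ∈ groupIdeal G) (h1 : p ∈ identityIdeal N)
    (k : ℕ) : p ∈ identityIdeal N ^ k ⊔ groupIdeal G := by
  obtain ⟨E, hE1, hE2, hE3⟩ := exists_euler ξ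
  have key : ∀ k : ℕ, ∀ q ∈ identityIdeal N ^ k,
      E q - (k : ℂ) • q ∈ identityIdeal N ^ (k + 1) ⊔ groupIdeal G := fun k => by
    induction k with
    | zero =>
      intro q _
      have h : E q = E (q - MvPolynomial.C (evalAt 1 q)) := by
        rw [map_sub, ← MvPolynomial.algebraMap_eq, Derivation.map_algebraMap, sub_zero]
      have h2 : q - MvPolynomial.C (evalAt 1 q) ∈ identityIdeal N := by
        rw [RingHom.mem_ker, map_sub, ← MvPolynomial.algebraMap_eq, AlgHom.commutes]
        exact sub_self _
      have h3 := hE3 _ h2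
      rw [Nat.cast_zero, zero_smul, sub_zero, zero_add, pow_one, h]
      have h4 : identityIdeal N ^ 2 ⊔ groupIdeal G ≤ identityIdeal N ⊔ groupIdeal G :=
        sup_le_sup_right (Ideal.pow_le_self two_ne_zero) _
      have h5 := add_mem (h4 h3) (Ideal.mem_sup_left h2)
      rwa [sub_add_cancel] at h5
    | succ k ih =>
      intro q hq
      rw [pow_succ'] at hq
      refine Submodule.mul_induction_on hq (fun a ha b hb => ?_) fun a b ha hb => ?_
      · have h2 : E (a * b) - ((k + 1 : ℕ) : ℂ) • (a * b) =
            a * (E b - (k : ℂ) • b) + (E a - a) * b := by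
          rw [Derivation.leibniz]
          simp only [smul_eq_mul, MvPolynomial.smul_eq_C_mul]
          push_cast
          simp only [map_add, map_one]
          ring
        rw [h2]
        have h3 : ∀ u ∈ identityIdeal N ^ 1, ∀ n, ∀ v ∈ identityIdeal N ^ n ⊔ groupIdeal G,
            u * v ∈ identityIdeal N ^ (n + 1) ⊔ groupIdeal G := fun u hu n v hv => by
          obtain ⟨v1, hv1, v2, hv2, rfl⟩ := Submodule.mem_sup.1 hv
          rw [mul_add]
          refine add_mem (Ideal.mem_sup_left ?_) (Ideal.mem_sup_right (Ideal.mul_mem_left _ _ hv2))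
          rw [pow_succ', ← pow_one (identityIdeal N), pow_one]
          rw [pow_one] at hu
          simpa using Ideal.mul_mem_mul hu hv1
        refine add_mem (h3 a (by rwa [pow_one]) _ _ (ih b hb)) ?_
        obtain ⟨v1, hv1, v2, hv2, hv⟩ := Submodule.mem_sup.1 (hE3 a ha)
        rw [← hv, add_mul]
        refine add_mem (Ideal.mem_sup_left ?_) (Ideal.mem_sup_right (Ideal.mul_mem_right _ _ hv2))
        rw [show k + 1 + 1 = 2 + k by omega, pow_add]
        exact Ideal.mul_mem_mul hv1 hb
      · rw [map_add, smul_add, add_sub_add_comm]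
        exact add_mem ha hb
  induction k with
  | zero => simp
  | succ k ih =>
    rcases Nat.eq_zero_or_pos k with rfl | hk
    · rw [zero_add, pow_one]
      exact Ideal.mem_sup_left h1
    obtain ⟨u, hu, i, hi, rfl⟩ := Submodule.mem_sup.1 ih
    refine add_mem ?_ (Ideal.mem_sup_right hi)
    -- `E u` is zero on `G`, and it is `k u` up to higher order.
    have hEu : E u ∈ groupIdeal G := by
      have h2 := sub_mem (hE1 _ hp) (hE2 _ hi)
      rwa [map_add, add_sub_cancel_right] at h2
    have h3 := sub_mem (Ideal.mem_sup_right hEu) (key k u hu)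
    rw [sub_sub_cancel] at h3
    have h4 : u = (MvPolynomial.C (k : ℂ)⁻¹) * ((k : ℂ) • u) := by
      rw [← MvPolynomial.smul_eq_C_mul, smul_smul, inv_mul_cancel₀ (by exact_mod_cast hk.ne'),
        one_smul]
    rw [h4]
    exact Ideal.mul_mem_left _ _ h3

/-- By Krull's intersection theorem, a function killed by the Lie algebra that vanishes at the
identity vanishes on the group near the identity. -/
theorem exists_mul_mem_groupIdeal (ξ : Module.Basis (Fin d) ℂ (lieAlgebraOf G))
    {p : MvPolynomial (Fin N × Fin N) ℂ}
    (hp : ∀ X ∈ lieAlgebraOf G, leftInvariant X p ∈ groupIdeal G) (h1 : p ∈ identityIdeal N) :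
    ∃ r ∈ identityIdeal N, (1 - r) * p ∈ groupIdeal G := by
  set π := Ideal.Quotient.mk (groupIdeal G)
  have h2 : π p ∈ (⨅ i : ℕ, ((identityIdeal N).map π) ^ i • ⊤ :
      Submodule (MvPolynomial (Fin N × Fin N) ℂ ⧸ groupIdeal G) _) := by
    rw [Submodule.mem_iInf]
    intro k
    rw [smul_eq_mul, Ideal.mul_top, ← Ideal.map_pow]
    obtain ⟨u, hu, i, hi, hui⟩ := Submodule.mem_sup.1 (mem_pow_sup_groupIdeal ξ hp h1 k)
    have h3 : π p = π u := by
      rw [← hui, map_add, Ideal.Quotient.eq_zero_iff_mem.2 hi, add_zero]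
    rw [h3]
    exact Ideal.mem_map_of_mem _ hu
  obtain ⟨⟨r, hr⟩, hrp⟩ := (Ideal.mem_iInf_smul_pow_eq_bot_iff _ _).1 h2
  obtain ⟨r, hr', rfl⟩ := (Ideal.mem_map_iff_of_surjective π Ideal.Quotient.mk_surjective).1 hr
  refine ⟨r, hr', ?_⟩
  rw [← Ideal.Quotient.eq_zero_iff_mem, map_mul, map_sub, map_one, sub_mul, one_mul]
  exact sub_eq_zero.2 hrp.symm

theorem continuous_evalAt (q : MvPolynomial (Fin N × Fin N) ℂ) :
    Continuous fun g : G => evalAt ((g : GL (Fin N) ℂ) : Matrix (Fin N) (Fin N) ℂ) q :=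
  (MvPolynomial.continuous_eval q).comp (continuous_pi fun ij =>
    (Units.continuous_val.comp continuous_subtype_val).matrix_elem ij.1 ij.2)

/-- On a connected group, the functions that the Lie algebra kills are constant. -/
theorem evalAt_eq_of_leftInvariant (hconn : IsConnected (G : Set (GL (Fin N) ℂ)))
    (ξ : Module.Basis (Fin d) ℂ (lieAlgebraOf G)) {p : MvPolynomial (Fin N × Fin N) ℂ}
    (hp : ∀ X ∈ lieAlgebraOf G, leftInvariant X p ∈ groupIdeal G) {g : GL (Fin N) ℂ}
    (hg : g ∈ G) : evalAt (g : Matrix (Fin N) (Fin N) ℂ) p = evalAt 1 p := by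
  have : ConnectedSpace G := isConnected_iff_connectedSpace.1 hconn
  have hloc : IsLocallyConstant fun g : G =>
      evalAt ((g : GL (Fin N) ℂ) : Matrix (Fin N) (Fin N) ℂ) p := by
    rw [IsLocallyConstant.iff_eventually_eq]
    intro x
    -- By translation from `x` to the identity.
    obtain ⟨r, hr, hrp⟩ := exists_mul_mem_groupIdeal ξ
      (p := leftTranslate ((x : GL (Fin N) ℂ) : Matrix (Fin N) (Fin N) ℂ) p -
        MvPolynomial.C (evalAt ((x : GL (Fin N) ℂ) : Matrix (Fin N) (Fin N) ℂ) p))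
      (fun X hX => by
        rw [map_sub, ← MvPolynomial.algebraMap_eq, Derivation.map_algebraMap, sub_zero,
          leftInvariant_leftTranslate]
        exact leftTranslate_mem x.2 (hp X hX)) (by
        rw [RingHom.mem_ker, map_sub, evalAt_leftTranslate, Matrix.mul_one,
          ← MvPolynomial.algebraMap_eq, AlgHom.commutes]
        exact sub_self _)
    -- On the neighbourhood of `x` where `q ≠ 1`, the factor `1 - r` can be cancelled.
    set q := leftTranslate (((x : GL (Fin N) ℂ)⁻¹ : GL (Fin N) ℂ) : Matrix (Fin N) (Fin N) ℂ) r
    have hq : ∀ y : G, evalAt ((y : GL (Fin N) ℂ) : Matrix (Fin N) (Fin N) ℂ) q =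
        evalAt (((x⁻¹ * y : G) : GL (Fin N) ℂ) : Matrix (Fin N) (Fin N) ℂ) r := fun y =>
      evalAt_leftTranslate _ _ r
    have hx : evalAt ((x : GL (Fin N) ℂ) : Matrix (Fin N) (Fin N) ℂ) q ≠ 1 := by
      rw [hq, inv_mul_cancel]
      exact fun h => zero_ne_one ((RingHom.mem_ker.1 hr).symm.trans h)
    filter_upwards [(continuous_evalAt q).continuousAt.eventually_ne hx] with y hy
    rw [hq] at hy
    have h1 := hrp _ (x⁻¹ * y).2
    change evalAt _ _ = 0 at h1
    rw [map_mul, map_sub, map_one, mul_eq_zero, sub_eq_zero] at h1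
    have h2 := h1.resolve_left (Ne.symm hy)
    rw [map_sub, evalAt_leftTranslate, ← MvPolynomial.algebraMap_eq, AlgHom.commutes,
      sub_eq_zero] at h2
    refine Eq.trans ?_ h2
    congr 1
    change evalAt _ = evalAt (((x : GL (Fin N) ℂ) * ((x⁻¹ * y : G) : GL (Fin N) ℂ) :
      GL (Fin N) ℂ) : Matrix (Fin N) (Fin N) ℂ)
    simp
  exact hloc.apply_eq_of_preconnectedSpace ⟨g, hg⟩ 1

end Constant

/-! ### The points of the group over commutative algebras -/

section Points

variable {N d : ℕ} {G : Subgroup (GL (Fin N) ℂ)} {R S : Type} [CommRing R] [Algebra ℂ R]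
  [CommRing S] [Algebra ℂ S]

theorem mem_groupPoints {g : GL (Fin N) R} : g ∈ groupPoints G R ↔
    ∀ p ∈ groupIdeal G, evalAt (g : Matrix (Fin N) (Fin N) R) p = 0 := Iff.rfl

theorem map_mem_groupPoints (φ : R →ₐ[ℂ] S) {g : GL (Fin N) R} (hg : g ∈ groupPoints G R) :
    Matrix.GeneralLinearGroup.map (φ : R →+* S) g ∈ groupPoints G S := fun p hp => by
  have h := congrArg φ (mem_groupPoints.1 hg p hp)
  rw [map_evalAt, map_zero] at h
  exact h

/-- An element of `R ⊗ ℂ[x_ij]` that vanishes on `G` vanishes at the `R`-points of `G`: its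
components in a basis of `R` are equations of `G`. -/
theorem lift_evalAt_eq_zero {t : R ⊗[ℂ] MvPolynomial (Fin N × Fin N) ℂ}
    (ht : ∀ g ∈ G, Algebra.TensorProduct.lift (AlgHom.id ℂ R)
      (evalAt ((g : Matrix (Fin N) (Fin N) ℂ).map (algebraMap ℂ R)))
      (fun _ _ => Commute.all _ _) t = 0)
    {g : GL (Fin N) R} (hg : g ∈ groupPoints G R) : Algebra.TensorProduct.lift (AlgHom.id ℂ R)
      (evalAt (g : Matrix (Fin N) (Fin N) R)) (fun _ _ => Commute.all _ _) t = 0 := by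
  obtain ⟨c, rfl⟩ := TensorProduct.eq_repr_basis_left (Module.Basis.ofVectorSpace ℂ R) t
  set b := Module.Basis.ofVectorSpace ℂ R
  have hc : ∀ i, c i ∈ groupIdeal G := fun i => by
    rw [mem_groupIdeal]
    intro g hg
    have h := ht g hg
    simp only [Finsupp.sum, map_sum, Algebra.TensorProduct.lift_tmul, AlgHom.id_apply,
      evalAt_algebraMap] at h
    simp only [mul_comm (b _), ← Algebra.smul_def] at h
    by_cases hi : i ∈ c.support
    · exact linearIndependent_iff'.1 b.linearIndependent _ _ h i hi
    · rw [Finsupp.notMem_support_iff.1 hi, map_zero]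
  simp only [Finsupp.sum, map_sum, Algebra.TensorProduct.lift_tmul]
  exact Finset.sum_eq_zero fun i _ => by rw [mem_groupPoints.1 hg _ (hc i), mul_zero]

/-- The product is a polynomial map that preserves `G`, so it preserves the equations over every algebra.
This is checked in one factor at a time. -/
theorem mul_mem_groupPoints {g h : GL (Fin N) R} (hg : g ∈ groupPoints G R)
    (hh : h ∈ groupPoints G R) : g * h ∈ groupPoints G R := fun p hp => by
  set φ : MvPolynomial (Fin N × Fin N) ℂ →ₐ[ℂ] R ⊗[ℂ] MvPolynomial (Fin N × Fin N) ℂ :=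
    MvPolynomial.aeval fun ij => ∑ k, (h : Matrix (Fin N) (Fin N) R) k ij.2 ⊗ₜ
      MvPolynomial.X (ij.1, k)
  have key : ∀ M : Matrix (Fin N) (Fin N) R, Algebra.TensorProduct.lift (AlgHom.id ℂ R)
      (evalAt M) (fun _ _ => Commute.all _ _) (φ p) =
        evalAt (M * (h : Matrix (Fin N) (Fin N) R)) p := fun M => by
    have h1 : (Algebra.TensorProduct.lift (AlgHom.id ℂ R) (evalAt M)
        (fun _ _ => Commute.all _ _)).comp φ = evalAt (M * (h : Matrix (Fin N) (Fin N) R)) := by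
      ext ij
      simp [φ, Matrix.mul_apply, mul_comm]
    exact DFunLike.congr_fun h1 p
  have h2 := lift_evalAt_eq_zero (t := φ p) (fun g' hg' => by
    rw [key, ← evalAt_leftTranslate]
    exact mem_groupPoints.1 hh _ (leftTranslate_mem hg' hp)) hg
  rw [key] at h2
  exact h2

/-- The unipotent matrix `1 + t X`, where `t² = 0`. -/
def oneAdd (t : R) (ht : t * t = 0) (X : Matrix (Fin N) (Fin N) ℂ) : GL (Fin N) R where
  val := 1 + t • X.map (algebraMap ℂ R)
  inv := 1 - t • X.map (algebraMap ℂ R)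
  val_inv := by
    rw [mul_sub, mul_one, add_mul, one_mul, smul_mul_smul_comm, ht, zero_smul]
    abel
  inv_val := by
    rw [mul_add, mul_one, sub_mul, one_mul, smul_mul_smul_comm, ht, zero_smul]
    abel

theorem oneAdd_mem_groupPoints {t : R} (ht : t * t = 0) {X : Matrix (Fin N) (Fin N) ℂ}
    (hX : X ∈ lieAlgebraOf G) : oneAdd t ht X ∈ groupPoints G R := fun p hp => by
  have key : ∀ p, evalAt (1 + t • X.map (algebraMap ℂ R)) p =
      algebraMap ℂ R (evalAt 1 p) + t * algebraMap ℂ R (evalAt 1 (leftInvariant X p)) := fun p => by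
    induction p using MvPolynomial.induction_on with
    | C r =>
      rw [← MvPolynomial.algebraMap_eq, AlgHom.commutes, AlgHom.commutes,
        Derivation.map_algebraMap, map_zero, map_zero, mul_zero, add_zero]
      rfl
    | add p q hp hq =>
      simp only [map_add, hp, hq]
      ring
    | mul_X p ij hp =>
      have h1 : evalAt (1 : Matrix (Fin N) (Fin N) ℂ) (leftInvariant X (MvPolynomial.X ij)) =
          X ij.1 ij.2 := by
        rw [leftInvariant, MvPolynomial.mkDerivation_X]
        simp [Matrix.one_apply]
      have h2 : algebraMap ℂ R ((1 : Matrix (Fin N) (Fin N) ℂ) ij.1 ij.2) =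
          (1 : Matrix (Fin N) (Fin N) R) ij.1 ij.2 := by
        rw [Matrix.one_apply, Matrix.one_apply]
        split_ifs <;> simp
      have h3 : evalAt (1 : Matrix (Fin N) (Fin N) ℂ) (leftInvariant X (p * MvPolynomial.X ij)) =
          evalAt 1 p * X ij.1 ij.2 +
            (1 : Matrix (Fin N) (Fin N) ℂ) ij.1 ij.2 * evalAt 1 (leftInvariant X p) := by
        rw [Derivation.leibniz, smul_eq_mul, smul_eq_mul, map_add, map_mul, map_mul, h1,
          MvPolynomial.aeval_X]
      rw [map_mul, hp, h3, map_mul, MvPolynomial.aeval_X, MvPolynomial.aeval_X, map_mul, map_add,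
        map_mul, map_mul, h2, Matrix.add_apply, Matrix.smul_apply, Matrix.map_apply, smul_eq_mul]
      linear_combination algebraMap ℂ R (evalAt 1 (leftInvariant X p)) *
        algebraMap ℂ R (X ij.1 ij.2) * ht
  refine (key p).trans ?_
  rw [← tangent_apply, mem_lieAlgebraOf.1 hX p hp, groupIdeal_le G hp]
  simp

variable (ξ : Module.Basis (Fin d) ℂ (lieAlgebraOf G))

/-- The tangent space of `G` at the identity, over `R`, is `𝔤 ⊗ R`. -/
theorem exists_lieMatrix_of_mem_groupPoints {M : Matrix (Fin N) (Fin N) R}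
    {u : GL (Fin N) (DualNumber R)} (hu : u ∈ groupPoints G (DualNumber R))
    (hfst : (u : Matrix (Fin N) (Fin N) (DualNumber R)).map TrivSqZeroExt.fst = 1)
    (hsnd : (u : Matrix (Fin N) (Fin N) (DualNumber R)).map TrivSqZeroExt.snd = M) :
    ∃ c, M = lieMatrix ξ c := by
  obtain ⟨l, hl⟩ := exists_coordinates ξ
  refine ⟨_, eq_lieMatrix_of_tangent ξ hl fun p hp => ?_⟩
  have h1 := snd_evalAt (u : Matrix (Fin N) (Fin N) (DualNumber R)) p
  rw [mem_groupPoints.1 hu p hp, TrivSqZeroExt.snd_zero, hfst] at h1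
  refine Eq.trans (Finset.sum_congr rfl fun ij _ => ?_) h1.symm
  have h2 : (1 : Matrix (Fin N) (Fin N) R) = (1 : Matrix (Fin N) (Fin N) ℂ).map
      (algebraMap ℂ R) := by simp
  rw [h2, evalAt_algebraMap, ← hsnd, Matrix.map_apply]
  congr 2
  simp only [tangent, LinearMap.coe_mk, AddHom.coe_mk, LinearMap.sum_apply,
    LinearMap.smul_apply, Matrix.entryLinearMap_apply, smul_eq_mul]
  rw [Finset.sum_eq_single ij (fun kl _ hkl => ?_) (by simp), Matrix.single_apply_same, mul_one]
  rw [Matrix.single_apply, if_neg (fun h => hkl (Prod.ext h.1.symm h.2.symm)), mul_zero]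

end Points

section Semisimple

variable {N d : ℕ} {G : Subgroup (GL (Fin N) ℂ)} {ξ : Module.Basis (Fin d) ℂ (lieAlgebraOf G)}

/-- A Lie algebra with an orthonormal basis for the Killing form is perfect, so its matrices have
trace zero. -/
theorem trace_eq_zero (hK : IsOrthonormal ξ) (X : lieAlgebraOf G) :
    (X : Matrix (Fin N) (Fin N) ℂ).trace = 0 := by
  rw [← hK.casimir X]
  simp only [AddSubmonoidClass.coe_finset_sum, Matrix.trace_sum, LieSubalgebra.coe_bracket]
  refine Finset.sum_eq_zero fun a _ => ?_
  rw [Ring.lie_def, Matrix.trace_sub, Matrix.trace_mul_comm, sub_self]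

/-- The determinant as a polynomial in the matrix entries. -/
def detPoly (N : ℕ) : MvPolynomial (Fin N × Fin N) ℂ :=
  (Matrix.of fun i j => MvPolynomial.X (i, j)).det

theorem evalAt_detPoly {R : Type} [CommRing R] [Algebra ℂ R] (M : Matrix (Fin N) (Fin N) R) :
    evalAt M (detPoly N) = M.det := by
  rw [detPoly, AlgHom.map_det]
  congr 1
  ext i j
  simp

/-- The determinant is killed by the trace-free Lie algebra of `G`, so it is constant on `G`. -/
theorem detPoly_sub_one_mem (hconn : IsConnected (G : Set (GL (Fin N) ℂ)))
    (hK : IsOrthonormal ξ) : detPoly N - 1 ∈ groupIdeal G := by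
  rw [mem_groupIdeal]
  intro g hg
  have h : ∀ X ∈ lieAlgebraOf G, leftInvariant X (detPoly N) ∈ groupIdeal G := fun X hX => by
    rw [mem_groupIdeal]
    intro g _
    set A : Matrix (Fin N) (Fin N) (DualNumber ℂ) :=
      (g : Matrix (Fin N) (Fin N) ℂ).map (algebraMap ℂ _) *
        (1 + (TrivSqZeroExt.inr 1 : DualNumber ℂ) • X.map (algebraMap ℂ _)) with hA
    have h1 := snd_evalAt A (detPoly N)
    have hA' : A = (g : Matrix (Fin N) (Fin N) ℂ).map (algebraMap ℂ _) +
        (TrivSqZeroExt.inr 1 : DualNumber ℂ) •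
          ((g : Matrix (Fin N) (Fin N) ℂ) * X).map (algebraMap ℂ _) := by
      rw [hA, mul_add, mul_one, mul_smul_comm, Matrix.map_mul]
    have h2 : A.map TrivSqZeroExt.fst = g := by
      ext i j
      simp [hA', TrivSqZeroExt.algebraMap_eq_inl', -Matrix.map_mul]
    have h3 : ∀ i j, (A i j).snd = ((g : Matrix (Fin N) (Fin N) ℂ) * X) i j := fun i j => by
      simp [hA', TrivSqZeroExt.algebraMap_eq_inl', -Matrix.map_mul]
    have h4 : A.det.snd = 0 := by
      have h5 : (X.map (algebraMap ℂ (DualNumber ℂ))).trace = 0 := by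
        have h6 := congrArg (algebraMap ℂ (DualNumber ℂ)) (trace_eq_zero hK ⟨X, hX⟩)
        rwa [map_zero, Matrix.trace, map_sum] at h6
      rw [hA, Matrix.det_mul, Matrix.det_one_add_smul, h5, pow_two,
        TrivSqZeroExt.inr_mul_inr, zero_mul, mul_zero, add_zero, add_zero, mul_one,
        ← (algebraMap ℂ (DualNumber ℂ)).mapMatrix_apply, ← RingHom.map_det]
      simp [TrivSqZeroExt.algebraMap_eq_inl']
    rw [evalAt_leftInvariant, ← h4, ← evalAt_detPoly, h1, h2]
    simp [h3]
  rw [map_sub, map_one, evalAt_eq_of_leftInvariant hconn ξ h hg, evalAt_detPoly, Matrix.det_one,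
    sub_self]

variable {R : Type} [CommRing R] [Algebra ℂ R]

/-- As `det = 1` on `G`, the inverse of a point is its adjugate, which is polynomial. -/
theorem inv_mem_groupPoints (hdet : detPoly N - 1 ∈ groupIdeal G) {g : GL (Fin N) R}
    (hg : g ∈ groupPoints G R) : g⁻¹ ∈ groupPoints G R := fun p hp => by
  have hinv : ∀ {S : Type} [CommRing S] [Algebra ℂ S] (g : GL (Fin N) S),
      g ∈ groupPoints G S → ((g⁻¹ : GL (Fin N) S) : Matrix (Fin N) (Fin N) S) =
        (g : Matrix (Fin N) (Fin N) S).adjugate := fun {S} _ _ g hg => by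
    have h := mem_groupPoints.1 hg _ hdet
    rw [map_sub, map_one, evalAt_detPoly, sub_eq_zero] at h
    rw [Matrix.coe_units_inv, Matrix.inv_def, h, Ring.inverse_one, one_smul]
  set φ : MvPolynomial (Fin N × Fin N) ℂ →ₐ[ℂ] MvPolynomial (Fin N × Fin N) ℂ :=
    MvPolynomial.aeval fun ij => (Matrix.of fun i j => MvPolynomial.X (i, j)).adjugate ij.1 ij.2
  have key : ∀ {S : Type} [CommRing S] [Algebra ℂ S] (M : Matrix (Fin N) (Fin N) S),
      evalAt M (φ p) = evalAt M.adjugate p := fun {S} _ _ M => by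
    have h1 : (evalAt M).comp φ = evalAt M.adjugate := by
      ext ij
      have h2 := (evalAt M).map_adjugate (Matrix.of fun i j => MvPolynomial.X (i, j))
      have h3 := congrFun (congrFun h2 ij.1) ij.2
      simp only [AlgHom.mapMatrix_apply, Matrix.map_apply] at h3
      simp only [φ, AlgHom.comp_apply, MvPolynomial.aeval_X, h3]
      congr 2
      ext i j
      simp
    exact DFunLike.congr_fun h1 p
  have h4 : φ p ∈ groupIdeal G := by
    rw [mem_groupIdeal]
    intro h hh
    rw [key, ← hinv h fun q hq => mem_groupIdeal.1 hq h hh]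
    exact hp _ (inv_mem hh)
  have h5 := mem_groupPoints.1 hg _ h4
  rw [key, ← hinv g hg] at h5
  exact h5

/-- The homomorphism `r ↦ r + ε D r` given by a derivation `D`. -/
def dualHom (D : Derivation ℂ R R) : R →ₐ[ℂ] DualNumber R :=
  AlgHom.ofLinearMap ((TrivSqZeroExt.inlAlgHom ℂ R R).toLinearMap +
      (TrivSqZeroExt.inrHom R R).restrictScalars ℂ ∘ₗ (D : R →ₗ[ℂ] R))
    (by simp) fun x y => by
      ext <;> simp [mul_comm]

theorem map_fst_mul (A B : Matrix (Fin N) (Fin N) (DualNumber R)) :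
    (A * B).map TrivSqZeroExt.fst = A.map TrivSqZeroExt.fst * B.map TrivSqZeroExt.fst :=
  Matrix.map_mul (f := (TrivSqZeroExt.fstHom R R R : DualNumber R →+* R))

theorem map_snd_mul (A B : Matrix (Fin N) (Fin N) (DualNumber R)) :
    (A * B).map TrivSqZeroExt.snd = A.map TrivSqZeroExt.fst * B.map TrivSqZeroExt.snd +
      A.map TrivSqZeroExt.snd * B.map TrivSqZeroExt.fst := by
  ext i j
  have h := map_sum (TrivSqZeroExt.sndHom R R) (fun k => A i k * B k j) Finset.univ
  rw [Matrix.map_apply, Matrix.mul_apply]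
  refine h.trans ?_
  simp [Matrix.mul_apply, Finset.sum_add_distrib]

theorem map_fst_inl (g : GL (Fin N) R) : ((Matrix.GeneralLinearGroup.map
    (TrivSqZeroExt.inlAlgHom ℂ R R : R →+* DualNumber R) g : GL (Fin N) (DualNumber R)) :
    Matrix (Fin N) (Fin N) (DualNumber R)).map TrivSqZeroExt.fst = g := by
  ext i j
  simp

theorem map_snd_inl (g : GL (Fin N) R) : ((Matrix.GeneralLinearGroup.map
    (TrivSqZeroExt.inlAlgHom ℂ R R : R →+* DualNumber R) g : GL (Fin N) (DualNumber R)) :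
    Matrix (Fin N) (Fin N) (DualNumber R)).map TrivSqZeroExt.snd = 0 := by
  ext i j
  simp

/-- The logarithmic derivative of a point of the group has values in the Lie algebra. -/
theorem exists_map_derivation_mul_inv (hdet : detPoly N - 1 ∈ groupIdeal G) {g : GL (Fin N) R}
    (hg : g ∈ groupPoints G R) (D : Derivation ℂ R R) : ∃ c,
    (g : Matrix (Fin N) (Fin N) R).map D * ((g⁻¹ : GL (Fin N) R) : Matrix (Fin N) (Fin N) R) =
      lieMatrix ξ c := by
  have hu := mul_mem_groupPoints (map_mem_groupPoints (dualHom D) hg)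
    (map_mem_groupPoints (TrivSqZeroExt.inlAlgHom ℂ R R) (inv_mem_groupPoints hdet hg))
  have h1 : ((Matrix.GeneralLinearGroup.map (dualHom D : R →+* DualNumber R) g : GL (Fin N)
      (DualNumber R)) : Matrix (Fin N) (Fin N) (DualNumber R)).map TrivSqZeroExt.fst = g := by
    ext i j
    simp [dualHom]
  have h2 : ((Matrix.GeneralLinearGroup.map (dualHom D : R →+* DualNumber R) g : GL (Fin N)
      (DualNumber R)) : Matrix (Fin N) (Fin N) (DualNumber R)).map TrivSqZeroExt.snd =
      (g : Matrix (Fin N) (Fin N) R).map D := by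
    ext i j
    simp [dualHom]
  refine exists_lieMatrix_of_mem_groupPoints ξ hu ?_ ?_
  · rw [Units.val_mul, map_fst_mul, h1, map_fst_inl, ← Units.val_mul, mul_inv_cancel, Units.val_one]
  · rw [Units.val_mul, map_snd_mul, h1, h2, map_fst_inl, map_snd_inl, mul_zero, zero_add]

theorem sum_smul_lieMatrix {ι : Type} [Fintype ι] (r : ι → R) (c : ι → Fin d → R) :
    ∑ i, r i • lieMatrix ξ (c i) = lieMatrix ξ fun b => ∑ i, r i * c i b := by
  simp only [lieMatrix, Finset.smul_sum, Finset.sum_smul, smul_smul]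
  exact Finset.sum_comm

/-- The adjoint action of a point of the group preserves the Lie algebra. -/
theorem exists_conj_lieMatrix (hdet : detPoly N - 1 ∈ groupIdeal G) {g : GL (Fin N) R}
    (hg : g ∈ groupPoints G R) (c : Fin d → R) : ∃ c',
    (g : Matrix (Fin N) (Fin N) R) * lieMatrix ξ c *
      ((g⁻¹ : GL (Fin N) R) : Matrix (Fin N) (Fin N) R) = lieMatrix ξ c' := by
  have hε : (TrivSqZeroExt.inr 1 : DualNumber R) * TrivSqZeroExt.inr 1 = 0 :=
    TrivSqZeroExt.inr_mul_inr R 1 1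
  have key : ∀ a, ∃ c', (g : Matrix (Fin N) (Fin N) R) *
      (ξ a : Matrix (Fin N) (Fin N) ℂ).map (algebraMap ℂ R) *
      ((g⁻¹ : GL (Fin N) R) : Matrix (Fin N) (Fin N) R) = lieMatrix ξ c' := fun a => by
    have hu := mul_mem_groupPoints (mul_mem_groupPoints
      (map_mem_groupPoints (TrivSqZeroExt.inlAlgHom ℂ R R) hg)
      (oneAdd_mem_groupPoints (R := DualNumber R) hε (ξ a).2))
      (map_mem_groupPoints (TrivSqZeroExt.inlAlgHom ℂ R R) (inv_mem_groupPoints hdet hg))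
    have h1 : ((oneAdd (TrivSqZeroExt.inr 1 : DualNumber R) hε (ξ a : Matrix (Fin N) (Fin N) ℂ) :
        GL (Fin N) (DualNumber R)) : Matrix (Fin N) (Fin N) (DualNumber R)).map
        TrivSqZeroExt.fst = 1 := by
      ext i j
      by_cases h : i = j <;> simp [oneAdd, Matrix.one_apply, h]
    have h2 : ((oneAdd (TrivSqZeroExt.inr 1 : DualNumber R) hε (ξ a : Matrix (Fin N) (Fin N) ℂ) :
        GL (Fin N) (DualNumber R)) : Matrix (Fin N) (Fin N) (DualNumber R)).map
        TrivSqZeroExt.snd = (ξ a : Matrix (Fin N) (Fin N) ℂ).map (algebraMap ℂ R) := by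
      ext i j
      have h3 : ∀ r : ℂ, (algebraMap ℂ (DualNumber R) r).fst = algebraMap ℂ R r :=
        (TrivSqZeroExt.fstHom ℂ R R).commutes
      by_cases h : i = j <;> simp [oneAdd, Matrix.one_apply, h, h3]
    refine exists_lieMatrix_of_mem_groupPoints ξ hu ?_ ?_
    · rw [Units.val_mul, Units.val_mul, map_fst_mul, map_fst_mul, h1, map_fst_inl, map_fst_inl,
        Matrix.mul_one, ← Units.val_mul, mul_inv_cancel, Units.val_one]
    · rw [Units.val_mul, Units.val_mul, map_snd_mul, map_snd_mul, h2, map_fst_inl, map_snd_inl,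
        map_fst_inl, map_snd_inl, mul_zero, zero_add, zero_mul, add_zero]
  choose c' hc' using key
  refine ⟨_, Eq.trans ?_ (sum_smul_lieMatrix (ξ := ξ) c c')⟩
  rw [lieMatrix, Matrix.mul_sum, Matrix.sum_mul]
  refine Finset.sum_congr rfl fun a _ => ?_
  rw [← hc', mul_smul_comm, smul_mul_assoc]

end Semisimple

/-! ### Functions on the formal super-disk -/

section Disk

variable {B : Type} [Ring B] [Algebra ℂ B] {ℬ : ZMod 2 → Submodule ℂ B} [GradedAlgebra ℬ]
  [SuperCommutative ℬ]

/-- The coefficient of `z^n`. -/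
def diskEven (ℬ : ZMod 2 → Submodule ℂ B) [GradedAlgebra ℬ] [SuperCommutative ℬ] (n : ℕ) :
    superDisk ℬ →ₗ[ℂ] B where
  toFun x := PowerSeries.coeff n (x : DualNumber (PowerSeries B)).fst
  map_add' _ _ := rfl
  map_smul' _ _ := rfl

/-- The coefficient of `s z^n`. -/
def diskOdd (ℬ : ZMod 2 → Submodule ℂ B) [GradedAlgebra ℬ] [SuperCommutative ℬ] (n : ℕ) :
    superDisk ℬ →ₗ[ℂ] B where
  toFun x := PowerSeries.coeff n (x : DualNumber (PowerSeries B)).snd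
  map_add' _ _ := rfl
  map_smul' _ _ := rfl

theorem diskEven_mem (n : ℕ) (x : superDisk ℬ) : diskEven ℬ n x ∈ ℬ 0 := (x.2 n).1

theorem diskOdd_mem (n : ℕ) (x : superDisk ℬ) : diskOdd ℬ n x ∈ ℬ 1 := (x.2 n).2

theorem disk_ext {x y : superDisk ℬ} (h0 : ∀ n, diskEven ℬ n x = diskEven ℬ n y)
    (h1 : ∀ n, diskOdd ℬ n x = diskOdd ℬ n y) : x = y :=
  Subtype.ext (TrivSqZeroExt.ext (PowerSeries.ext h0) (PowerSeries.ext h1))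

theorem diskEven_mul (n : ℕ) (x y : superDisk ℬ) : diskEven ℬ n (x * y) =
    ∑ p ∈ Finset.HasAntidiagonal.antidiagonal n, diskEven ℬ p.1 x * diskEven ℬ p.2 y :=
  PowerSeries.coeff_mul n _ _

theorem diskOdd_mul (n : ℕ) (x y : superDisk ℬ) : diskOdd ℬ n (x * y) =
    ∑ p ∈ Finset.HasAntidiagonal.antidiagonal n,
      (diskEven ℬ p.1 x * diskOdd ℬ p.2 y + diskOdd ℬ p.1 x * diskEven ℬ p.2 y) := by
  rw [Finset.sum_add_distrib]
  exact congrArg₂ (fun a b : B => a + b) (PowerSeries.coeff_mul n _ _) (PowerSeries.coeff_mul n _ _)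

/-- The element `∑ u_n z^n + s ∑ v_n z^n`. -/
def diskMk (u v : ℕ → B) (hu : ∀ n, u n ∈ ℬ 0) (hv : ∀ n, v n ∈ ℬ 1) : superDisk ℬ :=
  ⟨(PowerSeries.mk u, PowerSeries.mk v), fun n => by
    constructor
    · exact (PowerSeries.coeff_mk n u).symm ▸ hu n
    · exact (PowerSeries.coeff_mk n v).symm ▸ hv n⟩

theorem diskEven_mk (u v : ℕ → B) (hu : ∀ n, u n ∈ ℬ 0) (hv : ∀ n, v n ∈ ℬ 1) (n : ℕ) :
    diskEven ℬ n (diskMk u v hu hv) = u n := PowerSeries.coeff_mk n u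

theorem diskOdd_mk (u v : ℕ → B) (hu : ∀ n, u n ∈ ℬ 0) (hv : ∀ n, v n ∈ ℬ 1) (n : ℕ) :
    diskOdd ℬ n (diskMk u v hu hv) = v n := PowerSeries.coeff_mk n v

theorem diskEven_algebraMap (n : ℕ) (r : ℂ) :
    diskEven ℬ n (algebraMap ℂ (superDisk ℬ) r) = if n = 0 then algebraMap ℂ B r else 0 := by
  change PowerSeries.coeff n (algebraMap ℂ (DualNumber (PowerSeries B)) r).fst = _
  rw [TrivSqZeroExt.algebraMap_eq_inl', TrivSqZeroExt.fst_inl, PowerSeries.algebraMap_apply,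
    PowerSeries.coeff_C]

theorem diskOdd_algebraMap (n : ℕ) (r : ℂ) :
    diskOdd ℬ n (algebraMap ℂ (superDisk ℬ) r) = 0 := by
  change PowerSeries.coeff n (algebraMap ℂ (DualNumber (PowerSeries B)) r).snd = _
  rw [TrivSqZeroExt.algebraMap_eq_inl', TrivSqZeroExt.snd_inl, map_zero]

variable {d : ℕ}

theorem diskEven_component (x : SuperPoint ℬ d) (a : Fin d) (n : ℕ) :
    diskEven ℬ n (x.component a) = x.eval (evenCoord a n) := by
  change PowerSeries.coeff n (TrivSqZeroExt.inl (PowerSeries.mk fun m => x.eval (evenCoord a m)) +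
    TrivSqZeroExt.inr _ : DualNumber (PowerSeries B)).fst = _
  rw [TrivSqZeroExt.fst_add, TrivSqZeroExt.fst_inl, TrivSqZeroExt.fst_inr, add_zero,
    PowerSeries.coeff_mk]

theorem diskOdd_component (x : SuperPoint ℬ d) (a : Fin d) (n : ℕ) :
    diskOdd ℬ n (x.component a) = x.eval (oddCoord a n) := by
  change PowerSeries.coeff n (TrivSqZeroExt.inl _ + TrivSqZeroExt.inr
    (PowerSeries.mk fun m => x.eval (oddCoord a m)) : DualNumber (PowerSeries B)).snd = _
  rw [TrivSqZeroExt.snd_add, TrivSqZeroExt.snd_inl, TrivSqZeroExt.snd_inr, zero_add,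
    PowerSeries.coeff_mk]

theorem matrix_eq_lieMatrix {N : ℕ} {G : Subgroup (GL (Fin N) ℂ)}
    (ξ : Module.Basis (Fin d) ℂ (lieAlgebraOf G)) (x : SuperPoint ℬ d) :
    x.matrix G ξ = lieMatrix ξ x.component := rfl

end Disk

/-! ### The parity grading of a free supercommutative algebra -/

section Grading

variable {κ I A : Type} [Ring A] [Algebra ℂ A]

/-- The grading by parity. -/
def SuperGen.grading (S : SuperGen κ I A) (i : ZMod 2) : Submodule ℂ A :=
  LinearMap.ker (S.parity.toLinearMap - ((-1 : ℂ) ^ i.val) • LinearMap.id)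

theorem SuperGen.mem_grading (S : SuperGen κ I A) {i : ZMod 2} {x : A} :
    x ∈ S.grading i ↔ S.parity x = ((-1 : ℂ) ^ i.val) • x := by
  rw [SuperGen.grading, LinearMap.mem_ker, LinearMap.sub_apply, sub_eq_zero]
  rfl

theorem SuperGen.mem_grading_zero (S : SuperGen κ I A) {x : A} :
    x ∈ S.grading 0 ↔ S.parity x = x := by
  rw [S.mem_grading, ZMod.val_zero, pow_zero, one_smul]

theorem SuperGen.mem_grading_one (S : SuperGen κ I A) {x : A} :
    x ∈ S.grading 1 ↔ S.parity x = -x := by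
  rw [S.mem_grading, show (1 : ZMod 2).val = 1 from rfl, pow_one, neg_one_smul]

instance (S : SuperGen κ I A) : SetLike.GradedMonoid S.grading where
  one_mem := S.mem_grading_zero.2 (map_one _)
  mul_mem i j x y hx hy := by
    rw [S.mem_grading] at hx hy ⊢
    have h : ∀ i j : ZMod 2, (-1 : ℤ) ^ (i + j).val = (-1) ^ i.val * (-1) ^ j.val := by decide
    have h2 : (-1 : ℂ) ^ (i + j).val = (-1) ^ i.val * (-1) ^ j.val := by exact_mod_cast h i j
    rw [map_mul, hx, hy, smul_mul_smul_comm, h2]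

theorem isInternal_of_isCompl {M : Type} [AddCommGroup M] [Module ℂ M]
    (ℳ : ZMod 2 → Submodule ℂ M) (h : IsCompl (ℳ 0) (ℳ 1)) : DirectSum.IsInternal ℳ :=
  (DirectSum.isInternal_submodule_iff_isCompl ℳ (i := 0) (j := 1) (by decide) (by
    ext i
    simp only [Set.mem_univ, Set.mem_insert_iff, Set.mem_singleton_iff, true_iff]
    revert i
    decide)).2 h

theorem SuperGen.isCompl_grading (S : SuperGen κ I A) : IsCompl (S.grading 0) (S.grading 1) := by
  refine ⟨Submodule.disjoint_def.2 fun x h0 h1 => ?_, codisjoint_iff_le_sup.2 fun x _ => ?_⟩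
  · rw [S.mem_grading_zero] at h0
    rw [S.mem_grading_one, h0] at h1
    have h2 : (2 : ℂ) • x = 0 := by rw [two_smul, ← sub_neg_eq_add, ← h1, sub_self]
    exact (smul_eq_zero.1 h2).resolve_left two_ne_zero
  · have h2 : x = (1 / 2 : ℂ) • (x + S.parity x) + (1 / 2 : ℂ) • (x - S.parity x) := by
      rw [← smul_add, add_add_sub_cancel, ← two_smul ℂ x, smul_smul]
      norm_num
    rw [h2]
    refine Submodule.add_mem_sup (Submodule.smul_mem _ _ ?_) (Submodule.smul_mem _ _ ?_)
    · rw [S.mem_grading_zero, map_add, S.parity_parity, add_comm]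
    · rw [S.mem_grading_one, map_sub, S.parity_parity, neg_sub]

instance (S : SuperGen κ I A) : GradedAlgebra S.grading :=
  { (isInternal_of_isCompl _ S.isCompl_grading).chooseDecomposition with }

instance (S : SuperGen κ I A) : SuperCommutative S.grading where
  even_comm a ha b := by
    rw [S.mem_grading_zero] at ha
    induction b using super_induction S with
    | one => simp
    | add x y hx hy => rw [mul_add, add_mul, hx, hy]
    | smul c x hx => rw [mul_smul_comm, smul_mul_assoc, hx]
    | odd k x hx => rw [mul_assoc, ← hx, ← mul_assoc, ← mul_assoc, S.odd_mul, ha]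
    | even i x hx => rw [mul_assoc, ← hx, ← mul_assoc, ← mul_assoc, S.even_mul]
  odd_anticomm a ha b hb := by
    rw [S.mem_grading_one] at ha hb
    have key : ∀ b, a * b = S.parity b * a := fun b => by
      induction b using super_induction S with
      | one => simp
      | add x y hx hy => rw [mul_add, map_add, add_mul, hx, hy]
      | smul c x hx => rw [mul_smul_comm, map_smul, smul_mul_assoc, hx]
      | odd k x hx =>
        rw [map_mul, S.parity_odd, neg_mul, neg_mul, mul_assoc, ← hx, ← mul_assoc, ← mul_assoc,
          S.odd_mul, ha, neg_mul, neg_mul, neg_neg]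
      | even i x hx =>
        rw [map_mul, S.parity_even, mul_assoc, ← hx, ← mul_assoc, ← mul_assoc, S.even_mul]
    rw [key, hb, neg_mul]

end Grading

/-! ### Invariant functions are killed by the Lie superalgebra -/

section Infinitesimal

variable {N d : ℕ} {G : Subgroup (GL (Fin N) ℂ)} {ξ : Module.Basis (Fin d) ℂ (lieAlgebraOf G)}

theorem lieMatrix_add {R : Type} [CommRing R] [Algebra ℂ R] (c c' : Fin d → R) :
    lieMatrix ξ (fun b => c b + c' b) = lieMatrix ξ c + lieMatrix ξ c' := by
  simp only [lieMatrix, add_smul, Finset.sum_add_distrib]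

/-- Matrices with values in `𝔤 ⊗ R` multiply by the structure constants of `𝔤`. -/
theorem lieMatrix_bracket {R : Type} [CommRing R] [Algebra ℂ R] (c c' : Fin d → R) :
    lieMatrix ξ c * lieMatrix ξ c' - lieMatrix ξ c' * lieMatrix ξ c =
      lieMatrix ξ fun b => ∑ a, ∑ e, ξ.repr ⁅ξ a, ξ e⁆ b • (c a * c' e) := by
  have h1 : ∀ a e, (ξ a : Matrix (Fin N) (Fin N) ℂ) * ξ e - ξ e * ξ a =
      ∑ b, ξ.repr ⁅ξ a, ξ e⁆ b • (ξ b : Matrix (Fin N) (Fin N) ℂ) := fun a e => by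
    have h2 := congrArg (fun Y : lieAlgebraOf G => (Y : Matrix (Fin N) (Fin N) ℂ))
      (ξ.sum_repr ⁅ξ a, ξ e⁆)
    simp only [AddSubmonoidClass.coe_finset_sum, SetLike.val_smul, LieSubalgebra.coe_bracket,
      Ring.lie_def] at h2
    exact h2.symm
  have h3 : ∀ a e, (ξ a : Matrix (Fin N) (Fin N) ℂ).map (algebraMap ℂ R) *
      (ξ e : Matrix (Fin N) (Fin N) ℂ).map (algebraMap ℂ R) -
      (ξ e : Matrix (Fin N) (Fin N) ℂ).map (algebraMap ℂ R) *
        (ξ a : Matrix (Fin N) (Fin N) ℂ).map (algebraMap ℂ R) =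
      ∑ b, ξ.repr ⁅ξ a, ξ e⁆ b • (ξ b : Matrix (Fin N) (Fin N) ℂ).map (algebraMap ℂ R) :=
    fun a e => by
      have h4 := congrArg (fun M : Matrix (Fin N) (Fin N) ℂ =>
        (Algebra.ofId ℂ R).mapMatrix M) (h1 a e)
      simp only [map_sub, map_mul, map_sum, map_smul] at h4
      exact h4
  have h5 : lieMatrix ξ c' * lieMatrix ξ c = ∑ a, ∑ e, (c a * c' e) •
      ((ξ e : Matrix (Fin N) (Fin N) ℂ).map (algebraMap ℂ R) *
        (ξ a : Matrix (Fin N) (Fin N) ℂ).map (algebraMap ℂ R)) := by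
    rw [lieMatrix, lieMatrix, Finset.sum_mul_sum, Finset.sum_comm]
    simp only [smul_mul_smul_comm, mul_comm (c' _)]
  rw [h5, lieMatrix, lieMatrix, Finset.sum_mul_sum, ← Finset.sum_sub_distrib]
  simp only [smul_mul_smul_comm, ← Finset.sum_sub_distrib, ← smul_sub, h3, lieMatrix,
    Finset.smul_sum, Finset.sum_smul]
  conv_rhs => rw [Finset.sum_comm]
  refine Finset.sum_congr rfl fun a _ => ?_
  conv_rhs => rw [Finset.sum_comm]
  refine Finset.sum_congr rfl fun e _ => Finset.sum_congr rfl fun b _ => ?_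
  rw [smul_comm, smul_assoc]

/-- Conjugation by `1 - t ξ_a` moves the coordinates by `t` times the derivation `lieDer`: the sign makes
up for passing from `𝔤` to its coordinates. -/
theorem oneAdd_conj (hK : IsOrthonormal ξ) {R : Type} [CommRing R] [Algebra ℂ R] {t : R}
    (ht : t * t = 0) (a : Fin d) (c : Fin d → R) :
    ((oneAdd t ht (-(ξ a : Matrix (Fin N) (Fin N) ℂ)) : GL (Fin N) R) :
        Matrix (Fin N) (Fin N) R) * lieMatrix ξ c *
      (((oneAdd t ht (-(ξ a : Matrix (Fin N) (Fin N) ℂ)))⁻¹ : GL (Fin N) R) :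
        Matrix (Fin N) (Fin N) R) =
      lieMatrix ξ fun b => c b + t * ∑ e, ξ.repr ⁅ξ a, ξ b⁆ e • c e := by
  set A := (ξ a : Matrix (Fin N) (Fin N) ℂ).map (algebraMap ℂ R) with hA
  have h1 : lieMatrix ξ (Pi.single a 1) = A := by
    rw [lieMatrix, Finset.sum_eq_single a (fun b _ hb => by rw [Pi.single_eq_of_ne hb, zero_smul])
      (by simp), Pi.single_eq_same, one_smul]
  have h2 : A * lieMatrix ξ c - lieMatrix ξ c * A =
      -lieMatrix ξ fun b => ∑ e, ξ.repr ⁅ξ a, ξ b⁆ e • c e := by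
    rw [← h1, lieMatrix_bracket, lieMatrix, lieMatrix, ← Finset.sum_neg_distrib]
    refine Finset.sum_congr rfl fun b _ => ?_
    rw [← neg_smul, ← Finset.sum_neg_distrib,
      Finset.sum_eq_single a (fun a' _ ha' => by simp [Pi.single_eq_of_ne ha']) (by simp)]
    congr 1
    refine Finset.sum_congr rfl fun e _ => ?_
    rw [hK.repr_lie_swap, Pi.single_eq_same, one_mul, neg_smul]
  have h3 : (-(ξ a : Matrix (Fin N) (Fin N) ℂ)).map (algebraMap ℂ R) = -A := by
    ext i j
    simp [hA]
  have h4 : (lieMatrix ξ fun b => t * ∑ e, ξ.repr ⁅ξ a, ξ b⁆ e • c e) =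
      -(t • (A * lieMatrix ξ c - lieMatrix ξ c * A)) := by
    rw [h2, smul_neg, neg_neg, lieMatrix, lieMatrix, Finset.smul_sum]
    simp only [smul_smul]
  rw [lieMatrix_add, h4]
  change (1 + t • _) * _ * (1 - t • _) = _
  rw [h3]
  have h5 : ∀ M : Matrix (Fin N) (Fin N) R, t • t • M = 0 := fun M => by
    rw [smul_smul, ht, zero_smul]
  simp only [smul_neg, sub_neg_eq_add, add_mul, mul_add, one_mul, mul_one, neg_mul, smul_mul_assoc,
    mul_smul_comm, smul_add, h5, neg_zero, add_zero, smul_sub]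
  abel

variable {B : Type} [Ring B] [Algebra ℂ B] {ℬ : ZMod 2 → Submodule ℂ B} [GradedAlgebra ℬ]
  [SuperCommutative ℬ]

/-- An invariant function is invariant under the points `1 - T ξ_a`, where `T² = 0`. -/
theorem eval_eq_of_mem_invariantFunctions (hK : IsOrthonormal ξ) {f : SuperPoly d}
    (hf : f ∈ invariantFunctions G ξ) {T : superDisk ℬ} (hT : T * T = 0) (a : Fin d)
    {x y : SuperPoint ℬ d} (h : ∀ b, y.component b =
      x.component b + T * ∑ e, ξ.repr ⁅ξ a, ξ b⁆ e • x.component e) : y.eval f = x.eval f := by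
  refine hf B ℬ (oneAdd T hT (-(ξ a : Matrix (Fin N) (Fin N) ℂ))) x y
    (oneAdd_mem_groupPoints hT (neg_mem (ξ a).2)) ?_
  rw [matrix_eq_lieMatrix, matrix_eq_lieMatrix, oneAdd_conj hK hT, ← funext h]

theorem sum_antidiagonal_ite (n m : ℕ) (t : B) (g : ℕ → B) :
    ∑ p ∈ Finset.HasAntidiagonal.antidiagonal n, (if p.1 = m then t else 0) * g p.2 =
      if m ≤ n then t * g (n - m) else 0 := by
  split_ifs with h
  · rw [Finset.sum_eq_single (m, n - m)]
    · simp
    · rintro ⟨i, j⟩ hij hne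
      rw [Finset.HasAntidiagonal.mem_antidiagonal] at hij
      rw [if_neg, zero_mul]
      rintro rfl
      exact hne (by ext <;> simp; omega)
    · intro h2
      exact absurd (Finset.HasAntidiagonal.mem_antidiagonal.2 (by simp [h])) h2
  · refine Finset.sum_eq_zero fun p hp => ?_
    rw [Finset.HasAntidiagonal.mem_antidiagonal] at hp
    rw [if_neg (by omega), zero_mul]

/-- The homomorphism `f ↦ φ(f) + w φ(D f)`. -/
def perturb (φ : SuperPoly d →ₐ[ℂ] B) (w : B) (D : Module.End ℂ (SuperPoly d)) (h1 : D 1 = 0)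
    (hmul : ∀ x y, w * φ (D (x * y)) = φ x * (w * φ (D y)) + w * φ (D x) * φ y)
    (hsq : ∀ x y, w * φ (D x) * (w * φ (D y)) = 0) : SuperPoly d →ₐ[ℂ] B :=
  AlgHom.ofLinearMap (φ.toLinearMap + LinearMap.mulLeft ℂ w ∘ₗ φ.toLinearMap ∘ₗ D)
    (by simp [h1]) fun x y => by
      simp only [LinearMap.add_apply, LinearMap.comp_apply, LinearMap.mulLeft_apply,
        AlgHom.toLinearMap_apply, hmul, map_mul]
      rw [add_mul, mul_add, mul_add, hsq, add_zero]
      abel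

theorem perturb_apply (φ : SuperPoly d →ₐ[ℂ] B) (w : B) (D : Module.End ℂ (SuperPoly d)) (h1 hmul hsq)
    (f : SuperPoly d) : perturb φ w D h1 hmul hsq f = φ f + w * φ (D f) := rfl

/-- An invariant function is killed by `lieDer`, up to an even parameter of square zero. -/
theorem mul_eval_lieDer (hK : IsOrthonormal ξ) {f : SuperPoly d}
    (hf : f ∈ invariantFunctions G ξ) (x : SuperPoint ℬ d) {t : B} (ht : t ∈ ℬ 0)
    (htt : t * t = 0) (a : Fin d) (m : ℕ) : t * x.eval (lieDer ξ a m f) = 0 := by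
  have hc : ∀ b, t * b = b * t := SuperCommutative.even_comm t ht
  have hD := lieDer_evenDer ξ a m
  -- `T = t z^m`
  set T : superDisk ℬ := diskMk (fun n => if n = m then t else 0) 0 (fun n => by
    split_ifs
    · exact ht
    · exact zero_mem _) (fun n => zero_mem _) with hTdef
  have hT0 : ∀ n z, diskEven ℬ n (T * z) = if m ≤ n then t * diskEven ℬ (n - m) z else 0 :=
    fun n z => by
      rw [diskEven_mul]
      simp only [hTdef, diskEven_mk]
      exact sum_antidiagonal_ite n m t fun k => diskEven ℬ k z
  have hT1 : ∀ n z, diskOdd ℬ n (T * z) = if m ≤ n then t * diskOdd ℬ (n - m) z else 0 :=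
    fun n z => by
      rw [diskOdd_mul]
      simp only [hTdef, diskEven_mk, diskOdd_mk, Pi.zero_apply, zero_mul, add_zero]
      exact sum_antidiagonal_ite n m t fun k => diskOdd ℬ k z
  have hTT : T * T = 0 := disk_ext (fun n => by
    rw [hT0, map_zero, hTdef, diskEven_mk]
    split_ifs <;> simp [htt]) fun n => by
    rw [hT1, map_zero, hTdef, diskOdd_mk]
    simp
  -- The point `y` conjugate to `x` by `1 - T ξ_a` is `x + t x ∘ lieDer`.
  set ψ := perturb x.eval t (lieDer ξ a m) hD.map_one (fun p q => by
      rw [hD.leibniz, map_add, map_mul, map_mul, mul_add, ← mul_assoc, ← mul_assoc, ← mul_assoc,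
        hc (x.eval p), add_comm]) (fun p q => by
      rw [hc (x.eval (lieDer ξ a m p)), mul_assoc, ← mul_assoc t, htt, zero_mul, mul_zero]) with hψ
  have he : ∀ b n, ψ (evenCoord b n) = x.eval (evenCoord b n) + if m ≤ n then
      t * ∑ e, ξ.repr ⁅ξ a, ξ b⁆ e • x.eval (evenCoord e (n - m)) else 0 := fun b n => by
    rw [hψ, perturb_apply, lieDer_evenCoord]
    split_ifs <;> simp
  have ho : ∀ b n, ψ (oddCoord b n) = x.eval (oddCoord b n) + if m ≤ n then
      t * ∑ e, ξ.repr ⁅ξ a, ξ b⁆ e • x.eval (oddCoord e (n - m)) else 0 := fun b n => by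
    rw [hψ, perturb_apply, lieDer_oddCoord]
    split_ifs <;> simp
  have hmul : ∀ {i : ZMod 2} {u : B}, u ∈ ℬ i → t * u ∈ ℬ i := fun {i u} hu => by
    simpa using SetLike.mul_mem_graded ht hu
  set y : SuperPoint ℬ d := ⟨ψ, fun b n => by
    rw [he]
    refine add_mem (x.even_mem _ _) ?_
    split_ifs
    · exact hmul (Submodule.sum_mem _ fun e _ => Submodule.smul_mem _ _ (x.even_mem _ _))
    · exact zero_mem _, fun b n => by
    rw [ho]
    refine add_mem (x.odd_mem _ _) ?_
    split_ifs
    · exact hmul (Submodule.sum_mem _ fun e _ => Submodule.smul_mem _ _ (x.odd_mem _ _))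
    · exact zero_mem _⟩ with hy
  have h := eval_eq_of_mem_invariantFunctions hK hf hTT a (x := x) (y := y) fun b =>
    disk_ext (fun n => by
      rw [map_add, hT0, diskEven_component, diskEven_component]
      simp only [map_sum, map_smul, diskEven_component]
      exact he b n) fun n => by
      rw [map_add, hT1, diskOdd_component, diskOdd_component]
      simp only [map_sum, map_smul, diskOdd_component]
      exact ho b n
  change x.eval f + t * x.eval (lieDer ξ a m f) = x.eval f at h
  exact add_eq_left.1 h

theorem mul_self_of_odd {η : B} (hη : η ∈ ℬ 1) : η * η = 0 := by
  have h : (2 : ℂ) • (η * η) = 0 := by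
    rw [two_smul]
    nth_rw 1 [SuperCommutative.odd_anticomm η hη η hη]
    rw [neg_add_cancel]
  exact (smul_eq_zero.1 h).resolve_left two_ne_zero

/-- An odd element commutes with the values of `f` up to the parity of `f`. -/
theorem odd_mul_eval (x : SuperPoint ℬ d) {η : B} (hη : η ∈ ℬ 1) (f : SuperPoly d) :
    η * x.eval f = x.eval ((freeSuper (Fin d × ℕ) (Fin d × ℕ)).parity f) * η := by
  set S := freeSuper (Fin d × ℕ) (Fin d × ℕ)
  have ho : ∀ k, x.eval (S.odd k) ∈ ℬ 1 := fun k => x.odd_mem k.1 k.2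
  have he : ∀ k, x.eval (S.even k) ∈ ℬ 0 := fun k => x.even_mem k.1 k.2
  induction f using super_induction S with
  | one => simp
  | add p q hp hq => simp only [map_add, mul_add, add_mul, hp, hq]
  | smul c p hp => simp only [map_smul, mul_smul_comm, smul_mul_assoc, hp]
  | odd k p hp =>
    simp only [map_mul, map_neg, S.parity_odd, neg_mul]
    rw [← mul_assoc, SuperCommutative.odd_anticomm η hη _ (ho k), neg_mul, mul_assoc, hp, mul_assoc]
  | even i p hp =>
    simp only [map_mul, S.parity_even]
    rw [← mul_assoc, ← SuperCommutative.even_comm _ (he i) η, mul_assoc, hp, mul_assoc]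

/-- An invariant function is killed by `oddLieDer`, up to an odd parameter. -/
theorem mul_eval_oddLieDer (hK : IsOrthonormal ξ) {f : SuperPoly d}
    (hf : f ∈ invariantFunctions G ξ) (x : SuperPoint ℬ d) {η : B} (hη : η ∈ ℬ 1)
    (a : Fin d) (m : ℕ) : η * x.eval (oddLieDer ξ a m f) = 0 := by
  have hD := oddLieDer_oddDer ξ a m
  have hηη : η * η = 0 := mul_self_of_odd hη
  -- `T = η s z^m`
  set T : superDisk ℬ := diskMk 0 (fun n => if n = m then η else 0) (fun n => zero_mem _)
    (fun n => by
      split_ifs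
      · exact hη
      · exact zero_mem _) with hTdef
  have hT0 : ∀ n z, diskEven ℬ n (T * z) = 0 := fun n z => by
    rw [diskEven_mul]
    simp only [hTdef, diskEven_mk, Pi.zero_apply, zero_mul, Finset.sum_const_zero]
  have hT1 : ∀ n z, diskOdd ℬ n (T * z) = if m ≤ n then η * diskEven ℬ (n - m) z else 0 :=
    fun n z => by
      rw [diskOdd_mul]
      simp only [hTdef, diskEven_mk, diskOdd_mk, Pi.zero_apply, zero_mul, zero_add]
      exact sum_antidiagonal_ite n m η fun k => diskEven ℬ k z
  have hTT : T * T = 0 := disk_ext (fun n => by rw [hT0, map_zero]) fun n => by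
    rw [hT1, map_zero, hTdef, diskEven_mk]
    simp
  -- The point `y` conjugate to `x` by `1 - T ξ_a` is `x + η x ∘ oddLieDer`.
  set ψ := perturb x.eval η (oddLieDer ξ a m) hD.map_one (fun p q => by
      rw [hD.leibniz, map_add, map_mul, map_mul, mul_add, ← mul_assoc, ← mul_assoc, ← mul_assoc,
        odd_mul_eval x hη (SuperGen.parity _ p), SuperGen.parity_parity, add_comm])
    (fun p q => by
      rw [odd_mul_eval x hη, mul_assoc, ← mul_assoc η, hηη, zero_mul, mul_zero]) with hψ
  have he : ∀ b n, ψ (evenCoord b n) = x.eval (evenCoord b n) := fun b n => by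
    rw [hψ, perturb_apply, oddLieDer_evenCoord, map_zero, mul_zero, add_zero]
  have ho : ∀ b n, ψ (oddCoord b n) = x.eval (oddCoord b n) + if m ≤ n then
      η * ∑ e, ξ.repr ⁅ξ a, ξ b⁆ e • x.eval (evenCoord e (n - m)) else 0 := fun b n => by
    rw [hψ, perturb_apply, oddLieDer_oddCoord]
    split_ifs <;> simp
  set y : SuperPoint ℬ d := ⟨ψ, fun b n => by
    rw [he]
    exact x.even_mem _ _, fun b n => by
    rw [ho]
    refine add_mem (x.odd_mem _ _) ?_
    split_ifs
    · simpa using SetLike.mul_mem_graded hη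
        (Submodule.sum_mem (ℬ 0) fun e _ => Submodule.smul_mem _ _ (x.even_mem e (n - m)))
    · exact zero_mem _⟩ with hy
  have h := eval_eq_of_mem_invariantFunctions hK hf hTT a (x := x) (y := y) fun b =>
    disk_ext (fun n => by
      rw [map_add, hT0, diskEven_component, diskEven_component, add_zero]
      exact he b n) fun n => by
      rw [map_add, hT1, diskOdd_component, diskOdd_component]
      simp only [map_sum, map_smul, diskEven_component]
      exact ho b n
  change x.eval f + η * x.eval (oddLieDer ξ a m f) = x.eval f at h
  exact add_eq_left.1 h

end Infinitesimal

/-! ### Free odd parameters -/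

section FreeParameters

variable {κ I : Type}

theorem OddDer.map_odd_mul {A : Type} [Ring A] [Algebra ℂ A] {S : SuperGen κ I A}
    {P : Module.End ℂ A} (hP : OddDer S P) (k : κ) (y : A) :
    P (S.odd k * y) = P (S.odd k) * y - S.odd k * P y := by
  rw [hP.leibniz, S.parity_odd, neg_mul, sub_eq_add_neg]

/-- The inclusion of a free supercommutative algebra into the one with two more odd generators. -/
def adjoinOdd (κ I : Type) : FreeSuper κ I →ₐ[ℂ] FreeSuper (κ ⊕ Fin 2) I :=
  Algebra.TensorProduct.map (ExteriorAlgebra.map (Finsupp.lmapDomain ℂ ℂ Sum.inl))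
    (AlgHom.id ℂ _)

theorem adjoinOdd_odd (k : κ) :
    adjoinOdd κ I ((freeSuper κ I).odd k) = (freeSuper (κ ⊕ Fin 2) I).odd (Sum.inl k) := by
  simp [adjoinOdd, freeSuper, oddLin]

theorem adjoinOdd_even (i : I) :
    adjoinOdd κ I ((freeSuper κ I).even i) = (freeSuper (κ ⊕ Fin 2) I).even i := by
  simp [adjoinOdd, freeSuper]

theorem adjoinOdd_injective : Function.Injective (adjoinOdd κ I) := by
  set r : (κ ⊕ Fin 2 →₀ ℂ) →ₗ[ℂ] κ →₀ ℂ :=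
    Finsupp.linearCombination ℂ (Sum.elim (fun k => Finsupp.single k 1) 0) with hr
  have h1 : r ∘ₗ Finsupp.lmapDomain ℂ ℂ Sum.inl = LinearMap.id := by
    refine Finsupp.lhom_ext' fun k => LinearMap.ext_ring ?_
    simp [hr]
  have h2 : (Algebra.TensorProduct.map (ExteriorAlgebra.map r) (AlgHom.id ℂ _)).comp
      (adjoinOdd κ I) = AlgHom.id ℂ _ := by
    rw [adjoinOdd, ← Algebra.TensorProduct.map_comp, ExteriorAlgebra.map_comp_map, h1,
      ExteriorAlgebra.map_id]
    exact Algebra.TensorProduct.map_id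
  exact Function.LeftInverse.injective (g := Algebra.TensorProduct.map (ExteriorAlgebra.map r)
    (AlgHom.id ℂ _)) fun x => DFunLike.congr_fun h2 x

/-- Differentiation with respect to one of the two new odd generators. -/
def oddPartial (κ I : Type) (j : Fin 2) : Module.End ℂ (FreeSuper (κ ⊕ Fin 2) I) :=
  TensorProduct.map (contract (Finsupp.lapply (Sum.inr j))) LinearMap.id

theorem oddPartial_oddDer (j : Fin 2) :
    OddDer (freeSuper (κ ⊕ Fin 2) I) (oddPartial κ I j) := oddDer_map_contract _

theorem oddPartial_odd [DecidableEq κ] (j : Fin 2) (k : κ ⊕ Fin 2) :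
    oddPartial κ I j ((freeSuper (κ ⊕ Fin 2) I).odd k) = if k = Sum.inr j then 1 else 0 := by
  rw [oddPartial]
  simp only [freeSuper, oddLin, TensorProduct.map_tmul, contract_ι, Finsupp.lapply_apply,
    Finsupp.single_apply, LinearMap.id_apply]
  split_ifs
  · rw [one_smul, Algebra.TensorProduct.one_def]
  · rw [zero_smul, TensorProduct.zero_tmul]

theorem oddPartial_odd_mul [DecidableEq κ] (j : Fin 2) (k : κ ⊕ Fin 2) (y : FreeSuper (κ ⊕ Fin 2) I) :
    oddPartial κ I j ((freeSuper (κ ⊕ Fin 2) I).odd k * y) =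
      (if k = Sum.inr j then y else 0) -
        (freeSuper (κ ⊕ Fin 2) I).odd k * oddPartial κ I j y := by
  rw [(oddPartial_oddDer j).map_odd_mul, oddPartial_odd, ite_mul, one_mul, zero_mul]

theorem oddPartial_adjoinOdd (j : Fin 2) (x : FreeSuper κ I) :
    oddPartial κ I j (adjoinOdd κ I x) = 0 := by
  classical
  induction x using super_induction (freeSuper κ I) with
  | one => rw [map_one, (oddPartial_oddDer j).map_one]
  | add x y hx hy => rw [map_add, map_add, hx, hy, add_zero]
  | smul c x hx => rw [map_smul, map_smul, hx, smul_zero]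
  | odd k x hx =>
    rw [map_mul, adjoinOdd_odd, oddPartial_odd_mul, hx, mul_zero, if_neg (by simp), sub_zero]
  | even i x hx =>
    have h : oddPartial κ I j ((freeSuper (κ ⊕ Fin 2) I).even i) = 0 := by
      rw [oddPartial]
      simp only [freeSuper, TensorProduct.map_tmul, contract_one, TensorProduct.zero_tmul]
    rw [map_mul, adjoinOdd_even, (oddPartial_oddDer j).leibniz, hx, h, zero_mul, mul_zero,
      zero_add]

/-- A free odd parameter is cancelled by differentiation with respect to it. -/
theorem eq_zero_of_odd_mul_eq_zero (x : FreeSuper κ I)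
    (h : (freeSuper (κ ⊕ Fin 2) I).odd (Sum.inr 0) * adjoinOdd κ I x = 0) : x = 0 := by
  classical
  have h1 := congrArg (oddPartial κ I 0) h
  rw [oddPartial_odd_mul, oddPartial_adjoinOdd, mul_zero, if_pos rfl, sub_zero, map_zero] at h1
  exact adjoinOdd_injective (h1.trans (map_zero _).symm)

theorem eq_zero_of_odd_mul_odd_mul_eq_zero (x : FreeSuper κ I)
    (h : (freeSuper (κ ⊕ Fin 2) I).odd (Sum.inr 0) *
      ((freeSuper (κ ⊕ Fin 2) I).odd (Sum.inr 1) * adjoinOdd κ I x) = 0) : x = 0 := by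
  classical
  have h1 := congrArg (oddPartial κ I 1) (congrArg (oddPartial κ I 0) h)
  rw [oddPartial_odd_mul, oddPartial_odd_mul, oddPartial_adjoinOdd, mul_zero, if_pos rfl,
    if_neg (by simp), sub_zero, mul_zero, sub_zero, oddPartial_odd_mul, oddPartial_adjoinOdd,
    mul_zero, if_pos rfl, sub_zero, map_zero, map_zero] at h1
  exact adjoinOdd_injective (h1.trans (map_zero _).symm)

variable {N d : ℕ} {G : Subgroup (GL (Fin N) ℂ)} {ξ : Module.Basis (Fin d) ℂ (lieAlgebraOf G)}

/-- The universal point of `𝔤[[z,s]]`, with values in the polynomial functions with two more odd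
parameters. -/
def genericPoint (d : ℕ) :
    SuperPoint (freeSuper ((Fin d × ℕ) ⊕ Fin 2) (Fin d × ℕ)).grading d where
  eval := adjoinOdd _ _
  even_mem a m := by
    rw [SuperGen.mem_grading_zero]
    exact (congrArg _ (adjoinOdd_even (a, m))).trans
      ((SuperGen.parity_even _ _).trans (adjoinOdd_even (a, m)).symm)
  odd_mem a m := by
    rw [SuperGen.mem_grading_one]
    exact (congrArg _ (adjoinOdd_odd (a, m))).trans
      ((SuperGen.parity_odd _ _).trans (congrArg _ (adjoinOdd_odd (a, m)).symm))

/-- At the universal point, the free odd parameters can be cancelled. -/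
theorem lieInvariant_of_mem_invariantFunctions (hK : IsOrthonormal ξ) {f : SuperPoly d}
    (hf : f ∈ invariantFunctions G ξ) : LieInvariant ξ f := by
  set S := freeSuper ((Fin d × ℕ) ⊕ Fin 2) (Fin d × ℕ) with hS
  have hodd : ∀ k, S.odd k ∈ S.grading 1 := fun k => S.mem_grading_one.2 (S.parity_odd k)
  -- `η₀ η₁` is an even element of square zero that is free over the functions.
  have h2 : S.odd (Sum.inr 0) * S.odd (Sum.inr 1) ∈ S.grading 0 := by
    have h := SetLike.mul_mem_graded (hodd (Sum.inr 0)) (hodd (Sum.inr 1))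
    rwa [show (1 : ZMod 2) + 1 = 0 from rfl] at h
  have h3 : S.odd (Sum.inr 0) * S.odd (Sum.inr 1) * (S.odd (Sum.inr 0) * S.odd (Sum.inr 1)) = 0 := by
    rw [← mul_assoc, SuperCommutative.even_comm _ h2, ← mul_assoc, mul_self_of_odd (hodd _),
      zero_mul, zero_mul]
  refine ⟨fun a m => ?_, fun a m => ?_⟩
  · have h := mul_eval_lieDer hK hf (genericPoint d) h2 h3 a m
    rw [mul_assoc] at h
    exact eq_zero_of_odd_mul_odd_mul_eq_zero _ h
  · exact eq_zero_of_odd_mul_eq_zero _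
      (mul_eval_oddLieDer hK hf (genericPoint d) (hodd (Sum.inr 0)) a m)

end FreeParameters

/-! ### Maps between super-disks and points of `𝔤[[z,s]]` -/

section DiskMaps

variable {B C : Type} [Ring B] [Algebra ℂ B] {ℬ : ZMod 2 → Submodule ℂ B} [GradedAlgebra ℬ]
  [SuperCommutative ℬ] [Ring C] [Algebra ℂ C] {𝒞 : ZMod 2 → Submodule ℂ C} [GradedAlgebra 𝒞]
  [SuperCommutative 𝒞] {N d : ℕ} {G : Subgroup (GL (Fin N) ℂ)}
  {ξ : Module.Basis (Fin d) ℂ (lieAlgebraOf G)}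

theorem diskEven_one (n : ℕ) : diskEven ℬ n 1 = if n = 0 then 1 else 0 := by
  rw [← map_one (algebraMap ℂ (superDisk ℬ)), diskEven_algebraMap, map_one]

theorem diskOdd_one (n : ℕ) : diskOdd ℬ n 1 = 0 := by
  rw [← map_one (algebraMap ℂ (superDisk ℬ)), diskOdd_algebraMap]

/-- The linear map that applies `p n` to the coefficient of `z^n` and `q n` to that of `s z^n`. -/
def diskLin (p q : ℕ → B →ₗ[ℂ] C) (hp : ∀ n, ∀ u ∈ ℬ 0, p n u ∈ 𝒞 0)
    (hq : ∀ n, ∀ u ∈ ℬ 1, q n u ∈ 𝒞 1) : superDisk ℬ →ₗ[ℂ] superDisk 𝒞 where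
  toFun x := diskMk (fun n => p n (diskEven ℬ n x)) (fun n => q n (diskOdd ℬ n x))
    (fun n => hp n _ (diskEven_mem n x)) (fun n => hq n _ (diskOdd_mem n x))
  map_add' x y := disk_ext (fun n => by simp only [map_add, diskEven_mk])
    (fun n => by simp only [map_add, diskOdd_mk])
  map_smul' c x := disk_ext
    (fun n => by simp only [map_smul, diskEven_mk, RingHom.id_apply])
    (fun n => by simp only [map_smul, diskOdd_mk, RingHom.id_apply])

theorem diskEven_diskLin (p q : ℕ → B →ₗ[ℂ] C) (hp : ∀ n, ∀ u ∈ ℬ 0, p n u ∈ 𝒞 0)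
    (hq : ∀ n, ∀ u ∈ ℬ 1, q n u ∈ 𝒞 1) (n : ℕ) (x : superDisk ℬ) :
    diskEven 𝒞 n (diskLin p q hp hq x) = p n (diskEven ℬ n x) :=
  diskEven_mk (fun n => p n (diskEven ℬ n x)) (fun n => q n (diskOdd ℬ n x))
    (fun n => hp n _ (diskEven_mem n x)) (fun n => hq n _ (diskOdd_mem n x)) n

theorem diskOdd_diskLin (p q : ℕ → B →ₗ[ℂ] C) (hp : ∀ n, ∀ u ∈ ℬ 0, p n u ∈ 𝒞 0)
    (hq : ∀ n, ∀ u ∈ ℬ 1, q n u ∈ 𝒞 1) (n : ℕ) (x : superDisk ℬ) :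
    diskOdd 𝒞 n (diskLin p q hp hq x) = q n (diskOdd ℬ n x) :=
  diskOdd_mk (fun n => p n (diskEven ℬ n x)) (fun n => q n (diskOdd ℬ n x))
    (fun n => hp n _ (diskEven_mem n x)) (fun n => hq n _ (diskOdd_mem n x)) n

/-- `diskLin` as an algebra map. -/
def diskHom (p q : ℕ → B →ₗ[ℂ] C) (hp : ∀ n, ∀ u ∈ ℬ 0, p n u ∈ 𝒞 0)
    (hq : ∀ n, ∀ u ∈ ℬ 1, q n u ∈ 𝒞 1) (one : p 0 1 = 1)
    (hpp : ∀ i j u v, p (i + j) (u * v) = p i u * p j v)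
    (hpq : ∀ i j u v, q (i + j) (u * v) = p i u * q j v)
    (hqp : ∀ i j u v, q (i + j) (u * v) = q i u * p j v) : superDisk ℬ →ₐ[ℂ] superDisk 𝒞 :=
  AlgHom.ofLinearMap (diskLin p q hp hq)
    (by
      refine disk_ext (fun n => ?_) fun n => ?_
      · rw [diskEven_diskLin, diskEven_one, diskEven_one]
        split_ifs with h
        · rw [h, one]
        · rw [map_zero]
      · rw [diskOdd_diskLin, diskOdd_one, diskOdd_one, map_zero])
    (fun x y => by
      refine disk_ext (fun n => ?_) fun n => ?_
      · simp only [diskEven_diskLin, diskEven_mul, map_sum]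
        refine Finset.sum_congr rfl fun k hk => ?_
        rw [← hpp, Finset.HasAntidiagonal.mem_antidiagonal.1 hk]
      · simp only [diskEven_diskLin, diskOdd_diskLin, diskOdd_mul, map_sum]
        refine Finset.sum_congr rfl fun k hk => ?_
        rw [← hpq, ← hqp, Finset.HasAntidiagonal.mem_antidiagonal.1 hk, map_add])

/-- The action of a parity-preserving algebra map on the coefficients. -/
def diskMap (φ : B →ₐ[ℂ] C) (hφ : ∀ i, ∀ u ∈ ℬ i, φ u ∈ 𝒞 i) :
    superDisk ℬ →ₐ[ℂ] superDisk 𝒞 :=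
  diskHom (fun _ => φ.toLinearMap) (fun _ => φ.toLinearMap) (fun _ => hφ 0) (fun _ => hφ 1)
    (map_one φ) (fun _ _ => map_mul φ) (fun _ _ => map_mul φ) (fun _ _ => map_mul φ)

theorem diskEven_diskMap (φ : B →ₐ[ℂ] C) (hφ : ∀ i, ∀ u ∈ ℬ i, φ u ∈ 𝒞 i) (n : ℕ)
    (x : superDisk ℬ) : diskEven 𝒞 n (diskMap φ hφ x) = φ (diskEven ℬ n x) :=
  diskEven_diskLin (fun _ => φ.toLinearMap) (fun _ => φ.toLinearMap) (fun _ => hφ 0)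
    (fun _ => hφ 1) n x

theorem diskOdd_diskMap (φ : B →ₐ[ℂ] C) (hφ : ∀ i, ∀ u ∈ ℬ i, φ u ∈ 𝒞 i) (n : ℕ)
    (x : superDisk ℬ) : diskOdd 𝒞 n (diskMap φ hφ x) = φ (diskOdd ℬ n x) :=
  diskOdd_diskLin (fun _ => φ.toLinearMap) (fun _ => φ.toLinearMap) (fun _ => hφ 0)
    (fun _ => hφ 1) n x

/-- Even elements as constant functions on the super-disk. -/
def diskConst {A : Type} [CommRing A] [Algebra ℂ A] (φ : A →ₐ[ℂ] B) (hφ : ∀ a, φ a ∈ ℬ 0) :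
    A →ₐ[ℂ] superDisk ℬ :=
  AlgHom.ofLinearMap
    { toFun := fun x => diskMk (fun n => if n = 0 then φ x else 0) 0
        (fun n => by
          split_ifs
          · exact hφ x
          · exact zero_mem _) (fun n => zero_mem _)
      map_add' := fun x y => disk_ext
        (fun n => by simp only [map_add, diskEven_mk]; split_ifs <;> simp)
        (fun n => by simp only [map_add, diskOdd_mk, Pi.zero_apply, add_zero])
      map_smul' := fun c x => disk_ext
        (fun n => by
          simp only [map_smul, diskEven_mk, RingHom.id_apply, smul_ite, smul_zero])
        (fun n => by simp only [map_smul, diskOdd_mk, Pi.zero_apply, smul_zero]) }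
    (by
      refine disk_ext (fun n => ?_) fun n => ?_
      · simp only [LinearMap.coe_mk, AddHom.coe_mk, diskEven_mk]
        rw [diskEven_one, map_one]
      · simp only [LinearMap.coe_mk, AddHom.coe_mk, diskOdd_mk]
        rw [diskOdd_one, Pi.zero_apply])
    (fun x y => by
      refine disk_ext (fun n => ?_) fun n => ?_
      · simp only [LinearMap.coe_mk, AddHom.coe_mk, diskEven_mk, diskEven_mul, map_mul]
        rw [sum_antidiagonal_ite n 0 (φ x) fun k => if k = 0 then φ y else 0]
        simp
      · simp only [LinearMap.coe_mk, AddHom.coe_mk, diskOdd_mk, diskOdd_mul, Pi.zero_apply,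
          mul_zero, zero_mul, add_zero, Finset.sum_const_zero])

theorem diskEven_diskConst {A : Type} [CommRing A] [Algebra ℂ A] (φ : A →ₐ[ℂ] B)
    (hφ : ∀ a, φ a ∈ ℬ 0) (n : ℕ) (x : A) :
    diskEven ℬ n (diskConst φ hφ x) = if n = 0 then φ x else 0 :=
  diskEven_mk (fun n => if n = 0 then φ x else 0) 0 (fun n => by
    split_ifs
    · exact hφ x
    · exact zero_mem _) (fun n => zero_mem _) n

theorem diskOdd_diskConst {A : Type} [CommRing A] [Algebra ℂ A] (φ : A →ₐ[ℂ] B)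
    (hφ : ∀ a, φ a ∈ ℬ 0) (n : ℕ) (x : A) :
    diskOdd ℬ n (diskConst φ hφ x) = 0 :=
  diskOdd_mk (fun n => if n = 0 then φ x else 0) 0 (fun n => by
    split_ifs
    · exact hφ x
    · exact zero_mem _) (fun n => zero_mem _) n

/-- The value at the centre of the super-disk. -/
def diskCentre (ℬ : ZMod 2 → Submodule ℂ B) [GradedAlgebra ℬ] [SuperCommutative ℬ] :
    superDisk ℬ →ₐ[ℂ] B :=
  AlgHom.ofLinearMap (diskEven ℬ 0)
    (by rw [diskEven_one, if_pos rfl])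
    (fun x y => by rw [diskEven_mul]; simp)

/-- The action on the coefficients of a derivation that preserves parity. -/
def diskDerivation (δ : Module.End ℂ B) (hδ : ∀ x y, δ (x * y) = δ x * y + x * δ y)
    (hmem : ∀ i, ∀ u ∈ ℬ i, δ u ∈ ℬ i) : Derivation ℂ (superDisk ℬ) (superDisk ℬ) :=
  Derivation.mk' (diskLin (fun _ => δ) (fun _ => δ) (fun _ => hmem 0) (fun _ => hmem 1))
    (fun x y => by
      change diskLin _ _ _ _ _ = x * diskLin _ _ _ _ y + y * diskLin _ _ _ _ x
      rw [mul_comm y]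
      refine disk_ext (fun n => ?_) fun n => ?_
      · simp only [diskEven_diskLin, diskEven_mul, map_sum, map_add, hδ, Finset.sum_add_distrib]
        rw [add_comm]
      · simp only [diskEven_diskLin, diskOdd_diskLin, diskOdd_mul, map_sum, map_add, hδ,
          Finset.sum_add_distrib]
        abel)

theorem diskEven_diskDerivation (δ : Module.End ℂ B) (hδ : ∀ x y, δ (x * y) = δ x * y + x * δ y)
    (hmem : ∀ i, ∀ u ∈ ℬ i, δ u ∈ ℬ i) (n : ℕ) (x : superDisk ℬ) :
    diskEven ℬ n (diskDerivation δ hδ hmem x) = δ (diskEven ℬ n x) :=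
  diskEven_diskLin (fun _ => δ) (fun _ => δ) (fun _ => hmem 0) (fun _ => hmem 1) n x

theorem diskOdd_diskDerivation (δ : Module.End ℂ B) (hδ : ∀ x y, δ (x * y) = δ x * y + x * δ y)
    (hmem : ∀ i, ∀ u ∈ ℬ i, δ u ∈ ℬ i) (n : ℕ) (x : superDisk ℬ) :
    diskOdd ℬ n (diskDerivation δ hδ hmem x) = δ (diskOdd ℬ n x) :=
  diskOdd_diskLin (fun _ => δ) (fun _ => δ) (fun _ => hmem 0) (fun _ => hmem 1) n x

/-- The image of a point under a parity-preserving algebra map. -/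
def SuperPoint.map (x : SuperPoint ℬ d) (φ : B →ₐ[ℂ] C) (hφ : ∀ i, ∀ u ∈ ℬ i, φ u ∈ 𝒞 i) :
    SuperPoint 𝒞 d where
  eval := φ.comp x.eval
  even_mem a m := hφ 0 _ (x.even_mem a m)
  odd_mem a m := hφ 1 _ (x.odd_mem a m)

theorem SuperPoint.component_map (x : SuperPoint ℬ d) (φ : B →ₐ[ℂ] C)
    (hφ : ∀ i, ∀ u ∈ ℬ i, φ u ∈ 𝒞 i) (a : Fin d) :
    (x.map φ hφ).component a = diskMap φ hφ (x.component a) := by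
  refine disk_ext (fun n => ?_) fun n => ?_
  · rw [diskEven_diskMap, diskEven_component, diskEven_component]
    rfl
  · rw [diskOdd_diskMap, diskOdd_component, diskOdd_component]
    rfl

theorem lieMatrix_map {R S : Type} [CommRing R] [Algebra ℂ R] [CommRing S] [Algebra ℂ S]
    (φ : R →ₐ[ℂ] S) (c : Fin d → R) :
    (lieMatrix ξ c).map φ = lieMatrix ξ fun a => φ (c a) := by
  change φ.mapMatrix (lieMatrix ξ c) = _
  rw [lieMatrix, lieMatrix, map_sum]
  refine Finset.sum_congr rfl fun a _ => ?_
  ext i j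
  simp

theorem SuperPoint.matrix_map (x : SuperPoint ℬ d) (φ : B →ₐ[ℂ] C)
    (hφ : ∀ i, ∀ u ∈ ℬ i, φ u ∈ 𝒞 i) :
    (x.map φ hφ).matrix G ξ = (x.matrix G ξ).map (diskMap φ hφ) := by
  rw [matrix_eq_lieMatrix, matrix_eq_lieMatrix, lieMatrix_map]
  exact congrArg _ (funext fun a => x.component_map φ hφ a)

/-- A point of `𝔤[[z,s]]` is determined by its matrix. -/
theorem SuperPoint.eval_eq_of_matrix_eq {x y : SuperPoint ℬ d}
    (h : x.matrix G ξ = y.matrix G ξ) : x.eval = y.eval := by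
  rw [matrix_eq_lieMatrix, matrix_eq_lieMatrix] at h
  have h1 := congrFun (lieMatrix_injective ξ h)
  have he : ∀ a n, x.eval (evenCoord a n) = y.eval (evenCoord a n) := fun a n => by
    rw [← diskEven_component, h1, diskEven_component]
  have ho : ∀ a n, x.eval (oddCoord a n) = y.eval (oddCoord a n) := fun a n => by
    rw [← diskOdd_component, h1, diskOdd_component]
  refine AlgHom.ext fun f => ?_
  induction f using super_induction (freeSuper (Fin d × ℕ) (Fin d × ℕ)) with
  | one => rw [map_one, map_one]
  | add p q hp hq => rw [map_add, map_add, hp, hq]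
  | smul c p hp => rw [map_smul, map_smul, hp]
  | odd k p hp =>
    rw [map_mul, map_mul, hp]
    exact congrArg (· * _) (ho k.1 k.2)
  | even i p hp =>
    rw [map_mul, map_mul, hp]
    exact congrArg (· * _) (he i.1 i.2)

/-- Every element of `𝔤 ⊗ B[[z,s]]_even` is a `B`-point of `𝔤[[z,s]]`. -/
theorem exists_superPoint (c : Fin d → superDisk ℬ) :
    ∃ y : SuperPoint ℬ d, y.component = c := by
  have hmem : ∀ v : (Fin d × ℕ) →₀ ℂ,
      Finsupp.linearCombination ℂ (fun k : Fin d × ℕ => diskOdd ℬ k.2 (c k.1)) v ∈ ℬ 1 :=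
    fun v => Submodule.sum_mem _ fun k _ => Submodule.smul_mem _ _ (diskOdd_mem _ _)
  have hcentre : ∀ k : Fin d × ℕ, diskEven ℬ k.2 (c k.1) ∈ Subalgebra.center ℂ B := fun k =>
    Subalgebra.mem_center_iff.2 fun b => (SuperCommutative.even_comm _ (diskEven_mem _ _) b).symm
  set o : ExteriorAlgebra ℂ ((Fin d × ℕ) →₀ ℂ) →ₐ[ℂ] B := ExteriorAlgebra.lift ℂ
    ⟨Finsupp.linearCombination ℂ fun k : Fin d × ℕ => diskOdd ℬ k.2 (c k.1), fun v =>
      mul_self_of_odd (hmem v)⟩ with ho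
  set e : MvPolynomial (Fin d × ℕ) ℂ →ₐ[ℂ] Subalgebra.center ℂ B :=
    MvPolynomial.aeval fun k => ⟨diskEven ℬ k.2 (c k.1), hcentre k⟩ with he
  set F := Algebra.TensorProduct.lift o ((Subalgebra.center ℂ B).val.comp e) fun u v =>
    Subalgebra.mem_center_iff.1 (e v).2 (o u) with hF
  have h0 : ∀ a n, F (evenCoord a n) = diskEven ℬ n (c a) := fun a n => by
    simp [hF, evenCoord, he]
  have h1 : ∀ a n, F (oddCoord a n) = diskOdd ℬ n (c a) := fun a n => by
    refine (Algebra.TensorProduct.lift_tmul _ _ _ _ _).trans ?_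
    rw [map_one, mul_one, ho, ExteriorAlgebra.lift_ι_apply, Finsupp.linearCombination_single,
      one_smul]
  refine ⟨⟨F, fun a n => ?_, fun a n => ?_⟩, funext fun a => disk_ext (fun n => ?_) fun n => ?_⟩
  · rw [h0]
    exact diskEven_mem _ _
  · rw [h1]
    exact diskOdd_mem _ _
  · rw [diskEven_component, h0]
  · rw [diskOdd_component, h1]

/-- The adjoint action of a `B`-point of `G[[z,s]]` on a `B`-point of `𝔤[[z,s]]`. -/
theorem exists_conj_superPoint (hdet : detPoly N - 1 ∈ groupIdeal G)
    {g : GL (Fin N) (superDisk ℬ)} (hg : g ∈ groupPoints G (superDisk ℬ)) (x : SuperPoint ℬ d) :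
    ∃ y : SuperPoint ℬ d, y.matrix G ξ = (g : Matrix (Fin N) (Fin N) (superDisk ℬ)) *
      x.matrix G ξ * ((g⁻¹ : GL (Fin N) (superDisk ℬ)) : Matrix (Fin N) (Fin N) (superDisk ℬ)) := by
  obtain ⟨c, hc⟩ := exists_conj_lieMatrix (ξ := ξ) hdet hg x.component
  obtain ⟨y, rfl⟩ := exists_superPoint c
  exact ⟨y, hc.symm⟩

end DiskMaps

/-! ### Flows in the adjoint orbits -/

section Flow

variable {B : Type} [Ring B] [Algebra ℂ B] {ℬ : ZMod 2 → Submodule ℂ B} [GradedAlgebra ℬ]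
  [SuperCommutative ℬ] {N d : ℕ} {G : Subgroup (GL (Fin N) ℂ)}
  {ξ : Module.Basis (Fin d) ℂ (lieAlgebraOf G)}

theorem map_derivation_mul {R : Type} [CommRing R] [Algebra ℂ R] (D : Derivation ℂ R R)
    (M K : Matrix (Fin N) (Fin N) R) : (M * K).map D = M.map D * K + M * K.map D := by
  ext i j
  simp only [Matrix.map_apply, Matrix.mul_apply, Matrix.add_apply, map_sum, Derivation.leibniz,
    smul_eq_mul, Finset.sum_add_distrib]
  rw [add_comm]
  simp only [mul_comm]

theorem lieMatrix_map_derivation {R : Type} [CommRing R] [Algebra ℂ R] (D : Derivation ℂ R R)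
    (c : Fin d → R) : (lieMatrix ξ c).map D = lieMatrix ξ fun a => D (c a) := by
  ext i j
  simp only [lieMatrix, Matrix.map_apply, Matrix.sum_apply, Matrix.smul_apply, map_sum, smul_eq_mul]
  refine Finset.sum_congr rfl fun a _ => ?_
  rw [Derivation.leibniz, Derivation.map_algebraMap, smul_zero, zero_add, smul_eq_mul, mul_comm]

/-- If `x` is constant for a derivation, the conjugates `Y = h x h⁻¹` satisfy the Lax equation
`∂Y = [∂h h⁻¹, Y]`. -/
theorem lax_equation (hdet : detPoly N - 1 ∈ groupIdeal G) {R : Type} [CommRing R] [Algebra ℂ R]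
    {h : GL (Fin N) R} (hh : h ∈ groupPoints G R) (D : Derivation ℂ R R) {x Y : Fin d → R}
    (hx : ∀ b, D (x b) = 0) (hY : lieMatrix ξ Y = (h : Matrix (Fin N) (Fin N) R) *
      lieMatrix ξ x * ((h⁻¹ : GL (Fin N) R) : Matrix (Fin N) (Fin N) R)) :
    ∃ X : Fin d → R, ∀ b, D (Y b) = ∑ a, ∑ e, ξ.repr ⁅ξ a, ξ e⁆ b • (X a * Y e) := by
  obtain ⟨X, hX⟩ := exists_map_derivation_mul_inv (ξ := ξ) hdet hh D
  suffices hs : lieMatrix ξ (fun b => D (Y b)) =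
      lieMatrix ξ fun b => ∑ a, ∑ e, ξ.repr ⁅ξ a, ξ e⁆ b • (X a * Y e) from
    ⟨X, congrFun (lieMatrix_injective ξ hs)⟩
  have h1 : ((h⁻¹ : GL (Fin N) R) : Matrix (Fin N) (Fin N) R) * (h : Matrix (Fin N) (Fin N) R) = 1 :=
    Units.inv_mul h
  have h1' : (h : Matrix (Fin N) (Fin N) R) * ((h⁻¹ : GL (Fin N) R) : Matrix (Fin N) (Fin N) R) = 1 :=
    Units.mul_inv h
  generalize ((h⁻¹ : GL (Fin N) R) : Matrix (Fin N) (Fin N) R) = k at *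
  generalize (h : Matrix (Fin N) (Fin N) R) = g at *
  -- Differentiating `Y h = h x` avoids differentiating the inverse.
  have h2 : lieMatrix ξ Y * g = g * lieMatrix ξ x := by
    rw [hY, mul_assoc, h1, mul_one]
  have h3 : (lieMatrix ξ x).map D = 0 := by
    rw [lieMatrix_map_derivation]
    simp only [hx, lieMatrix, zero_smul, Finset.sum_const_zero]
  have h4 := congrArg (fun M : Matrix (Fin N) (Fin N) R => M.map D * k) h2
  simp only [map_derivation_mul, h3, mul_zero, add_zero] at h4
  rw [add_mul, mul_assoc, h1', mul_one, mul_assoc, hX] at h4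
  rw [← lieMatrix_bracket, ← lieMatrix_map_derivation, eq_sub_iff_add_eq, h4, ← hX, hY]
  rw [mul_assoc (g.map D), mul_assoc (g.map D), ← mul_assoc k, ← mul_assoc k, h1, one_mul]

variable (ξ) in
/-- The vector field on `𝔤[[z,s]]` given by the coefficients up to order `M` of an element of
`𝔤 ⊗ B[[z,s]]`, at a `B`-point. -/
def vectorField (X : Fin d → superDisk ℬ) (Y : SuperPoint ℬ d) (M : ℕ) : SuperPoly d →ₗ[ℂ] B :=
  ∑ a, ∑ m ∈ Finset.range M,
    (LinearMap.mulLeft ℂ (diskEven ℬ m (X a)) ∘ₗ Y.eval.toLinearMap ∘ₗ lieDer ξ a m +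
      LinearMap.mulLeft ℂ (diskOdd ℬ m (X a)) ∘ₗ Y.eval.toLinearMap ∘ₗ oddLieDer ξ a m)

theorem vectorField_apply (X : Fin d → superDisk ℬ) (Y : SuperPoint ℬ d) (M : ℕ)
    (f : SuperPoly d) : vectorField ξ X Y M f = ∑ a, ∑ m ∈ Finset.range M,
      (diskEven ℬ m (X a) * Y.eval (lieDer ξ a m f) +
        diskOdd ℬ m (X a) * Y.eval (oddLieDer ξ a m f)) := by
  simp [vectorField]

theorem vectorField_mul (X : Fin d → superDisk ℬ) (Y : SuperPoint ℬ d) (M : ℕ)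
    (f g : SuperPoly d) : vectorField ξ X Y M (f * g) =
      vectorField ξ X Y M f * Y.eval g + Y.eval f * vectorField ξ X Y M g := by
  simp only [vectorField_apply, Finset.sum_mul, Finset.mul_sum, ← Finset.sum_add_distrib]
  refine Finset.sum_congr rfl fun a _ => Finset.sum_congr rfl fun m _ => ?_
  rw [(lieDer_evenDer ξ a m).leibniz, (oddLieDer_oddDer ξ a m).leibniz]
  simp only [map_add, map_mul, mul_add, add_mul, ← mul_assoc]
  rw [odd_mul_eval Y (diskOdd_mem m (X a)) (SuperGen.parity _ f), SuperGen.parity_parity,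
    SuperCommutative.even_comm _ (diskEven_mem m (X a)) (Y.eval f)]
  abel

theorem sum_antidiagonal_eq_sum_range (n M : ℕ) (hM : n < M) (u v : ℕ → B) :
    ∑ p ∈ Finset.HasAntidiagonal.antidiagonal n, u p.1 * v p.2 =
      ∑ m ∈ Finset.range M, if m ≤ n then u m * v (n - m) else 0 := by
  rw [Finset.Nat.sum_antidiagonal_eq_sum_range_succ (fun i j => u i * v j), ← Finset.sum_filter]
  refine Finset.sum_congr (Finset.ext fun m => ?_) fun _ _ => rfl
  simp only [Finset.mem_range, Finset.mem_filter]
  omega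

theorem vectorField_evenCoord (hK : IsOrthonormal ξ) (X : Fin d → superDisk ℬ)
    (Y : SuperPoint ℬ d) {n M : ℕ} (hM : n < M) (b : Fin d) :
    diskEven ℬ n (∑ a, ∑ e, ξ.repr ⁅ξ a, ξ e⁆ b • (X a * Y.component e)) =
      -vectorField ξ X Y M (evenCoord b n) := by
  have h : ∀ a e, diskEven ℬ n (X a * Y.component e) = ∑ m ∈ Finset.range M,
      if m ≤ n then diskEven ℬ m (X a) * Y.eval (evenCoord e (n - m)) else 0 := fun a e => by
    rw [diskEven_mul, ← sum_antidiagonal_eq_sum_range n M hM (fun m => diskEven ℬ m (X a))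
      fun k => Y.eval (evenCoord e k)]
    simp only [diskEven_component]
  simp only [vectorField_apply, map_sum, map_smul, h, oddLieDer_evenCoord, map_zero, mul_zero,
    add_zero, lieDer_evenCoord, ← Finset.sum_neg_distrib]
  refine Finset.sum_congr rfl fun a _ => ?_
  simp only [Finset.smul_sum]
  rw [Finset.sum_comm]
  refine Finset.sum_congr rfl fun m _ => ?_
  split_ifs
  · simp only [map_sum, map_smul, Finset.mul_sum, ← Finset.sum_neg_distrib]
    refine Finset.sum_congr rfl fun e _ => ?_
    rw [hK.repr_lie_swap, neg_smul, mul_smul_comm]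
  · simp

theorem vectorField_oddCoord (hK : IsOrthonormal ξ) (X : Fin d → superDisk ℬ)
    (Y : SuperPoint ℬ d) {n M : ℕ} (hM : n < M) (b : Fin d) :
    diskOdd ℬ n (∑ a, ∑ e, ξ.repr ⁅ξ a, ξ e⁆ b • (X a * Y.component e)) =
      -vectorField ξ X Y M (oddCoord b n) := by
  have h : ∀ a e, diskOdd ℬ n (X a * Y.component e) = ∑ m ∈ Finset.range M, if m ≤ n then
      diskEven ℬ m (X a) * Y.eval (oddCoord e (n - m)) +
        diskOdd ℬ m (X a) * Y.eval (evenCoord e (n - m)) else 0 := fun a e => by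
    have h1 : ∀ (m : ℕ) (s t : B), (if m ≤ n then s + t else 0) =
        (if m ≤ n then s else 0) + if m ≤ n then t else 0 := fun m s t => by split_ifs <;> simp
    simp only [h1]
    rw [diskOdd_mul, Finset.sum_add_distrib, Finset.sum_add_distrib,
      ← sum_antidiagonal_eq_sum_range n M hM (fun m => diskEven ℬ m (X a))
        fun k => Y.eval (oddCoord e k),
      ← sum_antidiagonal_eq_sum_range n M hM (fun m => diskOdd ℬ m (X a))
        fun k => Y.eval (evenCoord e k)]
    simp only [diskEven_component, diskOdd_component]
  simp only [vectorField_apply, map_sum, map_smul, h, oddLieDer_oddCoord, lieDer_oddCoord,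
    ← Finset.sum_neg_distrib, Finset.smul_sum]
  refine Finset.sum_congr rfl fun a _ => ?_
  rw [Finset.sum_comm]
  refine Finset.sum_congr rfl fun m _ => ?_
  split_ifs
  · simp only [map_sum, map_smul, Finset.mul_sum, ← Finset.sum_neg_distrib,
      ← Finset.sum_add_distrib]
    refine Finset.sum_congr rfl fun e _ => ?_
    rw [hK.repr_lie_swap, mul_smul_comm, mul_smul_comm, ← smul_add, neg_smul]
  · simp

/-- A function that the Lie superalgebra kills is constant along the orbit `h x h⁻¹`. -/
theorem derivation_eval_conj (hK : IsOrthonormal ξ) (hdet : detPoly N - 1 ∈ groupIdeal G)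
    {f : SuperPoly d} (hf : LieInvariant ξ f) {h : GL (Fin N) (superDisk ℬ)}
    (hh : h ∈ groupPoints G (superDisk ℬ)) (δ : Module.End ℂ B)
    (hδ : ∀ x y, δ (x * y) = δ x * y + x * δ y) (hmem : ∀ i, ∀ u ∈ ℬ i, δ u ∈ ℬ i)
    {x Y : SuperPoint ℬ d} (hx : ∀ p, δ (x.eval p) = 0)
    (hY : Y.matrix G ξ = (h : Matrix (Fin N) (Fin N) (superDisk ℬ)) * x.matrix G ξ *
      ((h⁻¹ : GL (Fin N) (superDisk ℬ)) : Matrix (Fin N) (Fin N) (superDisk ℬ))) :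
    δ (Y.eval f) = 0 := by
  obtain ⟨X, hX⟩ := lax_equation (ξ := ξ) hdet hh (diskDerivation δ hδ hmem)
    (x := x.component) (Y := Y.component) (fun b => disk_ext (fun n => by
      rw [diskEven_diskDerivation, diskEven_component, hx, map_zero]) fun n => by
      rw [diskOdd_diskDerivation, diskOdd_component, hx, map_zero]) hY
  have he : ∀ (b : Fin d) (n M : ℕ), n < M →
      δ (Y.eval (evenCoord b n)) = -vectorField ξ X Y M (evenCoord b n) := fun b n M hM => by
    rw [← vectorField_evenCoord hK X Y hM, ← hX, diskEven_diskDerivation, diskEven_component]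
  have ho : ∀ (b : Fin d) (n M : ℕ), n < M →
      δ (Y.eval (oddCoord b n)) = -vectorField ξ X Y M (oddCoord b n) := fun b n M hM => by
    rw [← vectorField_oddCoord hK X Y hM, ← hX, diskOdd_diskDerivation, diskOdd_component]
  have h1 : ∀ M, vectorField ξ X Y M 1 = 0 := fun M => by
    simp [vectorField_apply, (lieDer_evenDer ξ _ _).map_one, (oddLieDer_oddDer ξ _ _).map_one]
  have hδ1 : δ 1 = 0 := by simpa using hδ 1 1
  have hmul : ∀ (M : ℕ) (p q : SuperPoly d), δ (Y.eval p) = -vectorField ξ X Y M p →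
      δ (Y.eval q) = -vectorField ξ X Y M q → δ (Y.eval (p * q)) = -vectorField ξ X Y M (p * q) :=
    fun M p q hp hq => by
      rw [map_mul, hδ, vectorField_mul, hp, hq, neg_mul, mul_neg, neg_add]
  -- The coefficients of order `≥ M` do not move the coordinates of order `< M`, so on a given
  -- polynomial the derivative along the orbit is that of a finite combination of derivations.
  have key : ∀ p : SuperPoly d, ∀ᶠ M in Filter.atTop,
      δ (Y.eval p) = -vectorField ξ X Y M p := fun p => by
    induction p using super_induction (freeSuper (Fin d × ℕ) (Fin d × ℕ)) with
    | one => exact Filter.Eventually.of_forall fun M => by rw [map_one, hδ1, h1, neg_zero]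
    | add p q hp hq =>
      filter_upwards [hp, hq] with M hp hq
      rw [map_add, map_add, map_add, hp, hq, neg_add]
    | smul c p hp =>
      filter_upwards [hp] with M hp
      rw [map_smul, map_smul, map_smul, hp, smul_neg]
    | odd k p hp =>
      filter_upwards [hp, Filter.eventually_gt_atTop k.2] with M hp hM
      exact hmul M _ _ (ho k.1 k.2 M hM) hp
    | even i p hp =>
      filter_upwards [hp, Filter.eventually_gt_atTop i.2] with M hp hM
      exact hmul M _ _ (he i.1 i.2 M hM) hp
  obtain ⟨M, hM⟩ := (key f).exists
  rw [hM, vectorField_apply]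
  simp only [hf.1, hf.2, map_zero, mul_zero, add_zero, Finset.sum_const_zero, neg_zero]

end Flow

/-! ### Families of points of `𝔤[[z,s]]` -/

section Families

variable {B : Type} [Ring B] [Algebra ℂ B] (ℬ : ZMod 2 → Submodule ℂ B)
  (A : Type) [CommRing A] [Algebra ℂ A]

/-- The parity grading of `B ⊗ A`, where `A` is even. -/
def tensorGrading : ZMod 2 → Submodule ℂ (B ⊗[ℂ] A) := DirectSum.decomposeTensor ℬ A

variable {ℬ A}

theorem tmul_mem_tensorGrading {i : ZMod 2} {b : B} (hb : b ∈ ℬ i) (a : A) :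
    b ⊗ₜ a ∈ tensorGrading ℬ A i := ⟨(⟨b, hb⟩ : ℬ i) ⊗ₜ a, by simp⟩

theorem tensorGrading_induction {i : ZMod 2} {p : ∀ x : B ⊗[ℂ] A, x ∈ tensorGrading ℬ A i → Prop}
    (zero : p 0 (zero_mem _)) (add : ∀ x y hx hy, p x hx → p y hy → p (x + y) (add_mem hx hy))
    (tmul : ∀ b (hb : b ∈ ℬ i) a, p (b ⊗ₜ a) (tmul_mem_tensorGrading hb a)) {x : B ⊗[ℂ] A}
    (hx : x ∈ tensorGrading ℬ A i) : p x hx := by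
  obtain ⟨t, rfl⟩ := hx
  induction t using TensorProduct.induction_on with
  | zero => simpa only [map_zero] using zero
  | add x y hx hy => simpa only [map_add] using add _ _ _ _ hx hy
  | tmul b a => exact tmul b.1 b.2 a

variable [GradedAlgebra ℬ]

instance : SetLike.GradedMonoid (tensorGrading ℬ A) where
  one_mem := tmul_mem_tensorGrading SetLike.GradedOne.one_mem 1
  mul_mem i j x y hx hy := by
    induction hx using tensorGrading_induction with
    | zero => rw [zero_mul]; exact zero_mem _
    | add x x' _ _ hx hx' => rw [add_mul]; exact add_mem hx hx'
    | tmul b hb a =>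
      induction hy using tensorGrading_induction with
      | zero => rw [mul_zero]; exact zero_mem _
      | add y y' _ _ hy hy' => rw [mul_add]; exact add_mem hy hy'
      | tmul b' hb' a' =>
        rw [Algebra.TensorProduct.tmul_mul_tmul]
        exact tmul_mem_tensorGrading (SetLike.mul_mem_graded hb hb') _

instance : GradedAlgebra (tensorGrading ℬ A) :=
  { DirectSum.tensorDecomposition ℬ A with }

instance [SuperCommutative ℬ] : SuperCommutative (tensorGrading ℬ A) where
  even_comm x hx y := by
    induction hx using tensorGrading_induction with
    | zero => rw [zero_mul, mul_zero]
    | add x x' _ _ hx hx' => rw [add_mul, mul_add, hx, hx']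
    | tmul b hb a =>
      induction y using TensorProduct.induction_on with
      | zero => rw [zero_mul, mul_zero]
      | add y y' hy hy' => rw [add_mul, mul_add, hy, hy']
      | tmul b' a' =>
        rw [Algebra.TensorProduct.tmul_mul_tmul, Algebra.TensorProduct.tmul_mul_tmul,
          SuperCommutative.even_comm b hb, mul_comm a]
  odd_anticomm x hx y hy := by
    induction hx using tensorGrading_induction with
    | zero => rw [zero_mul, mul_zero, neg_zero]
    | add x x' _ _ hx hx' => rw [add_mul, mul_add, hx, hx', neg_add]
    | tmul b hb a =>
      induction hy using tensorGrading_induction with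
      | zero => rw [zero_mul, mul_zero, neg_zero]
      | add y y' _ _ hy hy' => rw [add_mul, mul_add, hy, hy', neg_add]
      | tmul b' hb' a' =>
        rw [Algebra.TensorProduct.tmul_mul_tmul, Algebra.TensorProduct.tmul_mul_tmul,
          SuperCommutative.odd_anticomm b hb b' hb', mul_comm a, TensorProduct.neg_tmul]

omit [GradedAlgebra ℬ] in
theorem lTensor_mem_tensorGrading (D : A →ₗ[ℂ] A) (i : ZMod 2) (x : B ⊗[ℂ] A)
    (hx : x ∈ tensorGrading ℬ A i) : D.lTensor B x ∈ tensorGrading ℬ A i := by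
  induction hx using tensorGrading_induction with
  | zero => rw [map_zero]; exact zero_mem _
  | add x y _ _ hx hy => rw [map_add]; exact add_mem hx hy
  | tmul b hb a => exact tmul_mem_tensorGrading hb _

theorem lTensor_derivation_mul (D : Derivation ℂ A A) (x y : B ⊗[ℂ] A) :
    D.toLinearMap.lTensor B (x * y) =
      D.toLinearMap.lTensor B x * y + x * D.toLinearMap.lTensor B y := by
  induction x using TensorProduct.induction_on with
  | zero => simp
  | add x x' hx hx' => rw [add_mul, map_add, map_add, add_mul, add_mul, hx, hx']; abel
  | tmul b a =>
    induction y using TensorProduct.induction_on with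
    | zero => simp
    | add y y' hy hy' => rw [mul_add, map_add, map_add, mul_add, mul_add, hy, hy']; abel
    | tmul b' a' =>
      simp only [Algebra.TensorProduct.tmul_mul_tmul, LinearMap.lTensor_tmul,
        Derivation.coeFn_coe, Derivation.leibniz, smul_eq_mul, TensorProduct.tmul_add]
      rw [add_comm, mul_comm a']

/-- If only scalars are killed by the maps `D i`, only elements of `B` are killed by their
extensions to `B ⊗ A`. -/
theorem exists_eq_tmul_one {ι : Type} (D : ι → A →ₗ[ℂ] A)
    (hD : ∀ a, (∀ i, D i a = 0) → ∃ r : ℂ, a = algebraMap ℂ A r) {t : B ⊗[ℂ] A}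
    (ht : ∀ i, (D i).lTensor B t = 0) : ∃ b : B, t = b ⊗ₜ 1 := by
  classical
  set 𝓑 := Module.Basis.ofVectorSpace ℂ B
  set e := TensorProduct.equivFinsuppOfBasisLeft (N := A) 𝓑 with he
  have h1 : ∀ i (t : B ⊗[ℂ] A) j, e ((D i).lTensor B t) j = D i (e t j) := fun i t j => by
    induction t using TensorProduct.induction_on with
    | zero => simp
    | add x y hx hy => simp only [map_add, Finsupp.add_apply, hx, hy]
    | tmul b a => simp [he]
  -- The components of `t` in a basis of `B` are killed by the `D i`.
  have h2 : ∀ j, ∃ r : ℂ, e t j = algebraMap ℂ A r := fun j => hD _ fun i => by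
    rw [← h1, ht, map_zero, Finsupp.zero_apply]
  choose r hr using h2
  refine ⟨∑ j ∈ (e t).support, r j • 𝓑 j, ?_⟩
  rw [TensorProduct.sum_tmul]
  refine (e.symm_apply_apply t).symm.trans ?_
  rw [TensorProduct.equivFinsuppOfBasisLeft_symm_apply]
  refine Finset.sum_congr rfl fun j _ => ?_
  change 𝓑 j ⊗ₜ e t j = _
  rw [hr, Algebra.algebraMap_eq_smul_one, TensorProduct.tmul_smul, TensorProduct.smul_tmul']

end Families

/-! ### Functions killed by the Lie superalgebra are invariant -/

section Invariance

variable {B : Type} [Ring B] [Algebra ℂ B] {ℬ : ZMod 2 → Submodule ℂ B} [GradedAlgebra ℬ]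
  [SuperCommutative ℬ] {A : Type} [CommRing A] [Algebra ℂ A]
  {N d : ℕ} {G : Subgroup (GL (Fin N) ℂ)} {ξ : Module.Basis (Fin d) ℂ (lieAlgebraOf G)}

/-- The specialization `B ⊗ A → B` at a point `A → B` with even values. -/
def specialize (φ : A →ₐ[ℂ] B) (hφ : ∀ a, φ a ∈ ℬ 0) : B ⊗[ℂ] A →ₐ[ℂ] B :=
  Algebra.TensorProduct.lift (AlgHom.id ℂ B) φ fun b a =>
    (SuperCommutative.even_comm (φ a) (hφ a) b).symm

theorem specialize_tmul (φ : A →ₐ[ℂ] B) (hφ : ∀ a, φ a ∈ ℬ 0) (b : B) (a : A) :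
    specialize φ hφ (b ⊗ₜ a) = b * φ a := Algebra.TensorProduct.lift_tmul _ _ _ _ _

theorem specialize_mem (φ : A →ₐ[ℂ] B) (hφ : ∀ a, φ a ∈ ℬ 0) (i : ZMod 2) (u : B ⊗[ℂ] A)
    (hu : u ∈ tensorGrading ℬ A i) : specialize φ hφ u ∈ ℬ i := by
  induction hu using tensorGrading_induction with
  | zero => rw [map_zero]; exact zero_mem _
  | add x y _ _ hx hy => rw [map_add]; exact add_mem hx hy
  | tmul b hb a =>
    rw [specialize_tmul]
    simpa using SetLike.mul_mem_graded hb (hφ a)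

theorem SuperPoint.ext_eval {x y : SuperPoint ℬ d} (h : x.eval = y.eval) : x = y := by
  cases x
  cases y
  congr

/-- Specialization at `φ` of a point of `G[[z,s]]` over `B ⊗ A`. -/
def specializeGroup (φ : A →ₐ[ℂ] B) (hφ : ∀ a, φ a ∈ ℬ 0)
    (h : GL (Fin N) (superDisk (tensorGrading ℬ A))) : GL (Fin N) (superDisk ℬ) :=
  Matrix.GeneralLinearGroup.map
    (diskMap (specialize φ hφ) (specialize_mem φ hφ) :
      superDisk (tensorGrading ℬ A) →+* superDisk ℬ) h

/-- In a family of points of `G[[z,s]]` over a connected base, with coordinate ring `A`, a function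
that the Lie superalgebra kills takes the same value at all the conjugates of a fixed point. -/
theorem exists_eval_conj_eq (hK : IsOrthonormal ξ) (hdet : detPoly N - 1 ∈ groupIdeal G)
    {f : SuperPoly d} (hf : LieInvariant ξ f) {ι : Type} (D : ι → Derivation ℂ A A)
    (hD : ∀ a, (∀ i, D i a = 0) → ∃ r : ℂ, a = algebraMap ℂ A r)
    {h : GL (Fin N) (superDisk (tensorGrading ℬ A))}
    (hh : h ∈ groupPoints G (superDisk (tensorGrading ℬ A))) (x : SuperPoint ℬ d) :
    ∃ b : B, ∀ (φ : A →ₐ[ℂ] B) (hφ : ∀ a, φ a ∈ ℬ 0) (y : SuperPoint ℬ d),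
      y.matrix G ξ = (specializeGroup φ hφ h : Matrix (Fin N) (Fin N) (superDisk ℬ)) *
        x.matrix G ξ * (((specializeGroup φ hφ h)⁻¹ : GL (Fin N) (superDisk ℬ)) :
          Matrix (Fin N) (Fin N) (superDisk ℬ)) → y.eval f = b := by
  -- `x'` is the constant family `x`, and `Y` is the family of its conjugates.
  set x' : SuperPoint (tensorGrading ℬ A) d := x.map Algebra.TensorProduct.includeLeft
    fun i u hu => tmul_mem_tensorGrading hu 1 with hx'
  obtain ⟨Y, hY⟩ := exists_conj_superPoint (ξ := ξ) hdet hh x'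
  have hx0 : ∀ i p, (D i).toLinearMap.lTensor B (x'.eval p) = 0 := fun i p => by
    change (D i).toLinearMap.lTensor B (x.eval p ⊗ₜ 1) = 0
    rw [LinearMap.lTensor_tmul, Derivation.coeFn_coe, Derivation.map_one_eq_zero,
      TensorProduct.tmul_zero]
  obtain ⟨b, hb⟩ := exists_eq_tmul_one (fun i => (D i).toLinearMap) hD fun i =>
    derivation_eval_conj hK hdet hf hh _ (lTensor_derivation_mul (D i))
      (lTensor_mem_tensorGrading _) (hx0 i) hY
  refine ⟨b, fun φ hφ y hy => ?_⟩
  have h1 : x'.map (specialize φ hφ) (specialize_mem φ hφ) = x :=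
    SuperPoint.ext_eval (AlgHom.ext fun p => by
      change specialize φ hφ (x.eval p ⊗ₜ 1) = _
      rw [specialize_tmul, map_one, mul_one])
  have h2 : (Y.map (specialize φ hφ) (specialize_mem φ hφ)).matrix G ξ = y.matrix G ξ := by
    rw [hy, SuperPoint.matrix_map, hY]
    conv_rhs => rw [← h1, SuperPoint.matrix_map]
    rw [specializeGroup, ← map_inv]
    change (diskMap (specialize φ hφ) (specialize_mem φ hφ)).mapMatrix _ = _
    rw [map_mul, map_mul]
    rfl
  rw [← SuperPoint.eval_eq_of_matrix_eq h2]
  change specialize φ hφ (Y.eval f) = b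
  rw [hb, specialize_tmul, map_one, mul_one]

variable (ℬ) in
theorem diskCentre_mem (x : superDisk ℬ) : diskCentre ℬ x ∈ ℬ 0 := diskEven_mem 0 x

variable (ℬ) in
/-- The restriction of a function on the super-disk to its centre. -/
def diskRestrict : superDisk ℬ →ₐ[ℂ] superDisk ℬ := diskConst (diskCentre ℬ) (diskCentre_mem ℬ)

variable (ℬ) in
/-- The substitution `z ↦ l z`, `s ↦ l s`. -/
def diskScale (l : A) : superDisk ℬ →ₐ[ℂ] superDisk (tensorGrading ℬ A) :=
  diskHom (fun n => (TensorProduct.mk ℂ B A).flip (l ^ n))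
    (fun n => (TensorProduct.mk ℂ B A).flip (l ^ (n + 1)))
    (fun _ _ hu => tmul_mem_tensorGrading hu _) (fun _ _ hu => tmul_mem_tensorGrading hu _)
    (by rw [pow_zero]; rfl)
    (fun i j u v => by
      simp only [LinearMap.flip_apply, TensorProduct.mk_apply,
        Algebra.TensorProduct.tmul_mul_tmul, pow_add])
    (fun i j u v => by
      simp only [LinearMap.flip_apply, TensorProduct.mk_apply,
        Algebra.TensorProduct.tmul_mul_tmul, pow_add, mul_assoc])
    (fun i j u v => by
      simp only [LinearMap.flip_apply, TensorProduct.mk_apply,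
        Algebra.TensorProduct.tmul_mul_tmul, pow_add, mul_right_comm])

theorem diskEven_diskScale (l : A) (n : ℕ) (x : superDisk ℬ) :
    diskEven (tensorGrading ℬ A) n (diskScale ℬ l x) = diskEven ℬ n x ⊗ₜ (l ^ n) :=
  diskEven_diskLin (fun n => (TensorProduct.mk ℂ B A).flip (l ^ n))
    (fun n => (TensorProduct.mk ℂ B A).flip (l ^ (n + 1)))
    (fun _ _ hu => tmul_mem_tensorGrading hu _) (fun _ _ hu => tmul_mem_tensorGrading hu _) n x

theorem diskOdd_diskScale (l : A) (n : ℕ) (x : superDisk ℬ) :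
    diskOdd (tensorGrading ℬ A) n (diskScale ℬ l x) = diskOdd ℬ n x ⊗ₜ (l ^ (n + 1)) :=
  diskOdd_diskLin (fun n => (TensorProduct.mk ℂ B A).flip (l ^ n))
    (fun n => (TensorProduct.mk ℂ B A).flip (l ^ (n + 1)))
    (fun _ _ hu => tmul_mem_tensorGrading hu _) (fun _ _ hu => tmul_mem_tensorGrading hu _) n x

theorem specialize_diskScale_of_eq_one {l : A} {φ : A →ₐ[ℂ] B} (hφ : ∀ a, φ a ∈ ℬ 0) (hl : φ l = 1)
    (x : superDisk ℬ) :
    diskMap (specialize φ hφ) (specialize_mem φ hφ) (diskScale ℬ l x) = x := by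
  refine disk_ext (fun n => ?_) fun n => ?_
  · rw [diskEven_diskMap, diskEven_diskScale, specialize_tmul, map_pow, hl, one_pow, mul_one]
  · rw [diskOdd_diskMap, diskOdd_diskScale, specialize_tmul, map_pow, hl, one_pow, mul_one]

theorem specialize_diskScale_of_eq_zero {l : A} {φ : A →ₐ[ℂ] B} (hφ : ∀ a, φ a ∈ ℬ 0)
    (hl : φ l = 0) (x : superDisk ℬ) :
    diskMap (specialize φ hφ) (specialize_mem φ hφ) (diskScale ℬ l x) = diskRestrict ℬ x := by
  refine disk_ext (fun n => ?_) fun n => ?_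
  · rw [diskEven_diskMap, diskEven_diskScale, specialize_tmul, map_pow, hl, diskRestrict,
      diskEven_diskConst]
    split_ifs with h
    · rw [h, pow_zero, mul_one]
      rfl
    · rw [zero_pow h, mul_zero]
  · rw [diskOdd_diskMap, diskOdd_diskScale, specialize_tmul, map_pow, hl, diskRestrict,
      diskOdd_diskConst, zero_pow n.succ_ne_zero, mul_zero]

variable (ℬ) in
theorem ofId_mem (φ : A →ₐ[ℂ] ℂ) (a : A) : ((Algebra.ofId ℂ B).comp φ) a ∈ ℬ 0 :=
  SetLike.algebraMap_mem_graded ℬ (φ a)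

/-- Conjugation by a point of `G[[z,s]]` and by its value at the centre of the super-disk have the
same effect on a function that the Lie superalgebra kills, as scaling connects the two points. The
scaling parameter is a function `l` on a connected base. -/
theorem eval_conj_eq_eval_conj_diskRestrict (hK : IsOrthonormal ξ)
    (hdet : detPoly N - 1 ∈ groupIdeal G) {f : SuperPoly d} (hf : LieInvariant ξ f) {ι : Type}
    (D : ι → Derivation ℂ A A) (hD : ∀ a, (∀ i, D i a = 0) → ∃ r : ℂ, a = algebraMap ℂ A r)
    (l : A) {φ φ' : A →ₐ[ℂ] B} (hφ : ∀ a, φ a ∈ ℬ 0) (hφ' : ∀ a, φ' a ∈ ℬ 0) (hl : φ l = 1)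
    (hl' : φ' l = 0) {g : GL (Fin N) (superDisk ℬ)} (hg : g ∈ groupPoints G (superDisk ℬ))
    {x y y' : SuperPoint ℬ d}
    (hy : y.matrix G ξ = (g : Matrix (Fin N) (Fin N) (superDisk ℬ)) * x.matrix G ξ *
      ((g⁻¹ : GL (Fin N) (superDisk ℬ)) : Matrix (Fin N) (Fin N) (superDisk ℬ)))
    (hy' : y'.matrix G ξ = (Matrix.GeneralLinearGroup.map
        (diskRestrict ℬ : superDisk ℬ →+* superDisk ℬ) g : Matrix (Fin N) (Fin N) (superDisk ℬ)) *
      x.matrix G ξ * (((Matrix.GeneralLinearGroup.map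
        (diskRestrict ℬ : superDisk ℬ →+* superDisk ℬ) g)⁻¹ : GL (Fin N) (superDisk ℬ)) :
        Matrix (Fin N) (Fin N) (superDisk ℬ))) : y.eval f = y'.eval f := by
  obtain ⟨b, hb⟩ := exists_eval_conj_eq hK hdet hf D hD (map_mem_groupPoints (diskScale ℬ l) hg) x
  have h1 : specializeGroup φ hφ (Matrix.GeneralLinearGroup.map
      (diskScale ℬ l : superDisk ℬ →+* superDisk (tensorGrading ℬ A)) g) = g :=
    Units.ext (Matrix.ext fun i j => specialize_diskScale_of_eq_one hφ hl _)
  have h0 : specializeGroup φ' hφ' (Matrix.GeneralLinearGroup.map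
      (diskScale ℬ l : superDisk ℬ →+* superDisk (tensorGrading ℬ A)) g) =
      Matrix.GeneralLinearGroup.map (diskRestrict ℬ : superDisk ℬ →+* superDisk ℬ) g :=
    Units.ext (Matrix.ext fun i j => specialize_diskScale_of_eq_zero hφ' hl' _)
  rw [hb φ hφ y (by rw [h1, hy]), hb φ' hφ' y' (by rw [h0, hy'])]

variable (G) in
/-- The coordinate ring of the closure of `G` in the space of matrices; as `det = 1` on `G`, it is
the coordinate ring of `G`. -/
abbrev CoordRing : Type := MvPolynomial (Fin N × Fin N) ℂ ⧸ groupIdeal G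

variable (G) in
/-- The universal matrix in `G`. -/
def genericMatrix : Matrix (Fin N) (Fin N) (CoordRing G) :=
  Matrix.of fun i j => Ideal.Quotient.mk _ (MvPolynomial.X (i, j))

theorem evalAt_genericMatrix (p : MvPolynomial (Fin N × Fin N) ℂ) :
    evalAt (genericMatrix G) p = Ideal.Quotient.mkₐ ℂ (groupIdeal G) p := by
  refine DFunLike.congr_fun (MvPolynomial.algHom_ext fun ij => ?_) p
  rw [evalAt, MvPolynomial.aeval_X]
  rfl

theorem det_genericMatrix (hdet : detPoly N - 1 ∈ groupIdeal G) : (genericMatrix G).det = 1 := by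
  rw [← evalAt_detPoly, evalAt_genericMatrix, ← sub_eq_zero, ← map_one (Ideal.Quotient.mkₐ ℂ _),
    ← map_sub]
  exact Ideal.Quotient.eq_zero_iff_mem.2 hdet

/-- The universal point of `G`. -/
def genericElement (hdet : detPoly N - 1 ∈ groupIdeal G) : GL (Fin N) (CoordRing G) :=
  Matrix.GeneralLinearGroup.mk'' (genericMatrix G) (by rw [det_genericMatrix hdet]; exact isUnit_one)

theorem genericElement_mem (hdet : detPoly N - 1 ∈ groupIdeal G) :
    genericElement hdet ∈ groupPoints G (CoordRing G) := fun p hp =>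
  (evalAt_genericMatrix p).trans (Ideal.Quotient.eq_zero_iff_mem.2 hp)

theorem mk_leftInvariant (X : lieAlgebraOf G) (p : MvPolynomial (Fin N × Fin N) ℂ)
    (hp : Ideal.Quotient.mkₐ ℂ (groupIdeal G) p = 0) :
    Ideal.Quotient.mkₐ ℂ (groupIdeal G) (leftInvariant (X : Matrix (Fin N) (Fin N) ℂ) p) = 0 :=
  Ideal.Quotient.eq_zero_iff_mem.2 (X.2 p (Ideal.Quotient.eq_zero_iff_mem.1 hp))

/-- The derivation of the coordinate ring of `G` given by a left-invariant vector field. -/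
def coordDerivation (X : lieAlgebraOf G) : Derivation ℂ (CoordRing G) (CoordRing G) :=
  Derivation.liftOfSurjective (f := Ideal.Quotient.mkₐ ℂ (groupIdeal G))
    (Ideal.Quotient.mkₐ_surjective ℂ _) (d := leftInvariant (X : Matrix (Fin N) (Fin N) ℂ))
    (mk_leftInvariant X)

/-- The left-invariant vector fields kill only the constants of the coordinate ring. -/
theorem eq_algebraMap_of_coordDerivation (hconn : IsConnected (G : Set (GL (Fin N) ℂ)))
    (ξ : Module.Basis (Fin d) ℂ (lieAlgebraOf G)) (a : CoordRing G)
    (ha : ∀ X, coordDerivation X a = 0) : ∃ r : ℂ, a = algebraMap ℂ (CoordRing G) r := by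
  obtain ⟨p, rfl⟩ := Ideal.Quotient.mkₐ_surjective ℂ (groupIdeal G) a
  have hp : ∀ X ∈ lieAlgebraOf G, leftInvariant X p ∈ groupIdeal G := fun X hX => by
    have h := ha ⟨X, hX⟩
    rw [coordDerivation, Derivation.liftOfSurjective_apply] at h
    exact Ideal.Quotient.eq_zero_iff_mem.1 h
  refine ⟨evalAt 1 p, ?_⟩
  rw [← (Ideal.Quotient.mkₐ ℂ (groupIdeal G)).commutes, ← sub_eq_zero, ← map_sub]
  refine Ideal.Quotient.eq_zero_iff_mem.2 (mem_groupIdeal.2 fun g hg => ?_)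
  rw [map_sub, AlgHom.commutes, evalAt_eq_of_leftInvariant hconn ξ hp hg]
  exact sub_self _

/-- The map from the coordinate ring of `G` given by a point of `G`. -/
def pointHom {R : Type} [CommRing R] [Algebra ℂ R] {g : GL (Fin N) R} (hg : g ∈ groupPoints G R) :
    CoordRing G →ₐ[ℂ] R :=
  Ideal.Quotient.liftₐ (groupIdeal G) (evalAt (g : Matrix (Fin N) (Fin N) R)) hg

theorem pointHom_mk {R : Type} [CommRing R] [Algebra ℂ R] {g : GL (Fin N) R}
    (hg : g ∈ groupPoints G R) (i j : Fin N) : pointHom hg (genericMatrix G i j) = g i j :=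
  MvPolynomial.aeval_X _ _

theorem one_mem_groupPoints : (1 : GL (Fin N) ℂ) ∈ groupPoints G ℂ := fun p hp =>
  mem_groupIdeal.1 hp 1 G.one_mem

theorem includeRight_mem (a : A) :
    (Algebra.TensorProduct.includeRight : A →ₐ[ℂ] B ⊗[ℂ] A) a ∈ tensorGrading ℬ A 0 :=
  tmul_mem_tensorGrading SetLike.GradedOne.one_mem a

variable (ℬ A) in
/-- The elements of `A`, as constant functions on the super-disk over `B ⊗ A`. -/
def constHom : A →ₐ[ℂ] superDisk (tensorGrading ℬ A) :=
  diskConst Algebra.TensorProduct.includeRight includeRight_mem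

theorem specialize_constHom (φ : A →ₐ[ℂ] B) (hφ : ∀ a, φ a ∈ ℬ 0) (a : A) :
    diskMap (specialize φ hφ) (specialize_mem φ hφ) (constHom ℬ A a) = diskConst φ hφ a := by
  refine disk_ext (fun n => ?_) fun n => ?_
  · rw [diskEven_diskMap, constHom, diskEven_diskConst, diskEven_diskConst,
      Algebra.TensorProduct.includeRight_apply]
    split_ifs
    · rw [specialize_tmul, one_mul]
    · rw [map_zero]
  · rw [diskOdd_diskMap, constHom, diskOdd_diskConst, diskOdd_diskConst, map_zero]

/-- A function that the Lie superalgebra kills is invariant under the points of `G` over the even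
part of `B`: the universal point of `G` connects such a point to `1`. -/
theorem eval_conj_diskRestrict_eq_eval (hK : IsOrthonormal ξ)
    (hconn : IsConnected (G : Set (GL (Fin N) ℂ)))
    (hdet : detPoly N - 1 ∈ groupIdeal G) {f : SuperPoly d} (hf : LieInvariant ξ f)
    {g : GL (Fin N) (superDisk ℬ)} (hg : g ∈ groupPoints G (superDisk ℬ)) {x y : SuperPoint ℬ d}
    (hy : y.matrix G ξ = (Matrix.GeneralLinearGroup.map
        (diskRestrict ℬ : superDisk ℬ →+* superDisk ℬ) g : Matrix (Fin N) (Fin N) (superDisk ℬ)) *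
      x.matrix G ξ * (((Matrix.GeneralLinearGroup.map
        (diskRestrict ℬ : superDisk ℬ →+* superDisk ℬ) g)⁻¹ : GL (Fin N) (superDisk ℬ)) :
        Matrix (Fin N) (Fin N) (superDisk ℬ))) : y.eval f = x.eval f := by
  obtain ⟨b, hb⟩ := exists_eval_conj_eq hK hdet hf coordDerivation
    (eq_algebraMap_of_coordDerivation hconn ξ)
    (map_mem_groupPoints (constHom ℬ (CoordRing G)) (genericElement_mem hdet)) x
  have hmem : ∀ a, ((diskCentre ℬ).comp (pointHom hg)) a ∈ ℬ 0 := fun a => diskCentre_mem ℬ _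
  -- The universal point of `G` specializes to the value of `g` at the centre.
  have h1 : specializeGroup ((diskCentre ℬ).comp (pointHom hg)) hmem
      (Matrix.GeneralLinearGroup.map
        (constHom ℬ (CoordRing G) : CoordRing G →+* superDisk (tensorGrading ℬ (CoordRing G)))
        (genericElement hdet)) =
      Matrix.GeneralLinearGroup.map (diskRestrict ℬ : superDisk ℬ →+* superDisk ℬ) g :=
    Units.ext (Matrix.ext fun i j => by
      refine (specialize_constHom _ hmem (genericMatrix G i j)).trans ?_
      refine disk_ext (fun n => ?_) fun n => ?_
      · rw [diskEven_diskConst, AlgHom.comp_apply, pointHom_mk]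
        exact (diskEven_diskConst (diskCentre ℬ) (diskCentre_mem ℬ) n _).symm
      · rw [diskOdd_diskConst]
        exact (diskOdd_diskConst (diskCentre ℬ) (diskCentre_mem ℬ) n _).symm)
  have hmem0 := ofId_mem ℬ (pointHom (one_mem_groupPoints (G := G)))
  -- It also specializes to `1`.
  have h0 : specializeGroup ((Algebra.ofId ℂ B).comp (pointHom (one_mem_groupPoints (G := G)))) hmem0
      (Matrix.GeneralLinearGroup.map
        (constHom ℬ (CoordRing G) : CoordRing G →+* superDisk (tensorGrading ℬ (CoordRing G)))
        (genericElement hdet)) = 1 :=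
    Units.ext (Matrix.ext fun i j => by
      refine (specialize_constHom _ hmem0 (genericMatrix G i j)).trans ?_
      have h2 : (1 : Matrix (Fin N) (Fin N) (superDisk ℬ)) i j =
          algebraMap ℂ (superDisk ℬ) ((1 : GL (Fin N) ℂ) i j) := by
        rw [Units.val_one, Matrix.one_apply, Matrix.one_apply]
        split_ifs
        · rw [map_one]
        · rw [map_zero]
      refine Eq.trans ?_ h2.symm
      refine disk_ext (fun n => ?_) fun n => ?_
      · rw [diskEven_diskConst, AlgHom.comp_apply, pointHom_mk, diskEven_algebraMap]
        rfl
      · rw [diskOdd_diskConst, diskOdd_algebraMap])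
  rw [hb _ hmem y (by rw [h1, hy]), hb _ hmem0 x (by
    rw [h0, inv_one, Units.val_one, one_mul, mul_one])]

/-- The equivalence of invariance under the group and under its Lie superalgebra. -/
theorem mem_invariantFunctions_iff (hK : IsOrthonormal ξ)
    (hconn : IsConnected (G : Set (GL (Fin N) ℂ))) {f : SuperPoly d} :
    f ∈ invariantFunctions G ξ ↔ LieInvariant ξ f := by
  have hdet := detPoly_sub_one_mem hconn hK
  refine ⟨lieInvariant_of_mem_invariantFunctions hK, fun hf B _ _ ℬ _ _ g x y hg hy => ?_⟩
  obtain ⟨y', hy'⟩ := exists_conj_superPoint (ξ := ξ) hdet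
    (map_mem_groupPoints (diskRestrict ℬ) hg) x
  -- The family `z ↦ l z`, `s ↦ l s` over the affine line joins `g` to its value at the centre.
  rw [eval_conj_eq_eval_conj_diskRestrict hK hdet hf
      (fun _ : Unit => Polynomial.derivative' (R := ℂ))
      (fun p hp => ⟨p.coeff 0, Polynomial.eq_C_of_derivative_eq_zero (hp ())⟩) Polynomial.X
      (ofId_mem ℬ (Polynomial.aeval (R := ℂ) 1)) (ofId_mem ℬ (Polynomial.aeval (R := ℂ) 0))
      (by rw [AlgHom.comp_apply, Polynomial.aeval_X, map_one])
      (by rw [AlgHom.comp_apply, Polynomial.aeval_X, map_zero]) hg hy hy',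
    eval_conj_diskRestrict_eq_eval hK hconn hdet hf hg hy']

end Invariance

end HarmonicForms

end

theorem mainTheorem7 (N d : ℕ) (G : Subgroup (GL (Fin N) ℂ))
    (hclosed : HarmonicForms.IsZariskiClosed G)
    (hconn : IsConnected (G : Set (GL (Fin N) ℂ)))
    (hss : LieAlgebra.IsSemisimple ℂ (HarmonicForms.lieAlgebraOf G))
    (τ : HarmonicForms.lieAlgebraOf G →ₛₗ[starRingEnd ℂ] HarmonicForms.lieAlgebraOf G)
    (hτ : HarmonicForms.IsCompactConjugation τ)
    (ξ : Module.Basis (Fin d) ℂ (HarmonicForms.lieAlgebraOf G))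
    (hξ_selfAdjoint : ∀ a, τ (ξ a) = -ξ a)
    (hξ_orthonormal : ∀ a b,
      killingForm ℂ (HarmonicForms.lieAlgebraOf G) (ξ a) (ξ b) = if a = b then 1 else 0) :
    -- the differential and its adjoint act on the Koszul complex
    (∀ f ∈ HarmonicForms.koszul ξ,
      HarmonicForms.dbar ξ f ∈ HarmonicForms.koszul ξ ∧
      HarmonicForms.dbarStar ξ f ∈ HarmonicForms.koszul ξ) ∧
    (∀ f ∈ HarmonicForms.koszul ξ, ∀ g ∈ HarmonicForms.koszul ξ,
      HarmonicForms.metric (HarmonicForms.dbar ξ f) g =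
        HarmonicForms.metric f (HarmonicForms.dbarStar ξ g)) ∧
    -- relabelling identifies the harmonic forms with the ring of invariant functions
    (HarmonicForms.harmonicForms ξ).map (HarmonicForms.relabel d).toLinearMap =
      Subalgebra.toSubmodule (HarmonicForms.invariantFunctions G ξ) := by
  have hI := HarmonicForms.isImaginary_of_conjugation hτ hξ_selfAdjoint
  refine ⟨fun f hf => HarmonicForms.koszul_preserved hξ_orthonormal hI hf,
    fun f _ g _ => HarmonicForms.metric_dbar hξ_orthonormal hI f g, ?_⟩
  ext f
  obtain ⟨f, rfl⟩ := (HarmonicForms.relabel d).surjective f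
  rw [Subalgebra.mem_toSubmodule, HarmonicForms.mem_invariantFunctions_iff hξ_orthonormal hconn,
    ← HarmonicForms.mem_harmonicForms_iff hξ_orthonormal hI]
  constructor
  · rintro ⟨f', hf', h⟩
    rwa [← (HarmonicForms.relabel d).injective h]
  · exact fun hf => ⟨f, hf, rfl⟩
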